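/- The following is a theorem of Homotopy Type Theory, i.e. it is derivable in intensional Martin-Löf type theory with $\Pi$-, $\Sigma$-, $0$-, $1$-, $+$-, $\mathsf W$- and identity types, a hierarchy of universes, function extensionality and univalence; $\mathsf{Type}$ denotes the lowest universe. **Definitions.** Write $\mathrm{Dec}(X) = X + (X \to 0)$. A point $a : A$ is *isolated* if $\prod_{b:A}\mathrm{Dec}(a = b)$; $A^\circ$ is the type of isolated points of $A$, and $A\setminus a := \sum_{b:A}\neg(a=b)$. For $I : \mathsf{Type}$, an *$I$-indexed container* $F$ consists of shapes $F_{\mathrm{Sh}} : \mathsf{Type}$ and positions $F_{\mathrm{Ps}} : I \to F_{\mathrm{Sh}} \to \mathsf{Type}$; their type is $\mathrm{Cont}_I$. For $I+1$ we write $\mathsf{just}(i)=\mathsf{inl}(i)$ and $\mathsf{nothing}=\mathsf{inr}(\bullet)$. A *cartesian morphism* $F\multimap G$ is a map $f:F_{\mathrm{Sh}}\to G_{\mathrm{Sh}}$ with equivalences $G_{\mathrm{Ps}}(i,f(s))\simeq F_{\mathrm{Ps}}(i,s)$ for all $i,s$; it is an *equivalence* (an *embedding*) of containers if $f$ is an equivalence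 (an embedding, i.e. its fibers are propositions). Sums $F+G$ and products $F\times G$ have shapes $F_{\mathrm{Sh}}+G_{\mathrm{Sh}}$ and $F_{\mathrm{Sh}}\times G_{\mathrm{Sh}}$, with positions by cases, respectively $F_{\mathrm{Ps}}(i,s)+G_{\mathrm{Ps}}(i,t)$. For $F : \mathrm{Cont}_{I+1}$ and $G:\mathrm{Cont}_I$, the container $F[G] : \mathrm{Cont}_I$ has shapes $\sum_{s}(F_{\mathrm{Ps}}(\mathsf{nothing},s)\to G_{\mathrm{Sh}})$ and positions $F_{\mathrm{Ps}}(\mathsf{just}(i),s)+\sum_{p:F_{\mathrm{Ps}}(\mathsf{nothing},s)}G_{\mathrm{Ps}}(i,f(p))$ at $(i,(s,f))$. For $i : I^\circ$ and $F:\mathrm{Cont}_I$, the derivative $\partial_iF : \mathrm{Cont}_I$ has shapes $\sum_s F_{\mathrm{Ps}}(i,s)^\circ$ and positions at $(j,(s,p))$ equal to $F_{\mathrm{Ps}}(i,s)\setminus p$ if $i=j$ and $F_{\mathrm{Ps}}(j,s)$ otherwise. The smallest fixed point $\mu F:\mathrm{Cont}_I$ of $F:\mathrm{Cont}_{I+1}$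 has as shapes the trees $\mathsf W_{s:F_{\mathrm{Sh}}}F_{\mathrm{Ps}}(\mathsf{nothing},s)$, and as $i$-positions of a tree the pairs of a path to a node and a position in $F_{\mathrm{Ps}}(\mathsf{just}(i),s)$ of its label $s$; $\mathrm{in}_F:F[\mu F]\multimap\mu F$ is the tree constructor. Any $\alpha:F[G]\multimap G$ induces by recursion on trees $\mathrm{rec}_F(\alpha):\mu F\multimap G$, with $\mathrm{rec}_F(\alpha)\circ\mathrm{in}_F=\alpha\circ F[\mathrm{rec}_F(\alpha)]$. Finally ${\uparrow}A:\mathrm{Cont}_{I+1}$ is $A:\mathrm{Cont}_I$ with no positions at $\mathsf{nothing}$, and $\pi_{\mathsf{nothing}}$ has one shape, with positions $\mathsf{nothing}=j$ at index $j$. **The chain rule and the $\mu$-rule.** Let $I:\mathsf{Type}$, $i:I^\circ$, $F:\mathrm{Cont}_{I+1}$ and $G:\mathrm{Cont}_I$. The lax chain rule $$\mathrm{Chain}_{F,G}:(\partial_{\mathsf{just}(i)}F)[G]+\big((\partial_{\mathsf{nothing}}F)[G]\times\partial_iG\big)\multimap\partial_i(F[G])$$ sends a shape $((s,p),f)$ of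 the first summand to $((s,f),\mathsf{inl}(p))$ and a shape $(((s,p),f),(t,q))$ of the second to $((s,g),\mathsf{inr}(p,q))$, where $g$ extends $f:F_{\mathrm{Ps}}(\mathsf{nothing},s)\setminus p\to G_{\mathrm{Sh}}$ by $g(p):=t$; on positions it is the evident splitting of a type with an isolated point (removed if the index is $i$). Let $$F':={\uparrow}\big((\partial_{\mathsf{just}(i)}F)[\mu F]\big)+\big({\uparrow}\big((\partial_{\mathsf{nothing}}F)[\mu F]\big)\times\pi_{\mathsf{nothing}}\big):\mathrm{Cont}_{I+1}.$$ The lax $\mu$-rule $\mu\text{-rule}_F:\mu F'\multimap\partial_i(\mu F)$ is $\mathrm{rec}_{F'}(\alpha)$ for the composite $$\alpha: F'[\partial_i(\mu F)]\simeq(\partial_{\mathsf{just}(i)}F)[\mu F]+\big((\partial_{\mathsf{nothing}}F)[\mu F]\times\partial_i(\mu F)\big)\xrightarrow{\ \mathrm{Chain}_{F,\mu F}\ }\partial_i(F[\mu F])\xrightarrow{\ \partial_i(\mathrm{in}_F)\ }\partial_i(\mu F).$$ **Theorem.** For all $I:\mathsf{Type}$, $i:I^\circ$ and $F:\mathrm{Cont}_{I+1}$: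 the morphisms $\mathrm{Chain}_{F,G}$ (for all $G:\mathrm{Cont}_I$) and $\mu\text{-rule}_F$ are well-defined cartesian morphisms; $\mu\text{-rule}_F$ is an embedding of containers; and $\mu\text{-rule}_F$ is an equivalence of containers if and only if $\mathrm{Chain}_{F,\mu F}$ is. -/

import Mathlib

/-!  Intensional Martin-Löf type theory with univalence, as a deductive system over raw terms,
and, inside it, untruncated containers, their derivatives, the lax chain rule and the lax `μ`-rule.

Terms are in de Bruijn notation.  Only `pi`, `lam`, `sig` and `W` bind a variable (in their last
argument); motives and branches of the eliminators are terms of function type.  There is a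
cumulativity-free hierarchy of Russell universes; `univ 0` is the univalent universe `Type` whose
elements the containers below are made of. -/

namespace UF

inductive Tm : Type
  | var (n : ℕ)
  | univ (l : ℕ)
  | pi (A B : Tm)
  | lam (b : Tm)
  | app (f a : Tm)
  | sig (A B : Tm)
  | pair (a b : Tm)
  | fst (p : Tm)
  | snd (p : Tm)
  | split (C c p : Tm)
  | zero
  | abort (C e : Tm)
  | one
  | star
  | oneElim (C c u : Tm)
  | sum (A B : Tm)
  | inl (a : Tm)
  | inr (b : Tm)
  | sumElim (C l r s : Tm)
  | W (A B : Tm)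
  | sup (a f : Tm)
  | wrec (C c w : Tm)
  | path (A a b : Tm)
  | refl (a : Tm)
  | J (C c p : Tm)
  | funext (i j : ℕ)
  | ua (l : ℕ)

namespace Tm

def liftRen (ξ : ℕ → ℕ) : ℕ → ℕ
  | 0 => 0
  | n + 1 => ξ n + 1

def rename : (ℕ → ℕ) → Tm → Tm
  | ξ, var n => var (ξ n)
  | _, univ l => univ l
  | ξ, pi A B => pi (A.rename ξ) (B.rename (liftRen ξ))
  | ξ, lam b => lam (b.rename (liftRen ξ))
  | ξ, app f a => app (f.rename ξ) (a.rename ξ)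
  | ξ, sig A B => sig (A.rename ξ) (B.rename (liftRen ξ))
  | ξ, pair a b => pair (a.rename ξ) (b.rename ξ)
  | ξ, fst p => fst (p.rename ξ)
  | ξ, snd p => snd (p.rename ξ)
  | ξ, split C c p => split (C.rename ξ) (c.rename ξ) (p.rename ξ)
  | _, zero => zero
  | ξ, abort C e => abort (C.rename ξ) (e.rename ξ)
  | _, one => one
  | _, star => star
  | ξ, oneElim C c u => oneElim (C.rename ξ) (c.rename ξ) (u.rename ξ)
  | ξ, sum A B => sum (A.rename ξ) (B.rename ξ)
  | ξ, inl a => inl (a.rename ξ)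
  | ξ, inr b => inr (b.rename ξ)
  | ξ, sumElim C l r s => sumElim (C.rename ξ) (l.rename ξ) (r.rename ξ) (s.rename ξ)
  | ξ, W A B => W (A.rename ξ) (B.rename (liftRen ξ))
  | ξ, sup a f => sup (a.rename ξ) (f.rename ξ)
  | ξ, wrec C c w => wrec (C.rename ξ) (c.rename ξ) (w.rename ξ)
  | ξ, path A a b => path (A.rename ξ) (a.rename ξ) (b.rename ξ)
  | ξ, refl a => refl (a.rename ξ)
  | ξ, J C c p => J (C.rename ξ) (c.rename ξ) (p.rename ξ)
  | _, funext i j => funext i j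
  | _, ua l => ua l

/-- Weakening by `k` variables. -/
def wk (k : ℕ) (t : Tm) : Tm := t.rename (· + k)

def liftSub (σ : ℕ → Tm) : ℕ → Tm
  | 0 => var 0
  | n + 1 => (σ n).wk 1

def subst : (ℕ → Tm) → Tm → Tm
  | σ, var n => σ n
  | _, univ l => univ l
  | σ, pi A B => pi (A.subst σ) (B.subst (liftSub σ))
  | σ, lam b => lam (b.subst (liftSub σ))
  | σ, app f a => app (f.subst σ) (a.subst σ)
  | σ, sig A B => sig (A.subst σ) (B.subst (liftSub σ))
  | σ, pair a b => pair (a.subst σ) (b.subst σ)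
  | σ, fst p => fst (p.subst σ)
  | σ, snd p => snd (p.subst σ)
  | σ, split C c p => split (C.subst σ) (c.subst σ) (p.subst σ)
  | _, zero => zero
  | σ, abort C e => abort (C.subst σ) (e.subst σ)
  | _, one => one
  | _, star => star
  | σ, oneElim C c u => oneElim (C.subst σ) (c.subst σ) (u.subst σ)
  | σ, sum A B => sum (A.subst σ) (B.subst σ)
  | σ, inl a => inl (a.subst σ)
  | σ, inr b => inr (b.subst σ)
  | σ, sumElim C l r s => sumElim (C.subst σ) (l.subst σ) (r.subst σ) (s.subst σ)
  | σ, W A B => W (A.subst σ) (B.subst (liftSub σ))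
  | σ, sup a f => sup (a.subst σ) (f.subst σ)
  | σ, wrec C c w => wrec (C.subst σ) (c.subst σ) (w.subst σ)
  | σ, path A a b => path (A.subst σ) (a.subst σ) (b.subst σ)
  | σ, refl a => refl (a.subst σ)
  | σ, J C c p => J (C.subst σ) (c.subst σ) (p.subst σ)
  | _, funext i j => funext i j
  | _, ua l => ua l

def instVar (a : Tm) : ℕ → Tm
  | 0 => a
  | n + 1 => var n

/-- `b.inst a` is `b[a]`: the last variable of `b` is replaced by `a`. -/
def inst (b a : Tm) : Tm := b.subst (instVar a)

end Tm

/-! ### Named notation for raw terms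

An `Ex` is a raw term that may be placed under any number of binders: `e.run n` is the term
written in a context of length `n`.  It lets us write binders with Lean's own `fun`. -/

structure Ex : Type where
  run : ℕ → Tm

instance : Coe Tm Ex := ⟨fun t => ⟨fun _ => t⟩⟩

/-- The variable that was bound when the context had length `n`. -/
def bvar (n : ℕ) : Ex := ⟨fun m => .var (m - 1 - n)⟩

def app (f a : Ex) : Ex := ⟨fun n => .app (f.run n) (a.run n)⟩

instance : CoeFun Ex (fun _ => Ex → Ex) := ⟨app⟩
instance : CoeFun Tm (fun _ => Ex → Ex) := ⟨fun t => app ⟨fun _ => t⟩⟩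

/-- The term of the empty context described by `e`. -/
def close (e : Ex) : Tm := e.run 0

def univ (l : ℕ) : Ex := ⟨fun _ => .univ l⟩
def pi (A : Ex) (B : Ex → Ex) : Ex := ⟨fun n => .pi (A.run n) ((B (bvar n)).run (n + 1))⟩
def lam (b : Ex → Ex) : Ex := ⟨fun n => .lam ((b (bvar n)).run (n + 1))⟩
def sig (A : Ex) (B : Ex → Ex) : Ex := ⟨fun n => .sig (A.run n) ((B (bvar n)).run (n + 1))⟩
def pair (a b : Ex) : Ex := ⟨fun n => .pair (a.run n) (b.run n)⟩
def fst (p : Ex) : Ex := ⟨fun n => .fst (p.run n)⟩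
def snd (p : Ex) : Ex := ⟨fun n => .snd (p.run n)⟩
def split (C c p : Ex) : Ex := ⟨fun n => .split (C.run n) (c.run n) (p.run n)⟩
def zero : Ex := ⟨fun _ => .zero⟩
def abort (C e : Ex) : Ex := ⟨fun n => .abort (C.run n) (e.run n)⟩
def one : Ex := ⟨fun _ => .one⟩
def star : Ex := ⟨fun _ => .star⟩
def oneElim (C c u : Ex) : Ex := ⟨fun n => .oneElim (C.run n) (c.run n) (u.run n)⟩
def sum (A B : Ex) : Ex := ⟨fun n => .sum (A.run n) (B.run n)⟩
def inl (a : Ex) : Ex := ⟨fun n => .inl (a.run n)⟩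
def inr (b : Ex) : Ex := ⟨fun n => .inr (b.run n)⟩
def sumElim (C l r s : Ex) : Ex :=
  ⟨fun n => .sumElim (C.run n) (l.run n) (r.run n) (s.run n)⟩
def W (A : Ex) (B : Ex → Ex) : Ex := ⟨fun n => .W (A.run n) ((B (bvar n)).run (n + 1))⟩
def sup (a f : Ex) : Ex := ⟨fun n => .sup (a.run n) (f.run n)⟩
def wrec (C c w : Ex) : Ex := ⟨fun n => .wrec (C.run n) (c.run n) (w.run n)⟩
def path (A a b : Ex) : Ex := ⟨fun n => .path (A.run n) (a.run n) (b.run n)⟩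
def refl (a : Ex) : Ex := ⟨fun n => .refl (a.run n)⟩
def J (C c p : Ex) : Ex := ⟨fun n => .J (C.run n) (c.run n) (p.run n)⟩

def lam₂ (b : Ex → Ex → Ex) : Ex := lam fun x => lam fun y => b x y
def lam₃ (b : Ex → Ex → Ex → Ex) : Ex := lam fun x => lam₂ fun y z => b x y z
def lam₄ (b : Ex → Ex → Ex → Ex → Ex) : Ex := lam fun x => lam₃ fun y z w => b x y z w

/-- `A → B` -/
def arr (A B : Ex) : Ex := pi A fun _ => B
/-- `A × B` -/
def prod (A B : Ex) : Ex := sig A fun _ => B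

infixr:60 " ⇾ " => arr
infixr:65 " ⊠ " => prod

/-! ### Paths, contractibility, equivalences, embeddings -/

def neg (A : Ex) : Ex := A ⇾ zero
def dec (A : Ex) : Ex := sum A (neg A)

/-- For `p : a = b`, transport `B a → B b`. -/
def transport (B : Ex → Ex) (p x : Ex) : Ex := J (lam₂ fun y _ => B y) x p
/-- For `p : a = b` in `A`, the path `b = a`. -/
def symm (A a p : Ex) : Ex := J (lam₂ fun y _ => path A y a) (refl a) p
/-- For `p : a = b` and `q : b = c` in `A`, the path `a = c`. -/
def trans (A a p q : Ex) : Ex := J (lam₂ fun y _ => path A a y) p q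
/-- For `f` into `B` and `p : a = b`, the path `f a = f b`. -/
def cong (B : Ex) (f : Ex → Ex) (a p : Ex) : Ex :=
  J (lam₂ fun y _ => path B (f a) (f y)) (refl (f a)) p

/-- `λ A` -/
def isContr : Tm := close <| lam fun A => sig A fun a => pi A fun b => path A a b

/-- `λ A` -/
def isProp : Tm := close <| lam fun A => pi A fun a => pi A fun b => path A a b

/-- `λ A B f y` -/
def fiber : Tm := close <| lam₄ fun A B f y => sig A fun x => path B (f x) y

/-- `λ A B f` -/
def isEquiv : Tm := close <| lam₃ fun A B f => pi B fun y => isContr (fiber A B f y)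

/-- `λ A B` -/
def equiv : Tm := close <| lam₂ fun A B => sig (A ⇾ B) fun f => isEquiv A B f

/-- `λ A B f` -/
def isEmbedding : Tm := close <| lam₃ fun A B f => pi B fun y => isProp (fiber A B f y)

/-- `λ A`, of type `A ≃ A` -/
def idEquiv : Tm := close <| lam fun A =>
  pair (lam fun x => x) <| lam fun b =>
    pair (pair b (refl b)) <| lam fun z =>
      split (lam fun z => path (fiber A A (lam fun x => x) b) (pair b (refl b)) z)
        (lam₂ fun x p =>
          J (lam₂ fun y q => path (sig A fun x' => path A x' y) (pair y (refl y)) (pair x q))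
            (refl (pair x (refl x))) p)
        z

/-- `λ A B p`, the canonical map from `A = B` to `A ≃ B` -/
def idToEquiv : Tm := close <| lam₃ fun A _ p => J (lam₂ fun X _ => equiv A X) (idEquiv A) p

/-- `λ A B f g p`, the canonical map from `f = g` to `Π x, f x = g x` -/
def happly : Tm := close <| lam fun A => lam₄ fun B f _ p =>
  J (lam₂ fun g _ => pi A fun x => path (B x) (f x) (g x)) (lam fun x => refl (f x)) p

def funextType (i j : ℕ) : Tm := close <|
  pi (univ i) fun A => pi (A ⇾ univ j) fun B =>
    pi (pi A fun x => B x) fun f => pi (pi A fun x => B x) fun g =>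
      isEquiv (path (pi A fun x => B x) f g) (pi A fun x => path (B x) (f x) (g x))
        (happly A B f g)

def uaType (l : ℕ) : Tm := close <|
  pi (univ l) fun A => pi (univ l) fun B =>
    isEquiv (path (univ l) A B) (equiv A B) (idToEquiv A B)

/-! ### The deductive system -/

/-- Judgmental equality: the congruence generated by the computation rules and by the
uniqueness rule for functions. -/
inductive Conv : Tm → Tm → Prop
  | rfl (a : Tm) : Conv a a
  | symm {a b : Tm} : Conv a b → Conv b a
  | trans {a b c : Tm} : Conv a b → Conv b c → Conv a c
  -- computation rules
  | app_lam (b a : Tm) : Conv (.app (.lam b) a) (b.inst a)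
  | fst_pair (a b : Tm) : Conv (.fst (.pair a b)) a
  | snd_pair (a b : Tm) : Conv (.snd (.pair a b)) b
  | split_pair (C c a b : Tm) : Conv (.split C c (.pair a b)) (.app (.app c a) b)
  | oneElim_star (C c : Tm) : Conv (.oneElim C c .star) c
  | sumElim_inl (C l r a : Tm) : Conv (.sumElim C l r (.inl a)) (.app l a)
  | sumElim_inr (C l r b : Tm) : Conv (.sumElim C l r (.inr b)) (.app r b)
  | wrec_sup (C c a f : Tm) :
      Conv (.wrec C c (.sup a f))
        (.app (.app (.app c a) f) (.lam (.wrec (C.wk 1) (c.wk 1) (.app (f.wk 1) (.var 0)))))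
  | J_refl (C c a : Tm) : Conv (.J C c (.refl a)) c
  -- uniqueness rule for functions
  | lam_app (f : Tm) : Conv (.lam (.app (f.wk 1) (.var 0))) f
  -- congruence
  | pi {A A' B B' : Tm} : Conv A A' → Conv B B' → Conv (.pi A B) (.pi A' B')
  | lam {b b' : Tm} : Conv b b' → Conv (.lam b) (.lam b')
  | app {f f' a a' : Tm} : Conv f f' → Conv a a' → Conv (.app f a) (.app f' a')
  | sig {A A' B B' : Tm} : Conv A A' → Conv B B' → Conv (.sig A B) (.sig A' B')
  | pair {a a' b b' : Tm} : Conv a a' → Conv b b' → Conv (.pair a b) (.pair a' b')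
  | fst {p p' : Tm} : Conv p p' → Conv (.fst p) (.fst p')
  | snd {p p' : Tm} : Conv p p' → Conv (.snd p) (.snd p')
  | split {C C' c c' p p' : Tm} :
      Conv C C' → Conv c c' → Conv p p' → Conv (.split C c p) (.split C' c' p')
  | abort {C C' e e' : Tm} : Conv C C' → Conv e e' → Conv (.abort C e) (.abort C' e')
  | oneElim {C C' c c' u u' : Tm} :
      Conv C C' → Conv c c' → Conv u u' → Conv (.oneElim C c u) (.oneElim C' c' u')
  | sum {A A' B B' : Tm} : Conv A A' → Conv B B' → Conv (.sum A B) (.sum A' B')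
  | inl {a a' : Tm} : Conv a a' → Conv (.inl a) (.inl a')
  | inr {b b' : Tm} : Conv b b' → Conv (.inr b) (.inr b')
  | sumElim {C C' l l' r r' s s' : Tm} : Conv C C' → Conv l l' → Conv r r' → Conv s s' →
      Conv (.sumElim C l r s) (.sumElim C' l' r' s')
  | W {A A' B B' : Tm} : Conv A A' → Conv B B' → Conv (.W A B) (.W A' B')
  | sup {a a' f f' : Tm} : Conv a a' → Conv f f' → Conv (.sup a f) (.sup a' f')
  | wrec {C C' c c' w w' : Tm} :
      Conv C C' → Conv c c' → Conv w w' → Conv (.wrec C c w) (.wrec C' c' w')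
  | path {A A' a a' b b' : Tm} :
      Conv A A' → Conv a a' → Conv b b' → Conv (.path A a b) (.path A' a' b')
  | refl {a a' : Tm} : Conv a a' → Conv (.refl a) (.refl a')
  | J {C C' c c' p p' : Tm} :
      Conv C C' → Conv c c' → Conv p p' → Conv (.J C c p) (.J C' c' p')

/-- `HasType Γ a A` is the judgment `Γ ⊢ a : A`.  The head of the list `Γ` is the type of the
variable `0`, and each entry of `Γ` is a type in the context formed by the entries after it. -/
inductive HasType : List Tm → Tm → Tm → Prop
  | var {Γ : List Tm} {n : ℕ} {A : Tm} : Γ[n]? = some A → HasType Γ (.var n) (A.wk (n + 1))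
  | conv {Γ : List Tm} {a A B : Tm} {l : ℕ} :
      HasType Γ a A → HasType Γ B (.univ l) → Conv A B → HasType Γ a B
  | univ {Γ : List Tm} (l : ℕ) : HasType Γ (.univ l) (.univ (l + 1))
  -- dependent functions
  | pi {Γ : List Tm} {A B : Tm} {i j : ℕ} :
      HasType Γ A (.univ i) → HasType (A :: Γ) B (.univ j) →
      HasType Γ (.pi A B) (.univ (max i j))
  | lam {Γ : List Tm} {A B b : Tm} {i : ℕ} :
      HasType Γ A (.univ i) → HasType (A :: Γ) b B → HasType Γ (.lam b) (.pi A B)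
  | app {Γ : List Tm} {A B f a : Tm} :
      HasType Γ f (.pi A B) → HasType Γ a A → HasType Γ (.app f a) (B.inst a)
  -- dependent pairs
  | sig {Γ : List Tm} {A B : Tm} {i j : ℕ} :
      HasType Γ A (.univ i) → HasType (A :: Γ) B (.univ j) →
      HasType Γ (.sig A B) (.univ (max i j))
  | pair {Γ : List Tm} {A B a b : Tm} {l : ℕ} :
      HasType Γ (.sig A B) (.univ l) → HasType Γ a A → HasType Γ b (B.inst a) →
      HasType Γ (.pair a b) (.sig A B)
  | fst {Γ : List Tm} {A B p : Tm} : HasType Γ p (.sig A B) → HasType Γ (.fst p) A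
  | snd {Γ : List Tm} {A B p : Tm} :
      HasType Γ p (.sig A B) → HasType Γ (.snd p) (B.inst (.fst p))
  | split {Γ : List Tm} {A B C c p : Tm} {l : ℕ} :
      HasType Γ C (.pi (.sig A B) (.univ l)) →
      HasType Γ c (.pi A (.pi B (.app (C.wk 2) (.pair (.var 1) (.var 0))))) →
      HasType Γ p (.sig A B) → HasType Γ (.split C c p) (.app C p)
  -- the empty type
  | zero {Γ : List Tm} : HasType Γ .zero (.univ 0)
  | abort {Γ : List Tm} {C e : Tm} {l : ℕ} :
      HasType Γ C (.univ l) → HasType Γ e .zero → HasType Γ (.abort C e) C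
  -- the unit type
  | one {Γ : List Tm} : HasType Γ .one (.univ 0)
  | star {Γ : List Tm} : HasType Γ .star .one
  | oneElim {Γ : List Tm} {C c u : Tm} {l : ℕ} :
      HasType Γ C (.pi .one (.univ l)) → HasType Γ c (.app C .star) → HasType Γ u .one →
      HasType Γ (.oneElim C c u) (.app C u)
  -- binary sums
  | sum {Γ : List Tm} {A B : Tm} {i j : ℕ} :
      HasType Γ A (.univ i) → HasType Γ B (.univ j) → HasType Γ (.sum A B) (.univ (max i j))
  | inl {Γ : List Tm} {A B a : Tm} {l : ℕ} :
      HasType Γ (.sum A B) (.univ l) → HasType Γ a A → HasType Γ (.inl a) (.sum A B)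
  | inr {Γ : List Tm} {A B b : Tm} {l : ℕ} :
      HasType Γ (.sum A B) (.univ l) → HasType Γ b B → HasType Γ (.inr b) (.sum A B)
  | sumElim {Γ : List Tm} {A B C l r s : Tm} {k : ℕ} :
      HasType Γ C (.pi (.sum A B) (.univ k)) →
      HasType Γ l (.pi A (.app (C.wk 1) (.inl (.var 0)))) →
      HasType Γ r (.pi B (.app (C.wk 1) (.inr (.var 0)))) →
      HasType Γ s (.sum A B) → HasType Γ (.sumElim C l r s) (.app C s)
  -- well-founded trees
  | W {Γ : List Tm} {A B : Tm} {i j : ℕ} :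
      HasType Γ A (.univ i) → HasType (A :: Γ) B (.univ j) →
      HasType Γ (.W A B) (.univ (max i j))
  | sup {Γ : List Tm} {A B a f : Tm} {l : ℕ} :
      HasType Γ (.W A B) (.univ l) → HasType Γ a A →
      HasType Γ f (.pi (B.inst a) ((Tm.W A B).wk 1)) → HasType Γ (.sup a f) (.W A B)
  | wrec {Γ : List Tm} {A B C c w : Tm} {l : ℕ} :
      HasType Γ C (.pi (.W A B) (.univ l)) →
      HasType Γ c
        (.pi A (.pi (.pi B ((Tm.W A B).wk 2))
          (.pi (.pi (B.wk 1) (.app (C.wk 3) (.app (.var 1) (.var 0))))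
            (.app (C.wk 3) (.sup (.var 2) (.var 1)))))) →
      HasType Γ w (.W A B) → HasType Γ (.wrec C c w) (.app C w)
  -- identity types
  | path {Γ : List Tm} {A a b : Tm} {l : ℕ} :
      HasType Γ A (.univ l) → HasType Γ a A → HasType Γ b A →
      HasType Γ (.path A a b) (.univ l)
  | refl {Γ : List Tm} {A a : Tm} {l : ℕ} :
      HasType Γ A (.univ l) → HasType Γ a A → HasType Γ (.refl a) (.path A a a)
  | J {Γ : List Tm} {A a b C c p : Tm} {l : ℕ} :
      HasType Γ C (.pi A (.pi (.path (A.wk 1) (a.wk 1) (.var 0)) (.univ l))) →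
      HasType Γ c (.app (.app C a) (.refl a)) →
      HasType Γ p (.path A a b) → HasType Γ (.J C c p) (.app (.app C b) p)
  -- function extensionality and univalence
  | funext {Γ : List Tm} (i j : ℕ) : HasType Γ (.funext i j) (funextType i j)
  | ua {Γ : List Tm} (l : ℕ) : HasType Γ (.ua l) (uaType l)

/-! ### Isolated points and their removal -/

/-- `λ A a` -/
def isIsolated : Tm := close <| lam₂ fun A a => pi A fun b => dec (path A a b)

/-- `λ A` -/
def isolated : Tm := close <| lam fun A => sig A fun a => isIsolated A a

/-- `λ A a`, the type `A \ a` -/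
def remove : Tm := close <| lam₂ fun A a => sig A fun b => neg (path A a b)

/-- For `r : inl a = x` in `A + B`, an element of `a = a'` if `x` is `inl a'`, and of the empty
type if `x` is `inr b`. -/
def inlCode (A a r : Ex) : Ex :=
  J (lam₂ fun x _ => sumElim (lam fun _ => univ 0) (lam fun a' => path A a a') (lam fun _ => zero) x)
    (refl a) r

/-- For `r : inr b = x` in `A + B`, an element of `b = b'` if `x` is `inr b'`, and of the empty
type if `x` is `inl a`. -/
def inrCode (B b r : Ex) : Ex :=
  J (lam₂ fun x _ => sumElim (lam fun _ => univ 0) (lam fun _ => zero) (lam fun b' => path B b b') x)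
    (refl b) r

/-- `λ A B a a' d`: a decision of `inl a = inl a'` from the decision `d` of `a = a'` -/
def inlDec : Tm := close <| lam fun A => lam₄ fun B a a' d =>
  sumElim (lam fun _ => dec (path (sum A B) (inl a) (inl a')))
    (lam fun p => inl (cong (sum A B) inl a p))
    (lam fun n => inr (lam fun r => n (inlCode A a r))) d

/-- `λ A B b b' d`: a decision of `inr b = inr b'` from the decision `d` of `b = b'` -/
def inrDec : Tm := close <| lam fun A => lam₄ fun B b b' d =>
  sumElim (lam fun _ => dec (path (sum A B) (inr b) (inr b')))
    (lam fun p => inl (cong (sum A B) inr b p))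
    (lam fun n => inr (lam fun r => n (inrCode B b r))) d

/-- `λ A B a h`: if `a` is isolated then so is `inl a` -/
def inlIsolated : Tm := close <| lam₄ fun A B a h => lam fun x =>
  sumElim (lam fun x => dec (path (sum A B) (inl a) x))
    (lam fun a' => inlDec A B a a' (h a'))
    (lam fun _ => inr (lam fun r => inlCode A a r)) x

/-- `λ A B b h`: if `b` is isolated then so is `inr b` -/
def inrIsolated : Tm := close <| lam₄ fun A B b h => lam fun x =>
  sumElim (lam fun x => dec (path (sum A B) (inr b) x))
    (lam fun _ => inr (lam fun r => inrCode B b r))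
    (lam fun b' => inrDec A B b b' (h b')) x

/-- The unique point of `1` is isolated. -/
def starIsolated : Tm := close <| lam fun u =>
  oneElim (lam fun u => dec (path one star u)) (inl (refl star)) u

/-- `λ A a h p`: if `a` is isolated and `p : a = a`, then `p = refl` -/
def isolatedLoop : Tm := close <| lam₄ fun A a h p =>
  let k : Ex → Ex → Ex → Ex := fun d b e =>
    sumElim (lam fun _ => path A a b) (lam fun q => q) (lam fun n => abort (path A a b) (n e)) d
  let k₀ : Ex := k (h a) a (refl a)
  let c : Ex → Ex → Ex := fun b e => trans A b (symm A a k₀) (k (h b) b e)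
  -- the path `c b e = e`
  let cPath : Ex → Ex := fun e =>
    J (lam₂ fun b e => path (path A a b) (trans A a (symm A a k₀) (k (h b) b e)) e)
      (J (lam₂ fun y q => path (path A y y) (trans A y (symm A a q) q) (refl y)) (refl (refl a)) k₀)
      e
  -- the path `k e = k e'`, for `e e' : a = a`
  let kPath : Ex → Ex → Ex := fun e e' =>
    sumElim (lam fun d => path (path A a a) (k d a e) (k d a e'))
      (lam fun q => refl q)
      (lam fun n => abort
        (path (path A a a) (abort (path A a a) (n e)) (abort (path A a a) (n e'))) (n e)) (h a)
  trans (path A a a) p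
    (symm (path A a a) (c a p) (cPath p))
    (trans (path A a a) (c a p)
      (cong (path A a a) (fun q => trans A a (symm A a k₀) q) (k (h a) a p) (kPath p (refl a)))
      (cPath (refl a)))

/-- `λ A B a b b' h r`: if `a` is isolated and `r : (a, b) = (a, b')`, then `b = b'` -/
def sndPath : Tm := close <| lam₃ fun A B a => lam₄ fun b b' h r =>
  let E : Ex :=
    J (lam₂ fun w _ => sig (path A a (fst w)) fun e =>
        path (B (fst w)) (transport (fun x => B x) e b) (snd w))
      (pair (refl a) (refl b)) r
  J (lam₂ fun e _ => path (B a) (transport (fun x => B x) e b) b') (snd E)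
    (isolatedLoop A a h (fst E))

/-- `λ A B a b h k`: if `a : A` and `b : B a` are isolated, then so is `(a, b)` in `Σ A B` -/
def pairIsolated : Tm := close <| lam₂ fun A B => lam₄ fun a b h k => lam fun w =>
  let P : Ex := sig A fun x => B x
  split (lam fun w => dec (path P (pair a b) w))
    (lam₂ fun a' b' =>
      sumElim (lam fun _ => dec (path P (pair a b) (pair a' b')))
        (lam fun e =>
          J (lam₂ fun a' _ => pi (B a') fun b' => dec (path P (pair a b) (pair a' b')))
            (lam fun b' =>
              sumElim (lam fun _ => dec (path P (pair a b) (pair a b')))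
                (lam fun p => inl (cong P (fun y => pair a y) b p))
                (lam fun n => inr (lam fun r => n (sndPath A B a b b' h r)))
                (k b'))
            e b')
        (lam fun n => inr (lam fun r => n (cong A fst (pair a b) r)))
        (h a'))
    w

/-- `λ A B`, the map `Σ (a : A°), (B a)° → (Σ A B)°`, where `°` is the type of isolated points -/
def sigmaIsolate : Tm := close <| lam₃ fun A B z =>
  pair (pair (fst (fst z)) (fst (snd z)))
    (pairIsolated A B (fst (fst z)) (fst (snd z)) (snd (fst z)) (snd (snd z)))

/-- `λ A B a`, the map `(A + B) \ inl a → (A \ a) + B` -/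
def removeInl : Tm := close <| lam₄ fun A B a z =>
  sumElim (lam fun x => neg (path (sum A B) (inl a) x) ⇾ sum (remove A a) B)
    (lam₂ fun a' n => inl (pair a' (lam fun p => n (cong (sum A B) inl a p))))
    (lam₂ fun b _ => inr b) (fst z) (snd z)

/-- `λ A B b`, the map `(A + B) \ inr b → A + (B \ b)` -/
def removeInr : Tm := close <| lam₄ fun A B b z =>
  sumElim (lam fun x => neg (path (sum A B) (inr b) x) ⇾ sum A (remove B b))
    (lam₂ fun a _ => inl a)
    (lam₂ fun b' n => inr (pair b' (lam fun p => n (cong (sum A B) inr b p)))) (fst z) (snd z)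

/-- `λ A B a b h`, the map `(Σ A B) \ (a, b) → (Σ (x : A \ a), B x) + (B a \ b)` for isolated `a` -/
def removeSigma : Tm := close <| lam₂ fun A B => lam₄ fun a b h z =>
  let P : Ex := sig A fun x => B x
  let R : Ex := sum (sig (remove A a) fun x => B (fst x)) (remove (B a) b)
  split (lam fun w => neg (path P (pair a b) w) ⇾ R)
    (lam₃ fun a' b' n =>
      sumElim (lam fun _ => R)
        (lam fun e => inr
          (J (lam₂ fun a' _ => pi (B a') fun b' =>
              neg (path P (pair a b) (pair a' b')) ⇾ remove (B a) b)
            (lam₂ fun b' n => pair b' (lam fun p => n (cong P (fun y => pair a y) b p)))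
            e b' n))
        (lam fun m => inl (pair (pair a' m) b'))
        (h a'))
    (fst z) (snd z)

/-! ### Grafting -/

/-- The value at `x` of the function that is `f` on `A \ a` and `t` at `a`, given a decision `d`
of `a = x`. -/
def graftCase (T f t x d : Ex) : Ex :=
  sumElim (lam fun _ => T) (lam fun _ => t) (lam fun n => f (pair x n)) d

/-- `λ A T a f t`, the function `A → T` that is `f` on `A \ a` and `t` at the isolated point `a` -/
def graft : Tm := close <| lam₂ fun _ T => lam₄ fun a f t x => graftCase T f t x (snd a x)

/-- `λ A T a f t`, the path `t = graft a` -/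
def graftPath : Tm := close <| lam fun _ => lam₄ fun T a f t =>
  sumElim (lam fun d => path T t (graftCase T f t (fst a) d))
    (lam fun _ => refl t)
    (lam fun n => abort (path T t (f (pair (fst a) n))) (n (refl (fst a))))
    (snd a (fst a))

/-- `λ A T a f t B`, the map `Σ (x : A \ a), B (graft x) → Σ (x : A \ a), B (f x)` -/
def graftOff : Tm := close <| lam₃ fun A T a => lam₄ fun f t B v =>
  sumElim
    (lam fun d => B (graftCase T f t (fst (fst v)) d) ⇾ sig (remove A (fst a)) fun x => B (f x))
    (lam₂ fun e _ => abort (sig (remove A (fst a)) fun x => B (f x)) (snd (fst v) e))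
    (lam₂ fun n y => pair (pair (fst (fst v)) n) y)
    (snd a (fst (fst v))) (snd v)

/-- `λ A T a f t B`, the map `Σ (x : A), B (graft x) → (Σ (x : A \ a), B (f x)) + B t` -/
def graftSplit : Tm := close <| lam₃ fun A T a => lam₄ fun f t B v =>
  let R : Ex := sum (sig (remove A (fst a)) fun x => B (f x)) (B t)
  sumElim (lam fun d => B (graftCase T f t (fst v) d) ⇾ R)
    (lam₂ fun _ y => inr y)
    (lam₂ fun n y => inl (pair (pair (fst v) n) y))
    (snd a (fst v)) (snd v)

/-- For `p : t = t'` in `T`, the map `(B t)° → (B t')°`. -/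
def moveIsolated (B p q : Ex) : Ex := transport (fun t => isolated (B t)) p q

/-- `λ T B t t' p q`, for `p : t = t'` and `q : (B t)°` the map `B t' \ p⁎ q → B t \ q` -/
def moveRemove : Tm := close <| lam₂ fun _ B => lam₄ fun t _ p q =>
  J (lam₂ fun t' p => remove (B t') (fst (moveIsolated B p q)) ⇾ remove (B t) (fst q))
    (lam fun z => z) p

/-! ### Indexed containers -/

/-- `λ I`, the type of `I`-indexed containers -/
def cont : Tm := close <| lam fun I => sig (univ 0) fun S => I ⇾ S ⇾ univ 0

/-- The shapes of a container. -/
def Sh (F : Ex) : Ex := fst F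
/-- The positions with index `i` of the shape `s`. -/
def Ps (F i s : Ex) : Ex := snd F i s

/-- `I + 1`, with `just i` and `nothing`. -/
def opt (I : Ex) : Ex := sum I one
def just (i : Ex) : Ex := inl i
def nothing : Ex := inr star

/-- `λ I F G`: maps of shapes with maps of positions in the other direction -/
def hom : Tm := close <| lam₃ fun I F G =>
  sig (Sh F ⇾ Sh G) fun f => pi I fun i => pi (Sh F) fun s => Ps G i (f s) ⇾ Ps F i s

/-- `λ I F G m`: all position maps of `m` are equivalences -/
def isCartesian : Tm := close <| lam₄ fun I F G m =>
  pi I fun i => pi (Sh F) fun s => isEquiv (Ps G i (fst m s)) (Ps F i s) (snd m i s)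

/-- `λ I F G`, the type `F ⊸ G` of cartesian morphisms -/
def cart : Tm := close <| lam₃ fun I F G =>
  sig (Sh F ⇾ Sh G) fun f => pi I fun i => pi (Sh F) fun s => equiv (Ps G i (f s)) (Ps F i s)

/-- The morphism underlying a cartesian morphism. -/
def underlying (m : Ex) : Ex := pair (fst m) (lam₂ fun i s => fst (snd m i s))

/-- `λ I F G m`: `m` is an equivalence of containers (used for cartesian `m`) -/
def isEquivalence : Tm := close <| lam₄ fun _ F G m => isEquiv (Sh F) (Sh G) (fst m)

/-- `λ I F G m`: `m` is an embedding of containers (used for cartesian `m`) -/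
def isEmbeddingOfContainers : Tm := close <| lam₄ fun _ F G m => isEmbedding (Sh F) (Sh G) (fst m)

/-- `λ I F G H g f`, the composite `g ∘ f` -/
def comp : Tm := close <| lam₂ fun _ _ => lam₄ fun _ _ g f =>
  pair (lam fun s => fst g (fst f s))
    (lam₃ fun i s z => snd f i s (snd g i (fst f s) z))

/-- `λ I F G`, the container `F + G` -/
def plus : Tm := close <| lam₃ fun _ F G =>
  pair (sum (Sh F) (Sh G))
    (lam₂ fun i x =>
      sumElim (lam fun _ => univ 0) (lam fun s => Ps F i s) (lam fun t => Ps G i t) x)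

/-- `λ I F G`, the container `F × G` -/
def times : Tm := close <| lam₃ fun _ F G =>
  pair (Sh F ⊠ Sh G) (lam₂ fun i x => sum (Ps F i (fst x)) (Ps G i (snd x)))

/-- `λ I F`, the weakening `↑F` of an `I`-indexed container to an `(I + 1)`-indexed one -/
def weaken : Tm := close <| lam₂ fun _ F =>
  pair (Sh F)
    (lam₂ fun j s =>
      sumElim (lam fun _ => univ 0) (lam fun i => Ps F i s) (lam fun _ => zero) j)

/-- `λ I i`, the projection container `π i` -/
def proj : Tm := close <| lam₂ fun I i => pair one (lam₂ fun j _ => path I i j)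

/-- `λ I F G`, the substitution `F[G]` of an `I`-indexed `G` into an `(I + 1)`-indexed `F` -/
def substitute : Tm := close <| lam₃ fun _ F G =>
  pair (sig (Sh F) fun s => Ps F nothing s ⇾ Sh G)
    (lam₂ fun i x =>
      sum (Ps F (just i) (fst x)) (sig (Ps F nothing (fst x)) fun p => Ps G i (snd x p)))

/-! ### Derivatives -/

/-- `X` or `Y`, according to a decision `d`. -/
def ifDec (d X Y : Ex) : Ex := sumElim (lam fun _ => univ 0) (lam fun _ => X) (lam fun _ => Y) d

/-- `λ I i F`, the derivative `∂ᵢ F` at an isolated index `i` -/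
def der : Tm := close <| lam₃ fun _ i F =>
  pair (sig (Sh F) fun s => isolated (Ps F (fst i) s))
    (lam₂ fun j x =>
      ifDec (snd i j) (remove (Ps F (fst i) (fst x)) (fst (snd x))) (Ps F j (fst x)))

/-- `λ I i`: `just i` as an isolated index -/
def justIso : Tm := close <| lam₂ fun I i => pair (just (fst i)) (inlIsolated I one (fst i) (snd i))

/-- `λ I`: `nothing` as an isolated index -/
def nothingIso : Tm := close <| lam fun I => pair nothing (inrIsolated I one star starIsolated)

/-- The inverse of an equivalence `e`, at `b`. -/
def inv (e b : Ex) : Ex := fst (fst (snd e b))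

/-- `λ A B e b a p`: for `e : A ≃ B` and `p : b = e a`, the path `e⁻¹ b = a` -/
def invPath : Tm := close <| lam₂ fun A B => lam₄ fun e b a p =>
  cong A fst (fst (snd e b)) (snd (snd e b) (pair a (symm B b p)))

/-- `λ A B e`, the map `B° → A°` induced by the inverse of `e : A ≃ B` -/
def invIsolated : Tm := close <| lam₄ fun A B e b =>
  pair (inv e (fst b)) <| lam fun a =>
    sumElim (lam fun _ => dec (path A (inv e (fst b)) a))
      (lam fun p => inl (invPath A B e (fst b) a p))
      (lam fun n => inr (lam fun q => n
        (trans B (fst b)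
          (symm B (fst e (inv e (fst b))) (snd (fst (snd e (fst b)))))
          (cong B (fun x => fst e x) (inv e (fst b)) q))))
      (snd b (fst e a))

/-- `λ I i F G m`, the morphism from `∂ᵢ F` to `∂ᵢ G` underlying `∂ᵢ m`, for cartesian `m : F ⊸ G` -/
def derMap : Tm := close <| lam fun _ => lam₄ fun i F G m =>
  let P : Ex → Ex → Ex := fun j s => Ps F j s
  let Q : Ex → Ex → Ex := fun j s => Ps G j (fst m s)
  let p : Ex → Ex := fun x =>
    invIsolated (Q (fst i) (fst x)) (P (fst i) (fst x)) (snd m (fst i) (fst x)) (snd x)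
  pair
    (lam fun x => pair (fst m (fst x)) (p x))
    (lam₂ fun j x =>
      let s : Ex := fst x
      let e : Ex := snd m (fst i) s
      let X : Ex := remove (Q (fst i) s) (fst (p x))
      let Y : Ex := remove (P (fst i) s) (fst (snd x))
      sumElim (lam fun d => ifDec d X (Q j s) ⇾ ifDec d Y (P j s))
        (lam₂ fun _ z => pair (fst e (fst z)) (lam fun r => snd z
          (invPath (Q (fst i) s) (P (fst i) s) e (fst (snd x)) (fst z) r)))
        (lam₂ fun _ z => fst (snd m j s) z)
        (snd i j))

/-! ### The lax chain rule -/

/-- `λ I i F G`, the container `∂_{just i} F [G] + (∂_nothing F [G] × ∂ᵢ G)` -/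
def chainSource : Tm := close <| lam₄ fun I i F G =>
  plus I (substitute I (der (opt I) (justIso I i) F) G)
    (times I (substitute I (der (opt I) (nothingIso I) F) G) (der I i G))

/-- `λ I i F G`, the container `∂ᵢ (F[G])` -/
def chainTarget : Tm := close <| lam₄ fun I i F G => der I i (substitute I F G)

/-- `λ I i F G`, the shape map of the chain rule:
`((s, p), f) ↦ ((s, f), inl p)` and
`(((s, p), f), (t, q)) ↦ ((s, g), inr (p, q'))`, where `g` grafts `t` onto `f` at `p`, and `q'` is
`q` moved along the path `t = g p`. -/
def chainShape : Tm := close <| lam₄ fun I i F G => lam fun x =>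
  let B : Ex → Ex := fun g => lam fun p => Ps G (fst i) (g p)
  let Z : Ex → Ex → Ex := fun s g => sig (Ps F nothing s) fun p => Ps G (fst i) (g p)
  sumElim (lam fun _ => Sh (chainTarget I i F G))
    (lam fun y =>
      let s : Ex := fst (fst y)
      let p : Ex := snd (fst y)
      let f : Ex := snd y
      pair (pair s f)
        (pair (inl (fst p)) (inlIsolated (Ps F (just (fst i)) s) (Z s f) (fst p) (snd p))))
    (lam fun y =>
      let s : Ex := fst (fst (fst y))
      let p : Ex := snd (fst (fst y))
      let f : Ex := snd (fst y)
      let t : Ex := fst (snd y)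
      let q : Ex := snd (snd y)
      let g : Ex := graft (Ps F nothing s) (Sh G) p f t
      let q' : Ex := moveIsolated (snd G (fst i))
        (graftPath (Ps F nothing s) (Sh G) p f t) q
      let w : Ex := sigmaIsolate (Ps F nothing s) (B g) (pair p q')
      pair (pair s g)
        (pair (inr (fst w)) (inrIsolated (Ps F (just (fst i)) s) (Z s g) (fst w) (snd w))))
    x

/-- `λ I i F G j x`, the position maps of the chain rule.  They remove the point `inl p` or
`inr (p, q')` from `P + Σ Q` if `i = j`, and only split the graft if `i ≠ j`. -/
def chainPos : Tm := close <| lam₂ fun I i => lam₄ fun F G j x =>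
  let L : Ex := chainSource I i F G
  let R : Ex := chainTarget I i F G
  let i₀ : Ex := fst i
  let P : Ex → Ex → Ex := fun j s => Ps F (just j) s
  let N : Ex → Ex := fun s => Ps F nothing s
  let Q : Ex → Ex := fun j => snd G j
  let RP : Ex → Ex → Ex := fun j u => Ps (substitute I F G) j u
  sumElim
    (lam fun x => Ps R j (chainShape I i F G x) ⇾ Ps L j x)
    (lam fun y =>
      let s : Ex := fst (fst y)
      let p : Ex := snd (fst y)
      let f : Ex := snd y
      let Z : Ex → Ex := fun j => sig (N s) fun n => Ps G j (f n)
      let X : Ex := remove (RP i₀ (pair s f)) (inl (fst p))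
      sumElim
        (lam fun d => ifDec d X (RP j (pair s f)) ⇾
          sum (ifDec (inlDec I one i₀ j d) (remove (P i₀ s) (fst p)) (P j s)) (Z j))
        (lam fun e =>
          J (lam₂ fun j _ => X ⇾ sum (remove (P i₀ s) (fst p)) (Z j))
            (removeInl (P i₀ s) (Z i₀) (fst p)) e)
        (lam₂ fun _ z => z)
        (snd i j))
    (lam fun y =>
      let s : Ex := fst (fst (fst y))
      let p : Ex := snd (fst (fst y))
      let f : Ex := snd (fst y)
      let t : Ex := fst (snd y)
      let q : Ex := snd (snd y)
      let g : Ex := graft (N s) (Sh G) p f t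
      let c : Ex := graftPath (N s) (Sh G) p f t
      let q' : Ex := moveIsolated (Q i₀) c q
      let B : Ex := lam fun n => Ps G i₀ (g n)
      let V : Ex → Ex := fun j => sig (remove (N s) (fst p)) fun n => Ps G j (f n)
      let X : Ex := remove (RP i₀ (pair s g)) (inr (pair (fst p) (fst q')))
      let T : Ex := sum (sum (P i₀ s) (V i₀)) (remove (Ps G i₀ t) (fst q))
      sumElim
        (lam fun d => ifDec d X (RP j (pair s g)) ⇾
          sum (sum (P j s) (V j)) (ifDec d (remove (Ps G i₀ t) (fst q)) (Ps G j t)))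
        (lam fun e =>
          J (lam₂ fun j _ => X ⇾ sum (sum (P j s) (V j)) (remove (Ps G i₀ t) (fst q)))
            (lam fun z =>
              sumElim (lam fun _ => T)
                (lam fun a => inl (inl a))
                (lam fun w => sumElim (lam fun _ => T)
                  (lam fun v => inl (inr (graftOff (N s) (Sh G) p f t (Q i₀) v)))
                  (lam fun v => inr (moveRemove (Sh G) (Q i₀) t (g (fst p)) c q v))
                  (removeSigma (N s) B (fst p) (fst q') (snd p) w))
                (removeInr (P i₀ s) (sig (N s) fun n => Ps G i₀ (g n)) (pair (fst p) (fst q')) z))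
            e)
        (lam₂ fun _ z =>
          let T : Ex := sum (sum (P j s) (V j)) (Ps G j t)
          sumElim (lam fun _ => T)
            (lam fun a => inl (inl a))
            (lam fun w => sumElim (lam fun _ => T)
              (lam fun v => inl (inr v))
              (lam fun v => inr v)
              (graftSplit (N s) (Sh G) p f t (Q j) w))
            z)
        (snd i j))
    x

/-- `λ I i F G`, the lax chain rule from `∂_{just i} F [G] + (∂_nothing F [G] × ∂ᵢ G)` to
`∂ᵢ (F[G])` -/
def chain : Tm := close <| lam₄ fun I i F G => pair (chainShape I i F G) (chainPos I i F G)

/-! ### Smallest fixed points and the lax `μ`-rule -/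

/-- `λ I F`, the smallest fixed point `μ F` of an `(I + 1)`-indexed container `F`.  Shapes are
trees; a position with index `i` of a tree is a path to a node together with a position with index
`just i` of its label, that is, a position at the root or a position in an immediate subtree. -/
def mu : Tm := close <| lam₂ fun _ F =>
  pair (W (Sh F) fun s => Ps F nothing s)
    (lam₂ fun i w =>
      wrec (lam fun _ => univ 0)
        (lam₃ fun s _ ih => sum (Ps F (just i) s) (sig (Ps F nothing s) fun p => ih p)) w)

/-- `λ I F`, the structure map `F[μ F] ⊸ μ F`, which is cartesian -/
def muIn : Tm := close <| lam₂ fun I F =>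
  pair (lam fun x => sup (fst x) (snd x))
    (lam₂ fun i x => idEquiv (Ps (substitute I F (mu I F)) i x))

/-- `λ I F G m w`: the shape map of the recursor, by recursion on trees -/
def recShape : Tm := close <| lam fun _ => lam₄ fun _ G m w =>
  wrec (lam fun _ => Sh G) (lam₃ fun s _ ih => fst m (pair s ih)) w

/-- `λ I F G m i w`: the position maps of the recursor, by induction on trees -/
def recPos : Tm := close <| lam₂ fun I F => lam₄ fun G m i w =>
  wrec (lam fun w => Ps G i (recShape I F G m w) ⇾ Ps (mu I F) i w)
    (lam₃ fun s f ih => lam fun q =>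
      sumElim (lam fun _ => Ps (mu I F) i (sup s f))
        (lam fun a => inl a)
        (lam fun v => inr (pair (fst v) (ih (fst v) (snd v))))
        (snd m i (pair s (lam fun p => recShape I F G m (f p))) q))
    w

/-- `λ I F G m`, the morphism from `μ F` to `G` defined by recursion from `m`, a morphism from
`F[G]` to `G` -/
def muRec : Tm := close <| lam₄ fun I F G m => pair (recShape I F G m) (recPos I F G m)

/-- `λ I i F`, the `(I + 1)`-indexed container
`F' = ↑(∂_{just i} F [μ F]) + (↑(∂_nothing F [μ F]) × π nothing)` -/
def derSig : Tm := close <| lam₃ fun I i F =>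
  let D : Ex → Ex := fun k => weaken I (substitute I (der (opt I) k F) (mu I F))
  plus (opt I) (D (justIso I i)) (times (opt I) (D (nothingIso I)) (proj (opt I) nothing))

/-- `λ I A B Y`, the morphism from `(↑A + (↑B × π nothing))[Y]` to `A + (B × Y)` -/
def unfoldSig : Tm := close <| lam₄ fun I A B Y =>
  let F' : Ex := plus (opt I) (weaken I A) (times (opt I) (weaken I B) (proj (opt I) nothing))
  let T : Ex := plus I A (times I B Y)
  let N : Ex → Ex := fun x => Ps F' nothing x ⇾ Sh Y
  let pt : Ex := inr (refl nothing)
  let sh : Ex → Ex → Ex := fun x k =>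
    sumElim (lam fun x => N x ⇾ Sh T)
      (lam₂ fun a _ => inl a)
      (lam₂ fun y k => inr (pair (fst y) (k pt))) x k
  pair
    (lam fun z => sh (fst z) (snd z))
    (lam₂ fun i z =>
      sumElim
        (lam fun x => pi (N x) fun k =>
          Ps T i (sh x k) ⇾ sum (Ps F' (just i) x) (sig (Ps F' nothing x) fun p => Ps Y i (k p)))
        (lam₃ fun _ _ u => inl u)
        (lam₃ fun y k u =>
          sumElim
            (lam fun _ => sum (Ps F' (just i) (inr y))
              (sig (Ps F' nothing (inr y)) fun p => Ps Y i (k p)))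
            (lam fun b => inl (inl b))
            (lam fun v => inr (pair pt v)) u)
        (fst z) (snd z))

/-- `λ I i F`, the morphism from `F'[∂ᵢ (μ F)]` to `∂ᵢ (μ F)`, the composite
`F'[∂ᵢ (μ F)] → ∂_{just i} F [μ F] + (∂_nothing F [μ F] × ∂ᵢ (μ F)) → ∂ᵢ (F[μ F]) → ∂ᵢ (μ F)`
of the unfolding, the chain rule, and `∂ᵢ` of the structure map -/
def muRuleStep : Tm := close <| lam₃ fun I i F =>
  let M : Ex := mu I F
  let A : Ex := substitute I (der (opt I) (justIso I i) F) M
  let B : Ex := substitute I (der (opt I) (nothingIso I) F) M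
  let Y : Ex := der I i M
  let X : Ex := substitute I (derSig I i F) Y
  comp I X (chainTarget I i F M) Y
    (derMap I i (substitute I F M) M (muIn I F))
    (comp I X (chainSource I i F M) (chainTarget I i F M) (chain I i F M) (unfoldSig I A B Y))

/-- `λ I i F`, the lax `μ`-rule from `μ F'` to `∂ᵢ (μ F)`, defined by recursion -/
def muRule : Tm := close <| lam₃ fun I i F =>
  muRec I (derSig I i F) (der I i (mu I F)) (muRuleStep I i F)

/-! ### The statements -/

/-- The type of the lax chain rule. -/
def chainType : Tm := close <|
  pi (univ 0) fun I => pi (isolated I) fun i => pi (cont (opt I)) fun F => pi (cont I) fun G =>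
    hom I (chainSource I i F G) (chainTarget I i F G)

/-- The type of the lax `μ`-rule. -/
def muRuleType : Tm := close <|
  pi (univ 0) fun I => pi (isolated I) fun i => pi (cont (opt I)) fun F =>
    hom I (mu I (derSig I i F)) (der I i (mu I F))

/-- For every type of indices `I`, every isolated `i : I` and every signature container
`F : Cont_{I+1}`: all chain rules `Chain_{F,G}` and the `μ`-rule of `F` are cartesian, the `μ`-rule
is an embedding, and it is an equivalence if and only if `Chain_{F,μF}` is. -/
def strongMuRule : Tm := close <|
  pi (univ 0) fun I => pi (isolated I) fun i => pi (cont (opt I)) fun F =>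
    let M : Ex := mu I F
    let strongMu : Ex := isEquivalence I (mu I (derSig I i F)) (der I i M) (muRule I i F)
    let strongChain : Ex :=
      isEquivalence I (chainSource I i F M) (chainTarget I i F M) (chain I i F M)
    (pi (cont I) fun G =>
      isCartesian I (chainSource I i F G) (chainTarget I i F G) (chain I i F G)) ⊠
    isCartesian I (mu I (derSig I i F)) (der I i M) (muRule I i F) ⊠
    isEmbeddingOfContainers I (mu I (derSig I i F)) (der I i M) (muRule I i F) ⊠
    ((strongMu ⇾ strongChain) ⊠ (strongChain ⇾ strongMu))

end UF

namespace UF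
noncomputable section

/-! ## Annotated terms

`E` is a syntax for terms with named constants, with holes, and with the type annotations that
make the introduction forms inferable.  It is what the elaborator below works on. -/

/-! The heart of the matter is the shape map of the chain rule. It reaches an isolated point `inl p`
of `P + Σ N Q` when `p` is isolated, and a point `inr (n, q)` when `n` and `q` are both isolated. An
isolated point has only trivial loops, by the local form of Hedberg's argument, so being isolated is
a proposition (`isIsolatedProp`). Hence the shapes of the source are the isolated points that
satisfy a certain proposition (`isApart`), the rule is in effect the first projection, and it is an
embedding (`chainEmb`). It need not be surjective: a pair can be isolated without its first
component being so. On positions the rule is a composite of splittings: removing a point from a sum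
or from a dependent sum with isolated first component, and separating the value of a grafted
function at its isolated point (`chainCartesian`).

The algebra that defines the `μ`-rule is the chain rule for `μF` between two equivalences of shapes,
hence an embedding and cartesian. Recursion on trees preserves both properties (`treeRecEmb`,
`recCartesian`). An embedding is an equivalence once its fibers are inhabited. If the `μ`-rule is an
equivalence, the root of the tree lying over `∂(in) z` is a preimage of `z` under the chain rule
(`chainStrong`). If the chain rule for `μF` is an equivalence, every isolated position in a tree has
a preimage, by induction on the tree: a position at the root gives a node without subtrees, and for
a position in a subtree surjectivity of the chain rule makes both the branch and the rest of the
position isolated, so that the induction hypothesis applies (`muRuleStrong`).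

What has to be shown is derivability in a formal theory, so this argument is written as terms of
that theory, and their derivations are obtained by reflection. A type checker `infer` for annotated
terms is proved sound once (`infer_sound`) and is then evaluated by the kernel on every definition
and proof. Since judgmental equality is untyped, soundness needs subject reduction for weak head
reduction (`whnf_pres`). This needs the type formers to be injective up to conversion (`Conv.pi_inj`
and its companions), which follows from confluence of the computation rules together with `η`
(`Par.diamond`). -/

inductive Op0 | hole | zero | one | star | univ (l : ℕ) | fext | mv (i : ℕ)
inductive Op1 | fst | snd | refl
inductive Op2 | app | sum | abort | inl | inr | ann
inductive Op3 | pair | sup | split | oneElim | wrec | path | J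
inductive OpB | pi | lam | sig | W

/-- Grouping the constructors by arity leaves one case per arity in each operation and each
induction. The operations use primitive or structural recursion, `cond` and the Boolean arithmetic
of `Nat`, because the kernel has to evaluate them when the declarations are checked. -/
inductive E
  | var (n : ℕ)
  | con (k : ℕ)
  | op0 (o : Op0)
  | op1 (o : Op1) (a : E)
  | op2 (o : Op2) (a b : E)
  | op3 (o : Op3) (a b c : E)
  | elim (a b c d : E)
  | bnd (o : OpB) (a b : E)

def Op0.beq : Op0 → Op0 → Bool
  | hole, hole => true
  | zero, zero => true
  | one, one => true
  | star, star => true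
  | univ l, univ m => Nat.beq l m
  | fext, fext => true
  | mv i, mv j => Nat.beq i j
  | _, _ => false

def Op1.idx : Op1 → ℕ
  | fst => 0 | snd => 1 | refl => 2
def Op2.idx : Op2 → ℕ
  | app => 0 | sum => 1 | abort => 2 | inl => 3 | inr => 4 | ann => 5
def Op3.idx : Op3 → ℕ
  | pair => 0 | sup => 1 | split => 2 | oneElim => 3 | wrec => 4 | path => 5 | J => 6
def OpB.idx : OpB → ℕ
  | pi => 0 | lam => 1 | sig => 2 | W => 3

/-- The first argument is an annotation. -/
def Op2.skip : Op2 → Bool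
  | inl => true | inr => true | ann => true | _ => false
/-- The first argument is an annotation. -/
def Op3.skip : Op3 → Bool
  | pair => true | sup => true | _ => false
/-- The first argument is an annotation. -/
def OpB.skip : OpB → Bool
  | lam => true | _ => false

/-- Holes and metavariables erase to an arbitrary term. `inferOp0` gives them no type, so soundness
does not depend on this choice; where they serve as annotations they are dropped. -/
def Op0.er : Op0 → Tm
  | hole => .zero | zero => .zero | one => .one | star => .star | univ l => .univ l
  | fext => .funext 0 0 | mv _ => .zero
def Op1.er : Op1 → Tm → Tm
  | fst => .fst | snd => .snd | refl => .refl
def Op2.er : Op2 → Tm → Tm → Tm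
  | app => .app | sum => .sum | abort => .abort
  | inl => fun _ a => .inl a | inr => fun _ a => .inr a | ann => fun _ a => a
def Op3.er : Op3 → Tm → Tm → Tm → Tm
  | pair => fun _ a b => .pair a b | sup => fun _ a b => .sup a b | split => .split
  | oneElim => .oneElim | wrec => .wrec | path => .path | J => .J
def OpB.er : OpB → Tm → Tm → Tm
  | pi => .pi | lam => fun _ b => .lam b | sig => .sig | W => .W

namespace E

/-- The raw term described by an annotated one, for given values `ρ` of the constants. -/
def er (ρ : ℕ → Tm) : E → Tm
  | var n => .var n
  | con k => ρ k
  | op0 o => o.er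
  | op1 o a => o.er (a.er ρ)
  | op2 o a b => o.er (a.er ρ) (b.er ρ)
  | op3 o a b c => o.er (a.er ρ) (b.er ρ) (c.er ρ)
  | elim a b c d => .sumElim (a.er ρ) (b.er ρ) (c.er ρ) (d.er ρ)
  | bnd o a b => o.er (a.er ρ) (b.er ρ)

/-- Weakening by `k` variables, under `c` binders. -/
def shift (k c : ℕ) (t : E) : E :=
  E.rec (motive := fun _ => ℕ → E)
    (fun n c => cond (Nat.ble c n) (var (Nat.add n k)) (var n))
    (fun k _ => con k)
    (fun o _ => op0 o)
    (fun o _ a c => op1 o (a c))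
    (fun o _ _ a b c => op2 o (a c) (b c))
    (fun o _ _ _ a b d c => op3 o (a c) (b c) (d c))
    (fun _ _ _ _ a b d e c => elim (a c) (b c) (d c) (e c))
    (fun o _ _ a b c => bnd o (a c) (b (Nat.succ c))) t c

/-- Substitution of `a` for the variable `d`. -/
def substAt (a : E) (d : ℕ) (t : E) : E :=
  E.rec (motive := fun _ => ℕ → E)
    (fun n d => cond (Nat.ble d n)
      (cond (Nat.beq n d) (a.shift d 0) (var (Nat.pred n))) (var n))
    (fun k _ => con k)
    (fun o _ => op0 o)
    (fun o _ x d => op1 o (x d))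
    (fun o _ _ x y d => op2 o (x d) (y d))
    (fun o _ _ _ x y z d => op3 o (x d) (y d) (z d))
    (fun _ _ _ _ x y z w d => elim (x d) (y d) (z d) (w d))
    (fun o _ _ x y d => bnd o (x d) (y (Nat.succ d))) t d

def inst (b a : E) : E := substAt a 0 b
def wk (k : ℕ) (a : E) : E := a.shift k 0

/-- Syntactic equality up to annotations. -/
def beq (t : E) : E → Bool :=
  E.rec (motive := fun _ => E → Bool)
    (fun n u => match u with | var m => Nat.beq n m | _ => false)
    (fun n u => match u with | con m => Nat.beq n m | _ => false)
    (fun o u => match u with | op0 o' => o.beq o' | _ => false)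
    (fun o _ a u => match u with
      | op1 o' a' => Nat.beq o.idx o'.idx && a a' | _ => false)
    (fun o _ _ a b u => match u with
      | op2 o' a' b' => Nat.beq o.idx o'.idx && ((o.skip || a a') && b b') | _ => false)
    (fun o _ _ _ a b c u => match u with
      | op3 o' a' b' c' =>
        Nat.beq o.idx o'.idx && ((o.skip || a a') && (b b' && c c')) | _ => false)
    (fun _ _ _ _ a b c d u => match u with
      | elim a' b' c' d' => a a' && (b b' && (c c' && d d')) | _ => false)
    (fun o _ _ a b u => match u with
      | bnd o' a' b' => Nat.beq o.idx o'.idx && ((o.skip || a a') && b b') | _ => false) t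

/-- Strengthening by `k` variables, under `c` binders. -/
def lower (k : ℕ) : ℕ → E → Option E
  | c, var n => cond (Nat.ble c n)
      (cond (Nat.ble (Nat.add c k) n) (some (var (Nat.sub n k))) none) (some (var n))
  | _, con k => some (con k)
  | _, op0 o => some (op0 o)
  | c, op1 o a => (a.lower k c).bind fun a => some (op1 o a)
  | c, op2 o a b => (b.lower k c).bind fun b => (a.lower k c).bind fun a => some (op2 o a b)
  | c, op3 o a b d => (a.lower k c).bind fun a => (b.lower k c).bind fun b =>
      (d.lower k c).bind fun d => some (op3 o a b d)
  | c, elim a b d e => (a.lower k c).bind fun a => (b.lower k c).bind fun b =>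
      (d.lower k c).bind fun d => (e.lower k c).bind fun e => some (elim a b d e)
  | c, bnd o a b => (b.lower k (Nat.succ c)).bind fun b => (a.lower k c).bind fun a =>
      some (bnd o a b)

/-- Replaces `s` by a new variable, under `d` binders. -/
def abstr : E → ℕ → E → E
  | s, d, var n => cond (s.beq (var n)) (var d) (cond (Nat.ble d n) (var (Nat.succ n)) (var n))
  | _, _, con k => con k
  | _, _, op0 o => op0 o
  | s, d, op1 o a => cond (s.beq (op1 o a)) (var d) (op1 o (abstr s d a))
  | s, d, op2 o a b => cond (s.beq (op2 o a b)) (var d) (op2 o (abstr s d a) (abstr s d b))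
  | s, d, op3 o a b c =>
      cond (s.beq (op3 o a b c)) (var d) (op3 o (abstr s d a) (abstr s d b) (abstr s d c))
  | s, d, elim a b c e => cond (s.beq (elim a b c e)) (var d)
      (elim (abstr s d a) (abstr s d b) (abstr s d c) (abstr s d e))
  | s, d, bnd o a b => cond (s.beq (bnd o a b)) (var d)
      (bnd o (abstr s d a) (abstr (s.wk 1) (Nat.succ d) b))
termination_by structural _ _ t => t

/-- Decides whether an omitted motive has to depend on the term that is eliminated. -/
def occurs : E → E → Bool
  | s, var n => s.beq (var n)
  | _, con _ => false
  | _, op0 _ => false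
  | s, op1 o a => s.beq (op1 o a) || occurs s a
  | s, op2 o a b => s.beq (op2 o a b) || (occurs s a || occurs s b)
  | s, op3 o a b c => s.beq (op3 o a b c) || (occurs s a || (occurs s b || occurs s c))
  | s, elim a b c e =>
      s.beq (elim a b c e) || (occurs s a || (occurs s b || (occurs s c || occurs s e)))
  | s, bnd o a b => s.beq (bnd o a b) || (occurs s a || occurs (s.wk 1) b)
termination_by structural _ t => t

/-- All constants of the term are below `k`. -/
def consLt (k : ℕ) : E → Bool
  | var _ => true
  | con m => Nat.blt m k
  | op0 _ => true
  | op1 _ a => a.consLt k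
  | op2 _ a b => a.consLt k && b.consLt k
  | op3 _ a b c => a.consLt k && (b.consLt k && c.consLt k)
  | elim a b c d => a.consLt k && (b.consLt k && (c.consLt k && d.consLt k))
  | bnd _ a b => a.consLt k && b.consLt k

/-- The constant at the head of a sequence of applications. -/
def headCon : E → Option ℕ
  | con k => some k
  | op2 .app f _ => f.headCon
  | _ => none

end E

/-! ## Conversion -/

/-- `val` is `none` for theorems and for the axiom; such constants never unfold. -/
structure Entry : Type where
  id : ℕ
  ty : E
  val : Option E

abbrev Env := List Entry

def Env.find : Env → ℕ → Option Entry
  | [], _ => none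
  | d :: e, k => cond (Nat.beq d.id k) (some d) (Env.find e k)

def Env.unfold (e : Env) (k : ℕ) : Option E :=
  match e.find k with
  | some d => d.val
  | none => none

open E

def unfoldHead (e : Env) : E → E
  | con k => match e.unfold k with
    | some v => v
    | none => con k
  | op2 .app f a => op2 .app (unfoldHead e f) a
  | t => t

/-- Weak head reduction; `r` reduces further, without (`false`) or with (`true`) unfolding of a
constant at the head. -/
def whnfStep (e : Env) (r : Bool → E → E) (δ : Bool) : E → E
  | con k => cond δ (match e.unfold k with
    | some v => r true v
    | none => con k) (con k)
  | op1 o p => match o with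
    | .fst => match r true p with | op3 .pair _ a _ => r δ a | _ => op1 .fst p
    | .snd => match r true p with | op3 .pair _ _ b => r δ b | _ => op1 .snd p
    | .refl => op1 .refl p
  | op2 o f a => match o with
    | .app => match r δ f with | bnd .lam _ b => r δ (b.inst a) | f' => op2 .app f' a
    | .ann => r δ a
    | _ => op2 o f a
  | op3 o C c p => match o with
    | .split => match r true p with
      | op3 .pair _ a b => r δ (op2 .app (op2 .app c a) b) | _ => op3 .split C c p
    | .oneElim => match r true p with | op0 .star => r δ c | _ => op3 .oneElim C c p
    | .wrec => match r true p with
      | op3 .sup _ a f => r δ (op2 .app (op2 .app (op2 .app c a) f)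
          -- The domain of the function of recursive values is not computed: erasure and conversion
          -- both ignore the annotation of a `lam`.
          (bnd .lam (op0 .hole)
            (op3 .wrec (C.wk 1) (c.wk 1) (op2 .app (f.wk 1) (var 0)))))
      | _ => op3 .wrec C c p
    | .J => match r true p with | op1 .refl _ => r δ c | _ => op3 .J C c p
    | _ => op3 o C c p
  | elim C l r' s => match r true s with
    | op2 .inl _ a => r δ (op2 .app l a)
    | op2 .inr _ b => r δ (op2 .app r' b)
    | _ => elim C l r' s
  | t => t

/-- Raw terms may diverge, hence the fuel. When it runs out the term is returned as it stands, which
is harmless: every intermediate term converts to the original one. -/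
def whnf (e : Env) : ℕ → Bool → E → E
  | 0, _, t => t
  | n + 1, δ, t => whnfStep e (whnf e n) δ t

def spineConv (r : E → E → Bool) : E → E → Bool
  | op2 .app f a, u => match u with
    | op2 .app f' a' => spineConv r f f' && r a a'
    | _ => false
  | t, u => t.beq u

def etaConv (r : E → E → Bool) (t u : E) : Bool :=
  match t with
  | bnd .lam _ b => r b (op2 .app (u.wk 1) (var 0))
  | _ => match u with
    | bnd .lam _ b => r (op2 .app (t.wk 1) (var 0)) b
    | _ => false

/-- Comparison of terms in weak head normal form. -/
def convStruct (r : E → E → Bool) (t u : E) : Bool :=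
  match t, u with
  | var n, var m => Nat.beq n m
  | op0 o, op0 o' => o.beq o'
  | op1 o a, op1 o' a' => Nat.beq o.idx o'.idx && r a a'
  | op2 o a b, op2 o' a' b' =>
      cond (Nat.beq o.idx o'.idx) ((o.skip || r a a') && r b b') false
  | op3 o a b c, op3 o' a' b' c' =>
      Nat.beq o.idx o'.idx && ((o.skip || r a a') && (r b b' && r c c'))
  | elim a b c d, elim a' b' c' d' => r d d' && (r a a' && (r b b' && r c c'))
  | bnd o a b, bnd o' a' b' =>
      cond (Nat.beq o.idx o'.idx) ((o.skip || r a a') && r b b') (etaConv r (bnd o a b) (bnd o' a' b'))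
  | t, u => etaConv r t u

/-- Unfolding is lazy. Applications of the same constant are first compared argument by argument; of
two different constants the one with the larger number is unfolded first, since it may be defined in
terms of the other. -/
def convHead (e : Env) (r : E → E → Bool) (t u : E) : Bool :=
  match t.headCon with
  | none => match u.headCon with
    | none => convStruct r t u
    | some k => match e.unfold k with
      | some _ => r t (unfoldHead e u)
      | none => etaConv r t u
  | some k => match u.headCon with
    | none => match e.unfold k with
      | some _ => r (unfoldHead e t) u
      | none => etaConv r t u
    | some k' => cond (Nat.beq k k')
        (spineConv r t u || match e.unfold k with
          | some _ => r (unfoldHead e t) (unfoldHead e u)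
          | none => false)
        (cond (Nat.blt k k')
          (match e.unfold k' with
            | some _ => r t (unfoldHead e u)
            | none => r (unfoldHead e t) u)
          (match e.unfold k with
            | some _ => r (unfoldHead e t) u
            | none => r t (unfoldHead e u)))

def conv (e : Env) : ℕ → E → E → Bool
  | 0, _, _ => false
  | n + 1, t, u => t.beq u || convHead e (conv e n) (whnf e 100000 false t) (whnf e 100000 false u)

/-! ## Elaboration -/

inductive Res (α : Type)
  | ok (a : α)
  | err (msg : ℕ) (Γ : List E) (t u : E)

def Res.bind {α β : Type} : Res α → (α → Res β) → Res β
  | ok a, f => f a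
  | err m Γ t u, _ => err m Γ t u

/-- In a context, elaborates a term, for a given type or not, and returns it with its type. -/
abbrev Infer := List E → E → Option E → Res (E × E)

open Res (ok err)

def isHole : E → Bool
  | op0 .hole => true
  | _ => false

section

variable (e : Env) (n : ℕ) (r : Infer)

def inferTy (Γ : List E) (A : E) : Res (E × ℕ) :=
  (r Γ A none).bind fun p => match whnf e n true p.2 with
    | op0 (.univ l) => ok (p.1, l)
    | S => err 1 Γ A S

def coerce (Γ : List E) (t T : E) : Option E → Res (E × E)
  | none => ok (t, T)
  | some G => cond (conv e n T G) (ok (t, G)) (err 3 Γ T G)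

/-- The expected type, or else the annotation `T`. -/
def expected (Γ : List E) (T : E) : Option E → Res E
  | some G => ok G
  | none => (inferTy e n r Γ T).bind fun p => ok p.1

def inferLam (Γ : List E) (A b : E) : Option E → Res (E × E)
  | some G => match whnf e n true G with
    | bnd .pi A B => (r (A :: Γ) b (some B)).bind fun p => ok (bnd .lam A p.1, G)
    | _ => err 4 Γ (bnd .lam A b) G
  | none => (inferTy e n r Γ A).bind fun p => (r (p.1 :: Γ) b none).bind fun q =>
      ok (bnd .lam p.1 q.1, bnd .pi p.1 q.2)

/-- An unannotated pair of unknown type is not dependent. -/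
def inferPairInfer (Γ : List E) (a b : E) : Res (E × E) :=
  (r Γ a none).bind fun p => (r Γ b none).bind fun q =>
    ok (op3 .pair (bnd .sig p.2 (q.2.wk 1)) p.1 q.1, bnd .sig p.2 (q.2.wk 1))

def inferPair (Γ : List E) (T a b : E) (g : Option E) : Res (E × E) :=
  (expected e n r Γ T g).bind fun G => match whnf e n true G with
    | bnd .sig A B => (r Γ a (some A)).bind fun p => (r Γ b (some (B.inst p.1))).bind fun q =>
        ok (op3 .pair (bnd .sig A B) p.1 q.1, G)
    | _ => err 5 Γ (op3 .pair T a b) G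

def inferInl (Γ : List E) (T a : E) (g : Option E) : Res (E × E) :=
  (expected e n r Γ T g).bind fun G => match whnf e n true G with
    | op2 .sum A B => (r Γ a (some A)).bind fun p => ok (op2 .inl (op2 .sum A B) p.1, G)
    | _ => err 6 Γ (op2 .inl T a) G

def inferInr (Γ : List E) (T a : E) (g : Option E) : Res (E × E) :=
  (expected e n r Γ T g).bind fun G => match whnf e n true G with
    | op2 .sum A B => (r Γ a (some B)).bind fun p => ok (op2 .inr (op2 .sum A B) p.1, G)
    | _ => err 7 Γ (op2 .inr T a) G

def inferSup (Γ : List E) (T a f : E) (g : Option E) : Res (E × E) :=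
  (expected e n r Γ T g).bind fun G => match whnf e n true G with
    | bnd .W A B => (r Γ a (some A)).bind fun p =>
        (r Γ f (some (bnd .pi (B.inst p.1) ((bnd .W A B).wk 1)))).bind fun q =>
          ok (op3 .sup (bnd .W A B) p.1 q.1, G)
    | _ => err 8 Γ (op3 .sup T a f) G

/-- A guess of the type of a tree whose function of subtrees is `f`. -/
def treeType (Γ : List E) (f : E) : Res E :=
  (r Γ f none).bind fun p => match whnf e n true p.2 with
    | bnd .pi _ T => match T.lower 1 0 with
      | some T => ok T
      | none => err 9 Γ f T
    | P => err 9 Γ f P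

def inferRefl (Γ : List E) (a : E) : Option E → Res (E × E)
  | none => (r Γ a none).bind fun p => ok (op1 .refl p.1, op3 .path p.2 p.1 p.1)
  | some G => match whnf e n true G with
    -- A proof by computation is written `refl □`: the left endpoint fills the hole, and what
    -- remains is to see that the endpoints are convertible.
    | op3 .path A x y => (cond (isHole a) (ok (x, A)) (r Γ a (some A))).bind fun p =>
        cond (conv e n p.1 x && conv e n p.1 y) (ok (op1 .refl p.1, G)) (err 10 Γ x y)
    | P => err 11 Γ (op1 .refl a) P

/-- The body of a motive for the elimination of `s : D`. -/
def motive (Γ : List E) (D C s : E) (g : Option E) : Res E :=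
  match C with
  | bnd .lam _ c => (inferTy e n r (D :: Γ) c).bind fun p => ok p.1
  | op0 .hole => match g with
    -- Abstracting the eliminated term from the goal need not preserve typing, so the result is
    -- elaborated anew; if the term does not occur, the motive is constant.
    | some G => cond (occurs s G)
        ((inferTy e n r (D :: Γ) (abstr s 0 G)).bind fun p => ok p.1) (ok (G.wk 1))
    | none => err 12 Γ s D
  | _ => err 13 Γ C D

def inferElim (Γ : List E) (C x y s : E) (g : Option E) : Res (E × E) :=
  (r Γ s none).bind fun p => match whnf e n true p.2 with
    | op2 .sum A B => (motive e n r Γ (op2 .sum A B) C p.1 g).bind fun c =>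
        (r Γ x (some (bnd .pi A ((c.shift 1 1).inst (op2 .inl ((op2 .sum A B).wk 1) (var 0)))))).bind fun x =>
        (r Γ y (some (bnd .pi B ((c.shift 1 1).inst (op2 .inr ((op2 .sum A B).wk 1) (var 0)))))).bind fun y =>
          coerce e n Γ (elim (bnd .lam (op2 .sum A B) c) x.1 y.1 p.1) (c.inst p.1) g
    | P => err 14 Γ s P

def inferSplit (Γ : List E) (C x s : E) (g : Option E) : Res (E × E) :=
  (r Γ s none).bind fun p => match whnf e n true p.2 with
    | bnd .sig A B => (motive e n r Γ (bnd .sig A B) C p.1 g).bind fun c =>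
        (r Γ x (some (bnd .pi A (bnd .pi B
          ((c.shift 2 1).inst (op3 .pair ((bnd .sig A B).wk 2) (var 1) (var 0))))))).bind fun x =>
          coerce e n Γ (op3 .split (bnd .lam (bnd .sig A B) c) x.1 p.1) (c.inst p.1) g
    | P => err 15 Γ s P

def inferOneElim (Γ : List E) (C x s : E) (g : Option E) : Res (E × E) :=
  (r Γ s (some (op0 .one))).bind fun p => (motive e n r Γ (op0 .one) C p.1 g).bind fun c =>
    (r Γ x (some (c.inst (op0 .star)))).bind fun x =>
      coerce e n Γ (op3 .oneElim (bnd .lam (op0 .one) c) x.1 p.1) (c.inst p.1) g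

/-- The type of the branch of `wrec`. -/
def wrecBranch (A B c : E) : E :=
  bnd .pi A (bnd .pi (bnd .pi B ((bnd .W A B).wk 2))
    (bnd .pi (bnd .pi (B.wk 1) ((c.shift 3 1).inst (op2 .app (var 1) (var 0))))
      ((c.shift 3 1).inst (op3 .sup ((bnd .W A B).wk 3) (var 2) (var 1)))))

def inferWrec (Γ : List E) (C x s : E) (g : Option E) : Res (E × E) :=
  (r Γ s none).bind fun p => match whnf e n true p.2 with
    | bnd .W A B => (motive e n r Γ (bnd .W A B) C p.1 g).bind fun c =>
        (r Γ x (some (wrecBranch A B c))).bind fun x =>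
          coerce e n Γ (op3 .wrec (bnd .lam (bnd .W A B) c) x.1 p.1) (c.inst p.1) g
    | P => err 16 Γ s P

def inst₂ (c a p : E) : E := (c.inst (p.wk 1)).inst a

/-- The body of a motive for the elimination of `p : a = b` in `A`. -/
def motiveJ (Γ : List E) (A a b C p : E) (g : Option E) : Res E :=
  let Δ := op3 .path (A.wk 1) (a.wk 1) (var 0) :: A :: Γ
  match C with
  | bnd .lam _ (bnd .lam _ c) => (inferTy e n r Δ c).bind fun q => ok q.1
  | op0 .hole => match g with
    | some G => cond (occurs b G || occurs p G)
        ((inferTy e n r Δ (abstr (p.wk 1) 0 (abstr b 0 G))).bind fun q => ok q.1) (ok (G.wk 2))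
    | none => err 17 Γ p A
  | _ => err 18 Γ C A

def inferJ (Γ : List E) (C x p : E) (g : Option E) : Res (E × E) :=
  (r Γ p none).bind fun p => match whnf e n true p.2 with
    | op3 .path A a b => (motiveJ e n r Γ A a b C p.1 g).bind fun c =>
        (r Γ x (some (inst₂ c a (op1 .refl a)))).bind fun x =>
          coerce e n Γ
            (op3 .J (bnd .lam A
              (bnd .lam (op3 .path (A.wk 1) (a.wk 1) (var 0)) c)) x.1 p.1) (inst₂ c b p.1) g
    | P => err 19 Γ p.1 P

/-! ### Applications with holes -/

/-- An argument of a function: still to be elaborated, or elaborated, with its type. -/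
inductive Arg
  | raw (a : E)
  | done (a T : E)

def inferArg (Γ : List E) (A : E) : Arg → Res E
  | .raw a => (r Γ a (some A)).bind fun p => ok p.1
  | .done a T => cond (conv e n T A) (ok a) (err 20 Γ T A)

def inferSpine (Γ : List E) : List Arg → E → E → Res (E × E)
  | [], f, T => ok (f, T)
  | a :: as, f, T => match whnf e n true T with
    | bnd .pi A B => (inferArg e n r Γ A a).bind fun a =>
        inferSpine Γ as (op2 .app f a) (B.inst a)
    | P => err 21 Γ f P

/-- The guessing of omitted arguments is not verified. A solution is put back as a `raw` argument
and elaborated against its type, so no property of matching enters the soundness proof. -/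
abbrev Sol := List (ℕ × E)

def Sol.find : Sol → ℕ → Option E
  | [], _ => none
  | s :: σ, k => cond (Nat.beq s.1 k) (some s.2) (Sol.find σ k)

def Sol.add (σ : Sol) (k : ℕ) : Option E → Sol
  | none => σ
  | some a => match σ.find k with
    | some _ => σ
    | none => (k, a) :: σ

/-- Some metavariable of the term is not solved. -/
def unsolved (σ : Sol) : E → Bool
  | var _ => false
  | con _ => false
  | op0 (.mv i) => match σ.find i with | some _ => false | none => true
  | op0 _ => false
  | op1 _ a => unsolved σ a
  | op2 _ a b => unsolved σ a || unsolved σ b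
  | op3 _ a b c => unsolved σ a || (unsolved σ b || unsolved σ c)
  | elim a b c d => unsolved σ a || (unsolved σ b || (unsolved σ c || unsolved σ d))
  | bnd _ a b => unsolved σ a || unsolved σ b

/-- First-order matching, under `d` binders, of a term that has none of the metavariables; `u`
reduces the latter if the heads differ. -/
def mtch (e : Env) : ℕ → ℕ → E → E → Sol → Sol
  | 0, _, _, _, σ => σ
  | n + 1, d, p, t, σ =>
    let reduce : Sol :=
      match t.headCon with
      | some k => match e.unfold k with
        | some _ => mtch e n d p (whnf e n false (unfoldHead e t)) σ
        | none => σ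
      | none => σ
    let step : Sol := match p with
      | op1 o a => match t with
        | op1 o' a' => cond (Nat.beq o.idx o'.idx) (mtch e n d a a' σ) σ
        | _ => reduce
      | op2 o a b => match t with
        | op2 o' a' b' => cond (Nat.beq o.idx o'.idx)
            (mtch e n d b b' (mtch e n d a a' σ)) reduce
        | _ => reduce
      | op3 o a b c => match t with
        | op3 o' a' b' c' => cond (Nat.beq o.idx o'.idx)
            (mtch e n d c c' (mtch e n d b b' (mtch e n d a a' σ))) reduce
        | _ => reduce
      | elim a b c x => match t with
        | elim a' b' c' x' => mtch e n d x x' (mtch e n d c c' (mtch e n d b b' (mtch e n d a a' σ)))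
        | _ => reduce
      | bnd o a b => match t with
        | bnd o' a' b' => cond (Nat.beq o.idx o'.idx)
            (mtch e n (Nat.succ d) b b' (mtch e n d a a' σ)) reduce
        | _ => reduce
      | _ => σ
    match p with
    | op0 (.mv i) => σ.add i (t.lower d 0)
    -- A metavariable applied to the innermost bound variable is the one higher-order pattern that
    -- is solved: the solution abstracts that variable, provided that none of the other bound
    -- variables occurs.
    | op2 .app (op0 (.mv i)) (var 0) => match d with
      | 0 => step
      | d + 1 => match t.lower d 1 with
        | some b => σ.add i (some (bnd .lam (op0 .hole) b))
        | none => σ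
    | _ => match p.headCon with
      | none => step
      | some k => match t.headCon with
        | none => match whnf e n false t with
          | t' => match t'.headCon with
            | some _ => cond (t'.beq t) σ (mtch e n d p t' σ)
            | none => σ
        | some k' => cond (Nat.beq k k') step reduce

/-- The metavariable `i` stands for the argument with index `i` in the types of the later arguments
and in the type of the result. -/
def telescope (e : Env) (n : ℕ) : ℕ → E → List E → List E × E
  | _, T, [] => ([], T)
  | i, T, _ :: as =>
    let go (A B : E) : List E × E :=
      match telescope e n (Nat.succ i) (B.inst (op0 (.mv i))) as with
      | (Δ, R) => (A :: Δ, R)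
    match T with
    | bnd .pi A B => go A B
    | _ => match whnf e n true T with
      | bnd .pi A B => go A B
      | T => ([], T)

def hasHole : List E → Bool
  | [] => false
  | a :: as => isHole a || hasHole as

/-- Elaborates the arguments whose types contain unsolved metavariables. -/
def solveArgs (Γ : List E) : ℕ → List E → List E → Sol → List Arg × Sol
  | i, a :: as, A :: Δ, σ =>
    cond (isHole a || !unsolved σ A)
      (match solveArgs Γ (Nat.succ i) as Δ (cond (isHole a) σ (σ.add i (some a))) with
        | (bs, σ) => (.raw a :: bs, σ))
      (match r Γ a none with
        | ok p => match solveArgs Γ (Nat.succ i) as Δ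
              (mtch e n 0 A p.2 (σ.add i (some p.1))) with
            | (bs, σ) => (.done p.1 p.2 :: bs, σ)
        | err _ _ _ _ => match solveArgs Γ (Nat.succ i) as Δ σ with
            | (bs, σ) => (.raw a :: bs, σ))
  | _, as, _, σ => (as.map .raw, σ)

def fillHoles (σ : Sol) : ℕ → List Arg → List Arg
  | _, [] => []
  | i, a :: as => (match a with
    | .raw (op0 .hole) => match σ.find i with
      | some x => .raw x
      | none => .raw (op0 .hole)
    | a => a) :: fillHoles σ (Nat.succ i) as

/-- The expected type of the whole application is matched first, then the types of those arguments
whose expected types still contain unsolved metavariables. -/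
def prepare (Γ : List E) (T : E) (as : List E) (g : Option E) : List Arg :=
  cond (hasHole as)
    (match telescope e n 0 T as with
      | (Δ, R) => match solveArgs e n r Γ 0 as Δ
          (match g with | some G => mtch e n 0 R G [] | none => []) with
        | (bs, σ) => fillHoles σ 0 bs)
    (as.map .raw)

def unwind : E → List E → E × List E
  | op2 .app f a, as => unwind f (a :: as)
  | f, as => (f, as)

def inferApp (Γ : List E) (f a : E) (g : Option E) : Res (E × E) :=
  match unwind f [a] with
  | (h, as) => (r Γ h none).bind fun p =>
      (inferSpine e n r Γ (prepare e n r Γ p.2 as g) p.1 p.2).bind fun q =>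
        coerce e n Γ q.1 q.2 g

/-- A redex whose function is not annotated. -/
def inferRedex (Γ : List E) (b a : E) (g : Option E) : Res (E × E) :=
  (r Γ a none).bind fun p => (r (p.2 :: Γ) b none).bind fun q =>
    coerce e n Γ (op2 .app (bnd .lam p.2 q.1) p.1) (q.2.inst p.1) g

def inferFst (Γ : List E) (p : E) (g : Option E) : Res (E × E) :=
  (r Γ p none).bind fun p => match whnf e n true p.2 with
    | bnd .sig A _ => coerce e n Γ (op1 .fst p.1) A g
    | P => err 22 Γ p.1 P

def inferSnd (Γ : List E) (p : E) (g : Option E) : Res (E × E) :=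
  (r Γ p none).bind fun p => match whnf e n true p.2 with
    | bnd .sig _ B => coerce e n Γ (op1 .snd p.1) (B.inst (op1 .fst p.1)) g
    | P => err 23 Γ p.1 P

def maxLevel (i j : ℕ) : ℕ := cond (Nat.ble i j) j i

def inferBind (Γ : List E) (o : OpB) (A B : E) (g : Option E) : Res (E × E) :=
  (inferTy e n r Γ A).bind fun p => (inferTy e n r (p.1 :: Γ) B).bind fun q =>
    coerce e n Γ (bnd o p.1 q.1) (op0 (.univ (maxLevel p.2 q.2))) g

def inferSum (Γ : List E) (A B : E) (g : Option E) : Res (E × E) :=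
  (inferTy e n r Γ A).bind fun p => (inferTy e n r Γ B).bind fun q =>
    coerce e n Γ (op2 .sum p.1 q.1) (op0 (.univ (maxLevel p.2 q.2))) g

def inferPath (Γ : List E) (A a b : E) (g : Option E) : Res (E × E) :=
  (cond (isHole A) ((r Γ a none).bind fun p => inferTy e n r Γ p.2) (inferTy e n r Γ A)).bind fun p =>
    (r Γ a (some p.1)).bind fun a => (r Γ b (some p.1)).bind fun b =>
      coerce e n Γ (op3 .path p.1 a.1 b.1) (op0 (.univ p.2)) g

def inferAbort (Γ : List E) (C x : E) (g : Option E) : Res (E × E) :=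
  (cond (isHole C) (expected e n r Γ C g)
    ((inferTy e n r Γ C).bind fun p => ok p.1)).bind fun C =>
      (r Γ x (some (op0 .zero))).bind fun x => coerce e n Γ (op2 .abort C x.1) C g

def inferAnn (Γ : List E) (T a : E) (g : Option E) : Res (E × E) :=
  (inferTy e n r Γ T).bind fun p => (r Γ a (some p.1)).bind fun q => coerce e n Γ q.1 p.1 g

def inferOp0 (Γ : List E) (o : Op0) (g : Option E) : Res (E × E) :=
  match o with
  | .univ l => coerce e n Γ (op0 (.univ l)) (op0 (.univ (Nat.succ l))) g
  | .zero => coerce e n Γ (op0 .zero) (op0 (.univ 0)) g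
  | .one => coerce e n Γ (op0 .one) (op0 (.univ 0)) g
  | .star => coerce e n Γ (op0 .star) (op0 .one) g
  | _ => err 24 Γ (op0 o) (op0 o)

def inferVar (Γ : List E) (k : ℕ) (g : Option E) : Res (E × E) :=
  match Γ[k]? with
  | some A => coerce e n Γ (var k) (A.wk (Nat.succ k)) g
  | none => err 25 Γ (var k) (var k)

def inferCon (Γ : List E) (k : ℕ) (g : Option E) : Res (E × E) :=
  match e.find k with
  | some d => coerce e n Γ (con k) d.ty g
  | none => err 26 Γ (con k) (con k)

def inferOp2 (Γ : List E) (o : Op2) (a b : E) (g : Option E) : Res (E × E) :=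
  match o with
  | .app => match a with
    | bnd .lam (op0 .hole) c => inferRedex e n r Γ c b g
    | _ => inferApp e n r Γ a b g
  | .sum => inferSum e n r Γ a b g
  | .abort => inferAbort e n r Γ a b g
  | .inl => inferInl e n r Γ a b g
  | .inr => inferInr e n r Γ a b g
  | .ann => inferAnn e n r Γ a b g

def inferOp3 (Γ : List E) (o : Op3) (a b c : E) (g : Option E) : Res (E × E) :=
  match o with
  | .pair => cond (isHole a)
      (match g with | none => inferPairInfer r Γ b c | g => inferPair e n r Γ a b c g)
      (inferPair e n r Γ a b c g)
  | .sup => cond (isHole a)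
      (match g with
        | none => (treeType e n r Γ c).bind fun T => inferSup e n r Γ T b c none
        | g => inferSup e n r Γ a b c g)
      (inferSup e n r Γ a b c g)
  | .split => inferSplit e n r Γ a b c g
  | .oneElim => inferOneElim e n r Γ a b c g
  | .wrec => inferWrec e n r Γ a b c g
  | .path => inferPath e n r Γ a b c g
  | .J => inferJ e n r Γ a b c g

def inferStep (Γ : List E) (t : E) (g : Option E) : Res (E × E) :=
  match t with
  | var k => inferVar e n Γ k g
  | con k => inferCon e n Γ k g
  | op0 o => inferOp0 e n Γ o g
  | op1 o a => match o with
    | .fst => inferFst e n r Γ a g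
    | .snd => inferSnd e n r Γ a g
    | .refl => inferRefl e n r Γ a g
  | op2 o a b => inferOp2 e n r Γ o a b g
  | op3 o a b c => inferOp3 e n r Γ o a b c g
  | elim a b c d => inferElim e n r Γ a b c d g
  | bnd o a b => match o with
    | .lam => inferLam e n r Γ a b g
    | o => inferBind e n r Γ o a b g

end

/-- Exhausted fuel is an error, so that a success carries information for every amount of fuel. -/
def infer (e : Env) : ℕ → Infer
  | 0, Γ, t, _ => err 0 Γ t t
  | n + 1, Γ, t, g => inferStep e 100000 (infer e n) Γ t g

end
end UF

namespace UF

/-! ## Substitution -/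

namespace Tm

theorem liftRen_comp (ξ ζ : ℕ → ℕ) : liftRen (ξ ∘ ζ) = liftRen ξ ∘ liftRen ζ := by
  funext n; cases n <;> rfl

theorem rename_rename (t : Tm) (ξ ζ : ℕ → ℕ) : (t.rename ζ).rename ξ = t.rename (ξ ∘ ζ) := by
  induction t generalizing ξ ζ <;> simp [rename, liftRen_comp, *]

theorem liftSub_comp_liftRen (σ : ℕ → Tm) (ξ : ℕ → ℕ) :
    liftSub (σ ∘ ξ) = liftSub σ ∘ liftRen ξ := by
  funext n; cases n <;> rfl

theorem subst_rename (t : Tm) (σ : ℕ → Tm) (ξ : ℕ → ℕ) :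
    (t.rename ξ).subst σ = t.subst (σ ∘ ξ) := by
  induction t generalizing σ ξ <;> simp [rename, subst, liftSub_comp_liftRen, *]

theorem liftSub_rename (σ : ℕ → Tm) (ξ : ℕ → ℕ) :
    liftSub (fun n => (σ n).rename ξ) = fun n => (liftSub σ n).rename (liftRen ξ) := by
  funext n
  cases n with
  | zero => rfl
  | succ n => simp [liftSub, wk, rename_rename]; rfl

theorem rename_subst (t : Tm) (σ : ℕ → Tm) (ξ : ℕ → ℕ) :
    (t.subst σ).rename ξ = t.subst fun n => (σ n).rename ξ := by
  induction t generalizing σ ξ <;> simp [rename, subst, liftSub_rename, *]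

theorem liftSub_subst (σ τ : ℕ → Tm) :
    liftSub (fun n => (σ n).subst τ) = fun n => (liftSub σ n).subst (liftSub τ) := by
  funext n
  cases n with
  | zero => rfl
  | succ n => simp [liftSub, wk, rename_subst, subst_rename]; rfl

theorem subst_subst (t : Tm) (σ τ : ℕ → Tm) :
    (t.subst σ).subst τ = t.subst fun n => (σ n).subst τ := by
  induction t generalizing σ τ <;> simp [subst, liftSub_subst, *]

theorem liftSub_var : liftSub var = var := by
  funext n; cases n <;> rfl

theorem subst_var (t : Tm) : t.subst var = t := by
  induction t <;> simp [subst, liftSub_var, *]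

theorem liftSub_var_comp (ξ : ℕ → ℕ) : liftSub (var ∘ ξ) = var ∘ liftRen ξ := by
  rw [liftSub_comp_liftRen, liftSub_var]

theorem rename_eq_subst (t : Tm) (ξ : ℕ → ℕ) : t.rename ξ = t.subst (var ∘ ξ) := by
  rw [← subst_rename, subst_var]

theorem wk_subst (t : Tm) (σ : ℕ → Tm) : (t.wk 1).subst (liftSub σ) = (t.subst σ).wk 1 := by
  simp [wk, subst_rename, rename_subst]; rfl

theorem wk_zero (t : Tm) : t.wk 0 = t := by
  rw [wk, rename_eq_subst]; exact subst_var t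

theorem wk_wk (t : Tm) (j k : ℕ) : (t.wk j).wk k = t.wk (j + k) := by
  simp [wk, rename_rename, Function.comp_def, Nat.add_assoc]

theorem wk_two (t : Tm) : t.wk 2 = (t.wk 1).wk 1 := by rw [wk_wk]

theorem wk_three (t : Tm) : t.wk 3 = ((t.wk 1).wk 1).wk 1 := by rw [wk_wk, wk_wk]

theorem inst_subst (b a : Tm) (σ : ℕ → Tm) :
    (b.inst a).subst σ = (b.subst (liftSub σ)).inst (a.subst σ) := by
  simp only [inst, subst_subst]
  congr 1
  funext n
  cases n with
  | zero => rfl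
  | succ n =>
    simp only [instVar, liftSub, wk, subst_rename]
    exact (subst_var _).symm

theorem wk_inst (t a : Tm) : (t.wk 1).inst a = t := by
  rw [inst, wk, subst_rename]; exact subst_var t

end Tm

open Tm

/-- A term whose typing is derived from `h` is closed from the length of the context on. -/
theorem HasType.subst_eq {Γ : List Tm} {t A : Tm} (h : HasType Γ t A) :
    ∀ σ : ℕ → Tm, (∀ n < Γ.length, σ n = .var n) → t.subst σ = t := by
  have lift : ∀ (N : ℕ) (σ : ℕ → Tm), (∀ n < N, σ n = .var n) →
      ∀ n ≤ N, liftSub σ n = .var n := by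
    intro N σ h n hn
    cases n with
    | zero => rfl
    | succ n => simp [liftSub, h n (by omega), wk, rename]
  induction h with
  | var h => 
    intro σ hσ
    exact hσ _ (List.getElem?_eq_some_iff.1 h).1
  | conv _ _ _ ih _ => exact ih
  | funext i j => intro σ _; rfl
  | ua l => intro σ _; rfl
  | _ => 
    intro σ hσ
    have := lift _ σ hσ
    simp_all [subst]

/-! ### Substitution in conversions and in derivations -/

theorem Conv.subst {a b : Tm} (h : Conv a b) : ∀ σ : ℕ → Tm, Conv (a.subst σ) (b.subst σ) := by
  induction h with
  | rfl a => intro σ; exact .rfl _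
  | symm _ ih => intro σ; exact .symm (ih σ)
  | trans _ _ ih ih' => intro σ; exact .trans (ih σ) (ih' σ)
  | app_lam b a => intro σ; rw [inst_subst]; exact .app_lam _ _
  | wrec_sup C c a f =>
    intro σ
    have := Conv.wrec_sup (C.subst σ) (c.subst σ) (a.subst σ) (f.subst σ)
    simpa [Tm.subst, ← wk_subst, liftSub] using this
  | lam_app f =>
    intro σ
    have := Conv.lam_app (f.subst σ)
    simpa [Tm.subst, wk_subst, liftSub] using this
  | pi _ _ h₁ h₂ => intro σ; exact .pi (h₁ _) (h₂ _)
  | lam _ h₁ => intro σ; exact .lam (h₁ _)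
  | app _ _ h₁ h₂ => intro σ; exact .app (h₁ _) (h₂ _)
  | sig _ _ h₁ h₂ => intro σ; exact .sig (h₁ _) (h₂ _)
  | pair _ _ h₁ h₂ => intro σ; exact .pair (h₁ _) (h₂ _)
  | fst _ h₁ => intro σ; exact .fst (h₁ _)
  | snd _ h₁ => intro σ; exact .snd (h₁ _)
  | split _ _ _ h₁ h₂ h₃ => intro σ; exact .split (h₁ _) (h₂ _) (h₃ _)
  | abort _ _ h₁ h₂ => intro σ; exact .abort (h₁ _) (h₂ _)
  | oneElim _ _ _ h₁ h₂ h₃ => intro σ; exact .oneElim (h₁ _) (h₂ _) (h₃ _)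
  | sum _ _ h₁ h₂ => intro σ; exact .sum (h₁ _) (h₂ _)
  | inl _ h₁ => intro σ; exact .inl (h₁ _)
  | inr _ h₁ => intro σ; exact .inr (h₁ _)
  | sumElim _ _ _ _ h₁ h₂ h₃ h₄ => intro σ; exact .sumElim (h₁ _) (h₂ _) (h₃ _) (h₄ _)
  | W _ _ h₁ h₂ => intro σ; exact .W (h₁ _) (h₂ _)
  | sup _ _ h₁ h₂ => intro σ; exact .sup (h₁ _) (h₂ _)
  | wrec _ _ _ h₁ h₂ h₃ => intro σ; exact .wrec (h₁ _) (h₂ _) (h₃ _)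
  | path _ _ _ h₁ h₂ h₃ => intro σ; exact .path (h₁ _) (h₂ _) (h₃ _)
  | refl _ h₁ => intro σ; exact .refl (h₁ _)
  | J _ _ _ h₁ h₂ h₃ => intro σ; exact .J (h₁ _) (h₂ _) (h₃ _)
  | fst_pair => intro σ; exact .fst_pair _ _
  | snd_pair => intro σ; exact .snd_pair _ _
  | split_pair => intro σ; exact .split_pair _ _ _ _
  | oneElim_star => intro σ; exact .oneElim_star _ _
  | sumElim_inl => intro σ; exact .sumElim_inl _ _ _ _
  | sumElim_inr => intro σ; exact .sumElim_inr _ _ _ _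
  | J_refl => intro σ; exact .J_refl _ _ _

theorem Conv.inst {b b' a a' : Tm} (h : Conv b b') (h' : Conv a a') :
    Conv (b.inst a) (b'.inst a') :=
  .trans (.symm (.app_lam b a)) (.trans (.app (.lam h) h') (.app_lam b' a'))

theorem Conv.wk {a b : Tm} (h : Conv a b) (k : ℕ) : Conv (a.wk k) (b.wk k) := by
  simp only [Tm.wk, rename_eq_subst]; exact h.subst _

/-- Derivations are preserved by a class of substitutions that is closed under lifting and whose
members map variables to terms of the right types. -/
theorem HasType.subst_of {P : List Tm → List Tm → (ℕ → Tm) → Prop}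
    (lift : ∀ {Γ Δ σ} (A : Tm), P Γ Δ σ → P (A :: Γ) (A.subst σ :: Δ) (liftSub σ))
    (var : ∀ {Γ Δ σ n A}, P Γ Δ σ → Γ[n]? = some A → HasType Δ (σ n) ((A.wk (n + 1)).subst σ))
    {Γ : List Tm} {t A : Tm} (h : HasType Γ t A) :
    ∀ {Δ : List Tm} {σ : ℕ → Tm}, P Γ Δ σ → HasType Δ (t.subst σ) (A.subst σ) := by
  induction h with
  | var h => intro Δ σ p; exact var p h
  | conv _ _ h ih ih' => intro Δ σ p; exact .conv (ih p) (ih' p) (h.subst σ)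
  | univ l => intro Δ σ p; exact .univ l
  | pi _ _ ih ih' => intro Δ σ p; exact .pi (ih p) (ih' (lift _ p))
  | lam _ _ ih ih' => intro Δ σ p; exact .lam (ih p) (ih' (lift _ p))
  | app _ _ ih ih' => intro Δ σ p; rw [inst_subst]; exact .app (ih p) (ih' p)
  | sig _ _ ih ih' => intro Δ σ p; exact .sig (ih p) (ih' (lift _ p))
  | pair _ _ _ ih ih' ih'' =>
    intro Δ σ p
    exact .pair (ih p) (ih' p) (by rw [← inst_subst]; exact ih'' p)
  | fst _ ih => intro Δ σ p; exact .fst (ih p)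
  | snd _ ih => intro Δ σ p; rw [inst_subst]; exact .snd (ih p)
  | split _ _ _ ih ih' ih'' =>
    intro Δ σ p
    refine .split (ih p) ?_ (ih'' p)
    have := ih' p
    simp only [Tm.subst, wk_two, wk_subst, liftSub] at this ⊢
    exact this
  | zero => intro Δ σ p; exact .zero
  | abort _ _ ih ih' => intro Δ σ p; exact .abort (ih p) (ih' p)
  | one => intro Δ σ p; exact .one
  | star => intro Δ σ p; exact .star
  | oneElim _ _ _ ih ih' ih'' => intro Δ σ p; exact .oneElim (ih p) (ih' p) (ih'' p)
  | sum _ _ ih ih' => intro Δ σ p; exact .sum (ih p) (ih' p)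
  | inl _ _ ih ih' => intro Δ σ p; exact .inl (ih p) (ih' p)
  | inr _ _ ih ih' => intro Δ σ p; exact .inr (ih p) (ih' p)
  | sumElim _ _ _ _ ih ihl ihr ihs =>
    intro Δ σ p
    refine .sumElim (ih p) ?_ ?_ (ihs p)
    · have := ihl p
      simpa [Tm.subst, wk_subst, liftSub] using this
    · have := ihr p
      simpa [Tm.subst, wk_subst, liftSub] using this
  | W _ _ ih ih' => intro Δ σ p; exact .W (ih p) (ih' (lift _ p))
  | sup _ _ _ ih ih' ih'' =>
    intro Δ σ p
    refine .sup (ih p) (ih' p) ?_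
    have := ih'' p
    rwa [Tm.subst, wk_subst, inst_subst] at this
  | wrec _ _ _ ih ih' ih'' =>
    intro Δ σ p
    refine .wrec (ih p) ?_ (ih'' p)
    have := ih' p
    simp only [Tm.subst, wk_two, wk_three, wk_subst, liftSub] at this ⊢
    exact this
  | path _ _ _ ih ih' ih'' => intro Δ σ p; exact .path (ih p) (ih' p) (ih'' p)
  | refl _ _ ih ih' => intro Δ σ p; exact .refl (ih p) (ih' p)
  | @J _ _ _ _ _ _ _ l _ _ _ ih ih' ih'' =>
    intro Δ σ p
    refine .J (l := l) ?_ (ih' p) (ih'' p)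
    have := ih p
    simpa [Tm.subst, wk_subst, liftSub] using this
  | funext i j => intro Δ σ _; exact .funext i j
  | ua l => intro Δ σ _; exact .ua l

/-- Renamings have to be treated before substitutions, because lifting a substitution under a binder
weakens its values. Both are instances of `HasType.subst_of`, here for the class of substitutions
that come from type-preserving renamings. -/
theorem HasType.rename {Γ Δ : List Tm} {t A : Tm} (h : HasType Γ t A) {ξ : ℕ → ℕ}
    (hξ : ∀ n A, Γ[n]? = some A → ∃ B, Δ[ξ n]? = some B ∧ B.wk (ξ n + 1) = (A.wk (n + 1)).rename ξ) :
    HasType Δ (t.rename ξ) (A.rename ξ) := by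
  rw [rename_eq_subst, rename_eq_subst]
  refine HasType.subst_of
    (P := fun Γ Δ σ => ∃ ξ : ℕ → ℕ, σ = .var ∘ ξ ∧
      ∀ n A, Γ[n]? = some A → ∃ B, Δ[ξ n]? = some B ∧ B.wk (ξ n + 1) = (A.wk (n + 1)).rename ξ)
    ?_ ?_ h ⟨ξ, rfl, hξ⟩
  · rintro Γ Δ _ A ⟨ξ, rfl, hξ⟩
    refine ⟨liftRen ξ, liftSub_var_comp ξ, ?_⟩
    rintro (_ | n) B hB
    · obtain rfl : A = B := by simpa using hB
      refine ⟨A.subst (.var ∘ ξ), rfl, ?_⟩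
      rw [← rename_eq_subst]
      simp [Tm.wk, rename_rename]; rfl
    · obtain ⟨B', h, h'⟩ := hξ n B hB
      refine ⟨B', h, ?_⟩
      rw [show liftRen ξ (n + 1) + 1 = (ξ n + 1) + 1 from rfl, ← wk_wk, h', ← wk_wk]
      simp only [Tm.wk, rename_rename]; rfl
  · rintro Γ Δ _ n A ⟨ξ, rfl, hξ⟩ h
    obtain ⟨B, h, h'⟩ := hξ n A h
    rw [← rename_eq_subst, ← h']
    exact .var h

theorem HasType.weaken {Γ : List Tm} {t A : Tm} (h : HasType Γ t A) (Δ : List Tm) :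
    HasType (Δ ++ Γ) (t.wk Δ.length) (A.wk Δ.length) := by
  refine h.rename fun n B hB => ⟨B, ?_, ?_⟩
  · rw [List.getElem?_append_right (by omega), Nat.add_sub_cancel]; exact hB
  · rw [show n + Δ.length + 1 = (n + 1) + Δ.length by omega, ← wk_wk]; rfl

theorem HasType.wk {Γ : List Tm} {t A : Tm} (h : HasType Γ t A) (B : Tm) :
    HasType (B :: Γ) (t.wk 1) (A.wk 1) := h.weaken [B]

/-- A substitution between contexts. -/
def Sub (Γ Δ : List Tm) (σ : ℕ → Tm) : Prop :=
  ∀ n A, Γ[n]? = some A → HasType Δ (σ n) ((A.wk (n + 1)).subst σ)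

theorem Sub.lift {Γ Δ : List Tm} {σ : ℕ → Tm} (A : Tm) (h : Sub Γ Δ σ) :
    Sub (A :: Γ) (A.subst σ :: Δ) (liftSub σ) := by
  rintro (_ | n) B hB
  · obtain rfl : A = B := by simpa using hB
    rw [wk_subst]
    exact .var rfl
  · rw [← wk_wk, wk_subst]
    exact (h n B hB).wk _

theorem HasType.subst {Γ Δ : List Tm} {t A : Tm} (h : HasType Γ t A) {σ : ℕ → Tm}
    (hσ : Sub Γ Δ σ) : HasType Δ (t.subst σ) (A.subst σ) :=
  h.subst_of (P := Sub) (fun A h => Sub.lift A h) (fun h hn => h _ _ hn) hσ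

theorem Sub.inst {Γ : List Tm} {a A : Tm} (h : HasType Γ a A) : Sub (A :: Γ) Γ (instVar a) := by
  rintro (_ | n) B hB
  · obtain rfl : A = B := by simpa using hB
    rw [show (A.wk 1).subst (instVar a) = A from wk_inst A a]
    exact h
  · rw [← wk_wk, show ((B.wk (n + 1)).wk 1).subst (instVar a) = _ from wk_inst _ a]
    exact .var hB

theorem HasType.inst {Γ : List Tm} {b B a A : Tm} (h : HasType (A :: Γ) b B)
    (h' : HasType Γ a A) : HasType Γ (b.inst a) (B.inst a) := h.subst (Sub.inst h')

/-- The type of a variable may be replaced by a convertible one. -/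
theorem HasType.conv_ctx {Γ : List Tm} {t T A A' : Tm} {l : ℕ} (h : HasType (A :: Γ) t T)
    (hA : HasType Γ A (.univ l)) (hc : Conv A A') : HasType (A' :: Γ) t T := by
  have hσ : Sub (A :: Γ) (A' :: Γ) Tm.var := by
    rintro (_ | n) B hB
    · obtain rfl : A = B := by simpa using hB
      rw [subst_var]
      exact .conv (.var rfl) (hA.wk A') (hc.symm.wk 1)
    · rw [subst_var]
      exact .var hB
  simpa [subst_var] using h.subst hσ

theorem HasType.weaken_nil {t A : Tm} (h : HasType [] t A) (Γ : List Tm) : HasType Γ t A := by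
  have := h.subst (Δ := Γ) (σ := Tm.var) (by intro n A hA; simp at hA)
  simpa [subst_var] using this

end UF

namespace UF

/-! ## Confluence of the computation rules

Raw terms are regrouped by the number of their arguments, and the Church–Rosser property is proved
with parallel reduction.  It makes the type formers injective up to conversion. -/

inductive K0 | zero | one | star | univ (l : ℕ) | funext (i j : ℕ) | ua (l : ℕ)
inductive K1 | fst | snd | inl | inr | refl
inductive K2 | app | pair | sum | sup | abort
inductive K3 | split | oneElim | wrec | path | J
inductive KB | pi | sig | W

/-- One constructor per arity replaces the many term formers, which keeps the congruence cases of
parallel reduction few. Abstraction stays separate since the rules `β` and `η` mention it. -/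
inductive G : Type
  | var (n : ℕ)
  | nul (o : K0)
  | un (o : K1) (a : G)
  | bin (o : K2) (a b : G)
  | tri (o : K3) (a b c : G)
  | quad (a b c d : G)
  | bnd (o : KB) (a b : G)
  | lam (b : G)

namespace G

open Tm (liftRen)

def rename : (ℕ → ℕ) → G → G
  | ξ, var n => var (ξ n)
  | _, nul o => nul o
  | ξ, un o a => un o (a.rename ξ)
  | ξ, bin o a b => bin o (a.rename ξ) (b.rename ξ)
  | ξ, tri o a b c => tri o (a.rename ξ) (b.rename ξ) (c.rename ξ)
  | ξ, quad a b c d => quad (a.rename ξ) (b.rename ξ) (c.rename ξ) (d.rename ξ)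
  | ξ, bnd o a b => bnd o (a.rename ξ) (b.rename (liftRen ξ))
  | ξ, lam b => lam (b.rename (liftRen ξ))

def wk (t : G) : G := t.rename (· + 1)

def liftSub (σ : ℕ → G) : ℕ → G
  | 0 => var 0
  | n + 1 => (σ n).wk

def subst : (ℕ → G) → G → G
  | σ, var n => σ n
  | _, nul o => nul o
  | σ, un o a => un o (a.subst σ)
  | σ, bin o a b => bin o (a.subst σ) (b.subst σ)
  | σ, tri o a b c => tri o (a.subst σ) (b.subst σ) (c.subst σ)
  | σ, quad a b c d => quad (a.subst σ) (b.subst σ) (c.subst σ) (d.subst σ)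
  | σ, bnd o a b => bnd o (a.subst σ) (b.subst (liftSub σ))
  | σ, lam b => lam (b.subst (liftSub σ))

def instVar (a : G) : ℕ → G
  | 0 => a
  | n + 1 => var n

def inst (b a : G) : G := b.subst (instVar a)

def size : G → ℕ
  | var _ => 1
  | nul _ => 1
  | un _ a => a.size + 1
  | bin _ a b => a.size + b.size + 1
  | tri _ a b c => a.size + b.size + c.size + 1
  | quad a b c d => a.size + b.size + c.size + d.size + 1
  | bnd _ a b => a.size + b.size + 1
  | lam b => b.size + 1

theorem size_rename (t : G) (ξ : ℕ → ℕ) : (t.rename ξ).size = t.size := by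
  induction t generalizing ξ <;> simp [rename, size, *]

theorem rename_rename (t : G) (ξ ζ : ℕ → ℕ) : (t.rename ζ).rename ξ = t.rename (ξ ∘ ζ) := by
  induction t generalizing ξ ζ <;> simp [rename, Tm.liftRen_comp, *]

theorem liftSub_comp_liftRen (σ : ℕ → G) (ξ : ℕ → ℕ) :
    liftSub (σ ∘ ξ) = liftSub σ ∘ liftRen ξ := by
  funext n; cases n <;> rfl

theorem subst_rename (t : G) (σ : ℕ → G) (ξ : ℕ → ℕ) :
    (t.rename ξ).subst σ = t.subst (σ ∘ ξ) := by
  induction t generalizing σ ξ <;> simp [rename, subst, liftSub_comp_liftRen, *]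

theorem liftSub_rename (σ : ℕ → G) (ξ : ℕ → ℕ) :
    liftSub (fun n => (σ n).rename ξ) = fun n => (liftSub σ n).rename (liftRen ξ) := by
  funext n
  cases n with
  | zero => rfl
  | succ n => simp [liftSub, wk, rename_rename]; rfl

theorem rename_subst (t : G) (σ : ℕ → G) (ξ : ℕ → ℕ) :
    (t.subst σ).rename ξ = t.subst fun n => (σ n).rename ξ := by
  induction t generalizing σ ξ <;> simp [rename, subst, liftSub_rename, *]

theorem liftSub_subst (σ τ : ℕ → G) :
    liftSub (fun n => (σ n).subst τ) = fun n => (liftSub σ n).subst (liftSub τ) := by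
  funext n
  cases n with
  | zero => rfl
  | succ n => simp [liftSub, wk, rename_subst, subst_rename]; rfl

theorem subst_subst (t : G) (σ τ : ℕ → G) :
    (t.subst σ).subst τ = t.subst fun n => (σ n).subst τ := by
  induction t generalizing σ τ <;> simp [subst, liftSub_subst, *]

theorem liftSub_var : liftSub var = var := by
  funext n; cases n <;> rfl

theorem subst_var (t : G) : t.subst var = t := by
  induction t <;> simp [subst, liftSub_var, *]

theorem wk_subst (t : G) (σ : ℕ → G) : t.wk.subst (liftSub σ) = (t.subst σ).wk := by
  simp [wk, subst_rename, rename_subst]; rfl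

theorem wk_rename (t : G) (ξ : ℕ → ℕ) : t.wk.rename (liftRen ξ) = (t.rename ξ).wk := by
  simp [wk, rename_rename]; rfl

theorem wk_inst (t a : G) : t.wk.inst a = t := by
  rw [inst, wk, subst_rename]; exact subst_var t

theorem inst_subst (b a : G) (σ : ℕ → G) :
    (b.inst a).subst σ = (b.subst (liftSub σ)).inst (a.subst σ) := by
  simp only [inst, subst_subst]
  congr 1
  funext n
  cases n with
  | zero => rfl
  | succ n => exact (wk_inst (σ n) (a.subst σ)).symm

theorem inst_rename (b a : G) (ξ : ℕ → ℕ) :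
    (b.inst a).rename ξ = (b.rename (liftRen ξ)).inst (a.rename ξ) := by
  simp only [inst, rename_subst, subst_rename]
  congr 1
  funext n
  cases n <;> rfl

/-- A term in the images of two renamings comes from a term in their pullback. -/
theorem rename_pullback (p : G) : ∀ {ξ ζ ξ' ζ' : ℕ → ℕ} {f : G},
    (∀ m n, ξ m = ζ n → ∃ k, m = ζ' k ∧ n = ξ' k) → p.rename ξ = f.rename ζ →
    ∃ q : G, p = q.rename ζ' ∧ f = q.rename ξ' := by
  have lift : ∀ {ξ ζ ξ' ζ' : ℕ → ℕ}, (∀ m n, ξ m = ζ n → ∃ k, m = ζ' k ∧ n = ξ' k) →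
      ∀ m n, liftRen ξ m = liftRen ζ n → ∃ k, m = liftRen ζ' k ∧ n = liftRen ξ' k := by
    rintro ξ ζ ξ' ζ' h (_ | m) (_ | n) e
    · exact ⟨0, rfl, rfl⟩
    · cases e
    · cases e
    · obtain ⟨k, rfl, rfl⟩ := h m n (Nat.succ.inj e)
      exact ⟨k + 1, rfl, rfl⟩
  induction p with
  | var m =>
    intro ξ ζ ξ' ζ' f h e
    cases f <;> simp only [rename, reduceCtorEq, var.injEq] at e
    obtain ⟨k, rfl, rfl⟩ := h _ _ e
    exact ⟨var k, rfl, rfl⟩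
  | nul o =>
    intro ξ ζ ξ' ζ' f h e
    cases f <;> simp only [rename, reduceCtorEq] at e
    exact ⟨nul o, rfl, e.symm⟩
  | un o a iha =>
    intro ξ ζ ξ' ζ' f h e
    cases f <;> simp only [rename, reduceCtorEq, un.injEq] at e
    obtain ⟨rfl, ha⟩ := e
    obtain ⟨a, rfl, rfl⟩ := iha h ha
    exact ⟨un o a, rfl, rfl⟩
  | bin o a b iha ihb =>
    intro ξ ζ ξ' ζ' f h e
    cases f <;> simp only [rename, reduceCtorEq, bin.injEq] at e
    obtain ⟨rfl, ha, hb⟩ := e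
    obtain ⟨a, rfl, rfl⟩ := iha h ha
    obtain ⟨b, rfl, rfl⟩ := ihb h hb
    exact ⟨bin o a b, rfl, rfl⟩
  | tri o a b c iha ihb ihc =>
    intro ξ ζ ξ' ζ' f h e
    cases f <;> simp only [rename, reduceCtorEq, tri.injEq] at e
    obtain ⟨rfl, ha, hb, hc⟩ := e
    obtain ⟨a, rfl, rfl⟩ := iha h ha
    obtain ⟨b, rfl, rfl⟩ := ihb h hb
    obtain ⟨c, rfl, rfl⟩ := ihc h hc
    exact ⟨tri o a b c, rfl, rfl⟩
  | quad a b c d iha ihb ihc ihd =>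
    intro ξ ζ ξ' ζ' f h e
    cases f <;> simp only [rename, reduceCtorEq, quad.injEq] at e
    obtain ⟨ha, hb, hc, hd⟩ := e
    obtain ⟨a, rfl, rfl⟩ := iha h ha
    obtain ⟨b, rfl, rfl⟩ := ihb h hb
    obtain ⟨c, rfl, rfl⟩ := ihc h hc
    obtain ⟨d, rfl, rfl⟩ := ihd h hd
    exact ⟨quad a b c d, rfl, rfl⟩
  | bnd o a b iha ihb =>
    intro ξ ζ ξ' ζ' f h e
    cases f <;> simp only [rename, reduceCtorEq, bnd.injEq] at e
    obtain ⟨rfl, ha, hb⟩ := e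
    obtain ⟨a, rfl, rfl⟩ := iha h ha
    obtain ⟨b, rfl, rfl⟩ := ihb (lift h) hb
    exact ⟨bnd o a b, rfl, rfl⟩
  | lam b ihb =>
    intro ξ ζ ξ' ζ' f h e
    cases f <;> simp only [rename, reduceCtorEq, lam.injEq] at e
    obtain ⟨b, rfl, rfl⟩ := ihb (lift h) e
    exact ⟨lam b, rfl, rfl⟩

/-- An `η`-redex `λ x. f x` requires that `x` is not free in `f`, that is, that `f` is a weakening.
This condition is reflected by renamings, which `Par.of_rename` needs in its `η` case. -/
theorem rename_eq_wk {p f : G} {ξ : ℕ → ℕ} (h : p.rename (liftRen ξ) = f.wk) :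
    ∃ q : G, p = q.wk ∧ f = q.rename ξ := by
  refine rename_pullback p ?_ h
  rintro (_ | m) n e
  · cases e
  · exact ⟨m, rfl, (Nat.succ.inj e).symm⟩

end G

open G

/-- Parallel reduction. -/
inductive Par : G → G → Prop
  | var (n : ℕ) : Par (.var n) (.var n)
  | nul (o : K0) : Par (.nul o) (.nul o)
  | un {o : K1} {a a' : G} : Par a a' → Par (.un o a) (.un o a')
  | bin {o : K2} {a a' b b' : G} : Par a a' → Par b b' → Par (.bin o a b) (.bin o a' b')
  | tri {o : K3} {a a' b b' c c' : G} :
      Par a a' → Par b b' → Par c c' → Par (.tri o a b c) (.tri o a' b' c')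
  | quad {a a' b b' c c' d d' : G} :
      Par a a' → Par b b' → Par c c' → Par d d' → Par (.quad a b c d) (.quad a' b' c' d')
  | bnd {o : KB} {a a' b b' : G} : Par a a' → Par b b' → Par (.bnd o a b) (.bnd o a' b')
  | lam {b b' : G} : Par b b' → Par (.lam b) (.lam b')
  | beta {b b' a a' : G} : Par b b' → Par a a' → Par (.bin .app (.lam b) a) (b'.inst a')
  | fst {a a' b : G} : Par a a' → Par (.un .fst (.bin .pair a b)) a'
  | snd {a b b' : G} : Par b b' → Par (.un .snd (.bin .pair a b)) b'
  | split {C c c' a a' b b' : G} : Par c c' → Par a a' → Par b b' →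
      Par (.tri .split C c (.bin .pair a b)) (.bin .app (.bin .app c' a') b')
  | oneElim {C c c' : G} : Par c c' → Par (.tri .oneElim C c (.nul .star)) c'
  | inl {C l l' r a a' : G} :
      Par l l' → Par a a' → Par (.quad C l r (.un .inl a)) (.bin .app l' a')
  | inr {C l r r' b b' : G} :
      Par r r' → Par b b' → Par (.quad C l r (.un .inr b)) (.bin .app r' b')
  | wrec {C C' c c' a a' f f' : G} : Par C C' → Par c c' → Par a a' → Par f f' →
      Par (.tri .wrec C c (.bin .sup a f)) (.bin .app (.bin .app (.bin .app c' a') f')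
        (.lam (.tri .wrec C'.wk c'.wk (.bin .app f'.wk (.var 0)))))
  | J {C c c' a : G} : Par c c' → Par (.tri .J C c (.un .refl a)) c'
  | eta {f f' : G} : Par f f' → Par (.lam (.bin .app f.wk (.var 0))) f'

namespace Par

theorem refl (t : G) : Par t t := by
  induction t with
  | var n => exact .var n
  | nul o => exact .nul o
  | un _ _ h => exact .un h
  | bin _ _ _ h h' => exact .bin h h'
  | tri _ _ _ _ h h' h'' => exact .tri h h' h''
  | quad _ _ _ _ h₁ h₂ h₃ h₄ => exact .quad h₁ h₂ h₃ h₄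
  | bnd _ _ _ h h' => exact .bnd h h'
  | lam _ h => exact .lam h

theorem rename {t u : G} (h : Par t u) : ∀ ξ : ℕ → ℕ, Par (t.rename ξ) (u.rename ξ) := by
  induction h with
  | var n => intro ξ; exact .var _
  | nul o => intro ξ; exact .nul _
  | un _ h => intro ξ; exact .un (h ξ)
  | bin _ _ h h' => intro ξ; exact .bin (h ξ) (h' ξ)
  | tri _ _ _ h h' h'' => intro ξ; exact .tri (h ξ) (h' ξ) (h'' ξ)
  | quad _ _ _ _ h₁ h₂ h₃ h₄ => intro ξ; exact .quad (h₁ ξ) (h₂ ξ) (h₃ ξ) (h₄ ξ)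
  | bnd _ _ h h' => intro ξ; exact .bnd (h ξ) (h' _)
  | lam _ h => intro ξ; exact .lam (h _)
  | beta _ _ h h' => intro ξ; rw [inst_rename]; exact .beta (h _) (h' ξ)
  | fst _ h => intro ξ; exact .fst (h ξ)
  | snd _ h => intro ξ; exact .snd (h ξ)
  | split _ _ _ h h' h'' => intro ξ; exact .split (h ξ) (h' ξ) (h'' ξ)
  | oneElim _ h => intro ξ; exact .oneElim (h ξ)
  | inl _ _ h h' => intro ξ; exact .inl (h ξ) (h' ξ)
  | inr _ _ h h' => intro ξ; exact .inr (h ξ) (h' ξ)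
  | wrec _ _ _ _ h₁ h₂ h₃ h₄ =>
    intro ξ
    have := Par.wrec (h₁ ξ) (h₂ ξ) (h₃ ξ) (h₄ ξ)
    simpa only [G.rename, wk_rename, Tm.liftRen] using this
  | J _ h => intro ξ; exact .J (h ξ)
  | eta _ h =>
    intro ξ
    have := Par.eta (h ξ)
    simpa only [G.rename, wk_rename, Tm.liftRen] using this

theorem liftSub {σ τ : ℕ → G} (h : ∀ n, Par (σ n) (τ n)) (n : ℕ) :
    Par (G.liftSub σ n) (G.liftSub τ n) := by
  cases n with
  | zero => exact .var 0
  | succ n => exact (h n).rename _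

theorem subst {t u : G} (h : Par t u) : ∀ {σ τ : ℕ → G}, (∀ n, Par (σ n) (τ n)) →
    Par (t.subst σ) (u.subst τ) := by
  induction h with
  | var n => intro σ τ s; exact s n
  | nul o => intro σ τ s; exact .nul _
  | un _ h => intro σ τ s; exact .un (h s)
  | bin _ _ h h' => intro σ τ s; exact .bin (h s) (h' s)
  | tri _ _ _ h h' h'' => intro σ τ s; exact .tri (h s) (h' s) (h'' s)
  | quad _ _ _ _ h₁ h₂ h₃ h₄ => intro σ τ s; exact .quad (h₁ s) (h₂ s) (h₃ s) (h₄ s)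
  | bnd _ _ h h' => intro σ τ s; exact .bnd (h s) (h' (liftSub s))
  | lam _ h => intro σ τ s; exact .lam (h (liftSub s))
  | beta _ _ h h' => intro σ τ s; rw [inst_subst]; exact .beta (h (liftSub s)) (h' s)
  | fst _ h => intro σ τ s; exact .fst (h s)
  | snd _ h => intro σ τ s; exact .snd (h s)
  | split _ _ _ h h' h'' => intro σ τ s; exact .split (h s) (h' s) (h'' s)
  | oneElim _ h => intro σ τ s; exact .oneElim (h s)
  | inl _ _ h h' => intro σ τ s; exact .inl (h s) (h' s)
  | inr _ _ h h' => intro σ τ s; exact .inr (h s) (h' s)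
  | wrec _ _ _ _ h₁ h₂ h₃ h₄ =>
    intro σ τ s
    have := Par.wrec (h₁ s) (h₂ s) (h₃ s) (h₄ s)
    simpa only [G.subst, wk_subst, G.liftSub] using this
  | J _ h => intro σ τ s; exact .J (h s)
  | eta _ h =>
    intro σ τ s
    have := Par.eta (h s)
    simpa only [G.subst, wk_subst, G.liftSub] using this

theorem inst {b b' a a' : G} (h : Par b b') (h' : Par a a') : Par (b.inst a) (b'.inst a') := by
  refine h.subst ?_
  rintro (_ | n)
  · exact h'
  · exact .var n

/-- Reduction creates no free variables: a reduct of a renamed term is renamed. Applied to a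
weakening, it shows that reducing `f` inside `λ x. f x` leaves an `η`-redex. -/
theorem of_rename {t u : G} (h : Par t u) : ∀ {s : G} {ξ : ℕ → ℕ}, t = s.rename ξ →
    ∃ v : G, u = v.rename ξ ∧ Par s v := by
  induction h with
  | var n => intro s ξ e; exact ⟨s, e, .refl s⟩
  | nul o => intro s ξ e; exact ⟨s, e, .refl s⟩
  | un _ h =>
    intro s ξ e
    cases s <;> simp only [G.rename, reduceCtorEq, un.injEq] at e
    obtain ⟨rfl, e⟩ := e
    obtain ⟨v, rfl, p⟩ := h e
    exact ⟨_, rfl, .un p⟩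
  | bin _ _ h h' =>
    intro s ξ e
    cases s <;> simp only [G.rename, reduceCtorEq, bin.injEq] at e
    obtain ⟨rfl, e, e'⟩ := e
    obtain ⟨v, rfl, p⟩ := h e
    obtain ⟨v', rfl, p'⟩ := h' e'
    exact ⟨_, rfl, .bin p p'⟩
  | tri _ _ _ h h' h'' =>
    intro s ξ e
    cases s <;> simp only [G.rename, reduceCtorEq, tri.injEq] at e
    obtain ⟨rfl, e, e', e''⟩ := e
    obtain ⟨v, rfl, p⟩ := h e
    obtain ⟨v', rfl, p'⟩ := h' e'
    obtain ⟨v'', rfl, p''⟩ := h'' e''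
    exact ⟨_, rfl, .tri p p' p''⟩
  | quad _ _ _ _ h h' h'' h₄ =>
    intro s ξ e
    cases s <;> simp only [G.rename, reduceCtorEq, quad.injEq] at e
    obtain ⟨e, e', e'', e₄⟩ := e
    obtain ⟨v, rfl, p⟩ := h e
    obtain ⟨v', rfl, p'⟩ := h' e'
    obtain ⟨v'', rfl, p''⟩ := h'' e''
    obtain ⟨v₄, rfl, p₄⟩ := h₄ e₄
    exact ⟨.quad v v' v'' v₄, rfl, .quad p p' p'' p₄⟩
  | bnd _ _ h h' =>
    intro s ξ e
    cases s <;> simp only [G.rename, reduceCtorEq, bnd.injEq] at e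
    obtain ⟨rfl, e, e'⟩ := e
    obtain ⟨v, rfl, p⟩ := h e
    obtain ⟨v', rfl, p'⟩ := h' e'
    exact ⟨.bnd _ v v', rfl, .bnd p p'⟩
  | lam _ h =>
    intro s ξ e
    cases s <;> simp only [G.rename, reduceCtorEq, lam.injEq] at e
    obtain ⟨v, rfl, p⟩ := h e
    exact ⟨.lam v, rfl, .lam p⟩
  | beta _ _ h h' =>
    intro s ξ e
    rcases s with _ | _ | _ | ⟨_, s, x⟩ | _ | _ | _ | _ <;>
      simp only [G.rename, reduceCtorEq, bin.injEq] at e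
    obtain ⟨rfl, e, e'⟩ := e
    cases s <;> simp only [G.rename, reduceCtorEq, lam.injEq] at e
    obtain ⟨v, rfl, p⟩ := h e
    obtain ⟨v', rfl, p'⟩ := h' e'
    exact ⟨_, (inst_rename _ _ _).symm, .beta p p'⟩
  | fst _ h =>
    intro s ξ e
    rcases s with _ | _ | ⟨_, s⟩ | _ | _ | _ | _ | _ <;>
      simp only [G.rename, reduceCtorEq, un.injEq] at e
    obtain ⟨rfl, e⟩ := e
    cases s <;> simp only [G.rename, reduceCtorEq, bin.injEq] at e
    obtain ⟨rfl, e, e'⟩ := e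
    obtain ⟨v, rfl, p⟩ := h e
    exact ⟨_, rfl, .fst p⟩
  | snd _ h =>
    intro s ξ e
    rcases s with _ | _ | ⟨_, s⟩ | _ | _ | _ | _ | _ <;>
      simp only [G.rename, reduceCtorEq, un.injEq] at e
    obtain ⟨rfl, e⟩ := e
    cases s <;> simp only [G.rename, reduceCtorEq, bin.injEq] at e
    obtain ⟨rfl, e, e'⟩ := e
    obtain ⟨v, rfl, p⟩ := h e'
    exact ⟨_, rfl, .snd p⟩
  | split _ _ _ h h' h'' =>
    intro s ξ e
    rcases s with _ | _ | _ | _ | ⟨_, C, c, s⟩ | _ | _ | _ <;>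
      simp only [G.rename, reduceCtorEq, tri.injEq] at e
    obtain ⟨rfl, e, e', e''⟩ := e
    cases s <;> simp only [G.rename, reduceCtorEq, bin.injEq] at e''
    obtain ⟨rfl, e₁, e₂⟩ := e''
    obtain ⟨v, rfl, p⟩ := h e'
    obtain ⟨v', rfl, p'⟩ := h' e₁
    obtain ⟨v'', rfl, p''⟩ := h'' e₂
    exact ⟨_, rfl, .split p p' p''⟩
  | oneElim _ h =>
    intro s ξ e
    rcases s with _ | _ | _ | _ | ⟨_, C, c, s⟩ | _ | _ | _ <;>
      simp only [G.rename, reduceCtorEq, tri.injEq] at e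
    obtain ⟨rfl, e, e', e''⟩ := e
    cases s <;> simp only [G.rename, reduceCtorEq, nul.injEq] at e''
    obtain rfl := e''
    obtain ⟨v, rfl, p⟩ := h e'
    exact ⟨_, rfl, .oneElim p⟩
  | inl _ _ h h' =>
    intro s ξ e
    rcases s with _ | _ | _ | _ | _ | ⟨C, l, r, s⟩ | _ | _ <;>
      simp only [G.rename, reduceCtorEq, quad.injEq] at e
    obtain ⟨e₁, e₂, e₃, e₄⟩ := e
    cases s <;> simp only [G.rename, reduceCtorEq, un.injEq] at e₄
    obtain ⟨rfl, e₄⟩ := e₄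
    obtain ⟨v, rfl, p⟩ := h e₂
    obtain ⟨v', rfl, p'⟩ := h' e₄
    exact ⟨_, rfl, .inl p p'⟩
  | inr _ _ h h' =>
    intro s ξ e
    rcases s with _ | _ | _ | _ | _ | ⟨C, l, r, s⟩ | _ | _ <;>
      simp only [G.rename, reduceCtorEq, quad.injEq] at e
    obtain ⟨e₁, e₂, e₃, e₄⟩ := e
    cases s <;> simp only [G.rename, reduceCtorEq, un.injEq] at e₄
    obtain ⟨rfl, e₄⟩ := e₄
    obtain ⟨v, rfl, p⟩ := h e₃
    obtain ⟨v', rfl, p'⟩ := h' e₄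
    exact ⟨_, rfl, .inr p p'⟩
  | wrec _ _ _ _ h₁ h₂ h₃ h₄ =>
    intro s ξ e
    rcases s with _ | _ | _ | _ | ⟨_, C, c, s⟩ | _ | _ | _ <;>
      simp only [G.rename, reduceCtorEq, tri.injEq] at e
    obtain ⟨rfl, e, e', e''⟩ := e
    cases s <;> simp only [G.rename, reduceCtorEq, bin.injEq] at e''
    obtain ⟨rfl, e₁, e₂⟩ := e''
    obtain ⟨v₁, rfl, p₁⟩ := h₁ e
    obtain ⟨v₂, rfl, p₂⟩ := h₂ e'
    obtain ⟨v₃, rfl, p₃⟩ := h₃ e₁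
    obtain ⟨v₄, rfl, p₄⟩ := h₄ e₂
    refine ⟨_, ?_, .wrec p₁ p₂ p₃ p₄⟩
    simp only [G.rename, wk_rename]; rfl
  | J _ h =>
    intro s ξ e
    rcases s with _ | _ | _ | _ | ⟨_, C, c, s⟩ | _ | _ | _ <;>
      simp only [G.rename, reduceCtorEq, tri.injEq] at e
    obtain ⟨rfl, e, e', e''⟩ := e
    cases s <;> simp only [G.rename, reduceCtorEq, un.injEq] at e''
    obtain ⟨rfl, -⟩ := e''
    obtain ⟨v, rfl, p⟩ := h e'
    exact ⟨_, rfl, .J p⟩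
  | eta _ h =>
    intro s ξ e
    rcases s with _ | _ | _ | _ | _ | _ | _ | s <;>
      simp only [G.rename, reduceCtorEq, lam.injEq] at e
    rcases s with _ | _ | _ | ⟨_, s, x⟩ | _ | _ | _ | _ <;>
      simp only [G.rename, reduceCtorEq, bin.injEq] at e
    obtain ⟨rfl, e, e'⟩ := e
    rcases x with (_ | n) | _ | _ | _ | _ | _ | _ | _ <;>
      simp only [G.rename, reduceCtorEq, var.injEq, Tm.liftRen] at e'
    · obtain ⟨q, rfl, rfl⟩ := rename_eq_wk e.symm
      obtain ⟨v, rfl, p⟩ := h rfl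
      exact ⟨_, rfl, .eta p⟩

/-- Two terms with a common reduct. -/
def Join (u v : G) : Prop := ∃ w, Par u w ∧ Par v w

theorem Join.symm {u v : G} : Join u v → Join v u := fun ⟨w, h, h'⟩ => ⟨w, h', h⟩

/-- The diamond property of terms below a size. -/
def Diamond (N : ℕ) : Prop := ∀ t : G, t.size < N → ∀ {u v : G}, Par t u → Par t v → Join u v

/-- The critical case is `(λ x. g x) a`, where the abstraction is contracted by `η` on one side and
the application by `β` on the other. Both results are reducts of `g a`, which is smaller but not a
subterm; this is why the diamond property is proved by induction on the size. -/
theorem join_beta {b a : G} (ih : Diamond (G.bin .app (.lam b) a).size) {f a₁ b₂ a₂ : G}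
    (hf : Par (.lam b) f) (h₁ : Par a a₁) (hb : Par b b₂) (h₂ : Par a a₂) :
    Join (.bin .app f a₁) (b₂.inst a₂) := by
  simp only [size] at ih
  cases hf with
  | lam hb' =>
    obtain ⟨x, p, p'⟩ := ih b (by omega) hb' hb
    obtain ⟨y, q, q'⟩ := ih a (by omega) h₁ h₂
    exact ⟨x.inst y, .beta p q, p'.inst q'⟩
  | @eta g _ hg =>
    have e : (G.bin .app g.wk (.var 0)).inst a = .bin .app g a :=
      congrArg₂ (G.bin .app) (wk_inst g a) rfl
    refine ih (.bin .app g a) ?_ (.bin hg h₁) (e ▸ hb.inst h₂)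
    simp only [size, wk, size_rename]; omega

/-- Either the body `f x` reduces componentwise, and the redex survives by `Par.of_rename`, or `f =
λ c` and the body is contracted by `β`. In the latter case both sides are reducts of `λ c` itself.
-/
theorem join_eta {f : G} (ih : Diamond (G.lam (.bin .app f.wk (.var 0))).size) {b₁ f₂ : G}
    (hb : Par (.bin .app f.wk (.var 0)) b₁) (h₂ : Par f f₂) : Join (.lam b₁) f₂ := by
  simp only [size, wk, size_rename] at ih
  generalize hg : f.wk = g at hb
  cases hb with
  | bin h h' =>
    obtain ⟨f₁, rfl, p⟩ := h.of_rename (s := f) (ξ := (· + 1)) hg.symm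
    cases h'
    obtain ⟨x, q, q'⟩ := ih f (by omega) p h₂
    exact ⟨x, .eta q, q'⟩
  | beta h h' =>
    obtain _ | _ | _ | _ | _ | _ | _ | c := f <;> simp only [wk, G.rename, reduceCtorEq, lam.injEq] at hg
    have h := (h.inst h').lam
    rw [← hg] at h
    have e : (c.rename (Tm.liftRen (· + 1))).inst (.var 0) = c := by
      rw [G.inst, subst_rename]
      conv_rhs => rw [← subst_var c]
      congr 1
      funext n
      cases n <;> rfl
    rw [e] at h
    exact ih _ (by simp only [size]; omega) h h₂

theorem join_split {C c a b : G} (ih : Diamond (G.tri .split C c (.bin .pair a b)).size)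
    {C₁ c₁ s₁ c₂ a₂ b₂ : G} (hc : Par c c₁) (hs : Par (.bin .pair a b) s₁)
    (h : Par c c₂) (ha : Par a a₂) (hb : Par b b₂) :
    Join (.tri .split C₁ c₁ s₁) (.bin .app (.bin .app c₂ a₂) b₂) := by
  simp only [size] at ih
  cases hs with
  | bin h₁ h₂ =>
    obtain ⟨x, p, p'⟩ := ih c (by omega) hc h
    obtain ⟨y, q, q'⟩ := ih a (by omega) h₁ ha
    obtain ⟨z, r, r'⟩ := ih b (by omega) h₂ hb
    exact ⟨_, .split p q r, .bin (.bin p' q') r'⟩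

theorem join_inl {C l r a : G} (ih : Diamond (G.quad C l r (.un .inl a)).size)
    {C₁ l₁ r₁ s₁ l₂ a₂ : G} (hl : Par l l₁) (hs : Par (.un .inl a) s₁)
    (h : Par l l₂) (ha : Par a a₂) : Join (.quad C₁ l₁ r₁ s₁) (.bin .app l₂ a₂) := by
  simp only [size] at ih
  cases hs with
  | un h₁ =>
    obtain ⟨x, p, p'⟩ := ih l (by omega) hl h
    obtain ⟨y, q, q'⟩ := ih a (by omega) h₁ ha
    exact ⟨_, .inl p q, .bin p' q'⟩

theorem join_inr {C l r a : G} (ih : Diamond (G.quad C l r (.un .inr a)).size)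
    {C₁ l₁ r₁ s₁ r₂ a₂ : G} (hr : Par r r₁) (hs : Par (.un .inr a) s₁)
    (h : Par r r₂) (ha : Par a a₂) : Join (.quad C₁ l₁ r₁ s₁) (.bin .app r₂ a₂) := by
  simp only [size] at ih
  cases hs with
  | un h₁ =>
    obtain ⟨x, p, p'⟩ := ih r (by omega) hr h
    obtain ⟨y, q, q'⟩ := ih a (by omega) h₁ ha
    exact ⟨_, .inr p q, .bin p' q'⟩

theorem wrec_congr {C C' c c' a a' f f' : G} (h₁ : Par C C') (h₂ : Par c c') (h₃ : Par a a')
    (h₄ : Par f f') :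
    Par (.bin .app (.bin .app (.bin .app c a) f)
        (.lam (.tri .wrec C.wk c.wk (.bin .app f.wk (.var 0)))))
      (.bin .app (.bin .app (.bin .app c' a') f')
        (.lam (.tri .wrec C'.wk c'.wk (.bin .app f'.wk (.var 0))))) :=
  .bin (.bin (.bin h₂ h₃) h₄)
    (.lam (.tri (h₁.rename _) (h₂.rename _) (.bin (h₄.rename _) (.var 0))))

theorem join_wrec {C c a f : G} (ih : Diamond (G.tri .wrec C c (.bin .sup a f)).size)
    {C₁ c₁ s₁ C₂ c₂ a₂ f₂ : G} (hC : Par C C₁) (hc : Par c c₁) (hs : Par (.bin .sup a f) s₁)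
    (hC₂ : Par C C₂) (hc₂ : Par c c₂) (ha₂ : Par a a₂) (hf₂ : Par f f₂) :
    Join (.tri .wrec C₁ c₁ s₁) (.bin .app (.bin .app (.bin .app c₂ a₂) f₂)
      (.lam (.tri .wrec C₂.wk c₂.wk (.bin .app f₂.wk (.var 0))))) := by
  simp only [size] at ih
  cases hs with
  | bin h₁ h₂ =>
    obtain ⟨x, p, p'⟩ := ih C (by omega) hC hC₂
    obtain ⟨y, q, q'⟩ := ih c (by omega) hc hc₂
    obtain ⟨z, r, r'⟩ := ih a (by omega) h₁ ha₂
    obtain ⟨w, s, s'⟩ := ih f (by omega) h₂ hf₂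
    exact ⟨_, .wrec p q r s, wrec_congr p' q' r' s'⟩

/-- Apart from the overlaps of `β` and `η`, a computation rule only meets itself or the congruence
rule for the same constructor; the cases are then closed by the induction hypothesis for the
components. -/
theorem diamond (N : ℕ) : Diamond N := by
  induction N with
  | zero => intro t h; omega
  | succ N IH =>
    intro t ht u v h₁ h₂
    have ih : Diamond t.size := fun s hs => IH s (by omega)
    clear IH
    have ih₀ := ih
    cases h₁ with
    | var n => cases h₂; exact ⟨_, .var n, .var n⟩
    | nul o => cases h₂; exact ⟨_, .nul o, .nul o⟩
    | un h =>
      simp only [size] at ih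
      cases h₂ with
      | un h' =>
        obtain ⟨x, p, p'⟩ := ih _ (by omega) h h'
        exact ⟨_, .un p, .un p'⟩
      | fst h' =>
        simp only [size] at ih
        cases h with
        | bin k _ =>
          obtain ⟨x, p, p'⟩ := ih _ (by omega) k h'
          exact ⟨x, .fst p, p'⟩
      | snd h' =>
        simp only [size] at ih
        cases h with
        | bin _ k =>
          obtain ⟨x, p, p'⟩ := ih _ (by omega) k h'
          exact ⟨x, .snd p, p'⟩
    | bin h k =>
      simp only [size] at ih
      cases h₂ with
      | bin h' k' =>
        obtain ⟨x, p, p'⟩ := ih _ (by omega) h h'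
        obtain ⟨y, q, q'⟩ := ih _ (by omega) k k'
        exact ⟨_, .bin p q, .bin p' q'⟩
      | beta h' k' => exact join_beta ih₀ h k h' k'
    | tri h₁ h₂' h₃ =>
      simp only [size] at ih
      cases h₂ with
      | tri k₁ k₂ k₃ =>
        obtain ⟨x, p, p'⟩ := ih _ (by omega) h₁ k₁
        obtain ⟨y, q, q'⟩ := ih _ (by omega) h₂' k₂
        obtain ⟨z, r, r'⟩ := ih _ (by omega) h₃ k₃
        exact ⟨_, .tri p q r, .tri p' q' r'⟩
      | split k₁ k₂ k₃ => exact join_split ih₀ h₂' h₃ k₁ k₂ k₃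
      | oneElim k =>
        cases h₃
        obtain ⟨x, p, p'⟩ := ih _ (by omega) h₂' k
        exact ⟨x, .oneElim p, p'⟩
      | wrec k₁ k₂ k₃ k₄ => exact join_wrec ih₀ h₁ h₂' h₃ k₁ k₂ k₃ k₄
      | J k =>
        cases h₃
        obtain ⟨x, p, p'⟩ := ih _ (by omega) h₂' k
        exact ⟨x, .J p, p'⟩
    | quad h₁ h₂' h₃ h₄ =>
      simp only [size] at ih
      cases h₂ with
      | quad k₁ k₂ k₃ k₄ =>
        obtain ⟨x, p, p'⟩ := ih _ (by omega) h₁ k₁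
        obtain ⟨y, q, q'⟩ := ih _ (by omega) h₂' k₂
        obtain ⟨z, r, r'⟩ := ih _ (by omega) h₃ k₃
        obtain ⟨w, s, s'⟩ := ih _ (by omega) h₄ k₄
        exact ⟨_, .quad p q r s, .quad p' q' r' s'⟩
      | inl k₁ k₂ => exact join_inl ih₀ h₂' h₄ k₁ k₂
      | inr k₁ k₂ => exact join_inr ih₀ h₃ h₄ k₁ k₂
    | bnd h k =>
      simp only [size] at ih
      cases h₂ with
      | bnd h' k' =>
        obtain ⟨x, p, p'⟩ := ih _ (by omega) h h'
        obtain ⟨y, q, q'⟩ := ih _ (by omega) k k'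
        exact ⟨_, .bnd p q, .bnd p' q'⟩
    | lam h =>
      simp only [size] at ih
      cases h₂ with
      | lam h' =>
        obtain ⟨x, p, p'⟩ := ih _ (by omega) h h'
        exact ⟨_, .lam p, .lam p'⟩
      | eta h' => exact join_eta ih₀ h h'
    | beta h k =>
      simp only [size] at ih
      cases h₂ with
      | bin h' k' => exact (join_beta ih₀ h' k' h k).symm
      | beta h' k' =>
        obtain ⟨x, p, p'⟩ := ih _ (by omega) h h'
        obtain ⟨y, q, q'⟩ := ih _ (by omega) k k'
        exact ⟨_, p.inst q, p'.inst q'⟩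
    | fst h =>
      simp only [size] at ih
      cases h₂ with
      | un k =>
        cases k with
        | bin k _ =>
          obtain ⟨x, p, p'⟩ := ih _ (by omega) h k
          exact ⟨x, p, .fst p'⟩
      | fst h' => exact ih _ (by omega) h h'
    | snd h =>
      simp only [size] at ih
      cases h₂ with
      | un k =>
        cases k with
        | bin _ k =>
          obtain ⟨x, p, p'⟩ := ih _ (by omega) h k
          exact ⟨x, p, .snd p'⟩
      | snd h' => exact ih _ (by omega) h h'
    | split k₁ k₂ k₃ =>
      simp only [size] at ih
      cases h₂ with
      | tri _ h h' => exact (join_split ih₀ h h' k₁ k₂ k₃).symm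
      | split h₁ h₂ h₃ =>
        obtain ⟨x, p, p'⟩ := ih _ (by omega) k₁ h₁
        obtain ⟨y, q, q'⟩ := ih _ (by omega) k₂ h₂
        obtain ⟨z, r, r'⟩ := ih _ (by omega) k₃ h₃
        exact ⟨_, .bin (.bin p q) r, .bin (.bin p' q') r'⟩
    | oneElim k =>
      simp only [size] at ih
      cases h₂ with
      | tri _ h h' =>
        cases h'
        obtain ⟨x, p, p'⟩ := ih _ (by omega) k h
        exact ⟨x, p, .oneElim p'⟩
      | oneElim h => exact ih _ (by omega) k h
    | inl k₁ k₂ =>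
      simp only [size] at ih
      cases h₂ with
      | quad _ h _ h' => exact (join_inl ih₀ h h' k₁ k₂).symm
      | inl h h' =>
        obtain ⟨x, p, p'⟩ := ih _ (by omega) k₁ h
        obtain ⟨y, q, q'⟩ := ih _ (by omega) k₂ h'
        exact ⟨_, .bin p q, .bin p' q'⟩
    | inr k₁ k₂ =>
      simp only [size] at ih
      cases h₂ with
      | quad _ _ h h' => exact (join_inr ih₀ h h' k₁ k₂).symm
      | inr h h' =>
        obtain ⟨x, p, p'⟩ := ih _ (by omega) k₁ h
        obtain ⟨y, q, q'⟩ := ih _ (by omega) k₂ h'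
        exact ⟨_, .bin p q, .bin p' q'⟩
    | wrec k₁ k₂ k₃ k₄ =>
      simp only [size] at ih
      cases h₂ with
      | tri h h' h'' => exact (join_wrec ih₀ h h' h'' k₁ k₂ k₃ k₄).symm
      | wrec h₁ h₂ h₃ h₄ =>
        obtain ⟨x, p, p'⟩ := ih _ (by omega) k₁ h₁
        obtain ⟨y, q, q'⟩ := ih _ (by omega) k₂ h₂
        obtain ⟨z, r, r'⟩ := ih _ (by omega) k₃ h₃
        obtain ⟨w, s, s'⟩ := ih _ (by omega) k₄ h₄
        exact ⟨_, wrec_congr p q r s, wrec_congr p' q' r' s'⟩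
    | J k =>
      simp only [size] at ih
      cases h₂ with
      | tri _ h h' =>
        cases h' with
        | un h' =>
          obtain ⟨x, p, p'⟩ := ih _ (by omega) k h
          exact ⟨x, p, .J p'⟩
      | J h => exact ih _ (by omega) k h
    | eta h =>
      simp only [size, wk, size_rename] at ih
      generalize hg : G.bin .app (G.wk _) (.var 0) = b at h₂
      cases h₂ with
      | lam h' => subst hg; exact (join_eta ih₀ h' h).symm
      | @eta g _ h' =>
        obtain ⟨-, e, -⟩ := G.bin.inj hg
        have e := congrArg (G.inst · (.var 0)) e
        simp only [wk_inst] at e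
        subst e
        exact ih _ (by omega) h h'

end Par

open Relation

/-! ### Church–Rosser for judgmental equality and injectivity of the type formers. -/

/-- Conversion of regrouped terms. -/
def GConv : G → G → Prop := Join (ReflTransGen Par)

/-- Transitivity of joinability is the Church–Rosser property, obtained from the diamond property.
-/
theorem gconv_equivalence : Equivalence GConv :=
  equivalence_join_reflTransGen fun _ _ _ h h' =>
    let ⟨w, p, p'⟩ := Par.diamond _ _ (Nat.lt_succ_self _) h h'
    ⟨w, .single p, .single p'⟩

theorem Par.gconv {a b : G} (h : Par a b) : GConv a b := ⟨b, .single h, .refl⟩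

theorem GConv.map {f : G → G} (hf : ∀ a b, Par a b → Par (f a) (f b)) {a b : G}
    (h : GConv a b) : GConv (f a) (f b) :=
  let ⟨c, p, p'⟩ := h
  ⟨f c, p.lift f hf, p'.lift f hf⟩

theorem GConv.trans {a b c : G} (h : GConv a b) (h' : GConv b c) : GConv a c :=
  gconv_equivalence.trans h h'

theorem GConv.un {o : K1} {a a' : G} (h : GConv a a') : GConv (.un o a) (.un o a') :=
  h.map fun _ _ => .un

theorem GConv.bin {o : K2} {a a' b b' : G} (h : GConv a a') (h' : GConv b b') :
    GConv (.bin o a b) (.bin o a' b') :=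
  (h.map fun _ _ p => .bin p (.refl b)).trans (h'.map fun _ _ p => .bin (.refl a') p)

theorem GConv.tri {o : K3} {a a' b b' c c' : G} (h : GConv a a') (h' : GConv b b')
    (h'' : GConv c c') : GConv (.tri o a b c) (.tri o a' b' c') :=
  (h.map fun _ _ p => .tri p (.refl b) (.refl c)).trans
    ((h'.map fun _ _ p => .tri (.refl a') p (.refl c)).trans
      (h''.map fun _ _ p => .tri (.refl a') (.refl b') p))

theorem GConv.quad {a a' b b' c c' d d' : G} (h : GConv a a') (h' : GConv b b')
    (h'' : GConv c c') (h₄ : GConv d d') : GConv (.quad a b c d) (.quad a' b' c' d') :=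
  (h.map fun _ _ p => .quad p (.refl b) (.refl c) (.refl d)).trans
    ((h'.map fun _ _ p => .quad (.refl a') p (.refl c) (.refl d)).trans
      ((h''.map fun _ _ p => .quad (.refl a') (.refl b') p (.refl d)).trans
        (h₄.map fun _ _ p => .quad (.refl a') (.refl b') (.refl c') p)))

theorem GConv.bnd {o : KB} {a a' b b' : G} (h : GConv a a') (h' : GConv b b') :
    GConv (.bnd o a b) (.bnd o a' b') :=
  (h.map fun _ _ p => .bnd p (.refl b)).trans (h'.map fun _ _ p => .bnd (.refl a') p)

theorem GConv.lam {b b' : G} (h : GConv b b') : GConv (.lam b) (.lam b') := h.map fun _ _ => .lam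

namespace Tm

/-- The regrouped term. -/
def toG : Tm → G
  | var n => .var n
  | univ l => .nul (.univ l)
  | pi A B => .bnd .pi A.toG B.toG
  | lam b => .lam b.toG
  | app f a => .bin .app f.toG a.toG
  | sig A B => .bnd .sig A.toG B.toG
  | pair a b => .bin .pair a.toG b.toG
  | fst p => .un .fst p.toG
  | snd p => .un .snd p.toG
  | split C c p => .tri .split C.toG c.toG p.toG
  | zero => .nul .zero
  | abort C e => .bin .abort C.toG e.toG
  | one => .nul .one
  | star => .nul .star
  | oneElim C c u => .tri .oneElim C.toG c.toG u.toG
  | sum A B => .bin .sum A.toG B.toG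
  | inl a => .un .inl a.toG
  | inr b => .un .inr b.toG
  | sumElim C l r s => .quad C.toG l.toG r.toG s.toG
  | W A B => .bnd .W A.toG B.toG
  | sup a f => .bin .sup a.toG f.toG
  | wrec C c w => .tri .wrec C.toG c.toG w.toG
  | path A a b => .tri .path A.toG a.toG b.toG
  | refl a => .un .refl a.toG
  | J C c p => .tri .J C.toG c.toG p.toG
  | funext i j => .nul (.funext i j)
  | ua l => .nul (.ua l)

theorem toG_rename (t : Tm) (ξ : ℕ → ℕ) : (t.rename ξ).toG = t.toG.rename ξ := by
  induction t generalizing ξ <;> simp [rename, toG, G.rename, *]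

theorem toG_wk (t : Tm) : (t.wk 1).toG = t.toG.wk := toG_rename t _

theorem toG_liftSub (σ : ℕ → Tm) :
    (fun n => (liftSub σ n).toG) = G.liftSub fun n => (σ n).toG := by
  funext n
  cases n with
  | zero => rfl
  | succ n => exact toG_rename _ _

theorem toG_subst (t : Tm) (σ : ℕ → Tm) : (t.subst σ).toG = t.toG.subst fun n => (σ n).toG := by
  induction t generalizing σ <;> simp [subst, toG, G.subst, toG_liftSub, *]

theorem toG_inst (b a : Tm) : (b.inst a).toG = b.toG.inst a.toG := by
  rw [inst, toG_subst, G.inst]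
  congr 1
  funext n
  cases n <;> rfl

end Tm

def K0.toTm : K0 → Tm
  | zero => .zero | one => .one | star => .star | univ l => .univ l
  | funext i j => .funext i j | ua l => .ua l
def K1.toTm : K1 → Tm → Tm
  | fst => .fst | snd => .snd | inl => .inl | inr => .inr | refl => .refl
def K2.toTm : K2 → Tm → Tm → Tm
  | app => .app | pair => .pair | sum => .sum | sup => .sup | abort => .abort
def K3.toTm : K3 → Tm → Tm → Tm → Tm
  | split => .split | oneElim => .oneElim | wrec => .wrec | path => .path | J => .J
def KB.toTm : KB → Tm → Tm → Tm
  | pi => .pi | sig => .sig | W => .W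

namespace G

/-- The raw term of a regrouped term. -/
def toTm : G → Tm
  | var n => .var n
  | nul o => o.toTm
  | un o a => o.toTm a.toTm
  | bin o a b => o.toTm a.toTm b.toTm
  | tri o a b c => o.toTm a.toTm b.toTm c.toTm
  | quad a b c d => .sumElim a.toTm b.toTm c.toTm d.toTm
  | bnd o a b => o.toTm a.toTm b.toTm
  | lam b => .lam b.toTm

theorem toTm_toG (t : Tm) : t.toG.toTm = t := by
  induction t <;> simp [Tm.toG, toTm, K0.toTm, K1.toTm, K2.toTm, K3.toTm, KB.toTm, *]

theorem toTm_rename (t : G) (ξ : ℕ → ℕ) : (t.rename ξ).toTm = t.toTm.rename ξ := by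
  induction t generalizing ξ with
  | nul o => cases o <;> rfl
  | un o _ ih => cases o <;> simp [rename, toTm, K1.toTm, Tm.rename, ih]
  | bin o _ _ ih ih' => cases o <;> simp [rename, toTm, K2.toTm, Tm.rename, ih, ih']
  | tri o _ _ _ ih ih' ih'' => cases o <;> simp [rename, toTm, K3.toTm, Tm.rename, ih, ih', ih'']
  | bnd o _ _ ih ih' => cases o <;> simp [rename, toTm, KB.toTm, Tm.rename, ih, ih']
  | _ => simp [rename, toTm, Tm.rename, *]

theorem toTm_wk (t : G) : t.wk.toTm = t.toTm.wk 1 := toTm_rename t _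

theorem toTm_subst (t : G) (σ : ℕ → G) :
    (t.subst σ).toTm = t.toTm.subst fun n => (σ n).toTm := by
  have lift : ∀ σ : ℕ → G,
      (fun n => (liftSub σ n).toTm) = Tm.liftSub fun n => (σ n).toTm := by
    intro σ
    funext n
    cases n with
    | zero => rfl
    | succ n => exact toTm_rename _ _
  induction t generalizing σ with
  | nul o => cases o <;> rfl
  | un o _ ih => cases o <;> simp [subst, toTm, K1.toTm, Tm.subst, ih]
  | bin o _ _ ih ih' => cases o <;> simp [subst, toTm, K2.toTm, Tm.subst, ih, ih']
  | tri o _ _ _ ih ih' ih'' => cases o <;> simp [subst, toTm, K3.toTm, Tm.subst, ih, ih', ih'']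
  | bnd o _ _ ih ih' => cases o <;> simp [subst, toTm, KB.toTm, Tm.subst, ih, ih', lift]
  | _ => simp [subst, toTm, Tm.subst, *]

theorem toTm_inst (b a : G) : (b.inst a).toTm = b.toTm.inst a.toTm := by
  rw [inst, toTm_subst, Tm.inst]
  congr 1
  funext n
  cases n <;> rfl

end G

theorem Par.conv {t u : G} (h : Par t u) : Conv t.toTm u.toTm := by
  induction h with
  | var n => exact .rfl _
  | nul o => exact .rfl _
  | @un o _ _ _ h => cases o; exacts [.fst h, .snd h, .inl h, .inr h, .refl h]
  | @bin o _ _ _ _ _ _ h h' => 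
    cases o
    exacts [.app h h', .pair h h', .sum h h', .sup h h', .abort h h']
  | @tri o _ _ _ _ _ _ _ _ _ h h' h'' => 
    cases o
    exacts [.split h h' h'', .oneElim h h' h'', .wrec h h' h'', .path h h' h'', .J h h' h'']
  | quad _ _ _ _ h₁ h₂ h₃ h₄ => exact .sumElim h₁ h₂ h₃ h₄
  | @bnd o _ _ _ _ _ _ h h' =>
    cases o
    exacts [.pi h h', .sig h h', .W h h']
  | lam _ h => exact .lam h
  | beta _ _ h h' => rw [toTm_inst]; exact .trans (.app_lam _ _) (h.inst h')
  | fst _ h => exact .trans (.fst_pair _ _) h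
  | snd _ h => exact .trans (.snd_pair _ _) h
  | split _ _ _ h h' h'' => exact .trans (.split_pair _ _ _ _) (.app (.app h h') h'')
  | oneElim _ h => exact .trans (.oneElim_star _ _) h
  | inl _ _ h h' => exact .trans (.sumElim_inl _ _ _ _) (.app h h')
  | inr _ _ h h' => exact .trans (.sumElim_inr _ _ _ _) (.app h h')
  | wrec _ _ _ _ h₁ h₂ h₃ h₄ =>
    refine .trans (.wrec_sup _ _ _ _) (.app (.app (.app h₂ h₃) h₄) (.lam ?_))
    simp only [toTm, K3.toTm, K2.toTm, toTm_wk]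
    exact .wrec (h₁.wk 1) (h₂.wk 1) (.app (h₄.wk 1) (.rfl _))
  | J _ h => exact .trans (.J_refl _ _ _) h
  | eta _ h =>
    refine .trans ?_ h
    simp only [toTm, K2.toTm, toTm_wk]
    exact .lam_app _

theorem GConv.conv {t u : G} (h : GConv t u) : Conv t.toTm u.toTm := by
  have star : ∀ {t u : G}, ReflTransGen Par t u → Conv t.toTm u.toTm := by
    intro t u h
    induction h with
    | refl => exact .rfl _
    | tail _ p ih => exact ih.trans p.conv
  obtain ⟨v, p, p'⟩ := h
  exact (star p).trans (star p').symm

/-- Each computation rule, and the uniqueness rule for functions, is a single parallel step. With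
`GConv.conv` this identifies judgmental equality with having a common reduct. -/
theorem Conv.gconv {t u : Tm} (h : Conv t u) : GConv t.toG u.toG := by
  induction h with
  | rfl a => exact gconv_equivalence.refl _
  | symm _ h => exact gconv_equivalence.symm h
  | trans _ _ h h' => exact h.trans h'
  | app_lam b a => rw [Tm.toG, Tm.toG, Tm.toG_inst]; exact (Par.beta (.refl _) (.refl _)).gconv
  | fst_pair a b => exact (Par.fst (.refl _)).gconv
  | snd_pair a b => exact (Par.snd (.refl _)).gconv
  | split_pair C c a b => exact (Par.split (.refl _) (.refl _) (.refl _)).gconv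
  | oneElim_star C c => exact (Par.oneElim (.refl _)).gconv
  | sumElim_inl C l r a => exact (Par.inl (.refl _) (.refl _)).gconv
  | sumElim_inr C l r b => exact (Par.inr (.refl _) (.refl _)).gconv
  | wrec_sup C c a f =>
    simp only [Tm.toG, Tm.toG_wk]
    exact (Par.wrec (.refl _) (.refl _) (.refl _) (.refl _)).gconv
  | J_refl C c a => exact (Par.J (.refl _)).gconv
  | lam_app f => simp only [Tm.toG, Tm.toG_wk]; exact (Par.eta (.refl _)).gconv
  | pi _ _ h h' => exact h.bnd h'
  | lam _ h => exact h.lam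
  | app _ _ h h' => exact h.bin h'
  | sig _ _ h h' => exact h.bnd h'
  | pair _ _ h h' => exact h.bin h'
  | fst _ h => exact h.un
  | snd _ h => exact h.un
  | split _ _ _ h h' h'' => exact h.tri h' h''
  | abort _ _ h h' => exact h.bin h'
  | oneElim _ _ _ h h' h'' => exact h.tri h' h''
  | sum _ _ h h' => exact h.bin h'
  | inl _ h => exact h.un
  | inr _ h => exact h.un
  | sumElim _ _ _ _ h₁ h₂ h₃ h₄ => exact h₁.quad h₂ h₃ h₄
  | W _ _ h h' => exact h.bnd h'
  | sup _ _ h h' => exact h.bin h'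
  | wrec _ _ _ h h' h'' => exact h.tri h' h''
  | path _ _ _ h h' h'' => exact h.tri h' h''
  | refl _ h => exact h.un
  | J _ _ _ h h' h'' => exact h.tri h' h''

/-- No rule contracts a type former at the root, so all its reducts have the same head and reduction
takes place in the components. -/
theorem star_bnd {o : KB} {a b x : G} (h : ReflTransGen Par (.bnd o a b) x) :
    ∃ a' b', x = .bnd o a' b' ∧ ReflTransGen Par a a' ∧ ReflTransGen Par b b' := by
  induction h with
  | refl => exact ⟨a, b, rfl, .refl, .refl⟩
  | tail _ p ih =>
    obtain ⟨a', b', rfl, h, h'⟩ := ih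
    cases p with
    | bnd p p' => exact ⟨_, _, rfl, h.tail p, h'.tail p'⟩

theorem star_sum {a b x : G} (h : ReflTransGen Par (.bin .sum a b) x) :
    ∃ a' b', x = .bin .sum a' b' ∧ ReflTransGen Par a a' ∧ ReflTransGen Par b b' := by
  induction h with
  | refl => exact ⟨a, b, rfl, .refl, .refl⟩
  | tail _ p ih =>
    obtain ⟨a', b', rfl, h, h'⟩ := ih
    cases p with
    | bin p p' => exact ⟨_, _, rfl, h.tail p, h'.tail p'⟩

theorem star_path {a b c x : G} (h : ReflTransGen Par (.tri .path a b c) x) :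
    ∃ a' b' c', x = .tri .path a' b' c' ∧
      ReflTransGen Par a a' ∧ ReflTransGen Par b b' ∧ ReflTransGen Par c c' := by
  induction h with
  | refl => exact ⟨a, b, c, rfl, .refl, .refl, .refl⟩
  | tail _ p ih =>
    obtain ⟨a', b', c', rfl, h, h', h''⟩ := ih
    cases p with
    | tri p p' p'' => exact ⟨_, _, _, rfl, h.tail p, h'.tail p', h''.tail p''⟩

theorem conv_of_star {t u : Tm} {x : G} (h : ReflTransGen Par t.toG x)
    (h' : ReflTransGen Par u.toG x) : Conv t u := by
  have := GConv.conv (t := t.toG) (u := u.toG) ⟨x, h, h'⟩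
  rwa [toTm_toG, toTm_toG] at this

/-- A common reduct is again a `Π`-type, whose components are common reducts of the given ones. -/
theorem Conv.pi_inj {A A' B B' : Tm} (h : Conv (.pi A B) (.pi A' B')) : Conv A A' ∧ Conv B B' := by
  obtain ⟨x, p, q⟩ := h.gconv
  obtain ⟨a, b, rfl, h₁, h₂⟩ := star_bnd p
  obtain ⟨_, _, e, h₃, h₄⟩ := star_bnd q
  cases e
  exact ⟨conv_of_star h₁ h₃, conv_of_star h₂ h₄⟩

theorem Conv.sig_inj {A A' B B' : Tm} (h : Conv (.sig A B) (.sig A' B')) :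
    Conv A A' ∧ Conv B B' := by
  obtain ⟨x, p, q⟩ := h.gconv
  obtain ⟨a, b, rfl, h₁, h₂⟩ := star_bnd p
  obtain ⟨_, _, e, h₃, h₄⟩ := star_bnd q
  cases e
  exact ⟨conv_of_star h₁ h₃, conv_of_star h₂ h₄⟩

theorem Conv.W_inj {A A' B B' : Tm} (h : Conv (.W A B) (.W A' B')) : Conv A A' ∧ Conv B B' := by
  obtain ⟨x, p, q⟩ := h.gconv
  obtain ⟨a, b, rfl, h₁, h₂⟩ := star_bnd p
  obtain ⟨_, _, e, h₃, h₄⟩ := star_bnd q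
  cases e
  exact ⟨conv_of_star h₁ h₃, conv_of_star h₂ h₄⟩

theorem Conv.sum_inj {A A' B B' : Tm} (h : Conv (.sum A B) (.sum A' B')) :
    Conv A A' ∧ Conv B B' := by
  obtain ⟨x, p, q⟩ := h.gconv
  obtain ⟨a, b, rfl, h₁, h₂⟩ := star_sum p
  obtain ⟨_, _, e, h₃, h₄⟩ := star_sum q
  cases e
  exact ⟨conv_of_star h₁ h₃, conv_of_star h₂ h₄⟩

theorem Conv.path_inj {A A' a a' b b' : Tm} (h : Conv (.path A a b) (.path A' a' b')) :
    Conv A A' ∧ Conv a a' ∧ Conv b b' := by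
  obtain ⟨x, p, q⟩ := h.gconv
  obtain ⟨_, _, _, rfl, h₁, h₂, h₃⟩ := star_path p
  obtain ⟨_, _, _, e, k₁, k₂, k₃⟩ := star_path q
  cases e
  exact ⟨conv_of_star h₁ k₁, conv_of_star h₂ k₂, conv_of_star h₃ k₃⟩

end UF

namespace UF
open Tm

/-! ## Inversion and subject reduction -/

/-- What a typing derivation of a term says about its parts. -/
def Inv (Γ : List Tm) : Tm → Tm → Prop
  | .pi A B, _ => ∃ i j, HasType Γ A (.univ i) ∧ HasType (A :: Γ) B (.univ j)
  | .sig A B, _ => ∃ i j, HasType Γ A (.univ i) ∧ HasType (A :: Γ) B (.univ j)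
  | .W A B, _ => ∃ i j, HasType Γ A (.univ i) ∧ HasType (A :: Γ) B (.univ j)
  | .sum A B, _ => ∃ i j, HasType Γ A (.univ i) ∧ HasType Γ B (.univ j)
  | .path A a b, _ => ∃ i, HasType Γ A (.univ i) ∧ HasType Γ a A ∧ HasType Γ b A
  | .lam b, T => ∃ A B i, HasType Γ A (.univ i) ∧ HasType (A :: Γ) b B ∧ Conv (.pi A B) T
  | .app f a, T => ∃ A B, HasType Γ f (.pi A B) ∧ HasType Γ a A ∧ Conv (B.inst a) T
  | .pair a b, T => ∃ A B l, HasType Γ (.sig A B) (.univ l) ∧ HasType Γ a A ∧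
      HasType Γ b (B.inst a) ∧ Conv (.sig A B) T
  | .fst p, T => ∃ A B, HasType Γ p (.sig A B) ∧ Conv A T
  | .snd p, T => ∃ A B, HasType Γ p (.sig A B) ∧ Conv (B.inst (.fst p)) T
  | .split C c p, T => ∃ A B l, HasType Γ C (.pi (.sig A B) (.univ l)) ∧
      HasType Γ c (.pi A (.pi B (.app (C.wk 2) (.pair (.var 1) (.var 0))))) ∧
      HasType Γ p (.sig A B) ∧ Conv (.app C p) T
  | .oneElim C c u, T => HasType Γ c (.app C .star) ∧ HasType Γ u .one ∧ Conv (.app C u) T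
  | .inl a, T => ∃ A B l, HasType Γ (.sum A B) (.univ l) ∧ HasType Γ a A ∧ Conv (.sum A B) T
  | .inr b, T => ∃ A B l, HasType Γ (.sum A B) (.univ l) ∧ HasType Γ b B ∧ Conv (.sum A B) T
  | .sumElim C l r s, T => ∃ A B k, HasType Γ C (.pi (.sum A B) (.univ k)) ∧
      HasType Γ l (.pi A (.app (C.wk 1) (.inl (.var 0)))) ∧
      HasType Γ r (.pi B (.app (C.wk 1) (.inr (.var 0)))) ∧
      HasType Γ s (.sum A B) ∧ Conv (.app C s) T
  | .sup a f, T => ∃ A B l, HasType Γ (.W A B) (.univ l) ∧ HasType Γ a A ∧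
      HasType Γ f (.pi (B.inst a) ((Tm.W A B).wk 1)) ∧ Conv (.W A B) T
  | .wrec C c w, T => ∃ A B l, HasType Γ C (.pi (.W A B) (.univ l)) ∧
      HasType Γ c
        (.pi A (.pi (.pi B ((Tm.W A B).wk 2))
          (.pi (.pi (B.wk 1) (.app (C.wk 3) (.app (.var 1) (.var 0))))
            (.app (C.wk 3) (.sup (.var 2) (.var 1)))))) ∧
      HasType Γ w (.W A B) ∧ Conv (.app C w) T
  | .refl a, T => ∃ A l, HasType Γ A (.univ l) ∧ HasType Γ a A ∧ Conv (.path A a a) T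
  | .J C c p, T => ∃ A a b, HasType Γ c (.app (.app C a) (.refl a)) ∧
      HasType Γ p (.path A a b) ∧ Conv (.app (.app C b) p) T
  | _, _ => True

theorem Inv.conv {Γ : List Tm} {t A B : Tm} (h : Inv Γ t A) (hc : Conv A B) : Inv Γ t B := by
  cases t with
  | pi | sig | W | sum | path | var | univ | zero | abort | one | star | funext | ua => exact h
  | lam => obtain ⟨_, _, _, h₁, h₂, h₃⟩ := h; exact ⟨_, _, _, h₁, h₂, h₃.trans hc⟩
  | app => obtain ⟨_, _, h₁, h₂, h₃⟩ := h; exact ⟨_, _, h₁, h₂, h₃.trans hc⟩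
  | pair => obtain ⟨_, _, _, h₁, h₂, h₃, h₄⟩ := h; exact ⟨_, _, _, h₁, h₂, h₃, h₄.trans hc⟩
  | fst => obtain ⟨_, _, h₁, h₂⟩ := h; exact ⟨_, _, h₁, h₂.trans hc⟩
  | snd => obtain ⟨_, _, h₁, h₂⟩ := h; exact ⟨_, _, h₁, h₂.trans hc⟩
  | split => obtain ⟨_, _, _, h₁, h₂, h₃, h₄⟩ := h; exact ⟨_, _, _, h₁, h₂, h₃, h₄.trans hc⟩
  | oneElim => obtain ⟨h₁, h₂, h₃⟩ := h; exact ⟨h₁, h₂, h₃.trans hc⟩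
  | inl => obtain ⟨_, _, _, h₁, h₂, h₃⟩ := h; exact ⟨_, _, _, h₁, h₂, h₃.trans hc⟩
  | inr => obtain ⟨_, _, _, h₁, h₂, h₃⟩ := h; exact ⟨_, _, _, h₁, h₂, h₃.trans hc⟩
  | sumElim =>
    obtain ⟨_, _, _, h₁, h₂, h₃, h₄, h₅⟩ := h; exact ⟨_, _, _, h₁, h₂, h₃, h₄, h₅.trans hc⟩
  | sup => obtain ⟨_, _, _, h₁, h₂, h₃, h₄⟩ := h; exact ⟨_, _, _, h₁, h₂, h₃, h₄.trans hc⟩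
  | wrec => obtain ⟨_, _, _, h₁, h₂, h₃, h₄⟩ := h; exact ⟨_, _, _, h₁, h₂, h₃, h₄.trans hc⟩
  | refl => obtain ⟨_, _, h₁, h₂, h₃⟩ := h; exact ⟨_, _, h₁, h₂, h₃.trans hc⟩
  | J => obtain ⟨_, _, _, h₁, h₂, h₃⟩ := h; exact ⟨_, _, _, h₁, h₂, h₃.trans hc⟩

theorem HasType.inv {Γ : List Tm} {t T : Tm} (h : HasType Γ t T) : Inv Γ t T := by
  induction h with
  | conv _ _ hc ih => exact ih.conv hc
  | var | univ | zero | abort | one | star | funext | ua => trivial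
  | pi h h' => exact ⟨_, _, h, h'⟩
  | sig h h' => exact ⟨_, _, h, h'⟩
  | W h h' => exact ⟨_, _, h, h'⟩
  | sum h h' => exact ⟨_, _, h, h'⟩
  | path h h' h'' => exact ⟨_, h, h', h''⟩
  | lam h h' => exact ⟨_, _, _, h, h', .rfl _⟩
  | app h h' => exact ⟨_, _, h, h', .rfl _⟩
  | pair h h' h'' => exact ⟨_, _, _, h, h', h'', .rfl _⟩
  | fst h => exact ⟨_, _, h, .rfl _⟩
  | snd h => exact ⟨_, _, h, .rfl _⟩
  | split h h' h'' => exact ⟨_, _, _, h, h', h'', .rfl _⟩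
  | oneElim h h' h'' => exact ⟨h', h'', .rfl _⟩
  | inl h h' => exact ⟨_, _, _, h, h', .rfl _⟩
  | inr h h' => exact ⟨_, _, _, h, h', .rfl _⟩
  | sumElim h₁ h₂ h₃ h₄ => exact ⟨_, _, _, h₁, h₂, h₃, h₄, .rfl _⟩
  | sup h h' h'' => exact ⟨_, _, _, h, h', h'', .rfl _⟩
  | wrec h h' h'' => exact ⟨_, _, _, h, h', h'', .rfl _⟩
  | refl h h' => exact ⟨_, _, h, h', .rfl _⟩
  | J h h' h'' => exact ⟨_, _, _, h', h'', .rfl _⟩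

/-- `B` is a type. -/
def IsType (Γ : List Tm) (B : Tm) : Prop := ∃ l, HasType Γ B (.univ l)

theorem HasType.to {Γ : List Tm} {t A B : Tm} (h : HasType Γ t A) (hB : IsType Γ B)
    (hc : Conv A B) : HasType Γ t B := let ⟨_, hB⟩ := hB; .conv h hB hc

theorem IsType.of_pi {Γ : List Tm} {A B : Tm} (h : IsType Γ (.pi A B)) :
    IsType Γ A ∧ IsType (A :: Γ) B :=
  let ⟨_, h⟩ := h; let ⟨_, _, h, h'⟩ := h.inv; ⟨⟨_, h⟩, ⟨_, h'⟩⟩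

theorem IsType.of_sig {Γ : List Tm} {A B : Tm} (h : IsType Γ (.sig A B)) :
    IsType Γ A ∧ IsType (A :: Γ) B :=
  let ⟨_, h⟩ := h; let ⟨_, _, h, h'⟩ := h.inv; ⟨⟨_, h⟩, ⟨_, h'⟩⟩

theorem IsType.of_W {Γ : List Tm} {A B : Tm} (h : IsType Γ (.W A B)) :
    IsType Γ A ∧ IsType (A :: Γ) B :=
  let ⟨_, h⟩ := h; let ⟨_, _, h, h'⟩ := h.inv; ⟨⟨_, h⟩, ⟨_, h'⟩⟩

theorem IsType.of_sum {Γ : List Tm} {A B : Tm} (h : IsType Γ (.sum A B)) :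
    IsType Γ A ∧ IsType Γ B :=
  let ⟨_, h⟩ := h; let ⟨_, _, h, h'⟩ := h.inv; ⟨⟨_, h⟩, ⟨_, h'⟩⟩

theorem IsType.of_path {Γ : List Tm} {A a b : Tm} (h : IsType Γ (.path A a b)) :
    IsType Γ A ∧ HasType Γ a A ∧ HasType Γ b A :=
  let ⟨_, h⟩ := h; let ⟨_, h, h', h''⟩ := h.inv; ⟨⟨_, h⟩, h', h''⟩

theorem IsType.pi {Γ : List Tm} {A B : Tm} : IsType Γ A → IsType (A :: Γ) B → IsType Γ (.pi A B) :=
  fun ⟨_, h⟩ ⟨_, h'⟩ => ⟨_, .pi h h'⟩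

theorem IsType.sig {Γ : List Tm} {A B : Tm} :
    IsType Γ A → IsType (A :: Γ) B → IsType Γ (.sig A B) :=
  fun ⟨_, h⟩ ⟨_, h'⟩ => ⟨_, .sig h h'⟩

theorem IsType.univ (Γ : List Tm) (l : ℕ) : IsType Γ (.univ l) := ⟨_, .univ l⟩

theorem IsType.wk {Γ : List Tm} {A : Tm} (h : IsType Γ A) (B : Tm) : IsType (B :: Γ) (A.wk 1) :=
  let ⟨_, h⟩ := h; ⟨_, h.wk B⟩

theorem IsType.inst {Γ : List Tm} {A B a : Tm} (h : IsType (A :: Γ) B) (h' : HasType Γ a A) :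
    IsType Γ (B.inst a) := let ⟨_, h⟩ := h; ⟨_, h.inst h'⟩

theorem IsType.conv_ctx {Γ : List Tm} {A A' B : Tm} (h : IsType (A :: Γ) B) (hA : IsType Γ A)
    (hc : Conv A A') : IsType (A' :: Γ) B :=
  let ⟨_, h⟩ := h; let ⟨_, hA⟩ := hA; ⟨_, h.conv_ctx hA hc⟩

theorem HasType.lam' {Γ : List Tm} {A B b : Tm} (hA : IsType Γ A) (h : HasType (A :: Γ) b B) :
    HasType Γ (.lam b) (.pi A B) := let ⟨_, hA⟩ := hA; .lam hA h

/-- `t` converts to `u`, and `u` has the types of `t` up to conversion. -/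
structure Pres (Γ : List Tm) (t u : Tm) : Prop where
  conv : Conv t u
  typed : ∀ T, HasType Γ t T → ∃ T', HasType Γ u T' ∧ Conv T' T

namespace Pres

variable {Γ : List Tm}

protected theorem refl (t : Tm) : Pres Γ t t := ⟨.rfl _, fun T h => ⟨T, h, .rfl _⟩⟩

protected theorem trans {t u v : Tm} (h : Pres Γ t u) (h' : Pres Γ u v) : Pres Γ t v :=
  ⟨h.conv.trans h'.conv, fun T ht =>
    let ⟨_, hu, c⟩ := h.typed T ht
    let ⟨T₂, hv, c'⟩ := h'.typed _ hu
    ⟨T₂, hv, c'.trans c⟩⟩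

/-- Subject reduction for `β`. Inversion yields one `Π`-type from the application and another from
the abstraction; they are convertible, and injectivity makes their domains and codomains
convertible. -/
theorem app {f b a : Tm} (h : Pres Γ f (.lam b)) : Pres Γ (.app f a) (b.inst a) := by
  refine ⟨.trans (.app h.conv (.rfl _)) (.app_lam _ _), fun T ht => ?_⟩
  obtain ⟨A, B, hf, ha, c⟩ := ht.inv
  obtain ⟨F, hl, c'⟩ := h.typed _ hf
  obtain ⟨A', B', i, hA', hb, c''⟩ := hl.inv
  obtain ⟨cA, cB⟩ := (c''.trans c').pi_inj
  exact ⟨_, hb.inst (.conv ha hA' cA.symm), (cB.inst (.rfl a)).trans c⟩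

theorem fst {p a b : Tm} (h : Pres Γ p (.pair a b)) : Pres Γ (.fst p) a := by
  refine ⟨.trans (.fst h.conv) (.fst_pair _ _), fun T ht => ?_⟩
  obtain ⟨A, B, hp, c⟩ := ht.inv
  obtain ⟨P, hl, c'⟩ := h.typed _ hp
  obtain ⟨A', B', i, -, ha, -, c''⟩ := hl.inv
  exact ⟨_, ha, (c''.trans c').sig_inj.1.trans c⟩

theorem snd {p a b : Tm} (h : Pres Γ p (.pair a b)) : Pres Γ (.snd p) b := by
  refine ⟨.trans (.snd h.conv) (.snd_pair _ _), fun T ht => ?_⟩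
  obtain ⟨A, B, hp, c⟩ := ht.inv
  obtain ⟨P, hl, c'⟩ := h.typed _ hp
  obtain ⟨A', B', i, -, -, hb, c''⟩ := hl.inv
  refine ⟨_, hb, .trans (.inst (c''.trans c').sig_inj.2 ?_) c⟩
  exact .symm (.trans (.fst h.conv) (.fst_pair _ _))

theorem oneElim {C c p : Tm} (h : Pres Γ p .star) : Pres Γ (.oneElim C c p) c := by
  refine ⟨.trans (.oneElim (.rfl _) (.rfl _) h.conv) (.oneElim_star _ _), fun T ht => ?_⟩
  obtain ⟨hc, -, c⟩ := ht.inv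
  exact ⟨_, hc, .trans (.app (.rfl _) h.conv.symm) c⟩

/-- The type `a = b` of `p` converts to a type `x = x`, so by injectivity both endpoints convert to
`x`; hence the type of `c`, at `a` and `refl a`, converts to the type of the eliminator, at `b` and
`p`. -/
theorem J {C c p x : Tm} (h : Pres Γ p (.refl x)) : Pres Γ (.J C c p) c := by
  refine ⟨.trans (.J (.rfl _) (.rfl _) h.conv) (.J_refl _ _ _), fun T ht => ?_⟩
  obtain ⟨A, a, b, hc, hp, c⟩ := ht.inv
  obtain ⟨P, hl, c'⟩ := h.typed _ hp
  obtain ⟨A', l, -, -, c''⟩ := hl.inv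
  obtain ⟨-, ca, cb⟩ := (c''.trans c').path_inj
  exact ⟨_, hc, .trans (.app (.app (.rfl _) (ca.symm.trans cb))
    (.trans (.refl ca.symm) h.conv.symm)) c⟩

end Pres

theorem wk_lift_inst (t a : Tm) : (t.wk 2).subst (liftSub (instVar a)) = t.wk 1 := by
  rw [wk_two, wk_subst]; exact congrArg (Tm.wk 1) (wk_inst t a)

theorem wk_lift_lift_inst (t a : Tm) :
    (t.wk 3).subst (liftSub (liftSub (instVar a))) = t.wk 2 := by
  rw [show t.wk 3 = (t.wk 2).wk 1 by rw [wk_wk], wk_subst, wk_lift_inst, wk_wk]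

theorem HasType.app' {Γ : List Tm} {f a A B B' : Tm} (h : HasType Γ f (.pi A B))
    (h' : HasType Γ a A) (e : B.inst a = B') : HasType Γ (.app f a) B' := e ▸ .app h h'

theorem HasType.var' {Γ : List Tm} {n : ℕ} {A B : Tm} (h : Γ[n]? = some A)
    (e : A.wk (n + 1) = B) : HasType Γ (.var n) B := e ▸ .var h

theorem IsType.app_motive {Γ : List Tm} {C D a : Tm} {l : ℕ} (h : HasType Γ C (.pi D (.univ l)))
    (h' : HasType Γ a D) : IsType Γ (.app C a) := ⟨l, .app' h h' rfl⟩

theorem HasType.wk_motive {Γ : List Tm} {C D : Tm} {l : ℕ} (h : HasType Γ C (.pi D (.univ l)))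
    (B : Tm) : HasType (B :: Γ) (C.wk 1) (.pi (D.wk 1) (.univ l)) := h.wk B

namespace Pres

variable {Γ : List Tm}

theorem inl {C l r s a : Tm} (h : Pres Γ s (.inl a)) : Pres Γ (.sumElim C l r s) (.app l a) := by
  refine ⟨.trans (.sumElim (.rfl _) (.rfl _) (.rfl _) h.conv) (.sumElim_inl _ _ _ _), fun T ht => ?_⟩
  obtain ⟨A, B, k, hC, hl, -, hs, c⟩ := ht.inv
  obtain ⟨P, hi, c'⟩ := h.typed _ hs
  obtain ⟨A', B', i, hAB, ha, c''⟩ := hi.inv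
  have hA := (IsType.of_sum ⟨_, hAB⟩).1
  obtain ⟨cA, cB⟩ := (c''.trans c').sum_inj
  -- The argument of the injection is known to have type `A'`, the domain of the branch is `A`. The
  -- motive and the branch are retyped over `A'` and `B'`, for which a derivation of well-formedness
  -- is at hand.
  have hC' := hC.to (.pi ⟨_, hAB⟩ (.univ _ _)) (.pi (c''.trans c').symm (.rfl _))
  have hl' := hl.to (.pi hA (.app_motive (hC'.wk_motive A') (.inl (hAB.wk A') (.var rfl))))
    (.pi cA.symm (.rfl _))
  refine ⟨.app C (.inl a), .app' hl' ha ?_, .trans (.app (.rfl _) h.conv.symm) c⟩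
  exact congrArg₂ Tm.app (wk_inst C a) rfl

theorem inr {C l r s a : Tm} (h : Pres Γ s (.inr a)) : Pres Γ (.sumElim C l r s) (.app r a) := by
  refine ⟨.trans (.sumElim (.rfl _) (.rfl _) (.rfl _) h.conv) (.sumElim_inr _ _ _ _), fun T ht => ?_⟩
  obtain ⟨A, B, k, hC, -, hr, hs, c⟩ := ht.inv
  obtain ⟨P, hi, c'⟩ := h.typed _ hs
  obtain ⟨A', B', i, hAB, ha, c''⟩ := hi.inv
  have hB := (IsType.of_sum ⟨_, hAB⟩).2
  obtain ⟨cA, cB⟩ := (c''.trans c').sum_inj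
  have hC' := hC.to (.pi ⟨_, hAB⟩ (.univ _ _)) (.pi (c''.trans c').symm (.rfl _))
  have hr' := hr.to (.pi hB (.app_motive (hC'.wk_motive B') (.inr (hAB.wk B') (.var rfl))))
    (.pi cB.symm (.rfl _))
  refine ⟨.app C (.inr a), .app' hr' ha ?_, .trans (.app (.rfl _) h.conv.symm) c⟩
  exact congrArg₂ Tm.app (wk_inst C a) rfl

end Pres

theorem rename_lift_inst (B : Tm) : (B.rename (liftRen (· + 1))).inst (.var 0) = B := by
  rw [inst, subst_rename]
  refine (congrArg (Tm.subst · B) (funext fun n => ?_)).trans (subst_var B)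
  cases n <;> rfl

theorem rename_lift_lift_inst (B : Tm) :
    (B.rename (liftRen (· + 2))).inst (.var 1) = B.wk 1 := by
  rw [inst, subst_rename, Tm.wk, rename_eq_subst]
  exact congrArg (Tm.subst · B) (funext fun n => by cases n <;> rfl)

theorem HasType.branch_pair {Γ : List Tm} {A B : Tm} (h : IsType Γ (.sig A B)) :
    HasType (B :: A :: Γ) (.pair (.var 1) (.var 0)) ((Tm.sig A B).wk 2) := by
  obtain ⟨l, h⟩ := h
  have h' : HasType (B :: A :: Γ) ((Tm.sig A B).wk 2) (.univ l) := h.weaken [B, A]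
  exact .pair h' (.var rfl) (.var' rfl (rename_lift_lift_inst B).symm)

theorem IsType.split_branch {Γ : List Tm} {A B C : Tm} {l : ℕ} (h : IsType Γ (.sig A B))
    (hC : HasType Γ C (.pi (.sig A B) (.univ l))) :
    IsType Γ (.pi A (.pi B (.app (C.wk 2) (.pair (.var 1) (.var 0))))) :=
  .pi h.of_sig.1 (.pi h.of_sig.2 (.app_motive (D := (Tm.sig A B).wk 2)
    (show HasType _ _ _ from hC.weaken [B, A]) (.branch_pair h)))

theorem Pres.split {Γ : List Tm} {C x s a b : Tm} (h : Pres Γ s (.pair a b)) :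
    Pres Γ (.split C x s) (.app (.app x a) b) := by
  refine ⟨.trans (.split (.rfl _) (.rfl _) h.conv) (.split_pair _ _ _ _), fun T ht => ?_⟩
  obtain ⟨A, B, k, hC, hx, hs, c⟩ := ht.inv
  obtain ⟨P, hi, c'⟩ := h.typed _ hs
  obtain ⟨A', B', i, hAB, ha, hb, c''⟩ := hi.inv
  obtain ⟨cA, cB⟩ := (c''.trans c').sig_inj
  have hC' := hC.to (.pi ⟨_, hAB⟩ (.univ _ _)) (.pi (c''.trans c').symm (.rfl _))
  have hx' := hx.to (.split_branch ⟨_, hAB⟩ hC') (.pi cA.symm (.pi cB.symm (.rfl _)))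
  have h₁ : HasType Γ (.app x a) (.pi (B'.inst a) (.app (C.wk 1) (.pair (a.wk 1) (.var 0)))) :=
    .app' hx' ha (congrArg (fun t => Tm.pi (B'.inst a) (.app t (.pair (a.wk 1) (.var 0))))
      (wk_lift_inst C a))
  refine ⟨.app C (.pair a b), .app' h₁ hb ?_, .trans (.app (.rfl _) h.conv.symm) c⟩
  exact congrArg₂ (fun t u => Tm.app t (.pair u b)) (wk_inst C b) (wk_inst a b)

/-- The type of the branch of `wrec`. -/
def wrecBranchType (A B C : Tm) : Tm :=
  .pi A (.pi (.pi B ((Tm.W A B).wk 2))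
    (.pi (.pi (B.wk 1) (.app (C.wk 3) (.app (.var 1) (.var 0))))
      (.app (C.wk 3) (.sup (.var 2) (.var 1)))))

theorem rename_lift_three_inst (B : Tm) :
    (B.rename (liftRen (· + 3))).inst (.var 2) = B.wk 2 := by
  rw [inst, subst_rename, Tm.wk, rename_eq_subst]
  exact congrArg (Tm.subst · B) (funext fun n => by cases n <;> rfl)

theorem rename_lift_wk (t : Tm) (j k : ℕ) :
    (t.wk (j + 1)).rename (liftRen (· + k)) = t.wk (j + 1 + k) := by
  rw [Tm.wk, Tm.wk, rename_rename]
  exact congrArg (Tm.rename · t) (funext fun n => by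
    show n + j + k + 1 = _; omega)

theorem IsType.wrec_branch {Γ : List Tm} {A B C : Tm} {l : ℕ} (h : IsType Γ (.W A B))
    (hC : HasType Γ C (.pi (.W A B) (.univ l))) : IsType Γ (wrecBranchType A B C) := by
  obtain ⟨hA, hB⟩ := h.of_W
  obtain ⟨k, h⟩ := h
  have hW : HasType (B :: A :: Γ) ((Tm.W A B).wk 2) (.univ k) := h.weaken [B, A]
  have h₂ : IsType (A :: Γ) (.pi B ((Tm.W A B).wk 2)) := .pi hB ⟨_, hW⟩
  have h₃ : HasType (B.wk 1 :: .pi B ((Tm.W A B).wk 2) :: A :: Γ)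
      (.app (.var 1) (.var 0)) ((Tm.W A B).wk 3) := by
    refine .app' (A := B.wk 2) (B := (Tm.W A B).wk 4) (.var' rfl ?_) (.var' rfl (wk_wk _ _ _)) ?_
    · show Tm.pi _ _ = _
      rw [rename_lift_wk]
      rfl
    · rw [show (Tm.W A B).wk 4 = ((Tm.W A B).wk 3).wk 1 by rw [wk_wk], wk_inst]
  have h₄ : IsType (.pi B ((Tm.W A B).wk 2) :: A :: Γ)
      (.pi (B.wk 1) (.app (C.wk 3) (.app (.var 1) (.var 0)))) :=
    .pi (hB.wk _) (.app_motive (D := (Tm.W A B).wk 3)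
      (show HasType _ _ _ from hC.weaken [_, _, _]) h₃)
  refine .pi hA (.pi h₂ (.pi h₄ (.app_motive (D := (Tm.W A B).wk 3)
    (show HasType _ _ _ from hC.weaken [_, _, _]) ?_)))
  refine .sup (show HasType _ _ _ from h.weaken [_, _, _]) (.var rfl) (.var' rfl ?_)
  show Tm.pi _ _ = Tm.pi _ _
  congr 1
  · rw [rename_lift_three_inst]
    rfl
  · rw [rename_lift_wk]
    exact (wk_wk (Tm.W A B) 3 1).symm

theorem wrecBranchType_wk (A B C : Tm) :
    (wrecBranchType A B C).wk 1 =
      wrecBranchType (A.wk 1) (B.rename (liftRen (· + 1))) (C.wk 1) := by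
  simp only [wrecBranchType, Tm.wk, Tm.rename, rename_rename, ← liftRen_comp]
  rfl

/-- As for sums, the motive and the branch are moved to the `W`-type in the derivation for `sup a
f`. The function of recursive values is then typed by weakening the branch under one more variable.
-/
theorem Pres.wrec {Γ : List Tm} {C x s a f : Tm} (h : Pres Γ s (.sup a f)) :
    Pres Γ (.wrec C x s)
      (.app (.app (.app x a) f) (.lam (.wrec (C.wk 1) (x.wk 1) (.app (f.wk 1) (.var 0))))) := by
  refine ⟨.trans (.wrec (.rfl _) (.rfl _) h.conv) (.wrec_sup _ _ _ _), fun T ht => ?_⟩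
  obtain ⟨A, B, k, hC, hx, hs, c⟩ := ht.inv
  obtain ⟨P, hi, c'⟩ := h.typed _ hs
  obtain ⟨A', B', i, hW, ha, hf, c''⟩ := hi.inv
  have cW := (c''.trans c').symm
  obtain ⟨cA, cB⟩ := cW.W_inj
  have hC' := hC.to (.pi ⟨_, hW⟩ (.univ _ _)) (.pi cW (.rfl _))
  have hx' : HasType Γ x (wrecBranchType A' B' C) := hx.to (.wrec_branch ⟨_, hW⟩ hC')
    (.pi cA (.pi (.pi cB (cW.wk 2)) (.pi (.pi (cB.wk 1) (.rfl _)) (.rfl _))))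
  obtain ⟨hA, hB⟩ := IsType.of_W ⟨_, hW⟩
  have hBa := hB.inst ha
  have h₀ : HasType (B'.inst a :: Γ) (.app (f.wk 1) (.var 0)) ((Tm.W A' B').wk 1) :=
    .app' (A := (B'.inst a).wk 1) (B := ((Tm.W A' B').wk 1).rename (liftRen (· + 1)))
      (hf.wk _) (.var rfl) (rename_lift_inst _)
  have h₁ : HasType Γ (.lam (.wrec (C.wk 1) (x.wk 1) (.app (f.wk 1) (.var 0))))
      (.pi (B'.inst a) (.app (C.wk 1) (.app (f.wk 1) (.var 0)))) := by
    have := hx'.wk (B'.inst a)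
    rw [wrecBranchType_wk] at this
    exact .lam' hBa (.wrec (hC'.wk_motive _) this h₀)
  have h₂ : HasType Γ (.app x a) (.pi (.pi (B'.inst a) ((Tm.W A' B').wk 1))
      (.pi (.pi ((B'.inst a).wk 1) (.app (C.wk 2) (.app (.var 1) (.var 0))))
        (.app (C.wk 2) (.sup (a.wk 2) (.var 1))))) := by
    refine .app' hx' ha ?_
    show Tm.pi (.pi _ (.subst _ _)) (.pi (.pi (.subst _ _) (.app (.subst _ _) _))
      (.app (.subst _ _) (.sup (Tm.wk 1 (Tm.wk 1 a)) _))) = _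
    rw [wk_lift_inst, wk_lift_lift_inst, wk_subst, wk_two a]
    rfl
  have h₃ : HasType Γ (.app (.app x a) f) (.pi (.pi (B'.inst a) (.app (C.wk 1)
      (.app (f.wk 1) (.var 0)))) (.app (C.wk 1) (.sup (a.wk 1) (f.wk 1)))) := by
    refine .app' h₂ hf ?_
    show Tm.pi (.pi (.subst _ _) (.app (.subst _ _) _)) (.app (.subst _ _) (.sup (.subst _ _) _)) = _
    rw [wk_lift_inst, wk_lift_inst]
    exact congrArg (fun t => Tm.pi (.pi t _) _) (wk_inst _ f)
  refine ⟨.app C (.sup a f), .app' h₃ h₁ ?_, .trans (.app (.rfl _) h.conv.symm) c⟩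
  exact congrArg₂ Tm.app (wk_inst C _) (congrArg₂ Tm.sup (wk_inst a _) (wk_inst f _))

end UF

namespace UF
open Tm

/-! ## Soundness of the operations on annotated terms -/

/-- The values of the constants are closed. -/
def Closed (ρ : ℕ → Tm) : Prop := ∀ k σ, (ρ k).subst σ = ρ k

namespace E

variable {ρ : ℕ → Tm}

/-- Substitution by `σ` under `d` binders. -/
def liftN (d : ℕ) (σ : ℕ → Tm) : ℕ → Tm := Nat.iterate liftSub d σ

theorem liftN_succ (d : ℕ) (σ : ℕ → Tm) : liftSub (liftN d σ) = liftN (d + 1) σ :=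
  (Function.iterate_succ_apply' _ _ _).symm

theorem liftN_apply (d : ℕ) (σ : ℕ → Tm) (n : ℕ) :
    liftN d σ n = if n < d then .var n else (σ (n - d)).wk d := by
  induction d generalizing n with
  | zero => simp [liftN, wk_zero]
  | succ d ih =>
    rw [← liftN_succ]
    cases n with
    | zero => rfl
    | succ n =>
      show (liftN d σ n).wk 1 = _
      rw [ih]
      by_cases h : n < d
      · simp [h, Tm.wk, Tm.rename]
      · simp [h, wk_wk]

/-- The operations on annotated terms do not touch constants, whereas after erasure they act on the
values of the constants; the two agree because these values are closed. -/
theorem er_shift (hρ : Closed ρ) (k : ℕ) (t : E) : ∀ c,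
    (t.shift k c).er ρ = (t.er ρ).subst (liftN c fun n => .var (n + k)) := by
  induction t with
  | var n =>
    intro c
    show E.er ρ (cond (Nat.ble c n) (var (n + k)) (var n)) = liftN c _ n
    rw [liftN_apply]
    by_cases h : n < c
    · have : Nat.ble c n = false := by rw [Bool.eq_false_iff]; simp; omega
      rw [this, if_pos h]; rfl
    · have : Nat.ble c n = true := by simp; omega
      rw [this, if_neg h]
      show Tm.var (n + k) = .var (n - c + k + c)
      congr 1; omega
  | con m => intro c; exact (hρ m _).symm
  | op0 o => intro c; cases o <;> rfl
  | op1 o _ ih => intro c; cases o <;> simp only [shift, er, Op1.er, Tm.subst] <;> exact congrArg _ (ih c)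
  | op2 o a b ih ih' =>
    intro c
    show o.er ((a.shift k c).er ρ) ((b.shift k c).er ρ) = _
    rw [ih, ih']
    cases o <;> rfl
  | op3 o a b d ih ih' ih'' =>
    intro c
    show o.er ((a.shift k c).er ρ) ((b.shift k c).er ρ) ((d.shift k c).er ρ) = _
    rw [ih, ih', ih'']
    cases o <;> rfl
  | elim a b d e ih ih' ih'' ih''' =>
    intro c
    show Tm.sumElim ((a.shift k c).er ρ) ((b.shift k c).er ρ) ((d.shift k c).er ρ)
      ((e.shift k c).er ρ) = _
    rw [ih, ih', ih'', ih''']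
    rfl
  | bnd o a b ih ih' =>
    intro c
    show o.er ((a.shift k c).er ρ) ((b.shift k (c + 1)).er ρ) = _
    rw [ih, ih', ← liftN_succ]
    cases o <;> rfl

theorem er_wk (hρ : Closed ρ) (k : ℕ) (t : E) : (t.wk k).er ρ = (t.er ρ).wk k := by
  rw [E.wk, er_shift hρ, Tm.wk, rename_eq_subst]; rfl

theorem er_shift_one (hρ : Closed ρ) (k : ℕ) (t : E) :
    (t.shift k 1).er ρ = (t.er ρ).rename (liftRen (· + k)) := by
  rw [er_shift hρ, rename_eq_subst]
  exact congrArg (Tm.subst · _) (funext fun n => by cases n <;> rfl)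

theorem er_substAt (hρ : Closed ρ) (a : E) (t : E) : ∀ d,
    (substAt a d t).er ρ = (t.er ρ).subst (liftN d (instVar (a.er ρ))) := by
  induction t with
  | var n =>
    intro d
    show E.er ρ (cond (Nat.ble d n) (cond (Nat.beq n d) (a.wk d) (var (n - 1))) (var n)) =
      liftN d _ n
    rw [liftN_apply]
    by_cases h : n < d
    · have : Nat.ble d n = false := by rw [Bool.eq_false_iff]; simp; omega
      rw [this, if_pos h]; rfl
    · have : Nat.ble d n = true := by simp; omega
      rw [this, if_neg h]
      by_cases h' : n = d
      · subst h'
        rw [show Nat.beq n n = true by simp, Nat.sub_self]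
        exact er_wk hρ n a
      · rw [show Nat.beq n d = false by rw [Bool.eq_false_iff]; simpa using h']
        obtain ⟨m, rfl⟩ : ∃ m, n = d + m + 1 := ⟨n - d - 1, by omega⟩
        rw [show d + m + 1 - d = m + 1 by omega]
        show Tm.var (d + m) = .var (m + d)
        rw [Nat.add_comm]
  | con m => intro c; exact (hρ m _).symm
  | op0 o => intro c; cases o <;> rfl
  | op1 o b ih =>
    intro d
    show o.er ((substAt a d b).er ρ) = _
    rw [ih]
    cases o <;> rfl
  | op2 o x y ih ih' =>
    intro d
    show o.er ((substAt a d x).er ρ) ((substAt a d y).er ρ) = _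
    rw [ih, ih']
    cases o <;> rfl
  | op3 o x y z ih ih' ih'' =>
    intro d
    show o.er ((substAt a d x).er ρ) ((substAt a d y).er ρ) ((substAt a d z).er ρ) = _
    rw [ih, ih', ih'']
    cases o <;> rfl
  | elim x y z w ih ih' ih'' ih''' =>
    intro d
    show Tm.sumElim ((substAt a d x).er ρ) ((substAt a d y).er ρ) ((substAt a d z).er ρ)
      ((substAt a d w).er ρ) = _
    rw [ih, ih', ih'', ih''']
    rfl
  | bnd o x y ih ih' =>
    intro d
    show o.er ((substAt a d x).er ρ) ((substAt a (d + 1) y).er ρ) = _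
    rw [ih, ih', ← liftN_succ]
    cases o <;> rfl

theorem er_inst (hρ : Closed ρ) (b a : E) : (b.inst a).er ρ = (b.er ρ).inst (a.er ρ) :=
  er_substAt hρ a b 0

theorem idx_inj₁ {o o' : Op1} (h : Nat.beq o.idx o'.idx = true) : o = o' := by
  cases o <;> cases o' <;> first | rfl | cases h

theorem idx_inj₂ {o o' : Op2} (h : Nat.beq o.idx o'.idx = true) : o = o' := by
  cases o <;> cases o' <;> first | rfl | cases h

theorem idx_inj₃ {o o' : Op3} (h : Nat.beq o.idx o'.idx = true) : o = o' := by
  cases o <;> cases o' <;> first | rfl | cases h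

theorem idx_injB {o o' : OpB} (h : Nat.beq o.idx o'.idx = true) : o = o' := by
  cases o <;> cases o' <;> first | rfl | cases h

theorem _root_.UF.Op0.eq_of_beq {o o' : Op0} (h : o.beq o' = true) : o = o' := by
  cases o <;> cases o' <;> first | rfl | cases h | exact congrArg _ (Nat.eq_of_beq_eq_true h)

theorem er_eq_of_beq (t : E) : ∀ u, t.beq u = true → t.er ρ = u.er ρ := by
  induction t with
  | var n => intro u h; cases u <;> first | exact congrArg Tm.var (Nat.eq_of_beq_eq_true h) | exact absurd h Bool.false_ne_true
  | con n =>
    intro u h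
    cases u <;> first | exact congrArg ρ (Nat.eq_of_beq_eq_true h) | exact absurd h Bool.false_ne_true
  | op0 o => intro u h; cases u <;> first | exact congrArg Op0.er (Op0.eq_of_beq h) | exact absurd h Bool.false_ne_true
  | op1 o a ih =>
    intro u h
    cases u with
    | op1 o' a' =>
      change (Nat.beq o.idx o'.idx && a.beq a') = true at h
      rw [Bool.and_eq_true] at h
      rw [er, er, idx_inj₁ h.1, ih _ h.2]
    | _ => cases h
  | op2 o a b ih ih' =>
    intro u h
    cases u with
    | op2 o' a' b' =>
      change (Nat.beq o.idx o'.idx && ((o.skip || a.beq a') && b.beq b')) = true at h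
      simp only [Bool.and_eq_true, Bool.or_eq_true] at h
      obtain ⟨e, h, h'⟩ := h
      obtain rfl := idx_inj₂ e
      rw [er, er, ih' _ h']
      rcases h with h | h
      · cases o <;> first | rfl | cases h
      · rw [ih _ h]
    | _ => cases h
  | op3 o a b c ih ih' ih'' =>
    intro u h
    cases u with
    | op3 o' a' b' c' =>
      change (Nat.beq o.idx o'.idx && ((o.skip || a.beq a') && (b.beq b' && c.beq c'))) = true at h
      simp only [Bool.and_eq_true, Bool.or_eq_true] at h
      obtain ⟨e, h, h', h''⟩ := h
      obtain rfl := idx_inj₃ e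
      rw [er, er, ih' _ h', ih'' _ h'']
      rcases h with h | h
      · cases o <;> first | rfl | cases h
      · rw [ih _ h]
    | _ => cases h
  | elim a b c d ih ih' ih'' ih''' =>
    intro u h
    cases u with
    | elim a' b' c' d' =>
      change (a.beq a' && (b.beq b' && (c.beq c' && d.beq d'))) = true at h
      simp only [Bool.and_eq_true] at h
      rw [er, er, ih _ h.1, ih' _ h.2.1, ih'' _ h.2.2.1, ih''' _ h.2.2.2]
    | _ => cases h
  | bnd o a b ih ih' =>
    intro u h
    cases u with
    | bnd o' a' b' =>
      change (Nat.beq o.idx o'.idx && ((o.skip || a.beq a') && b.beq b')) = true at h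
      simp only [Bool.and_eq_true, Bool.or_eq_true] at h
      obtain ⟨e, h, h'⟩ := h
      obtain rfl := idx_injB e
      rw [er, er, ih' _ h']
      rcases h with h | h
      · cases o <;> first | rfl | cases h
      · rw [ih _ h]
    | _ => cases h

end E

open E

/-- The values of the transparent constants are as in the environment. -/
structure Env.Valid (e : Env) (ρ : ℕ → Tm) : Prop where
  closed : Closed ρ
  unfold : ∀ k v, e.unfold k = some v → ρ k = v.er ρ

variable {e : Env} {ρ : ℕ → Tm}

/-- The term is not an application. -/
def NotApp : E → Prop
  | op2 .app _ _ => False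
  | _ => True

theorem er_unfoldHead (H : e.Valid ρ) (t : E) : (unfoldHead e t).er ρ = t.er ρ := by
  induction t with
  | con k =>
    simp only [unfoldHead]
    split
    · rename_i v hv; exact (H.unfold _ _ hv).symm
    · rfl
  | op2 o f a ih _ =>
    cases o <;> first | rfl | exact congrArg (Tm.app · _) ih
  | _ => rfl

theorem er_wrec_step (H : e.Valid ρ) (C c a f : E) :
    (op2 .app (op2 .app (op2 .app c a) f) (bnd .lam (op0 .hole)
      (op3 .wrec (C.wk 1) (c.wk 1) (op2 .app (f.wk 1) (var 0))))).er ρ =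
    .app (.app (.app (c.er ρ) (a.er ρ)) (f.er ρ)) (.lam (.wrec ((C.er ρ).wk 1) ((c.er ρ).wk 1)
      (.app ((f.er ρ).wk 1) (.var 0)))) := by
  simp only [er, Op2.er, OpB.er, Op3.er, er_wk H.closed]

theorem whnf_conv (H : e.Valid ρ) : ∀ n δ t, Conv (t.er ρ) ((whnf e n δ t).er ρ) := by
  intro n
  induction n with
  | zero => intro δ t; exact .rfl _
  | succ n ih =>
    intro δ t
    show Conv _ ((whnfStep e (whnf e n) δ t).er ρ)
    cases t with
    | var | op0 | bnd => exact .rfl _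
    | con k =>
      cases δ
      · exact .rfl _
      · simp only [whnfStep, cond_true]
        split
        · rename_i v hv
          rw [er, H.unfold _ _ hv]
          exact ih _ _
        · exact .rfl _
    | op1 o p =>
      have hp := ih true p
      cases o with
      | refl => exact .rfl _
      | fst =>
        simp only [whnfStep]
        split
        · rename_i h; rw [h] at hp
          exact .trans (.trans (.fst hp) (.fst_pair _ _)) (ih _ _)
        · exact .rfl _
      | snd =>
        simp only [whnfStep]
        split
        · rename_i h; rw [h] at hp
          exact .trans (.trans (.snd hp) (.snd_pair _ _)) (ih _ _)
        · exact .rfl _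
    | op2 o f a =>
      cases o with
      | app =>
        have hf := ih δ f
        simp only [whnfStep]
        split
        · rename_i b h; rw [h] at hf
          refine .trans (.trans (.app hf (.rfl _)) ?_) (ih _ _)
          rw [er_inst H.closed]
          exact .app_lam _ _
        · exact .app hf (.rfl _)
      | ann => exact ih δ a
      | _ => exact .rfl _
    | op3 o C c p =>
      have hp := ih true p
      cases o with
      | split =>
        simp only [whnfStep]
        split
        · rename_i h; rw [h] at hp
          exact .trans (.trans (.split (.rfl _) (.rfl _) hp) (.split_pair _ _ _ _))
            (ih δ (op2 .app (op2 .app c _) _))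
        · exact .rfl _
      | oneElim =>
        simp only [whnfStep]
        split
        · rename_i h; rw [h] at hp
          exact .trans (.trans (.oneElim (.rfl _) (.rfl _) hp) (.oneElim_star _ _)) (ih _ _)
        · exact .rfl _
      | wrec =>
        simp only [whnfStep]
        split
        · rename_i h; rw [h] at hp
          refine .trans (.trans (.wrec (.rfl _) (.rfl _) hp) (.wrec_sup _ _ _ _)) ?_
          refine .trans ?_ (ih _ _)
          rw [er_wrec_step H]
          exact .rfl _
        · exact .rfl _
      | J =>
        simp only [whnfStep]
        split
        · rename_i h; rw [h] at hp
          exact .trans (.trans (.J (.rfl _) (.rfl _) hp) (.J_refl _ _ _)) (ih _ _)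
        · exact .rfl _
      | _ => exact .rfl _
    | elim C l r s =>
      have hs := ih true s
      simp only [whnfStep]
      split
      · rename_i h; rw [h] at hs
        exact .trans (.trans (.sumElim (.rfl _) (.rfl _) (.rfl _) hs) (.sumElim_inl _ _ _ _))
          (ih δ (op2 .app l _))
      · rename_i h; rw [h] at hs
        exact .trans (.trans (.sumElim (.rfl _) (.rfl _) (.rfl _) hs) (.sumElim_inr _ _ _ _))
          (ih δ (op2 .app r _))
      · exact .rfl _

/-- Stuck applications are excluded: congruence would require converting the type of the reduced
function back to a `Π`-type that is not known to be well formed. Other stuck eliminators are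
returned with their original arguments, so nothing is to be shown for them. The checker applies the
statement when the normal form is a type former; here it is also used for the constructors and
abstractions that unblock a redex. -/
theorem whnf_pres (H : e.Valid ρ) (Γ : List Tm) : ∀ n δ t, NotApp (whnf e n δ t) →
    Pres Γ (t.er ρ) ((whnf e n δ t).er ρ) := by
  intro n
  induction n with
  | zero => intro δ t _; exact .refl _
  | succ n ih =>
    intro δ t
    change NotApp (whnfStep e (whnf e n) δ t) → Pres Γ _ ((whnfStep e (whnf e n) δ t).er ρ)
    cases t with
    | var | op0 | bnd => intro _; exact .refl _
    | con k =>
      cases δ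
      · intro _; exact .refl _
      · simp only [whnfStep, cond_true]
        split
        · rename_i v hv
          rw [er, H.unfold _ _ hv]
          exact ih _ _
        · intro _; exact .refl _
    | op1 o p =>
      have hp := ih true p
      cases o with
      | refl => intro _; exact .refl _
      | fst =>
        simp only [whnfStep]
        split
        · rename_i h; rw [h] at hp
          intro h'
          exact .trans (.fst (hp trivial)) (ih _ _ h')
        · intro _; exact .refl _
      | snd =>
        simp only [whnfStep]
        split
        · rename_i h; rw [h] at hp
          intro h'
          exact .trans (.snd (hp trivial)) (ih _ _ h')
        · intro _; exact .refl _
    | op2 o f a =>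
      cases o with
      | app =>
        have hf := ih δ f
        simp only [whnfStep]
        split
        · rename_i b h; rw [h] at hf
          intro h'
          refine .trans (.app (hf trivial)) ?_
          rw [← er_inst H.closed]
          exact ih _ _ h'
        · intro h; exact h.elim
      | ann => exact ih _ _
      | _ => intro _; exact .refl _
    | op3 o C c p =>
      have hp := ih true p
      cases o with
      | split =>
        simp only [whnfStep]
        split
        · rename_i h; rw [h] at hp
          intro h'
          exact .trans (.split (hp trivial)) (ih _ _ h')
        · intro _; exact .refl _
      | oneElim =>
        simp only [whnfStep]
        split
        · rename_i h; rw [h] at hp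
          intro h'
          exact .trans (.oneElim (hp trivial)) (ih _ _ h')
        · intro _; exact .refl _
      | wrec =>
        simp only [whnfStep]
        split
        · rename_i h; rw [h] at hp
          intro h'
          refine .trans (.wrec (hp trivial)) ?_
          rw [← er_wrec_step H]
          exact ih _ _ h'
        · intro _; exact .refl _
      | J =>
        simp only [whnfStep]
        split
        · rename_i h; rw [h] at hp
          intro h'
          exact .trans (.J (hp trivial)) (ih _ _ h')
        · intro _; exact .refl _
      | _ => intro _; exact .refl _
    | elim C l r s =>
      have hs := ih true s
      simp only [whnfStep]
      split
      · rename_i h; rw [h] at hs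
        intro h'
        exact .trans (.inl (hs trivial)) (ih _ _ h')
      · rename_i h; rw [h] at hs
        intro h'
        exact .trans (.inr (hs trivial)) (ih _ _ h')
      · intro _; exact .refl _


theorem spineConv_sound {r : E → E → Bool} (hr : ∀ t u, r t u = true → Conv (t.er ρ) (u.er ρ)) :
    ∀ t u, spineConv r t u = true → Conv (t.er ρ) (u.er ρ)
  | op2 .app f a, op2 .app f' a', h => by
    simp only [spineConv, Bool.and_eq_true] at h
    exact .app (spineConv_sound hr f f' h.1) (hr _ _ h.2)
  | t, u, h => by
    unfold spineConv at h
    split at h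
    · split at h
      · rw [Bool.and_eq_true] at h
        exact .app (spineConv_sound hr _ _ h.1) (hr _ _ h.2)
      · exact absurd h Bool.false_ne_true
    · rw [er_eq_of_beq _ _ h]; exact .rfl _

theorem etaConv_sound (hρ : Closed ρ) {r : E → E → Bool}
    (hr : ∀ t u, r t u = true → Conv (t.er ρ) (u.er ρ)) (t u : E) (h : etaConv r t u = true) :
    Conv (t.er ρ) (u.er ρ) := by
  unfold etaConv at h
  split at h
  · refine .trans (.lam (hr _ _ h)) ?_
    simp only [er, Op2.er, er_wk hρ]
    exact .lam_app _
  · split at h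
    · refine .symm (.trans (.lam (hr _ _ h).symm) ?_)
      simp only [er, Op2.er, er_wk hρ]
      exact .lam_app _
    · exact absurd h Bool.false_ne_true

theorem convStruct_sound (hρ : Closed ρ) {r : E → E → Bool}
    (hr : ∀ t u, r t u = true → Conv (t.er ρ) (u.er ρ)) (t u : E) (h : convStruct r t u = true) :
    Conv (t.er ρ) (u.er ρ) := by
  unfold convStruct at h
  split at h
  · rw [Nat.eq_of_beq_eq_true h]; exact .rfl _
  · rw [Op0.eq_of_beq h]; exact .rfl _
  · rw [Bool.and_eq_true] at h
    rename_i o a o' a'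
    obtain rfl := idx_inj₁ h.1
    have := hr _ _ h.2
    cases o
    exacts [.fst this, .snd this, .refl this]
  · rename_i o a b o' a' b'
    rw [Bool.cond_false_right, Bool.and_eq_true, Bool.and_eq_true, Bool.or_eq_true] at h
    obtain ⟨e, h, h'⟩ := h
    obtain rfl := idx_inj₂ e
    have h' := hr _ _ h'
    cases o <;> simp only [Op2.skip, Bool.false_eq_true, false_or] at h
    exacts [.app (hr _ _ h) h', .sum (hr _ _ h) h', .abort (hr _ _ h) h', .inl h', .inr h', h']
  · rename_i o a b c o' a' b' c'
    simp only [Bool.and_eq_true, Bool.or_eq_true] at h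
    obtain ⟨e, h, h', h''⟩ := h
    obtain rfl := idx_inj₃ e
    have h' := hr _ _ h'
    have h'' := hr _ _ h''
    cases o <;> simp only [Op3.skip, Bool.false_eq_true, false_or] at h
    exacts [.pair h' h'', .sup h' h'', .split (hr _ _ h) h' h'', .oneElim (hr _ _ h) h' h'',
      .wrec (hr _ _ h) h' h'', .path (hr _ _ h) h' h'', .J (hr _ _ h) h' h'']
  · simp only [Bool.and_eq_true] at h
    exact .sumElim (hr _ _ h.2.1) (hr _ _ h.2.2.1) (hr _ _ h.2.2.2) (hr _ _ h.1)
  · rename_i o a b o' a' b'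
    cases e : Nat.beq o.idx o'.idx
    · rw [e] at h
      exact etaConv_sound hρ hr _ _ h
    · rw [e, cond_true, Bool.and_eq_true, Bool.or_eq_true] at h
      obtain ⟨h, h'⟩ := h
      obtain rfl := idx_injB e
      have h' := hr _ _ h'
      cases o <;> simp only [OpB.skip, Bool.false_eq_true, false_or] at h
      exacts [.pi (hr _ _ h) h', .lam h', .sig (hr _ _ h) h', .W (hr _ _ h) h']
  · exact etaConv_sound hρ hr _ _ h

theorem convHead_sound (H : e.Valid ρ) {r : E → E → Bool}
    (hr : ∀ t u, r t u = true → Conv (t.er ρ) (u.er ρ)) (t u : E)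
    (h : convHead e r t u = true) : Conv (t.er ρ) (u.er ρ) := by
  have left : r (unfoldHead e t) u = true → Conv (t.er ρ) (u.er ρ) := fun h => by
    have := hr _ _ h; rwa [er_unfoldHead H] at this
  have right : r t (unfoldHead e u) = true → Conv (t.er ρ) (u.er ρ) := fun h => by
    have := hr _ _ h; rwa [er_unfoldHead H] at this
  have both : r (unfoldHead e t) (unfoldHead e u) = true → Conv (t.er ρ) (u.er ρ) := fun h => by
    have := hr _ _ h; rwa [er_unfoldHead H, er_unfoldHead H] at this
  have eta := etaConv_sound H.closed hr t u
  unfold convHead at h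
  split at h
  · split at h
    · exact convStruct_sound H.closed hr _ _ h
    · split at h
      · exact right h
      · exact eta h
  · split at h
    · split at h
      · exact left h
      · exact eta h
    · rename_i k _ _ k' _
      cases e₁ : Nat.beq k k' <;> rw [e₁] at h
      · cases e₂ : Nat.blt k k' <;> rw [e₂] at h
        · simp only [cond_false] at h
          split at h
          · exact left h
          · exact right h
        · simp only [cond_false, cond_true] at h
          split at h
          · exact right h
          · exact left h
      · rw [cond_true, Bool.or_eq_true] at h
        rcases h with h | h
        · exact spineConv_sound hr _ _ h
        · split at h
          · exact both h
          · exact absurd h Bool.false_ne_true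

theorem conv_sound (H : e.Valid ρ) : ∀ n t u, conv e n t u = true → Conv (t.er ρ) (u.er ρ) := by
  intro n
  induction n with
  | zero => intro t u h; exact absurd h Bool.false_ne_true
  | succ n ih =>
    intro t u h
    rw [conv, Bool.or_eq_true] at h
    rcases h with h | h
    · rw [er_eq_of_beq _ _ h]; exact .rfl _
    · exact .trans (whnf_conv H _ _ _) (.trans (convHead_sound H ih _ _ h) (whnf_conv H _ _ _).symm)

end UF

namespace UF
open Tm E Res

/-! ## Soundness of type inference -/

/-- The result, if there is one, has the property. -/
def Res.All {α : Type} (P : α → Prop) : Res α → Prop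
  | ok a => P a
  | err _ _ _ _ => True

theorem Res.All.bind {α β : Type} {P : α → Prop} {Q : β → Prop} {x : Res α} {f : α → Res β}
    (h : x.All P) (h' : ∀ a, P a → (f a).All Q) : (x.bind f).All Q := by
  cases x with
  | ok a => exact h' a h
  | err => trivial

theorem Res.All.imp {α : Type} {P Q : α → Prop} {x : Res α} (h : x.All P) (h' : ∀ a, P a → Q a) :
    x.All Q := by
  cases x with
  | ok a => exact h' a h
  | err => trivial

theorem Res.All.cond {α : Type} {P : α → Prop} {b : Bool} {x y : Res α}
    (h : b = true → x.All P) (h' : b = false → y.All P) : (cond b x y).All P := by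
  cases b
  · exact h' rfl
  · exact h rfl

/-- The variables of the context have well-formed types. -/
def Wf (Γ : List Tm) : Prop := ∀ (n : ℕ) (A : Tm), Γ[n]? = some A → IsType Γ (A.wk (n + 1))

theorem Wf.nil : Wf [] := by intro n A h; simp at h

theorem Wf.cons {Γ : List Tm} {A : Tm} (h : Wf Γ) (hA : IsType Γ A) : Wf (A :: Γ) := by
  rintro (_ | n) B hB
  · obtain rfl : A = B := by simpa using hB
    exact hA.wk _
  · rw [← wk_wk]
    exact (h n B hB).wk _

/-- The checker writes instances of the body of a motive where the typing rules have applications of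
the motive. Subject reduction shows that such instances are types. -/
theorem IsType.beta {Γ : List Tm} {b a : Tm} (h : IsType Γ (.app (.lam b) a)) :
    IsType Γ (b.inst a) :=
  let ⟨l, h⟩ := h
  let ⟨_, h, c⟩ := (Pres.app (Pres.refl (.lam b))).typed _ h
  ⟨l, .conv h (.univ l) c⟩

/-- The environment is valid and its constants are well typed. -/
structure Env.Typed (e : Env) (ρ : ℕ → Tm) : Prop extends e.Valid ρ where
  typed : ∀ k d, e.find k = some d → HasType [] (ρ k) (d.ty.er ρ)
  isType : ∀ k d, e.find k = some d → IsType [] (d.ty.er ρ)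

/-- The term has the type, which is well formed and the given one, if one is given. -/
structure Good (ρ : ℕ → Tm) (Γ : List E) (g : Option E) (p : E × E) : Prop where
  typed : HasType (Γ.map (er ρ)) (p.1.er ρ) (p.2.er ρ)
  isType : IsType (Γ.map (er ρ)) (p.2.er ρ)
  eq : ∀ G, g = some G → p.2 = G

/-- The given type, if there is one, is well formed. -/
def GoodGoal (ρ : ℕ → Tm) (Γ : List E) (g : Option E) : Prop :=
  ∀ G, g = some G → IsType (Γ.map (er ρ)) (G.er ρ)

/-- Partial correctness only: errors satisfy `Res.All` trivially, and neither completeness nor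
termination without fuel is claimed. Well-formedness of the context and of the goal is an invariant
of all recursive calls. -/
def Infer.Sound (ρ : ℕ → Tm) (r : Infer) : Prop :=
  ∀ Γ t g, Wf (Γ.map (er ρ)) → GoodGoal ρ Γ g → (r Γ t g).All (Good ρ Γ g)

section

variable {ρ : ℕ → Tm} {e : Env} {n : ℕ} {r : Infer} (H : e.Typed ρ) (hr : r.Sound ρ)
  {Γ : List E} (hΓ : Wf (Γ.map (er ρ)))

theorem GoodGoal.none : GoodGoal ρ Γ none := by intro G h; cases h

theorem GoodGoal.some {G : E} (h : IsType (Γ.map (er ρ)) (G.er ρ)) : GoodGoal ρ Γ (some G) := by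
  intro G' e; cases e; exact h

theorem Good.typed_some {G : E} {p : E × E} (h : Good ρ Γ (some G) p) :
    HasType (Γ.map (er ρ)) (p.1.er ρ) (G.er ρ) := by
  rw [← h.eq G rfl]; exact h.typed

include hr hΓ in
theorem Infer.Sound.check {t G : E} (hG : IsType (Γ.map (er ρ)) (G.er ρ)) :
    (r Γ t (Option.some G)).All fun p => HasType (Γ.map (er ρ)) (p.1.er ρ) (G.er ρ) :=
  (hr Γ t _ hΓ (.some hG)).imp fun _ h => h.typed_some

include hr hΓ in
theorem Infer.Sound.synth {t : E} : (r Γ t Option.none).All fun p =>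
    HasType (Γ.map (er ρ)) (p.1.er ρ) (p.2.er ρ) ∧ IsType (Γ.map (er ρ)) (p.2.er ρ) :=
  (hr Γ t _ hΓ .none).imp fun _ h => ⟨h.typed, h.isType⟩

include H in
-- This is where subject reduction enters the checker. The type former found by reducing a type is
-- itself well formed, so inversion gives well-formed components, and the term can be converted to
-- it.
theorem whnf_isType {T P : E} (hT : IsType (Γ.map (er ρ)) (T.er ρ)) (h : whnf e n true T = P)
    (hP : NotApp P) : IsType (Γ.map (er ρ)) (P.er ρ) ∧ Conv (T.er ρ) (P.er ρ) := by
  subst h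
  obtain ⟨l, hT⟩ := hT
  obtain ⟨_, h, c⟩ := (whnf_pres H.toValid (Γ.map (er ρ)) n true T hP).typed _ hT
  exact ⟨⟨l, .conv h (.univ l) c⟩, whnf_conv H.toValid n true T⟩

include H in
theorem coerce_sound {t T : E} {g : Option E} (hg : GoodGoal ρ Γ g)
    (h : HasType (Γ.map (er ρ)) (t.er ρ) (T.er ρ)) (hT : IsType (Γ.map (er ρ)) (T.er ρ)) :
    (coerce e n Γ t T g).All (Good ρ Γ g) := by
  cases g with
  | none => exact ⟨h, hT, fun _ h => by cases h⟩
  | some G =>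
    refine .cond (fun hc => ?_) fun _ => trivial
    exact ⟨h.to (hg G rfl) (conv_sound H.toValid _ _ _ hc), hg G rfl, fun _ h => by cases h; rfl⟩

include H hr hΓ in
theorem inferTy_sound {A : E} : (inferTy e n r Γ A).All fun p =>
    HasType (Γ.map (er ρ)) (p.1.er ρ) (.univ p.2) := by
  refine .bind (hr.synth hΓ) fun p ⟨h, _⟩ => ?_
  split
  · rename_i l hl
    have := whnf_conv H.toValid n true p.2
    rw [hl] at this
    exact h.to (.univ _ l) this
  · trivial

include H hr hΓ in
theorem expected_sound {T : E} {g : Option E} (hg : GoodGoal ρ Γ g) :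
    (expected e n r Γ T g).All fun G =>
      IsType (Γ.map (er ρ)) (G.er ρ) ∧ ∀ G', g = some G' → G = G' := by
  cases g with
  | none => exact .bind (inferTy_sound H hr hΓ) fun p h => ⟨⟨_, h⟩, fun _ h => by cases h⟩
  | some G => exact ⟨hg G rfl, fun _ h => by cases h; rfl⟩

include H hr hΓ in
theorem inferLam_sound {A b : E} {g : Option E} (hg : GoodGoal ρ Γ g) :
    (inferLam e n r Γ A b g).All (Good ρ Γ g) := by
  cases g with
  | none =>
    refine .bind (inferTy_sound H hr hΓ) fun p hp => ?_
    refine .bind (hr.synth (Γ := p.1 :: Γ) (hΓ.cons ⟨_, hp⟩)) fun q ⟨hq, hq'⟩ => ?_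
    exact ⟨.lam hp hq, .pi ⟨_, hp⟩ hq', fun _ h => by cases h⟩
  | some G =>
    simp only [inferLam]
    split
    · rename_i A B hP
      obtain ⟨hP, c⟩ := whnf_isType H (hg G rfl) hP trivial
      obtain ⟨hA, hB⟩ := IsType.of_pi hP
      refine .bind (hr.check (Γ := A :: Γ) (hΓ.cons hA) hB) fun p hp => ?_
      exact ⟨(HasType.lam' hA hp).to (hg G rfl) c.symm, hg G rfl, fun _ h => by cases h; rfl⟩
    · trivial

include H hr hΓ in
theorem inferPairInfer_sound {a b : E} : (inferPairInfer r Γ a b).All (Good ρ Γ none) := by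
  refine .bind (hr.synth hΓ) fun p ⟨hp, hp'⟩ => .bind (hr.synth hΓ) fun q ⟨hq, hq'⟩ => ?_
  have h : IsType (Γ.map (er ρ)) ((bnd .sig p.2 (q.2.wk 1)).er ρ) := by
    refine .sig hp' ?_
    rw [er_wk H.closed]
    exact hq'.wk _
  have ⟨l, h'⟩ := h
  refine ⟨.pair h' hp ?_, h, fun _ h => by cases h⟩
  rw [er_wk H.closed, wk_inst]
  exact hq

include H hr hΓ in
theorem inferPair_sound {T a b : E} {g : Option E} (hg : GoodGoal ρ Γ g) :
    (inferPair e n r Γ T a b g).All (Good ρ Γ g) := by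
  refine .bind (expected_sound H hr hΓ hg) fun G ⟨hG, e⟩ => ?_
  split
  · rename_i A B hP
    obtain ⟨hP, c⟩ := whnf_isType H hG hP trivial
    obtain ⟨hA, hB⟩ := IsType.of_sig hP
    refine .bind (hr.check hΓ hA) fun p hp => ?_
    have hB' := hB.inst hp
    rw [← er_inst H.closed] at hB'
    refine .bind (hr.check hΓ hB') fun q hq => ?_
    rw [er_inst H.closed] at hq
    exact ⟨HasType.to (let ⟨_, h⟩ := hP; .pair h hp hq) hG c.symm, hG, e⟩
  · trivial

include H hr hΓ in
theorem inferInl_sound {T a : E} {g : Option E} (hg : GoodGoal ρ Γ g) :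
    (inferInl e n r Γ T a g).All (Good ρ Γ g) := by
  refine .bind (expected_sound H hr hΓ hg) fun G ⟨hG, e⟩ => ?_
  split
  · rename_i A B hP
    obtain ⟨hP, c⟩ := whnf_isType H hG hP trivial
    refine .bind (hr.check hΓ (IsType.of_sum hP).1) fun p hp => ?_
    exact ⟨HasType.to (let ⟨_, h⟩ := hP; .inl h hp) hG c.symm, hG, e⟩
  · trivial

include H hr hΓ in
theorem inferInr_sound {T a : E} {g : Option E} (hg : GoodGoal ρ Γ g) :
    (inferInr e n r Γ T a g).All (Good ρ Γ g) := by
  refine .bind (expected_sound H hr hΓ hg) fun G ⟨hG, e⟩ => ?_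
  split
  · rename_i A B hP
    obtain ⟨hP, c⟩ := whnf_isType H hG hP trivial
    refine .bind (hr.check hΓ (IsType.of_sum hP).2) fun p hp => ?_
    exact ⟨HasType.to (let ⟨_, h⟩ := hP; .inr h hp) hG c.symm, hG, e⟩
  · trivial

include H hr hΓ in
theorem inferSup_sound {T a f : E} {g : Option E} (hg : GoodGoal ρ Γ g) :
    (inferSup e n r Γ T a f g).All (Good ρ Γ g) := by
  refine .bind (expected_sound H hr hΓ hg) fun G ⟨hG, e⟩ => ?_
  split
  · rename_i A B hP
    obtain ⟨hP, c⟩ := whnf_isType H hG hP trivial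
    obtain ⟨hA, hB⟩ := IsType.of_W hP
    refine .bind (hr.check hΓ hA) fun p hp => ?_
    have hT : (bnd .pi (B.inst p.1) ((bnd .W A B).wk 1)).er ρ =
        .pi ((B.er ρ).inst (p.1.er ρ)) ((Tm.W (A.er ρ) (B.er ρ)).wk 1) := by
      rw [er, er_inst H.closed, er_wk H.closed]; rfl
    have hf : IsType (Γ.map (er ρ)) ((bnd .pi (B.inst p.1) ((bnd .W A B).wk 1)).er ρ) := by
      rw [hT]; exact .pi (hB.inst hp) (hP.wk _)
    refine .bind (hr.check hΓ hf) fun q hq => ?_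
    rw [hT] at hq
    exact ⟨HasType.to (let ⟨_, h⟩ := hP; .sup h hp hq) hG c.symm, hG, e⟩
  · trivial

include H hr hΓ in
theorem inferRefl_sound {a : E} {g : Option E} (hg : GoodGoal ρ Γ g) :
    (inferRefl e n r Γ a g).All (Good ρ Γ g) := by
  cases g with
  | none =>
    refine .bind (hr.synth hΓ) fun p ⟨hp, ⟨_, hp'⟩⟩ => ?_
    exact ⟨.refl hp' hp, ⟨_, .path hp' hp hp⟩, fun _ h => by cases h⟩
  | some G =>
    simp only [inferRefl]
    split
    · rename_i A x y hP
      obtain ⟨hP, c⟩ := whnf_isType H (hg G rfl) hP trivial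
      obtain ⟨⟨l, hA⟩, hx, hy⟩ := IsType.of_path hP
      refine .bind (P := fun p : E × E => HasType (Γ.map (er ρ)) (p.1.er ρ) (A.er ρ))
        (.cond (fun _ => hx) fun _ => hr.check hΓ ⟨l, hA⟩) fun p hp => ?_
      refine .cond (fun h => ?_) fun _ => trivial
      rw [Bool.and_eq_true] at h
      refine ⟨(HasType.refl hA hp).to (hg G rfl) (.trans (.path (.rfl _) ?_ ?_) c.symm), hg G rfl,
        fun _ h => by cases h; rfl⟩
      · exact conv_sound H.toValid _ _ _ h.1
      · exact conv_sound H.toValid _ _ _ h.2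
    · trivial

include H hr hΓ in
theorem motive_sound {D C s : E} {g : Option E} (hg : GoodGoal ρ Γ g)
    (hD : IsType (Γ.map (er ρ)) (D.er ρ)) :
    (motive e n r Γ D C s g).All fun c =>
      ∃ l, HasType ((D :: Γ).map (er ρ)) (c.er ρ) (.univ l) := by
  unfold motive
  split
  · exact .bind (inferTy_sound (Γ := D :: Γ) H hr (hΓ.cons hD)) fun p hp => ⟨_, hp⟩
  · split
    · rename_i G
      refine .cond (fun _ => .bind (inferTy_sound (Γ := D :: Γ) H hr (hΓ.cons hD))
        fun p hp => ⟨_, hp⟩) fun _ => ?_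
      show ∃ l, _
      rw [er_wk H.closed]
      exact (hg G rfl).wk _
    · trivial
  · trivial

include H in
theorem er_shift_inst (k : ℕ) (c x : E) :
    ((c.shift k 1).inst x).er ρ = ((c.er ρ).rename (liftRen (· + k))).inst (x.er ρ) := by
  rw [er_inst H.closed, er_shift_one H.closed]

/-- The type of a branch in terms of the body `c` of the motive, and in terms of the motive. -/
theorem Conv.motive (k : ℕ) (c x : Tm) :
    Conv ((c.rename (liftRen (· + k))).inst x) (.app ((Tm.lam c).wk k) x) :=
  (Conv.app_lam _ _).symm

include H hr hΓ in
-- The eliminators follow one scheme. The checker uses types in which the body of the motive is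
-- instantiated, the typing rules use the abstracted motive applied to its arguments; every branch
-- and the result are converted by `β` between the two forms, both of which are types.
theorem inferElim_sound {C x y s : E} {g : Option E} (hg : GoodGoal ρ Γ g) :
    (inferElim e n r Γ C x y s g).All (Good ρ Γ g) := by
  refine .bind (hr.synth hΓ) fun p ⟨hp, hp'⟩ => ?_
  split
  · rename_i A B hP
    obtain ⟨hP, cP⟩ := whnf_isType H hp' hP trivial
    obtain ⟨hA, hB⟩ := IsType.of_sum hP
    have ⟨lP, hP'⟩ := hP
    refine .bind (motive_sound H hr hΓ hg hP) fun c ⟨l, hc⟩ => ?_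
    have hC : HasType _ (.lam (c.er ρ)) (.pi (.sum (A.er ρ) (B.er ρ)) (.univ l)) := .lam' hP hc
    have hX : IsType (Γ.map (er ρ)) (.pi (A.er ρ)
        (.app ((Tm.lam (c.er ρ)).wk 1) (.inl (.var 0)))) :=
      .pi hA (.app_motive (hC.wk_motive _) (.inl (hP'.wk _) (.var rfl)))
    have hY : IsType (Γ.map (er ρ)) (.pi (B.er ρ)
        (.app ((Tm.lam (c.er ρ)).wk 1) (.inr (.var 0)))) :=
      .pi hB (.app_motive (hC.wk_motive _) (.inr (hP'.wk _) (.var rfl)))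
    refine .bind (hr.check hΓ ?_) fun x hx => .bind (hr.check hΓ ?_) fun y hy => ?_
    · rw [er, er_shift_inst H]
      exact .pi hA hX.of_pi.2.beta
    · rw [er, er_shift_inst H]
      exact .pi hB hY.of_pi.2.beta
    rw [er, er_shift_inst H] at hx hy
    have hs := hp.to hP cP
    refine coerce_sound H hg ?_ ?_ <;> rw [er_inst H.closed]
    · exact (HasType.sumElim hC (hx.to hX (.pi (.rfl _) (.motive 1 _ _)))
        (hy.to hY (.pi (.rfl _) (.motive 1 _ _))) hs).to
        (.inst ⟨l, hc⟩ hs) (.app_lam _ _)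
    · exact .inst ⟨l, hc⟩ hs
  · trivial

include H hr hΓ in
theorem inferSplit_sound {C x s : E} {g : Option E} (hg : GoodGoal ρ Γ g) :
    (inferSplit e n r Γ C x s g).All (Good ρ Γ g) := by
  refine .bind (hr.synth hΓ) fun p ⟨hp, hp'⟩ => ?_
  split
  · rename_i A B hP
    obtain ⟨hP, cP⟩ := whnf_isType H hp' hP trivial
    obtain ⟨hA, hB⟩ := IsType.of_sig hP
    refine .bind (motive_sound H hr hΓ hg hP) fun c ⟨l, hc⟩ => ?_
    have hC : HasType _ (.lam (c.er ρ)) (.pi (.sig (A.er ρ) (B.er ρ)) (.univ l)) := .lam' hP hc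
    have hX := IsType.split_branch hP hC
    refine .bind (hr.check hΓ ?_) fun x hx => ?_
    · rw [er, er, er_shift_inst H]
      exact .pi hA (.pi hB hX.of_pi.2.of_pi.2.beta)
    rw [er, er, er_shift_inst H] at hx
    have hs := hp.to hP cP
    refine coerce_sound H hg ?_ ?_ <;> rw [er_inst H.closed]
    · exact (HasType.split hC (hx.to hX (.pi (.rfl _) (.pi (.rfl _) (.motive 2 _ _)))) hs).to
        (.inst ⟨l, hc⟩ hs) (.app_lam _ _)
    · exact .inst ⟨l, hc⟩ hs
  · trivial

include H hr hΓ in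
theorem inferOneElim_sound {C x s : E} {g : Option E} (hg : GoodGoal ρ Γ g) :
    (inferOneElim e n r Γ C x s g).All (Good ρ Γ g) := by
  have h1 : IsType (Γ.map (er ρ)) ((op0 .one).er ρ) := ⟨_, .one⟩
  refine .bind (hr.check hΓ h1) fun p hs => ?_
  refine .bind (motive_sound H hr hΓ hg h1) fun c ⟨l, hc⟩ => ?_
  have hC : HasType _ (.lam (c.er ρ)) (.pi .one (.univ l)) := .lam' h1 hc
  have hX : IsType (Γ.map (er ρ)) ((c.er ρ).inst .star) := .inst ⟨l, hc⟩ .star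
  refine .bind (hr.check hΓ ?_) fun x hx => ?_
  · rw [er_inst H.closed]; exact hX
  rw [er_inst H.closed] at hx
  refine coerce_sound H hg ?_ ?_ <;> rw [er_inst H.closed]
  · exact (HasType.oneElim hC (hx.to (.app_motive hC .star) (Conv.app_lam _ _).symm) hs).to
      (.inst ⟨l, hc⟩ hs) (.app_lam _ _)
  · exact .inst ⟨l, hc⟩ hs


include H hr hΓ in
theorem inferWrec_sound {C x s : E} {g : Option E} (hg : GoodGoal ρ Γ g) :
    (inferWrec e n r Γ C x s g).All (Good ρ Γ g) := by
  refine .bind (hr.synth hΓ) fun p ⟨hp, hp'⟩ => ?_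
  split
  · rename_i A B hP
    obtain ⟨hP, cP⟩ := whnf_isType H hp' hP trivial
    obtain ⟨hA, hB⟩ := IsType.of_W hP
    refine .bind (motive_sound H hr hΓ hg hP) fun c ⟨l, hc⟩ => ?_
    have hC : HasType _ (.lam (c.er ρ)) (.pi (.W (A.er ρ) (B.er ρ)) (.univ l)) := .lam' hP hc
    have hX := IsType.wrec_branch hP hC
    have hb : (wrecBranch A B c).er ρ = .pi (A.er ρ)
        (.pi (.pi (B.er ρ) ((Tm.W (A.er ρ) (B.er ρ)).wk 2))
          (.pi (.pi ((B.er ρ).wk 1)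
              (((c.er ρ).rename (liftRen (· + 3))).inst (.app (.var 1) (.var 0))))
            (((c.er ρ).rename (liftRen (· + 3))).inst (.sup (.var 2) (.var 1))))) := by
      simp only [wrecBranch, er, OpB.er, er_wk H.closed, er_shift_inst H]
      rfl
    have h₁ := hX.of_pi.2.of_pi
    have h₂ := h₁.2.of_pi
    have h₃ := h₂.1.of_pi
    have h₄ : IsType (Γ.map (er ρ)) ((wrecBranch A B c).er ρ) := by
      rw [hb]
      refine .pi hA (.pi h₁.1 (.pi (.pi h₃.1 h₃.2.beta) ?_))
      exact (h₂.2.conv_ctx h₂.1 (.pi (.rfl _) (.app_lam _ _))).beta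
    refine .bind (hr.check hΓ h₄) fun x hx => ?_
    rw [hb] at hx
    have hs := hp.to hP cP
    refine coerce_sound H hg ?_ ?_ <;> rw [er_inst H.closed]
    · exact (HasType.wrec hC (hx.to hX (.pi (.rfl _) (.pi (.rfl _) (.pi (.pi (.rfl _)
        (.motive 3 _ _)) (.motive 3 _ _))))) hs).to (.inst ⟨l, hc⟩ hs) (.app_lam _ _)
    · exact .inst ⟨l, hc⟩ hs
  · trivial

include H in
theorem er_inst₂ (c a p : E) : (inst₂ c a p).er ρ =
    ((c.er ρ).subst (liftSub (instVar (a.er ρ)))).inst (p.er ρ) := by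
  rw [inst₂, er_inst H.closed, er_inst H.closed, er_wk H.closed, Tm.inst, inst_subst]
  exact congrArg _ (wk_inst _ _)

theorem IsType.path_fibration {Γ : List Tm} {A a : Tm} (hA : IsType Γ A) (ha : HasType Γ a A) :
    IsType (A :: Γ) (.path (A.wk 1) (a.wk 1) (.var 0)) :=
  let ⟨_, h⟩ := hA
  ⟨_, .path (h.wk A) (ha.wk A) (.var rfl)⟩

include H hr hΓ in
theorem motiveJ_sound {A a b C p : E} {g : Option E} (hg : GoodGoal ρ Γ g)
    (hA : IsType (Γ.map (er ρ)) (A.er ρ)) (ha : HasType (Γ.map (er ρ)) (a.er ρ) (A.er ρ)) :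
    (motiveJ e n r Γ A a b C p g).All fun c => ∃ l,
      HasType (.path ((A.er ρ).wk 1) ((a.er ρ).wk 1) (.var 0) :: A.er ρ :: Γ.map (er ρ))
        (c.er ρ) (.univ l) := by
  have hΔ : (op3 .path (A.wk 1) (a.wk 1) (var 0) :: A :: Γ).map (er ρ) =
      .path ((A.er ρ).wk 1) ((a.er ρ).wk 1) (.var 0) :: A.er ρ :: Γ.map (er ρ) := by
    simp only [List.map_cons, er, Op3.er, er_wk H.closed]
  have hW := (hΓ.cons hA).cons (.path_fibration hA ha)
  rw [← hΔ] at hW ⊢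
  unfold motiveJ
  split
  · exact .bind (inferTy_sound H hr hW) fun p hp => ⟨_, hp⟩
  · split
    · rename_i G
      refine .cond (fun _ => .bind (inferTy_sound H hr hW) fun p hp => ⟨_, hp⟩) fun _ => ?_
      show ∃ l, _
      rw [er_wk H.closed, wk_two]
      exact ((hg G rfl).wk _).wk _
    · trivial
  · trivial

theorem IsType.inst₂ {Γ : List Tm} {A a b c p : Tm}
    (hc : IsType (.path (A.wk 1) (a.wk 1) (.var 0) :: A :: Γ) c) (hb : HasType Γ b A)
    (hp : HasType Γ p (.path A a b)) : IsType Γ ((c.subst (liftSub (instVar b))).inst p) := by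
  obtain ⟨l, hc⟩ := hc
  have := hc.subst ((Sub.inst hb).lift (.path (A.wk 1) (a.wk 1) (.var 0)))
  refine ⟨l, HasType.inst (B := .univ l) this ?_⟩
  show HasType Γ p (.path ((A.wk 1).inst b) ((a.wk 1).inst b) b)
  rwa [wk_inst, wk_inst]

theorem Conv.inst₂ (c b p : Tm) :
    Conv (.app (.app (.lam (.lam c)) b) p) ((c.subst (liftSub (instVar b))).inst p) :=
  .trans (.app (.app_lam _ _) (.rfl _)) (.app_lam _ _)

include H hr hΓ in
theorem inferJ_sound {C x p : E} {g : Option E} (hg : GoodGoal ρ Γ g) :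
    (inferJ e n r Γ C x p g).All (Good ρ Γ g) := by
  refine .bind (hr.synth hΓ) fun p ⟨hp, hp'⟩ => ?_
  split
  · rename_i A a b hP
    obtain ⟨hP, cP⟩ := whnf_isType H hp' hP trivial
    obtain ⟨hA, ha, hb⟩ := IsType.of_path hP
    refine .bind (motiveJ_sound H hr hΓ hg hA ha) fun c ⟨l, hc⟩ => ?_
    have hF := IsType.path_fibration hA ha
    have hC : HasType (Γ.map (er ρ)) (.lam (.lam (c.er ρ))) (.pi (A.er ρ)
        (.pi (.path ((A.er ρ).wk 1) ((a.er ρ).wk 1) (.var 0)) (.univ l))) :=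
      .lam' hA (.lam' hF hc)
    obtain ⟨lA, hA'⟩ := hA
    have hr' := HasType.refl hA' ha
    have hX := IsType.inst₂ ⟨l, hc⟩ ha hr'
    refine .bind (hr.check hΓ ?_) fun x hx => ?_
    · rw [er_inst₂ H]; exact hX
    rw [er_inst₂ H] at hx
    have hs := hp.to hP cP
    have hT := IsType.inst₂ ⟨l, hc⟩ hb hs
    have hD : IsType (Γ.map (er ρ))
        (.app (.app (.lam (.lam (c.er ρ))) (a.er ρ)) (.refl (a.er ρ))) := by
      refine ⟨l, .app' (B := .univ l) (.app' hC ha ?_) hr' rfl⟩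
      show Tm.pi (.path (((A.er ρ).wk 1).inst _) (((a.er ρ).wk 1).inst _) _) _ = _
      rw [wk_inst, wk_inst]
      rfl
    refine coerce_sound H hg ?_ ?_ <;> rw [er_inst₂ H]
    · simp only [er, Op3.er, OpB.er]
      exact (HasType.J hC (hx.to hD (.symm (.inst₂ _ _ _))) hs).to hT (.inst₂ _ _ _)
    · exact hT
  · trivial

/-- An elaborated argument has its type. -/
def Arg.Good (ρ : ℕ → Tm) (Γ : List E) : Arg → Prop
  | .raw _ => True
  | .done a T => HasType (Γ.map (er ρ)) (a.er ρ) (T.er ρ)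

include H hr hΓ in
theorem inferSpine_sound : ∀ (as : List Arg) (f T : E), (∀ a ∈ as, a.Good ρ Γ) →
    HasType (Γ.map (er ρ)) (f.er ρ) (T.er ρ) → IsType (Γ.map (er ρ)) (T.er ρ) →
    (inferSpine e n r Γ as f T).All fun q =>
      HasType (Γ.map (er ρ)) (q.1.er ρ) (q.2.er ρ) ∧ IsType (Γ.map (er ρ)) (q.2.er ρ) := by
  intro as
  induction as with
  | nil => intro f T _ h h'; exact ⟨h, h'⟩
  | cons a as ih =>
    intro f T ha h h'
    simp only [inferSpine]
    split
    · rename_i A B hP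
      obtain ⟨hP, c⟩ := whnf_isType H h' hP trivial
      obtain ⟨hA, hB⟩ := IsType.of_pi hP
      refine .bind (P := fun a => HasType (Γ.map (er ρ)) (a.er ρ) (A.er ρ)) ?_ fun x hx => ?_
      · cases a with
        | raw a => exact .bind (hr.check hΓ hA) fun p hp => hp
        | done a T' =>
          have := ha _ List.mem_cons_self
          exact .cond (fun hc => this.to hA (conv_sound H.toValid _ _ _ hc)) fun _ => trivial
      · refine ih _ _ (fun a h => ha a (List.mem_cons_of_mem _ h)) ?_ ?_ <;> rw [er_inst H.closed]
        · exact .app (h.to hP c) hx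
        · exact hB.inst hx
    · trivial

theorem good_map_raw (as : List E) : ∀ a ∈ as.map Arg.raw, a.Good ρ Γ := by
  intro a h
  obtain ⟨b, -, rfl⟩ := List.mem_map.1 h
  trivial

include hr hΓ in
-- The substitution found by matching is arbitrary here. An argument is marked as elaborated only
-- together with a type that sound inference has returned for it.
theorem good_solveArgs : ∀ (as : List E) (i : ℕ) (Δ : List E) (σ : Sol),
    ∀ a ∈ (solveArgs e n r Γ i as Δ σ).1, a.Good ρ Γ := by
  intro as
  induction as with
  | nil => intro i Δ σ; exact good_map_raw []
  | cons a as ih =>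
    intro i Δ σ
    cases Δ with
    | nil => exact good_map_raw (a :: as)
    | cons A Δ =>
      unfold solveArgs
      cases isHole a || !unsolved σ A
      · have h := hr.synth hΓ (t := a)
        rw [cond_false]
        split
        · rename_i p hp
          rw [hp] at h
          rintro b (_ | ⟨_, hb⟩)
          · exact h.1
          · exact ih _ _ _ b hb
        · rintro b (_ | ⟨_, hb⟩)
          · trivial
          · exact ih _ _ _ b hb
      · rintro b (_ | ⟨_, hb⟩)
        · trivial
        · exact ih _ _ _ b hb

theorem good_fillHoles (σ : Sol) : ∀ (as : List Arg) (i : ℕ), (∀ a ∈ as, a.Good ρ Γ) →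
    ∀ a ∈ fillHoles σ i as, a.Good ρ Γ := by
  intro as
  induction as with
  | nil => intro i _ a h; cases h
  | cons a as ih =>
    rintro i h b (_ | ⟨_, hb⟩)
    · have := h a List.mem_cons_self
      split
      · split <;> trivial
      · exact this
    · exact ih _ (fun a h' => h a (List.mem_cons_of_mem _ h')) b hb

include hr hΓ in
theorem good_prepare (T : E) (as : List E) (g : Option E) :
    ∀ a ∈ prepare e n r Γ T as g, a.Good ρ Γ := by
  unfold prepare
  cases hasHole as
  · exact good_map_raw as
  · exact good_fillHoles _ _ _ (good_solveArgs hr hΓ _ _ _ _)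

include H hr hΓ in
theorem inferApp_sound {f a : E} {g : Option E} (hg : GoodGoal ρ Γ g) :
    (inferApp e n r Γ f a g).All (Good ρ Γ g) := by
  unfold inferApp
  refine .bind (hr.synth hΓ) fun p ⟨hp, hp'⟩ => ?_
  refine .bind (inferSpine_sound H hr hΓ _ _ _ (good_prepare hr hΓ _ _ _) hp hp') fun q ⟨hq, hq'⟩ => ?_
  exact coerce_sound H hg hq hq'

include H hr hΓ in
theorem inferRedex_sound {b a : E} {g : Option E} (hg : GoodGoal ρ Γ g) :
    (inferRedex e n r Γ b a g).All (Good ρ Γ g) := by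
  refine .bind (hr.synth hΓ) fun p ⟨hp, hp'⟩ => ?_
  refine .bind (hr.synth (Γ := p.2 :: Γ) (hΓ.cons hp')) fun q ⟨hq, hq'⟩ => ?_
  refine coerce_sound H hg ?_ ?_ <;> rw [er_inst H.closed]
  · exact .app (.lam' hp' hq) hp
  · exact hq'.inst hp

include H hr hΓ in
theorem inferFst_sound {p : E} {g : Option E} (hg : GoodGoal ρ Γ g) :
    (inferFst e n r Γ p g).All (Good ρ Γ g) := by
  refine .bind (hr.synth hΓ) fun p ⟨hp, hp'⟩ => ?_
  split
  · rename_i A B hP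
    obtain ⟨hP, c⟩ := whnf_isType H hp' hP trivial
    exact coerce_sound H hg (.fst (hp.to hP c)) (IsType.of_sig hP).1
  · trivial

include H hr hΓ in
theorem inferSnd_sound {p : E} {g : Option E} (hg : GoodGoal ρ Γ g) :
    (inferSnd e n r Γ p g).All (Good ρ Γ g) := by
  refine .bind (hr.synth hΓ) fun p ⟨hp, hp'⟩ => ?_
  split
  · rename_i A B hP
    obtain ⟨hP, c⟩ := whnf_isType H hp' hP trivial
    have hp := hp.to hP c
    refine coerce_sound H hg ?_ ?_ <;> rw [er_inst H.closed]
    · exact .snd hp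
    · exact (IsType.of_sig hP).2.inst (.fst hp)
  · trivial

theorem maxLevel_eq (i j : ℕ) : maxLevel i j = max i j := by
  unfold maxLevel
  cases h : Nat.ble i j
  · have : ¬ i ≤ j := by rw [← Nat.ble_eq, h]; exact Bool.false_ne_true
    rw [cond_false]; omega
  · have : i ≤ j := Nat.ble_eq ▸ h
    rw [cond_true]; omega

include H hr hΓ in
theorem inferBind_sound {o : OpB} (ho : o ≠ .lam) {A B : E} {g : Option E} (hg : GoodGoal ρ Γ g) :
    (inferBind e n r Γ o A B g).All (Good ρ Γ g) := by
  refine .bind (inferTy_sound H hr hΓ) fun p hp => ?_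
  refine .bind (inferTy_sound (Γ := p.1 :: Γ) H hr (hΓ.cons ⟨_, hp⟩)) fun q hq => ?_
  refine coerce_sound H hg ?_ (.univ _ _)
  rw [maxLevel_eq]
  cases o
  exacts [.pi hp hq, (ho rfl).elim, .sig hp hq, .W hp hq]

include H hr hΓ in
theorem inferSum_sound {A B : E} {g : Option E} (hg : GoodGoal ρ Γ g) :
    (inferSum e n r Γ A B g).All (Good ρ Γ g) := by
  refine .bind (inferTy_sound H hr hΓ) fun p hp => ?_
  refine .bind (inferTy_sound H hr hΓ) fun q hq => ?_
  refine coerce_sound H hg ?_ (.univ _ _)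
  rw [maxLevel_eq]
  exact .sum hp hq

include H hr hΓ in
theorem inferPath_sound {A a b : E} {g : Option E} (hg : GoodGoal ρ Γ g) :
    (inferPath e n r Γ A a b g).All (Good ρ Γ g) := by
  refine .bind (P := fun p : E × ℕ => HasType (Γ.map (er ρ)) (p.1.er ρ) (.univ p.2))
    (.cond (fun _ => .bind (hr.synth hΓ) fun _ _ => inferTy_sound H hr hΓ)
      fun _ => inferTy_sound H hr hΓ) fun p hp => ?_
  refine .bind (hr.check hΓ ⟨_, hp⟩) fun x hx => .bind (hr.check hΓ ⟨_, hp⟩) fun y hy => ?_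
  exact coerce_sound H hg (.path hp hx hy) (.univ _ _)

include H hr hΓ in
theorem inferAbort_sound {C x : E} {g : Option E} (hg : GoodGoal ρ Γ g) :
    (inferAbort e n r Γ C x g).All (Good ρ Γ g) := by
  refine .bind (P := fun C => IsType (Γ.map (er ρ)) (C.er ρ))
    (.cond (fun _ => (expected_sound H hr hΓ hg).imp fun _ h => h.1)
      fun _ => .bind (inferTy_sound H hr hΓ) fun _ h => ⟨_, h⟩) fun C hC => ?_
  refine .bind (hr.check hΓ ⟨_, .zero⟩) fun x hx => ?_
  exact coerce_sound H hg (let ⟨_, h⟩ := hC; .abort h hx) hC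

include H hr hΓ in
theorem inferAnn_sound {T a : E} {g : Option E} (hg : GoodGoal ρ Γ g) :
    (inferAnn e n r Γ T a g).All (Good ρ Γ g) :=
  .bind (inferTy_sound H hr hΓ) fun _ hp => .bind (hr.check hΓ ⟨_, hp⟩) fun _ hq =>
    coerce_sound H hg hq ⟨_, hp⟩

include H in
theorem inferOp0_sound {o : Op0} {g : Option E} (hg : GoodGoal ρ Γ g) :
    (inferOp0 e n Γ o g).All (Good ρ Γ g) := by
  cases o with
  | univ l => exact coerce_sound H hg (.univ l) (.univ _ _)
  | zero => exact coerce_sound H hg .zero (.univ _ _)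
  | one => exact coerce_sound H hg .one (.univ _ _)
  | star => exact coerce_sound H hg .star ⟨_, .one⟩
  | _ => trivial

include H hΓ in
theorem inferVar_sound {k : ℕ} {g : Option E} (hg : GoodGoal ρ Γ g) :
    (inferVar e n Γ k g).All (Good ρ Γ g) := by
  unfold inferVar
  split
  · rename_i A h
    have h : (Γ.map (er ρ))[k]? = some (A.er ρ) := by rw [List.getElem?_map, h]; rfl
    refine coerce_sound H hg ?_ ?_ <;> rw [er_wk H.closed]
    · exact .var h
    · exact hΓ _ _ h
  · trivial

include H in
theorem inferCon_sound {k : ℕ} {g : Option E} (hg : GoodGoal ρ Γ g) :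
    (inferCon e n Γ k g).All (Good ρ Γ g) := by
  unfold inferCon
  split
  · rename_i d h
    exact coerce_sound H hg ((H.typed _ _ h).weaken_nil _)
      (let ⟨l, h⟩ := H.isType _ _ h; ⟨l, h.weaken_nil _⟩)
  · trivial

include H hr in
theorem inferStep_sound : Infer.Sound ρ (inferStep e n r) := by
  intro Γ t g hΓ hg
  cases t with
  | var k => exact inferVar_sound H hΓ hg
  | con k => exact inferCon_sound H hg
  | op0 o => exact inferOp0_sound H hg
  | op1 o a =>
    cases o with
    | fst => exact inferFst_sound H hr hΓ hg
    | snd => exact inferSnd_sound H hr hΓ hg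
    | refl => exact inferRefl_sound H hr hΓ hg
  | op2 o a b =>
    cases o with
    | app =>
      show (inferOp2 e n r Γ .app a b g).All _
      simp only [inferOp2]
      split
      · exact inferRedex_sound H hr hΓ hg
      · exact inferApp_sound H hr hΓ hg
    | sum => exact inferSum_sound H hr hΓ hg
    | abort => exact inferAbort_sound H hr hΓ hg
    | inl => exact inferInl_sound H hr hΓ hg
    | inr => exact inferInr_sound H hr hΓ hg
    | ann => exact inferAnn_sound H hr hΓ hg
  | op3 o a b c =>
    cases o with
    | pair =>
      refine .cond (fun _ => ?_) fun _ => inferPair_sound H hr hΓ hg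
      cases g with
      | none => exact inferPairInfer_sound H hr hΓ
      | some G => exact inferPair_sound H hr hΓ hg
    | sup =>
      refine .cond (fun _ => ?_) fun _ => inferSup_sound H hr hΓ hg
      cases g with
      | none =>
        exact .bind (P := fun _ => True) (by cases treeType e n r Γ c <;> trivial)
          fun _ _ => inferSup_sound H hr hΓ hg
      | some G => exact inferSup_sound H hr hΓ hg
    | split => exact inferSplit_sound H hr hΓ hg
    | oneElim => exact inferOneElim_sound H hr hΓ hg
    | wrec => exact inferWrec_sound H hr hΓ hg
    | path => exact inferPath_sound H hr hΓ hg
    | J => exact inferJ_sound H hr hΓ hg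
  | elim a b c d => exact inferElim_sound H hr hΓ hg
  | bnd o a b =>
    cases o with
    | lam => exact inferLam_sound H hr hΓ hg
    | pi => exact inferBind_sound H hr hΓ (by rintro ⟨⟩) hg
    | sig => exact inferBind_sound H hr hΓ (by rintro ⟨⟩) hg
    | W => exact inferBind_sound H hr hΓ (by rintro ⟨⟩) hg

end

theorem infer_sound {e : Env} {ρ : ℕ → Tm} (H : e.Typed ρ) (n : ℕ) :
    Infer.Sound ρ (infer e n) := by
  induction n with
  | zero => intro Γ t g _ _; trivial
  | succ n ih => exact inferStep_sound H ih

end UF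

/-! ### The definitions of the statement as typed declarations of numbered constants. -/

namespace UF.Src
open E

/-- A term that may be placed under any number of binders. -/
structure Bd : Type where
  run : ℕ → E

/-- The variable that was bound when the context had length `n`. -/
def bvar (n : ℕ) : Bd := ⟨fun m => var (Nat.sub (Nat.sub m 1) n)⟩
def app (f a : Bd) : Bd := ⟨fun n => op2 .app (f.run n) (a.run n)⟩

/-- The declaration of a constant; the value of a hidden one is not used after the declaration. -/
structure Decl : Type where
  id : ℕ
  hidden : Bool
  ty : Bd
  val : Bd

/-- A definition. -/
def Decl.defn (k : ℕ) (ty val : Bd) : Decl := ⟨k, false, ty, val⟩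
/-- A theorem. -/
def Decl.thm (k : ℕ) (ty val : Bd) : Decl := ⟨k, true, ty, val⟩
def Decl.toBd (d : Decl) : Bd := ⟨fun _ => con d.id⟩
def Decl.entry (d : Decl) : Entry := ⟨d.id, d.ty.run 0, cond d.hidden none (some (d.val.run 0))⟩

instance : Coe Decl Bd := ⟨Decl.toBd⟩
instance : CoeFun Bd (fun _ => Bd → Bd) := ⟨app⟩
instance : CoeFun Decl (fun _ => Bd → Bd) := ⟨fun d => app d.toBd⟩

def hole : Bd := ⟨fun _ => op0 .hole⟩
def ann (T a : Bd) : Bd := ⟨fun n => op2 .ann (T.run n) (a.run n)⟩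
def univ (l : ℕ) : Bd := ⟨fun _ => op0 (.univ l)⟩
def pi (A : Bd) (B : Bd → Bd) : Bd := ⟨fun n => bnd .pi (A.run n) ((B (bvar n)).run (Nat.succ n))⟩
def lam (b : Bd → Bd) : Bd := ⟨fun n => bnd .lam (op0 .hole) ((b (bvar n)).run (Nat.succ n))⟩
def sig (A : Bd) (B : Bd → Bd) : Bd := ⟨fun n => bnd .sig (A.run n) ((B (bvar n)).run (Nat.succ n))⟩
def pair (a b : Bd) : Bd := ⟨fun n => op3 .pair (op0 .hole) (a.run n) (b.run n)⟩
def fst (p : Bd) : Bd := ⟨fun n => op1 .fst (p.run n)⟩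
def snd (p : Bd) : Bd := ⟨fun n => op1 .snd (p.run n)⟩
def split (C c p : Bd) : Bd := ⟨fun n => op3 .split (C.run n) (c.run n) (p.run n)⟩
def zero : Bd := ⟨fun _ => op0 .zero⟩
def abort (C e : Bd) : Bd := ⟨fun n => op2 .abort (C.run n) (e.run n)⟩
def one : Bd := ⟨fun _ => op0 .one⟩
def star : Bd := ⟨fun _ => op0 .star⟩
def oneElim (C c u : Bd) : Bd := ⟨fun n => op3 .oneElim (C.run n) (c.run n) (u.run n)⟩
def sum (A B : Bd) : Bd := ⟨fun n => op2 .sum (A.run n) (B.run n)⟩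
def inl (a : Bd) : Bd := ⟨fun n => op2 .inl (op0 .hole) (a.run n)⟩
def inr (b : Bd) : Bd := ⟨fun n => op2 .inr (op0 .hole) (b.run n)⟩
def sumElim (C l r s : Bd) : Bd := ⟨fun n => elim (C.run n) (l.run n) (r.run n) (s.run n)⟩
def W (A : Bd) (B : Bd → Bd) : Bd := ⟨fun n => bnd .W (A.run n) ((B (bvar n)).run (Nat.succ n))⟩
def sup (a f : Bd) : Bd := ⟨fun n => op3 .sup (op0 .hole) (a.run n) (f.run n)⟩
def wrec (C c w : Bd) : Bd := ⟨fun n => op3 .wrec (C.run n) (c.run n) (w.run n)⟩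
def path (A a b : Bd) : Bd := ⟨fun n => op3 .path (A.run n) (a.run n) (b.run n)⟩
def refl (a : Bd) : Bd := ⟨fun n => op1 .refl (a.run n)⟩
def J (C c p : Bd) : Bd := ⟨fun n => op3 .J (C.run n) (c.run n) (p.run n)⟩

def lam₂ (b : Bd → Bd → Bd) : Bd := lam fun x => lam fun y => b x y
def lam₃ (b : Bd → Bd → Bd → Bd) : Bd := lam fun x => lam₂ fun y z => b x y z
def lam₄ (b : Bd → Bd → Bd → Bd → Bd) : Bd := lam fun x => lam₃ fun y z w => b x y z w

/-- `A → B` -/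
def arr (A B : Bd) : Bd := pi A fun _ => B
/-- `A × B` -/
def prod (A B : Bd) : Bd := sig A fun _ => B

infixr:60 " ⇀ " => arr
infixr:65 " ⊡ " => prod

/-! ### Source of paths, equivalences and embeddings. -/

def neg (A : Bd) : Bd := A ⇀ zero
def dec (A : Bd) : Bd := sum A (neg A)

/-- For `p : a = b`, transport `B a → B b`. -/
def transport (B : Bd → Bd) (p x : Bd) : Bd := J (lam₂ fun y _ => B y) x p
/-- For `p : a = b` in `A`, the path `b = a`. -/
def symm (A a p : Bd) : Bd := J (lam₂ fun y _ => path A y a) (refl a) p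
/-- For `p : a = b` and `q : b = c` in `A`, the path `a = c`. -/
def trans (A a p q : Bd) : Bd := J (lam₂ fun y _ => path A a y) p q
/-- For `f` into `B` and `p : a = b`, the path `f a = f b`. -/
def cong (B : Bd) (f : Bd → Bd) (a p : Bd) : Bd :=
  J (lam₂ fun y _ => path B (f a) (f y)) (refl (f a)) p

/-- `λ A` -/
def isContr : Decl := .defn 0
  (univ 0 ⇀ univ 0) <|
  lam fun A => sig A fun a => pi A fun b => path A a b

/-- `λ A` -/
def isProp : Decl := .defn 1
  (univ 0 ⇀ univ 0) <|
  lam fun A => pi A fun a => pi A fun b => path A a b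

/-- `λ A B f y` -/
def fiber : Decl := .defn 2
  (pi (univ 0) fun A => pi (univ 0) fun B => (A ⇀ B) ⇀ B ⇀ univ 0) <|
  lam₄ fun A B f y => sig A fun x => path B (f x) y

/-- `λ A B f` -/
def isEquiv : Decl := .defn 3
  (pi (univ 0) fun A => pi (univ 0) fun B => (A ⇀ B) ⇀ univ 0) <|
  lam₃ fun A B f => pi B fun y => isContr (fiber A B f y)

/-- `λ A B` -/
def equiv : Decl := .defn 4
  (univ 0 ⇀ univ 0 ⇀ univ 0) <|
  lam₂ fun A B => sig (A ⇀ B) fun f => isEquiv A B f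

/-- `λ A B f` -/
def isEmbedding : Decl := .defn 5
  (pi (univ 0) fun A => pi (univ 0) fun B => (A ⇀ B) ⇀ univ 0) <|
  lam₃ fun A B f => pi B fun y => isProp (fiber A B f y)

/-- `λ A`, of type `A ≃ A` -/
def idEquiv : Decl := .defn 6
  (pi (univ 0) fun A => equiv A A) <|
  lam fun A =>
  pair (lam fun x => x) <| lam fun b =>
    pair (pair b (refl b)) <| lam fun z =>
      split (lam fun z => path (fiber A A (lam fun x => x) b) (pair b (refl b)) z)
        (lam₂ fun x p =>
          J (lam₂ fun y q => path (sig A fun x' => path A x' y) (pair y (refl y)) (pair x q))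
            (refl (pair x (refl x))) p)
        z

/-- `λ A B f g p`, the canonical map from `f = g` to `Π x, f x = g x` -/
def happly : Decl := .defn 7
  (pi (univ 0) fun A => pi (A ⇀ univ 0) fun B => pi (pi A fun x => B x) fun f =>
    pi (pi A fun x => B x) fun g => path (pi A fun x => B x) f g ⇀ pi A fun x => path (B x) (f x) (g x)) <|
  lam fun A => lam₄ fun B f _ p =>
  J (lam₂ fun g _ => pi A fun x => path (B x) (f x) (g x)) (lam fun x => refl (f x)) p

/-! ### Source of isolated points, their removal, and grafting. -/

/-- `λ A a` -/
def isIsolated : Decl := .defn 8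
  (pi (univ 0) fun A => A ⇀ univ 0) <|
  lam₂ fun A a => pi A fun b => dec (path A a b)

/-- `λ A` -/
def isolated : Decl := .defn 9
  (univ 0 ⇀ univ 0) <|
  lam fun A => sig A fun a => isIsolated A a

/-- `λ A a`, the type `A \ a` -/
def remove : Decl := .defn 10
  (pi (univ 0) fun A => A ⇀ univ 0) <|
  lam₂ fun A a => sig A fun b => neg (path A a b)

/-- For `r : inl a = x` in `A + B`, an element of `a = a'` if `x` is `inl a'`, and of the empty
type if `x` is `inr b`. -/
def inlCode (A a r : Bd) : Bd :=
  J (lam₂ fun x _ => sumElim (lam fun _ => univ 0) (lam fun a' => path A a a') (lam fun _ => zero) x)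
    (refl a) r

/-- For `r : inr b = x` in `A + B`, an element of `b = b'` if `x` is `inr b'`, and of the empty
type if `x` is `inl a`. -/
def inrCode (B b r : Bd) : Bd :=
  J (lam₂ fun x _ => sumElim (lam fun _ => univ 0) (lam fun _ => zero) (lam fun b' => path B b b') x)
    (refl b) r

/-- `λ A B a a' d`: a decision of `inl a = inl a'` from the decision `d` of `a = a'` -/
def inlDec : Decl := .defn 11
  (pi (univ 0) fun A => pi (univ 0) fun B => pi A fun a => pi A fun a' =>
    dec (path A a a') ⇀ dec (path (sum A B) (inl a) (inl a'))) <|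
  lam fun A => lam₄ fun B a a' d =>
  sumElim (lam fun _ => dec (path (sum A B) (inl a) (inl a')))
    (lam fun p => inl (cong (sum A B) inl a p))
    (lam fun n => inr (lam fun r => n (inlCode A a r))) d

/-- `λ A B b b' d`: a decision of `inr b = inr b'` from the decision `d` of `b = b'` -/
def inrDec : Decl := .defn 12
  (pi (univ 0) fun A => pi (univ 0) fun B => pi B fun b => pi B fun b' =>
    dec (path B b b') ⇀ dec (path (sum A B) (inr b) (inr b'))) <|
  lam fun A => lam₄ fun B b b' d =>
  sumElim (lam fun _ => dec (path (sum A B) (inr b) (inr b')))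
    (lam fun p => inl (cong (sum A B) inr b p))
    (lam fun n => inr (lam fun r => n (inrCode B b r))) d

/-- `λ A B a h`: if `a` is isolated then so is `inl a` -/
def inlIsolated : Decl := .defn 13
  (pi (univ 0) fun A => pi (univ 0) fun B => pi A fun a =>
    isIsolated A a ⇀ isIsolated (sum A B) (inl a)) <|
  lam₄ fun A B a h => lam fun x =>
  sumElim (lam fun x => dec (path (sum A B) (inl a) x))
    (lam fun a' => inlDec A B a a' (h a'))
    (lam fun _ => inr (lam fun r => inlCode A a r)) x

/-- `λ A B b h`: if `b` is isolated then so is `inr b` -/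
def inrIsolated : Decl := .defn 14
  (pi (univ 0) fun A => pi (univ 0) fun B => pi B fun b =>
    isIsolated B b ⇀ isIsolated (sum A B) (inr b)) <|
  lam₄ fun A B b h => lam fun x =>
  sumElim (lam fun x => dec (path (sum A B) (inr b) x))
    (lam fun _ => inr (lam fun r => inrCode B b r))
    (lam fun b' => inrDec A B b b' (h b')) x

/-- The unique point of `1` is isolated. -/
def starIsolated : Decl := .defn 15
  (isIsolated one star) <|
  lam fun u =>
  oneElim (lam fun u => dec (path one star u)) (inl (refl star)) u

/-- `λ A a h p`: if `a` is isolated and `p : a = a`, then `p = refl` -/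
def isolatedLoop : Decl := .defn 16
  (pi (univ 0) fun A => pi A fun a => isIsolated A a ⇀
    pi (path A a a) fun p => path (path A a a) p (refl a)) <|
  lam₄ fun A a h p =>
  let k : Bd → Bd → Bd → Bd := fun d b e =>
    sumElim (lam fun _ => path A a b) (lam fun q => q) (lam fun n => abort (path A a b) (n e)) d
  let k₀ : Bd := k (h a) a (refl a)
  let c : Bd → Bd → Bd := fun b e => trans A b (symm A a k₀) (k (h b) b e)
  -- the path `c b e = e`
  let cPath : Bd → Bd := fun e =>
    J (lam₂ fun b e => path (path A a b) (trans A a (symm A a k₀) (k (h b) b e)) e)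
      (J (lam₂ fun y q => path (path A y y) (trans A y (symm A a q) q) (refl y)) (refl (refl a)) k₀)
      e
  -- the path `k e = k e'`, for `e e' : a = a`
  let kPath : Bd → Bd → Bd := fun e e' =>
    sumElim (lam fun d => path (path A a a) (k d a e) (k d a e'))
      (lam fun q => refl q)
      (lam fun n => abort
        (path (path A a a) (abort (path A a a) (n e)) (abort (path A a a) (n e'))) (n e)) (h a)
  trans (path A a a) p
    (symm (path A a a) (c a p) (cPath p))
    (trans (path A a a) (c a p)
      (cong (path A a a) (fun q => trans A a (symm A a k₀) q) (k (h a) a p) (kPath p (refl a)))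
      (cPath (refl a)))

/-- `λ A B a b b' h r`: if `a` is isolated and `r : (a, b) = (a, b')`, then `b = b'` -/
def sndPath : Decl := .defn 17
  (pi (univ 0) fun A => pi (A ⇀ univ 0) fun B => pi A fun a => pi (B a) fun b => pi (B a) fun b' =>
    isIsolated A a ⇀ path (sig A fun x => B x) (pair a b) (pair a b') ⇀ path (B a) b b') <|
  lam₃ fun A B a => lam₄ fun b b' h r =>
  let E : Bd :=
    J (lam₂ fun w _ => sig (path A a (fst w)) fun e =>
        path (B (fst w)) (transport (fun x => B x) e b) (snd w))
      (pair (refl a) (refl b)) r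
  J (lam₂ fun e _ => path (B a) (transport (fun x => B x) e b) b') (snd E)
    (isolatedLoop A a h (fst E))

/-- `λ A B a b h k`: if `a : A` and `b : B a` are isolated, then so is `(a, b)` in `Σ A B` -/
def pairIsolated : Decl := .defn 18
  (pi (univ 0) fun A => pi (A ⇀ univ 0) fun B => pi A fun a => pi (B a) fun b =>
    isIsolated A a ⇀ isIsolated (B a) b ⇀ isIsolated (sig A fun x => B x) (pair a b)) <|
  lam₂ fun A B => lam₄ fun a b h k => lam fun w =>
  let P : Bd := sig A fun x => B x
  split (lam fun w => dec (path P (pair a b) w))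
    (lam₂ fun a' b' =>
      sumElim (lam fun _ => dec (path P (pair a b) (pair a' b')))
        (lam fun e =>
          J (lam₂ fun a' _ => pi (B a') fun b' => dec (path P (pair a b) (pair a' b')))
            (lam fun b' =>
              sumElim (lam fun _ => dec (path P (pair a b) (pair a b')))
                (lam fun p => inl (cong P (fun y => pair a y) b p))
                (lam fun n => inr (lam fun r => n (sndPath A B a b b' h r)))
                (k b'))
            e b')
        (lam fun n => inr (lam fun r => n (cong A fst (pair a b) r)))
        (h a'))
    w

/-- `λ A B`, the map `Σ (a : A°), (B a)° → (Σ A B)°`, where `°` is the type of isolated points -/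
def sigmaIsolate : Decl := .defn 19
  (pi (univ 0) fun A => pi (A ⇀ univ 0) fun B =>
    (sig (isolated A) fun a => isolated (B (fst a))) ⇀ isolated (sig A fun x => B x)) <|
  lam₃ fun A B z =>
  pair (pair (fst (fst z)) (fst (snd z)))
    (pairIsolated A B (fst (fst z)) (fst (snd z)) (snd (fst z)) (snd (snd z)))

/-- `λ A B a`, the map `(A + B) \ inl a → (A \ a) + B` -/
def removeInl : Decl := .defn 20
  (pi (univ 0) fun A => pi (univ 0) fun B => pi A fun a =>
    remove (sum A B) (inl a) ⇀ sum (remove A a) B) <|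
  lam₄ fun A B a z =>
  sumElim (lam fun x => neg (path (sum A B) (inl a) x) ⇀ sum (remove A a) B)
    (lam₂ fun a' n => inl (pair a' (lam fun p => n (cong (sum A B) inl a p))))
    (lam₂ fun b _ => inr b) (fst z) (snd z)

/-- `λ A B b`, the map `(A + B) \ inr b → A + (B \ b)` -/
def removeInr : Decl := .defn 21
  (pi (univ 0) fun A => pi (univ 0) fun B => pi B fun b =>
    remove (sum A B) (inr b) ⇀ sum A (remove B b)) <|
  lam₄ fun A B b z =>
  sumElim (lam fun x => neg (path (sum A B) (inr b) x) ⇀ sum A (remove B b))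
    (lam₂ fun a _ => inl a)
    (lam₂ fun b' n => inr (pair b' (lam fun p => n (cong (sum A B) inr b p)))) (fst z) (snd z)

/-- The place in `(Σ (x : A \ a), B x) + (B a \ b)` of `(a', b') ≠ (a, b)`, given a decision `d` of
`a = a'`. -/
def removeSigmaCase (A B a b a' b' n d : Bd) : Bd :=
  let P : Bd := sig A fun x => B x
  let R : Bd := sum (sig (remove A a) fun x => B (fst x)) (remove (B a) b)
  sumElim (lam fun _ => R)
    (lam fun e => inr
      (J (lam₂ fun a' _ => pi (B a') fun b' =>
          neg (path P (pair a b) (pair a' b')) ⇀ remove (B a) b)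
        (lam₂ fun b' n => pair b' (lam fun p => n (cong P (fun y => pair a y) b p)))
        e b' n))
    (lam fun m => inl (pair (pair a' m) b'))
    d

/-- `λ A B a b h`, the map `(Σ A B) \ (a, b) → (Σ (x : A \ a), B x) + (B a \ b)` for isolated `a` -/
def removeSigma : Decl := .defn 22
  (pi (univ 0) fun A => pi (A ⇀ univ 0) fun B => pi A fun a => pi (B a) fun b =>
    isIsolated A a ⇀ remove (sig A fun x => B x) (pair a b) ⇀
      sum (sig (remove A a) fun x => B (fst x)) (remove (B a) b)) <|
  lam₂ fun A B => lam₄ fun a b h z =>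
  let P : Bd := sig A fun x => B x
  let R : Bd := sum (sig (remove A a) fun x => B (fst x)) (remove (B a) b)
  split (lam fun w => neg (path P (pair a b) w) ⇀ R)
    (lam₃ fun a' b' n => removeSigmaCase A B a b a' b' n (h a'))
    (fst z) (snd z)

/-- The value at `x` of the function that is `f` on `A \ a` and `t` at `a`, given a decision `d`
of `a = x`. -/
def graftCase (T f t x d : Bd) : Bd :=
  sumElim (lam fun _ => T) (lam fun _ => t) (lam fun n => f (pair x n)) d

/-- `λ A T a f t`, the function `A → T` that is `f` on `A \ a` and `t` at the isolated point `a` -/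
def graft : Decl := .defn 23
  (pi (univ 0) fun A => pi (univ 0) fun T => pi (isolated A) fun a =>
    (remove A (fst a) ⇀ T) ⇀ T ⇀ A ⇀ T) <|
  lam₂ fun _ T => lam₄ fun a f t x => graftCase T f t x (snd a x)

/-- `λ A T a f t`, the path `t = graft a` -/
def graftPath : Decl := .defn 24
  (pi (univ 0) fun A => pi (univ 0) fun T => pi (isolated A) fun a =>
    pi (remove A (fst a) ⇀ T) fun f => pi T fun t => path T t (graft A T a f t (fst a))) <|
  lam fun _ => lam₄ fun T a f t =>
  sumElim (lam fun d => path T t (graftCase T f t (fst a) d))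
    (lam fun _ => refl t)
    (lam fun n => abort (path T t (f (pair (fst a) n))) (n (refl (fst a))))
    (snd a (fst a))

/-- `λ A T a f t B`, the map `Σ (x : A \ a), B (graft x) → Σ (x : A \ a), B (f x)` -/
def graftOff : Decl := .defn 25
  (pi (univ 0) fun A => pi (univ 0) fun T => pi (isolated A) fun a =>
    pi (remove A (fst a) ⇀ T) fun f => pi T fun t => pi (T ⇀ univ 0) fun B =>
      (sig (remove A (fst a)) fun x => B (graft A T a f t (fst x))) ⇀
        sig (remove A (fst a)) fun x => B (f x)) <|
  lam₃ fun A T a => lam₄ fun f t B v =>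
  sumElim
    (lam fun d => B (graftCase T f t (fst (fst v)) d) ⇀ sig (remove A (fst a)) fun x => B (f x))
    (lam₂ fun e _ => abort (sig (remove A (fst a)) fun x => B (f x)) (snd (fst v) e))
    (lam₂ fun n y => pair (pair (fst (fst v)) n) y)
    (snd a (fst (fst v))) (snd v)

/-- `λ A T a f t B`, the map `Σ (x : A), B (graft x) → (Σ (x : A \ a), B (f x)) + B t` -/
def graftSplit : Decl := .defn 26
  (pi (univ 0) fun A => pi (univ 0) fun T => pi (isolated A) fun a =>
    pi (remove A (fst a) ⇀ T) fun f => pi T fun t => pi (T ⇀ univ 0) fun B =>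
      (sig A fun x => B (graft A T a f t x)) ⇀
        sum (sig (remove A (fst a)) fun x => B (f x)) (B t)) <|
  lam₃ fun A T a => lam₄ fun f t B v =>
  let R : Bd := sum (sig (remove A (fst a)) fun x => B (f x)) (B t)
  sumElim (lam fun d => B (graftCase T f t (fst v) d) ⇀ R)
    (lam₂ fun _ y => inr y)
    (lam₂ fun n y => inl (pair (pair (fst v) n) y))
    (snd a (fst v)) (snd v)

/-- For `p : t = t'` in `T`, the map `(B t)° → (B t')°`. -/
def moveIsolated (B p q : Bd) : Bd := transport (fun t => isolated (B t)) p q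

/-- `λ T B t t' p q`, for `p : t = t'` and `q : (B t)°` the map `B t' \ p⁎ q → B t \ q` -/
def moveRemove : Decl := .defn 27
  (pi (univ 0) fun T => pi (T ⇀ univ 0) fun B => pi T fun t => pi T fun t' => pi (path T t t') fun p =>
    pi (isolated (B t)) fun q => remove (B t') (fst (moveIsolated B p q)) ⇀ remove (B t) (fst q)) <|
  lam₂ fun _ B => lam₄ fun t _ p q =>
  J (lam₂ fun t' p => remove (B t') (fst (moveIsolated B p q)) ⇀ remove (B t) (fst q))
    (lam fun z => z) p

/-! ### Source of indexed containers. -/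

/-- `λ I`, the type of `I`-indexed containers -/
def cont : Decl := .defn 28
  (univ 0 ⇀ univ 1) <|
  lam fun I => sig (univ 0) fun S => I ⇀ S ⇀ univ 0

/-- The shapes of a container. -/
def Sh (F : Bd) : Bd := fst F
/-- The positions with index `i` of the shape `s`. -/
def Ps (F i s : Bd) : Bd := snd F i s

/-- `I + 1`, with `just i` and `nothing`. -/
def opt (I : Bd) : Bd := sum I one
def just (i : Bd) : Bd := inl i
def nothing : Bd := inr star

/-- `λ I F G`: maps of shapes with maps of positions in the other direction -/
def hom : Decl := .defn 29
  (pi (univ 0) fun I => pi (cont I) fun F => pi (cont I) fun G => univ 0) <|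
  lam₃ fun I F G =>
  sig (Sh F ⇀ Sh G) fun f => pi I fun i => pi (Sh F) fun s => Ps G i (f s) ⇀ Ps F i s

/-- `λ I F G m`: all position maps of `m` are equivalences -/
def isCartesian : Decl := .defn 30
  (pi (univ 0) fun I => pi (cont I) fun F => pi (cont I) fun G => hom I F G ⇀ univ 0) <|
  lam₄ fun I F G m =>
  pi I fun i => pi (Sh F) fun s => isEquiv (Ps G i (fst m s)) (Ps F i s) (snd m i s)

/-- `λ I F G`, the type `F ⊸ G` of cartesian morphisms -/
def cart : Decl := .defn 31
  (pi (univ 0) fun I => pi (cont I) fun F => pi (cont I) fun G => univ 0) <|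
  lam₃ fun I F G =>
  sig (Sh F ⇀ Sh G) fun f => pi I fun i => pi (Sh F) fun s => equiv (Ps G i (f s)) (Ps F i s)

/-- `λ I F G m`: `m` is an equivalence of containers (used for cartesian `m`) -/
def isEquivalence : Decl := .defn 32
  (pi (univ 0) fun I => pi (cont I) fun F => pi (cont I) fun G => hom I F G ⇀ univ 0) <|
  lam₄ fun _ F G m => isEquiv (Sh F) (Sh G) (fst m)

/-- `λ I F G m`: `m` is an embedding of containers (used for cartesian `m`) -/
def isEmbeddingOfContainers : Decl := .defn 33
  (pi (univ 0) fun I => pi (cont I) fun F => pi (cont I) fun G => hom I F G ⇀ univ 0) <|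
  lam₄ fun _ F G m => isEmbedding (Sh F) (Sh G) (fst m)

/-- `λ I F G H g f`, the composite `g ∘ f` -/
def comp : Decl := .defn 34
  (pi (univ 0) fun I => pi (cont I) fun F => pi (cont I) fun G => pi (cont I) fun H =>
    hom I G H ⇀ hom I F G ⇀ hom I F H) <|
  lam₂ fun _ _ => lam₄ fun _ _ g f =>
  pair (lam fun s => fst g (fst f s))
    (lam₃ fun i s z => snd f i s (snd g i (fst f s) z))

/-- `λ I F G`, the container `F + G` -/
def plus : Decl := .defn 35
  (pi (univ 0) fun I => cont I ⇀ cont I ⇀ cont I) <|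
  lam₃ fun _ F G =>
  pair (sum (Sh F) (Sh G))
    (lam₂ fun i x =>
      sumElim (lam fun _ => univ 0) (lam fun s => Ps F i s) (lam fun t => Ps G i t) x)

/-- `λ I F G`, the container `F × G` -/
def times : Decl := .defn 36
  (pi (univ 0) fun I => cont I ⇀ cont I ⇀ cont I) <|
  lam₃ fun _ F G =>
  pair (Sh F ⊡ Sh G) (lam₂ fun i x => sum (Ps F i (fst x)) (Ps G i (snd x)))

/-- `λ I F`, the weakening `↑F` of an `I`-indexed container to an `(I + 1)`-indexed one -/
def weaken : Decl := .defn 37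
  (pi (univ 0) fun I => cont I ⇀ cont (opt I)) <|
  lam₂ fun _ F =>
  pair (Sh F)
    (lam₂ fun j s =>
      sumElim (lam fun _ => univ 0) (lam fun i => Ps F i s) (lam fun _ => zero) j)

/-- `λ I i`, the projection container `π i` -/
def proj : Decl := .defn 38
  (pi (univ 0) fun I => I ⇀ cont I) <|
  lam₂ fun I i => pair one (lam₂ fun j _ => path I i j)

/-- `λ I F G`, the substitution `F[G]` of an `I`-indexed `G` into an `(I + 1)`-indexed `F` -/
def substitute : Decl := .defn 39
  (pi (univ 0) fun I => cont (opt I) ⇀ cont I ⇀ cont I) <|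
  lam₃ fun _ F G =>
  pair (sig (Sh F) fun s => Ps F nothing s ⇀ Sh G)
    (lam₂ fun i x =>
      sum (Ps F (just i) (fst x)) (sig (Ps F nothing (fst x)) fun p => Ps G i (snd x p)))

/-! ### Source of derivatives. -/

/-- `X` or `Y`, according to a decision `d`. -/
def ifDec (d X Y : Bd) : Bd := sumElim (lam fun _ => univ 0) (lam fun _ => X) (lam fun _ => Y) d

/-- `λ I i F`, the derivative `∂ᵢ F` at an isolated index `i` -/
def der : Decl := .defn 40
  (pi (univ 0) fun I => isolated I ⇀ cont I ⇀ cont I) <|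
  lam₃ fun _ i F =>
  pair (sig (Sh F) fun s => isolated (Ps F (fst i) s))
    (lam₂ fun j x =>
      ifDec (snd i j) (remove (Ps F (fst i) (fst x)) (fst (snd x))) (Ps F j (fst x)))

/-- `λ I i`: `just i` as an isolated index -/
def justIso : Decl := .defn 41
  (pi (univ 0) fun I => isolated I ⇀ isolated (opt I)) <|
  lam₂ fun I i => pair (just (fst i)) (inlIsolated I one (fst i) (snd i))

/-- `λ I`: `nothing` as an isolated index -/
def nothingIso : Decl := .defn 42
  (pi (univ 0) fun I => isolated (opt I)) <|
  lam fun I => pair nothing (inrIsolated I one star starIsolated)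

/-- The inverse of an equivalence `e`, at `b`. -/
def inv (e b : Bd) : Bd := fst (fst (snd e b))

/-- `λ A B e b a p`: for `e : A ≃ B` and `p : b = e a`, the path `e⁻¹ b = a` -/
def invPath : Decl := .defn 43
  (pi (univ 0) fun A => pi (univ 0) fun B => pi (equiv A B) fun e => pi B fun b => pi A fun a =>
    path B b (fst e a) ⇀ path A (inv e b) a) <|
  lam₂ fun A B => lam₄ fun e b a p =>
  cong A fst (fst (snd e b)) (snd (snd e b) (pair a (symm B b p)))

/-- `λ A B e`, the map `B° → A°` induced by the inverse of `e : A ≃ B` -/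
def invIsolated : Decl := .defn 44
  (pi (univ 0) fun A => pi (univ 0) fun B => equiv A B ⇀ isolated B ⇀ isolated A) <|
  lam₄ fun A B e b =>
  pair (inv e (fst b)) <| lam fun a =>
    sumElim (lam fun _ => dec (path A (inv e (fst b)) a))
      (lam fun p => inl (invPath A B e (fst b) a p))
      (lam fun n => inr (lam fun q => n
        (trans B (fst b)
          (symm B (fst e (inv e (fst b))) (snd (fst (snd e (fst b)))))
          (cong B (fun x => fst e x) (inv e (fst b)) q))))
      (snd b (fst e a))

/-- `λ I i F G m`, the morphism from `∂ᵢ F` to `∂ᵢ G` underlying `∂ᵢ m`, for cartesian `m : F ⊸ G` -/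
def derMap : Decl := .defn 45
  (pi (univ 0) fun I => pi (isolated I) fun i => pi (cont I) fun F => pi (cont I) fun G =>
    cart I F G ⇀ hom I (der I i F) (der I i G)) <|
  lam fun _ => lam₄ fun i F G m =>
  let P : Bd → Bd → Bd := fun j s => Ps F j s
  let Q : Bd → Bd → Bd := fun j s => Ps G j (fst m s)
  let p : Bd → Bd := fun x =>
    invIsolated (Q (fst i) (fst x)) (P (fst i) (fst x)) (snd m (fst i) (fst x)) (snd x)
  pair
    (lam fun x => pair (fst m (fst x)) (p x))
    (lam₂ fun j x =>
      let s : Bd := fst x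
      let e : Bd := snd m (fst i) s
      let X : Bd := remove (Q (fst i) s) (fst (p x))
      let Y : Bd := remove (P (fst i) s) (fst (snd x))
      sumElim (lam fun d => ifDec d X (Q j s) ⇀ ifDec d Y (P j s))
        (lam₂ fun _ z => pair (fst e (fst z)) (lam fun r => snd z
          (invPath (Q (fst i) s) (P (fst i) s) e (fst (snd x)) (fst z) r)))
        (lam₂ fun _ z => fst (snd m j s) z)
        (snd i j))

/-! ### Source of the lax chain rule. -/

/-- `λ I i F G`, the container `∂_{just i} F [G] + (∂_nothing F [G] × ∂ᵢ G)` -/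
def chainSource : Decl := .defn 46
  (pi (univ 0) fun I => isolated I ⇀ cont (opt I) ⇀ cont I ⇀ cont I) <|
  lam₄ fun I i F G =>
  plus I (substitute I (der (opt I) (justIso I i) F) G)
    (times I (substitute I (der (opt I) (nothingIso I) F) G) (der I i G))

/-- `λ I i F G`, the container `∂ᵢ (F[G])` -/
def chainTarget : Decl := .defn 47
  (pi (univ 0) fun I => isolated I ⇀ cont (opt I) ⇀ cont I ⇀ cont I) <|
  lam₄ fun I i F G => der I i (substitute I F G)

/-- The shape map of the chain rule, for families `P` and `N` of types and `Q` of types over `T`: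
`((s, p), f) ↦ ((s, f), inl p)` and
`(((s, p), f), (t, q)) ↦ ((s, g), inr (p, q'))`, where `g` grafts `t` onto `f` at `p`, and `q'` is
`q` moved along the path `t = g p`. -/
def chainMap (P N : Bd → Bd) (T Q D x : Bd) : Bd :=
  let Z : Bd → Bd → Bd := fun s g => sig (N s) fun p => Q (g p)
  sumElim (lam fun _ => D)
    (lam fun y =>
      let s : Bd := fst (fst y)
      let p : Bd := snd (fst y)
      let f : Bd := snd y
      pair (pair s f) (pair (inl (fst p)) (inlIsolated (P s) (Z s f) (fst p) (snd p))))
    (lam fun y =>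
      let s : Bd := fst (fst (fst y))
      let p : Bd := snd (fst (fst y))
      let f : Bd := snd (fst y)
      let t : Bd := fst (snd y)
      let q : Bd := snd (snd y)
      let g : Bd := graft (N s) T p f t
      let q' : Bd := moveIsolated Q (graftPath (N s) T p f t) q
      let w : Bd := sigmaIsolate (N s) (lam fun p => Q (g p)) (pair p q')
      pair (pair s g) (pair (inr (fst w)) (inrIsolated (P s) (Z s g) (fst w) (snd w))))
    x

/-- `λ I i F G`, the shape map of the chain rule -/
def chainShape : Decl := .defn 48
  (pi (univ 0) fun I => pi (isolated I) fun i => pi (cont (opt I)) fun F => pi (cont I) fun G =>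
    Sh (chainSource I i F G) ⇀ Sh (chainTarget I i F G)) <|
  lam₄ fun I i F G => lam fun x =>
  chainMap (Ps F (just (fst i))) (Ps F nothing) (Sh G) (snd G (fst i)) (Sh (chainTarget I i F G)) x

/-- A map from `dom j d` to `cod j d` for every decision `d` of `i = j`, defined by `base` at `i = i`
and by `off j` if `i ≠ j`. -/
structure PosMap where
  dom : Bd → Bd → Bd
  cod : Bd → Bd → Bd
  X : Bd
  Y : Bd → Bd
  base : Bd
  off : Bd → Bd

def PosMap.map (m : PosMap) (j d : Bd) : Bd :=
  sumElim (lam fun d => m.dom j d ⇀ m.cod j d)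
    (lam fun e => J (lam₂ fun j _ => m.X ⇀ m.Y j) m.base e)
    (lam fun _ => m.off j) d

/-- The position maps of the chain rule at the shape `y` of the first summand. -/
def leftMap (I i F G y : Bd) : PosMap :=
  let i₀ : Bd := fst i
  let P : Bd → Bd → Bd := fun j s => Ps F (just j) s
  let s : Bd := fst (fst y)
  let p : Bd := snd (fst y)
  let f : Bd := snd y
  let R : Bd → Bd := fun j => Ps (substitute I F G) j (pair s f)
  let Z : Bd → Bd := fun j => sig (Ps F nothing s) fun n => Ps G j (f n)
  let X : Bd := remove (R i₀) (inl (fst p))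
  let Y : Bd := remove (P i₀ s) (fst p)
  { dom := fun j d => ifDec d X (R j)
    cod := fun j d => sum (ifDec (inlDec I one i₀ j d) Y (P j s)) (Z j)
    X := X
    Y := fun j => sum Y (Z j)
    base := removeInl (P i₀ s) (Z i₀) (fst p)
    off := fun _ => lam fun z => z }

/-- `A + B → (A + C) + D` for `u : B → C' + D'`, `v : C' → C` and `w : D' → D` -/
def assocMap (A C D : Bd) (u v w : Bd → Bd) (z : Bd) : Bd :=
  let T : Bd := sum (sum A C) D
  sumElim (lam fun _ => T)
    (lam fun a => inl (inl a))
    (lam fun b => sumElim (lam fun _ => T)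
      (lam fun c => inl (inr (v c))) (lam fun d => inr (w d)) (u b)) z

/-- The position maps of the chain rule at the shape `y` of the second summand. -/
def rightMap (I i F G y : Bd) : PosMap :=
  let i₀ : Bd := fst i
  let P : Bd → Bd := fun j => Ps F (just j) (fst (fst (fst y)))
  let s : Bd := fst (fst (fst y))
  let N : Bd := Ps F nothing s
  let Q : Bd → Bd := fun j => snd G j
  let p : Bd := snd (fst (fst y))
  let f : Bd := snd (fst y)
  let t : Bd := fst (snd y)
  let q : Bd := snd (snd y)
  let g : Bd := graft N (Sh G) p f t
  let c : Bd := graftPath N (Sh G) p f t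
  let q' : Bd := moveIsolated (Q i₀) c q
  let V : Bd → Bd := fun j => sig (remove N (fst p)) fun n => Ps G j (f n)
  let R : Bd → Bd := fun j => Ps (substitute I F G) j (pair s g)
  let Z : Bd := sig N fun n => Ps G i₀ (g n)
  let X : Bd := remove (R i₀) (inr (pair (fst p) (fst q')))
  let Y : Bd := remove (Ps G i₀ t) (fst q)
  { dom := fun j d => ifDec d X (R j)
    cod := fun j d => sum (sum (P j) (V j)) (ifDec d Y (Ps G j t))
    X := X
    Y := fun j => sum (sum (P j) (V j)) Y
    base := lam fun z =>
      assocMap (P i₀) (V i₀) Y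
        (removeSigma N (lam fun n => Ps G i₀ (g n)) (fst p) (fst q') (snd p))
        (graftOff N (Sh G) p f t (Q i₀)) (moveRemove (Sh G) (Q i₀) t (g (fst p)) c q)
        (removeInr (P i₀) Z (pair (fst p) (fst q')) z)
    off := fun j => lam fun z => assocMap (P j) (V j) (Ps G j t)
      (graftSplit N (Sh G) p f t (Q j)) (fun v => v) (fun v => v) z }

/-- `λ I i F G j x`, the position maps of the chain rule.  They remove the point `inl p` or
`inr (p, q')` from `P + Σ Q` if `i = j`, and only split the graft if `i ≠ j`. -/
def chainPos : Decl := .defn 49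
  (pi (univ 0) fun I => pi (isolated I) fun i => pi (cont (opt I)) fun F => pi (cont I) fun G =>
    pi I fun j => pi (Sh (chainSource I i F G)) fun x =>
      Ps (chainTarget I i F G) j (chainShape I i F G x) ⇀ Ps (chainSource I i F G) j x) <|
  lam₂ fun I i => lam₄ fun F G j x =>
  sumElim
    (lam fun x => Ps (chainTarget I i F G) j (chainShape I i F G x) ⇀ Ps (chainSource I i F G) j x)
    (lam fun y => (leftMap I i F G y).map j (snd i j))
    (lam fun y => (rightMap I i F G y).map j (snd i j))
    x

/-- `λ I i F G`, the lax chain rule from `∂_{just i} F [G] + (∂_nothing F [G] × ∂ᵢ G)` to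
`∂ᵢ (F[G])` -/
def chain : Decl := .defn 50
  (pi (univ 0) fun I => pi (isolated I) fun i => pi (cont (opt I)) fun F => pi (cont I) fun G =>
    hom I (chainSource I i F G) (chainTarget I i F G)) <|
  lam₄ fun I i F G => pair (chainShape I i F G) (chainPos I i F G)

/-! ### Source of smallest fixed points and the lax `μ`-rule. -/

/-- `λ I F`, the smallest fixed point `μ F` of an `(I + 1)`-indexed container `F`.  Shapes are
trees; a position with index `i` of a tree is a path to a node together with a position with index
`just i` of its label, that is, a position at the root or a position in an immediate subtree. -/
def mu : Decl := .defn 51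
  (pi (univ 0) fun I => cont (opt I) ⇀ cont I) <|
  lam₂ fun _ F =>
  pair (W (Sh F) fun s => Ps F nothing s)
    (lam₂ fun i w =>
      wrec (lam fun _ => univ 0)
        (lam₃ fun s _ ih => sum (Ps F (just i) s) (sig (Ps F nothing s) fun p => ih p)) w)

/-- `λ I F`, the structure map `F[μ F] ⊸ μ F`, which is cartesian -/
def muIn : Decl := .defn 52
  (pi (univ 0) fun I => pi (cont (opt I)) fun F => cart I (substitute I F (mu I F)) (mu I F)) <|
  lam₂ fun I F =>
  pair (lam fun x => sup (fst x) (snd x))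
    (lam₂ fun i x => idEquiv (Ps (substitute I F (mu I F)) i x))

/-- `λ I F G m w`: the shape map of the recursor, by recursion on trees -/
def recShape : Decl := .defn 53
  (pi (univ 0) fun I => pi (cont (opt I)) fun F => pi (cont I) fun G =>
    pi (hom I (substitute I F G) G) fun m => Sh (mu I F) ⇀ Sh G) <|
  lam fun _ => lam₄ fun _ G m w =>
  wrec (lam fun _ => Sh G) (lam₃ fun s _ ih => fst m (pair s ih)) w

/-- `λ I F G m i w`: the position maps of the recursor, by induction on trees -/
def recPos : Decl := .defn 54
  (pi (univ 0) fun I => pi (cont (opt I)) fun F => pi (cont I) fun G =>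
    pi (hom I (substitute I F G) G) fun m => pi I fun i => pi (Sh (mu I F)) fun w =>
      Ps G i (recShape I F G m w) ⇀ Ps (mu I F) i w) <|
  lam₂ fun I F => lam₄ fun G m i w =>
  wrec (lam fun w => Ps G i (recShape I F G m w) ⇀ Ps (mu I F) i w)
    (lam₃ fun s f ih => lam fun q =>
      sumElim (lam fun _ => Ps (mu I F) i (sup s f))
        (lam fun a => inl a)
        (lam fun v => inr (pair (fst v) (ih (fst v) (snd v))))
        (snd m i (pair s (lam fun p => recShape I F G m (f p))) q))
    w

/-- `λ I F G m`, the morphism from `μ F` to `G` defined by recursion from `m`, a morphism from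
`F[G]` to `G` -/
def muRec : Decl := .defn 55
  (pi (univ 0) fun I => pi (cont (opt I)) fun F => pi (cont I) fun G =>
    pi (hom I (substitute I F G) G) fun m => hom I (mu I F) G) <|
  lam₄ fun I F G m => pair (recShape I F G m) (recPos I F G m)

/-- `λ I i F`, the `(I + 1)`-indexed container
`F' = ↑(∂_{just i} F [μ F]) + (↑(∂_nothing F [μ F]) × π nothing)` -/
def derSig : Decl := .defn 56
  (pi (univ 0) fun I => isolated I ⇀ cont (opt I) ⇀ cont (opt I)) <|
  lam₃ fun I i F =>
  let D : Bd → Bd := fun k => weaken I (substitute I (der (opt I) k F) (mu I F))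
  plus (opt I) (D (justIso I i)) (times (opt I) (D (nothingIso I)) (proj (opt I) nothing))

/-- `λ I A B Y`, the morphism from `(↑A + (↑B × π nothing))[Y]` to `A + (B × Y)` -/
def unfoldSig : Decl := .defn 57
  (pi (univ 0) fun I => pi (cont I) fun A => pi (cont I) fun B => pi (cont I) fun Y =>
    hom I (substitute I (plus (opt I) (weaken I A)
      (times (opt I) (weaken I B) (proj (opt I) nothing))) Y) (plus I A (times I B Y))) <|
  lam₄ fun I A B Y =>
  let F' : Bd := plus (opt I) (weaken I A) (times (opt I) (weaken I B) (proj (opt I) nothing))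
  let T : Bd := plus I A (times I B Y)
  let N : Bd → Bd := fun x => Ps F' nothing x ⇀ Sh Y
  let pt : Bd := inr (refl nothing)
  let sh : Bd → Bd → Bd := fun x k =>
    sumElim (lam fun x => N x ⇀ Sh T)
      (lam₂ fun a _ => inl a)
      (lam₂ fun y k => inr (pair (fst y) (k pt))) x k
  pair
    (lam fun z => sh (fst z) (snd z))
    (lam₂ fun i z =>
      sumElim
        (lam fun x => pi (N x) fun k =>
          Ps T i (sh x k) ⇀ sum (Ps F' (just i) x) (sig (Ps F' nothing x) fun p => Ps Y i (k p)))
        (lam₃ fun _ _ u => inl u)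
        (lam₃ fun y k u =>
          sumElim
            (lam fun _ => sum (Ps F' (just i) (inr y))
              (sig (Ps F' nothing (inr y)) fun p => Ps Y i (k p)))
            (lam fun b => inl (inl b))
            (lam fun v => inr (pair pt v)) u)
        (fst z) (snd z))

/-- `λ I i F`, the morphism from `F'[∂ᵢ (μ F)]` to `∂ᵢ (μ F)`, the composite
`F'[∂ᵢ (μ F)] → ∂_{just i} F [μ F] + (∂_nothing F [μ F] × ∂ᵢ (μ F)) → ∂ᵢ (F[μ F]) → ∂ᵢ (μ F)`
of the unfolding, the chain rule, and `∂ᵢ` of the structure map -/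
def muRuleStep : Decl := .defn 58
  (pi (univ 0) fun I => pi (isolated I) fun i => pi (cont (opt I)) fun F =>
    hom I (substitute I (derSig I i F) (der I i (mu I F))) (der I i (mu I F))) <|
  lam₃ fun I i F =>
  let M : Bd := mu I F
  let A : Bd := substitute I (der (opt I) (justIso I i) F) M
  let B : Bd := substitute I (der (opt I) (nothingIso I) F) M
  let Y : Bd := der I i M
  let X : Bd := substitute I (derSig I i F) Y
  comp I X (chainTarget I i F M) Y
    (derMap I i (substitute I F M) M (muIn I F))
    (comp I X (chainSource I i F M) (chainTarget I i F M) (chain I i F M) (unfoldSig I A B Y))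

/-- `λ I i F`, the lax `μ`-rule from `μ F'` to `∂ᵢ (μ F)`, defined by recursion -/
def muRule : Decl := .defn 59
  (pi (univ 0) fun I => pi (isolated I) fun i => pi (cont (opt I)) fun F =>
    hom I (mu I (derSig I i F)) (der I i (mu I F))) <|
  lam₃ fun I i F =>
  muRec I (derSig I i F) (der I i (mu I F)) (muRuleStep I i F)

/-! ### Source of the statements, and function extensionality. -/

/-- The type of the lax chain rule. -/
def chainType : Decl := .defn 60
  (univ 1) <|
  pi (univ 0) fun I => pi (isolated I) fun i => pi (cont (opt I)) fun F => pi (cont I) fun G =>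
    hom I (chainSource I i F G) (chainTarget I i F G)

/-- The type of the lax `μ`-rule. -/
def muRuleType : Decl := .defn 61
  (univ 1) <|
  pi (univ 0) fun I => pi (isolated I) fun i => pi (cont (opt I)) fun F =>
    hom I (mu I (derSig I i F)) (der I i (mu I F))

/-- For every type of indices `I`, every isolated `i : I` and every signature container
`F : Cont_{I+1}`: all chain rules `Chain_{F,G}` and the `μ`-rule of `F` are cartesian, the `μ`-rule
is an embedding, and it is an equivalence if and only if `Chain_{F,μF}` is. -/
def strongMuRule : Decl := .defn 62
  (univ 1) <|
  pi (univ 0) fun I => pi (isolated I) fun i => pi (cont (opt I)) fun F =>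
    let M : Bd := mu I F
    let strongMu : Bd := isEquivalence I (mu I (derSig I i F)) (der I i M) (muRule I i F)
    let strongChain : Bd :=
      isEquivalence I (chainSource I i F M) (chainTarget I i F M) (chain I i F M)
    (pi (cont I) fun G =>
      isCartesian I (chainSource I i F G) (chainTarget I i F G) (chain I i F G)) ⊡
    isCartesian I (mu I (derSig I i F)) (der I i M) (muRule I i F) ⊡
    isEmbeddingOfContainers I (mu I (derSig I i F)) (der I i M) (muRule I i F) ⊡
    ((strongMu ⇀ strongChain) ⊡ (strongChain ⇀ strongMu))


/-- The type of function extensionality. -/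
def funextType : Decl := .defn 63
  (univ 1) <|
  pi (univ 0) fun A => pi (A ⇀ univ 0) fun B =>
    pi (pi A fun x => B x) fun f => pi (pi A fun x => B x) fun g =>
      isEquiv (path (pi A fun x => B x) f g) (pi A fun x => path (B x) (f x) (g x))
        (happly A B f g)

/-- Function extensionality, as a constant. -/
def fext : Decl := .thm 64 funextType hole

/-- The constants with their values. -/
def basics : List (Decl × Tm) :=
  [(isContr, UF.isContr),
    (isProp, UF.isProp),
    (fiber, UF.fiber),
    (isEquiv, UF.isEquiv),
    (equiv, UF.equiv),
    (isEmbedding, UF.isEmbedding),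
    (idEquiv, UF.idEquiv),
    (happly, UF.happly),
    (isIsolated, UF.isIsolated),
    (isolated, UF.isolated),
    (remove, UF.remove),
    (inlDec, UF.inlDec),
    (inrDec, UF.inrDec),
    (inlIsolated, UF.inlIsolated),
    (inrIsolated, UF.inrIsolated),
    (starIsolated, UF.starIsolated),
    (isolatedLoop, UF.isolatedLoop),
    (sndPath, UF.sndPath),
    (pairIsolated, UF.pairIsolated),
    (sigmaIsolate, UF.sigmaIsolate),
    (removeInl, UF.removeInl),
    (removeInr, UF.removeInr),
    (removeSigma, UF.removeSigma),
    (graft, UF.graft),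
    (graftPath, UF.graftPath),
    (graftOff, UF.graftOff),
    (graftSplit, UF.graftSplit),
    (moveRemove, UF.moveRemove),
    (cont, UF.cont),
    (hom, UF.hom),
    (isCartesian, UF.isCartesian),
    (cart, UF.cart),
    (isEquivalence, UF.isEquivalence),
    (isEmbeddingOfContainers, UF.isEmbeddingOfContainers),
    (comp, UF.comp),
    (plus, UF.plus),
    (times, UF.times),
    (weaken, UF.weaken),
    (proj, UF.proj),
    (substitute, UF.substitute),
    (der, UF.der),
    (justIso, UF.justIso),
    (nothingIso, UF.nothingIso),
    (invPath, UF.invPath),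
    (invIsolated, UF.invIsolated),
    (derMap, UF.derMap),
    (chainSource, UF.chainSource),
    (chainTarget, UF.chainTarget),
    (chainShape, UF.chainShape),
    (chainPos, UF.chainPos),
    (chain, UF.chain),
    (mu, UF.mu),
    (muIn, UF.muIn),
    (recShape, UF.recShape),
    (recPos, UF.recPos),
    (muRec, UF.muRec),
    (derSig, UF.derSig),
    (unfoldSig, UF.unfoldSig),
    (muRuleStep, UF.muRuleStep),
    (muRule, UF.muRule),
    (chainType, UF.chainType),
    (muRuleType, UF.muRuleType),
    (strongMuRule, UF.strongMuRule),
    (funextType, UF.funextType 0 0)]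

end UF.Src

namespace UF
open Tm E Res

/-! ## Checking of declarations -/

namespace E

theorem er_congr {ρ ρ' : ℕ → Tm} {k : ℕ} (h : ∀ j < k, ρ j = ρ' j) (t : E) :
    t.consLt k = true → t.er ρ = t.er ρ' := by
  induction t with
  | var | op0 => intro _; rfl
  | con m => intro hm; exact h m (by rwa [consLt, Nat.blt_eq] at hm)
  | op1 o a ih => intro ha; rw [er, er, ih ha]
  | op2 o a b ih ih' =>
    intro hab
    simp only [consLt, Bool.and_eq_true] at hab
    rw [er, er, ih hab.1, ih' hab.2]
  | op3 o a b c ih ih' ih'' =>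
    intro hab
    simp only [consLt, Bool.and_eq_true] at hab
    rw [er, er, ih hab.1, ih' hab.2.1, ih'' hab.2.2]
  | elim a b c d ih ih' ih'' ih''' =>
    intro hab
    simp only [consLt, Bool.and_eq_true] at hab
    rw [er, er, ih hab.1, ih' hab.2.1, ih'' hab.2.2.1, ih''' hab.2.2.2]
  | bnd o a b ih ih' =>
    intro hab
    simp only [consLt, Bool.and_eq_true] at hab
    rw [er, er, ih hab.1, ih' hab.2]

theorem consLt_mono {j k : ℕ} (h : j ≤ k) (t : E) : t.consLt j = true → t.consLt k = true := by
  induction t with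
  | var | op0 => exact id
  | con m => simp only [consLt, Nat.blt_eq]; omega
  | op1 o a ih => exact ih
  | op2 o a b ih ih' => simp only [consLt, Bool.and_eq_true]; exact And.imp ih ih'
  | op3 o a b c ih ih' ih'' =>
    simp only [consLt, Bool.and_eq_true]; exact And.imp ih (And.imp ih' ih'')
  | elim a b c d ih ih' ih'' ih''' =>
    simp only [consLt, Bool.and_eq_true]; exact And.imp ih (And.imp ih' (And.imp ih'' ih'''))
  | bnd o a b ih ih' => simp only [consLt, Bool.and_eq_true]; exact And.imp ih ih'

end E

theorem Env.find_some {e : Env} {k : ℕ} {d : Entry} (h : e.find k = some d) : d ∈ e ∧ d.id = k := by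
  induction e with
  | nil => cases h
  | cons x e ih =>
    rw [Env.find] at h
    cases hx : Nat.beq x.id k <;> rw [hx] at h
    · exact ⟨List.mem_cons_of_mem _ (ih h).1, (ih h).2⟩
    · cases h; exact ⟨List.mem_cons_self, Nat.eq_of_beq_eq_true hx⟩

/-- The constants of the entry, and of its type and value, are below `k`. -/
structure Entry.Below (k : ℕ) (d : Entry) : Prop where
  id : d.id < k
  ty : d.ty.consLt k = true
  val : ∀ v, d.val = some v → v.consLt k = true

theorem Entry.Below.mono {j k : ℕ} (h : j ≤ k) {d : Entry} (hd : d.Below j) : d.Below k :=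
  ⟨hd.id.trans_le h, consLt_mono h _ hd.ty, fun v hv => consLt_mono h _ (hd.val v hv)⟩

/-- The head of the environment is below `k`. -/
def Env.below (e : Env) (k : ℕ) : Bool :=
  match e with
  | [] => true
  | d :: _ => Nat.blt d.id k

/-- The environment is ordered, and interpreted by `ρ`. -/
structure Env.Models (e : Env) (ρ : ℕ → Tm) : Prop extends e.Typed ρ where
  below : ∀ k, e.below k = true → ∀ d ∈ e, d.Below k

theorem Env.Models.nil : Env.Models [] fun _ => .star where
  closed _ _ := rfl
  unfold _ _ h := by cases h
  typed _ _ h := by cases h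
  isType _ _ h := by cases h
  below _ _ _ h := by cases h

theorem HasType.closed {t T : Tm} (h : HasType [] t T) (σ : ℕ → Tm) : t.subst σ = t :=
  h.subst_eq σ (by intro n hn; cases hn)

/-- An entry mentions only constants with smaller numbers than its own. Choosing the value at the
new number therefore changes neither the types nor the values of the older constants. -/
theorem Env.Models.cons {e : Env} {ρ : ℕ → Tm} (H : e.Models ρ) {d : Entry} {t : Tm}
    (hd : e.below d.id = true) (hT : d.ty.consLt d.id = true)
    (hv : ∀ v, d.val = some v → v.consLt d.id = true ∧ t = v.er ρ)
    (h : HasType [] t (d.ty.er ρ)) (h' : IsType [] (d.ty.er ρ)) :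
    Env.Models (d :: e) (Function.update ρ d.id t) := by
  have old : ∀ j < d.id, ρ j = Function.update ρ d.id t j := fun j hj =>
    (Function.update_of_ne hj.ne _ _).symm
  have hb := H.below _ hd
  have hself : Function.update ρ d.id t d.id = t := Function.update_self _ _ _
  have find : ∀ k x, Env.find (d :: e) k = some x →
      (x = d ∧ k = d.id) ∨ (e.find k = some x ∧ k < d.id ∧ x ∈ e) := by
    intro k x hx
    rw [Env.find] at hx
    cases hk : Nat.beq d.id k <;> rw [hk] at hx
    · obtain ⟨hm, hi⟩ := Env.find_some hx
      exact .inr ⟨hx, hi ▸ (hb x hm).id, hm⟩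
    · cases hx; exact .inl ⟨rfl, (Nat.eq_of_beq_eq_true hk).symm⟩
  refine ⟨⟨⟨?_, ?_⟩, ?_, ?_⟩, ?_⟩
  · intro k σ
    by_cases hk : k = d.id
    · subst hk; rw [hself]; exact h.closed σ
    · rw [Function.update_of_ne hk]; exact H.closed k σ
  · intro k v hu
    unfold Env.unfold at hu
    split at hu
    · rename_i x hx
      rcases find k x hx with ⟨rfl, rfl⟩ | ⟨hf, hk, hm⟩
      · obtain ⟨hc, ht⟩ := hv v hu
        rw [hself, ← er_congr old v hc, ht]
      · rw [← old k hk, H.unfold k v (by unfold Env.unfold; rw [hf]; exact hu)]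
        exact er_congr old v ((hb x hm).val v hu)
    · cases hu
  · intro k x hx
    rcases find k x hx with ⟨rfl, rfl⟩ | ⟨hf, hk, hm⟩
    · rw [hself, ← er_congr old _ hT]; exact h
    · rw [← old k hk, ← er_congr old _ (hb x hm).ty]; exact H.typed k x hf
  · intro k x hx
    rcases find k x hx with ⟨rfl, rfl⟩ | ⟨hf, hk, hm⟩
    · rw [← er_congr old _ hT]; exact h'
    · rw [← er_congr old _ (hb x hm).ty]; exact H.isType k x hf
  · intro k hk x hx
    have hk : d.id < k := by rwa [Env.below, Nat.blt_eq] at hk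
    rcases hx with _ | ⟨_, hx⟩
    · exact ⟨hk, consLt_mono hk.le _ hT, fun v h => consLt_mono hk.le _ (hv v h).1⟩
    · exact (hb x hx).mono hk.le

namespace Src
noncomputable section

def Decl.check (e : Env) (d : Decl) : Bool :=
  e.below d.id && ((d.ty.run 0).consLt d.id &&
    match inferTy e 100000 (infer e 100000) [] (d.ty.run 0) with
    -- The environment records the type as written; elaboration has to return it unchanged up to
    -- annotations.
    | ok p => p.1.beq (d.ty.run 0) &&
      match infer e 100000 [] (d.val.run 0) (some (d.ty.run 0)) with
      -- A definition may be unfolded later, so its elaborated value must agree with the written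
      -- one. For a theorem any inhabitant will do, and the elaborated term, with its holes filled,
      -- is taken as the value.
      | ok q => d.hidden || (q.1.beq (d.val.run 0) && (d.val.run 0).consLt d.id)
      | err _ _ _ _ => false
    | err _ _ _ _ => false)

def checkAll : Env → List Decl → Bool
  | _, [] => true
  | e, d :: ds => d.check e && checkAll (d.entry :: e) ds

def extend : Env → List Decl → Env
  | e, [] => e
  | e, d :: ds => extend (d.entry :: e) ds

theorem Decl.check_sound {e : Env} {ρ : ℕ → Tm} (H : e.Models ρ) {d : Decl}
    (h : d.check e = true) :
    e.below d.id = true ∧ ∃ t, Env.Models (d.entry :: e) (Function.update ρ d.id t) := by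
  simp only [Decl.check, Bool.and_eq_true] at h
  obtain ⟨hb, hT, h⟩ := h
  have hi := inferTy_sound (n := 100000) (A := d.ty.run 0) H.toTyped
    (infer_sound H.toTyped 100000) Wf.nil (Γ := [])
  split at h
  · rename_i p hp
    rw [hp] at hi
    rw [Bool.and_eq_true] at h
    obtain ⟨hpT, h⟩ := h
    have hT' : IsType [] ((d.ty.run 0).er ρ) := by
      rw [← er_eq_of_beq _ _ hpT]; exact ⟨_, hi⟩
    have hs := (infer_sound H.toTyped 100000).check Wf.nil (Γ := []) (t := d.val.run 0) hT'
    split at h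
    · rename_i q hq
      rw [hq] at hs
      refine ⟨hb, _, H.cons (d := d.entry) hb hT (fun v hv => ?_) hs hT'⟩
      cases hd : d.hidden
      · rw [hd, Bool.false_or, Bool.and_eq_true] at h
        simp only [Decl.entry, hd, cond_false, Option.some.injEq] at hv
        subst hv
        exact ⟨h.2, er_eq_of_beq _ _ h.1⟩
      · simp [Decl.entry, hd] at hv
    · exact absurd h Bool.false_ne_true
  · exact absurd h Bool.false_ne_true

/-- The values of the constants below 64. -/
def value (k : ℕ) : Tm := (basics.map Prod.snd).getD k .star

/-- The environment has a model in which the constants below 64 have their values. -/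
structure Sound (e : Env) : Prop where
  below : e.below 63 = false
  models : ∃ ρ, e.Models ρ ∧ ∀ k < 64, ρ k = value k

theorem Sound.cons {e : Env} {ρ : ℕ → Tm} (hb : e.below 63 = false)
    (hρ : ∀ k < 64, ρ k = value k) {d : Entry} {t : Tm} (hd : e.below d.id = true)
    (H : Env.Models (d :: e) (Function.update ρ d.id t)) : Sound (d :: e) := by
  -- The newest constant has number at least 63 and the next one is larger, so no further
  -- declaration can overwrite one of the 64 definitions.
  have hd : 63 < d.id := by
    cases e with
    | nil => cases hb
    | cons x e =>
      rw [Env.below, Nat.blt_eq] at hd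
      rw [Env.below, ← Bool.not_eq_true, Nat.blt_eq] at hb
      omega
  refine ⟨?_, _, H, fun k hk => ?_⟩
  · rw [Env.below, ← Bool.not_eq_true, Nat.blt_eq]; omega
  · rw [Function.update_of_ne (by omega)]; exact hρ k hk

theorem Sound.extend : ∀ (ds : List Decl) {e : Env}, Sound e →
    checkAll e ds = true → Sound (extend e ds) := by
  intro ds
  induction ds with
  | nil => intro e H _; exact H
  | cons d ds ih =>
    rintro e ⟨hb, ρ, H, hρ⟩ h
    rw [checkAll, Bool.and_eq_true] at h
    obtain ⟨hd, t, H'⟩ := Decl.check_sound H h.1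
    exact ih (.cons hb hρ (d := d.entry) hd H') h.2

/-- For the definitions themselves, whose interpretation is found here without saying yet what it
is; `eq_value` identifies it. -/
theorem models_of_checkAll : ∀ (ds : List Decl) {e : Env} {ρ : ℕ → Tm}, e.Models ρ →
    checkAll e ds = true → ∃ ρ, Env.Models (Src.extend e ds) ρ := by
  intro ds
  induction ds with
  | nil => intro e ρ H _; exact ⟨ρ, H⟩
  | cons d ds ih =>
    rintro e ρ H h
    rw [checkAll, Bool.and_eq_true] at h
    obtain ⟨-, t, H'⟩ := Decl.check_sound H h.1
    exact ih H' h.2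

/-- The environment of the definitions. -/
def env₀ : Env := Src.extend [] (basics.map Prod.fst)

theorem basics_check : checkAll [] (basics.map Prod.fst) = true := by decide +kernel

/-- The link to the statement of the theorem: the declarations are written differently in places,
with shared auxiliary terms, but they erase to exactly the raw terms that the statement is about. -/
theorem basics_er : basics.map (fun p => (p.1.val.run 0).er value) = basics.map Prod.snd := rfl

theorem basics_unfold :
    basics.map (fun p => env₀.unfold p.1.id) = basics.map fun p => some (p.1.val.run 0) := rfl

theorem basics_id : basics.map (fun p => p.1.id) = List.range 64 := rfl

theorem basics_consLt :
    basics.map (fun p => (p.1.val.run 0).consLt p.1.id) = List.replicate 64 true := rfl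

theorem map_eq_getElem {α β : Type} {f : α → β} {l : List α} {l' : List β} (h : l.map f = l')
    {i : ℕ} (hi : i < l.length) : l'[i]? = some (f l[i]) := by
  rw [← h, List.getElem?_map, List.getElem?_eq_getElem hi]; rfl

/-- A definition is transparent, so its value in any model is the erasure of its body in that model.
The body uses smaller constants only, whose values are known by strong induction. -/
theorem eq_value {ρ : ℕ → Tm} (H : env₀.Models ρ) : ∀ k < 64, ρ k = value k := by
  intro k
  induction k using Nat.strong_induction_on with
  | _ k ih =>
    intro hk
    have hi : k < basics.length := hk
    have hid := map_eq_getElem basics_id hi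
    have her := map_eq_getElem basics_er hi
    have hun := map_eq_getElem basics_unfold hi
    have hlt := map_eq_getElem basics_consLt hi
    rw [List.getElem?_range hk] at hid
    rw [List.getElem?_replicate, if_pos hk] at hlt
    rw [List.getElem?_map, List.getElem?_eq_getElem hi] at her hun
    simp only [Option.map_some, Option.some.injEq] at hid her hun hlt
    rw [← hid] at hlt hun
    rw [H.unfold k _ hun.symm, er_congr (fun j hj => ih j hj (hj.trans hk)) _ hlt.symm, ← her]
    simp [value, hi]

/-- This constant is not checked: it is interpreted by the primitive term `funext 0 0`, and its
typing is a rule of the theory. Its entry carries no value, so the placeholder in the declaration is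
never used. -/
theorem sound_fext : Sound (fext.entry :: env₀) := by
  obtain ⟨ρ, H⟩ := models_of_checkAll _ Env.Models.nil basics_check
  have hρ := eq_value H
  have h63 : ρ 63 = UF.funextType 0 0 := hρ 63 (by decide)
  refine .cons (t := .funext 0 0) rfl hρ rfl (H.cons rfl rfl (fun v h => by cases h) ?_ ?_)
  · show HasType [] _ (ρ 63)
    rw [h63]
    exact .funext 0 0
  · exact ⟨1, H.typed 63 funextType.entry rfl⟩

theorem Sound.typed {e : Env} (H : Sound e) {d : Decl} {t T : Tm} (hd : e.find d.id = some d.entry)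
    (hlt : d.id < 64) (ht : value d.id = t) (hT : (d.ty.run 0).er value = T)
    (hc : (d.ty.run 0).consLt 64 = true) : HasType [] t T := by
  obtain ⟨-, ρ, H, hρ⟩ := H
  have := H.typed _ _ hd
  rw [hρ _ hlt, ht] at this
  rw [← hT, ← er_congr hρ _ hc]
  exact this

theorem Sound.inhabited {e : Env} (H : Sound e) {d : Decl} {T : Tm}
    (hd : e.find d.id = some d.entry) (hT : (d.ty.run 0).er value = T)
    (hc : (d.ty.run 0).consLt 64 = true) : ∃ t, HasType [] t T := by
  obtain ⟨-, ρ, H, hρ⟩ := H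
  have := H.typed _ _ hd
  rw [← hT, ← er_congr hρ _ hc]
  exact ⟨_, this⟩

end
end Src
end UF

/-! ### The proof of the theorem inside the object theory. -/

namespace UF.Src

set_option linter.unusedVariables false

notation "□" => hole

/-- Assumes `A` in a statement and in its proof. -/
def given (A : Bd) (k : Bd → Bd × Bd) : Bd × Bd :=
  (pi A fun x => (k x).1, lam fun x => (k x).2)

/-- The statement `p.1` with the proof `p.2`. -/
def Decl.prove (k : ℕ) (p : Bd × Bd) : Decl := .thm k p.1 p.2
/-- A transparent proof. -/
def Decl.construct (k : ℕ) (p : Bd × Bd) : Decl := .defn k p.1 p.2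

def lam₅ (b : Bd → Bd → Bd → Bd → Bd → Bd) : Bd := lam fun x => lam₄ fun y z w v => b x y z w v

/-- `Σ x, B x` for a family `B`, given as a function -/
def total (A B : Bd) : Bd := sig A fun x => B x

def type : Bd := univ 0

/-! ### Paths -/

def symmDef : Decl := .defn 66 (pi type fun A => pi A fun a => pi A fun b => path A a b ⇀ path A b a)
  (lam₄ fun A a _ p => symm A a p)

def transDef : Decl := .defn 67
  (pi type fun A => pi A fun a => pi A fun b => pi A fun c =>
    path A a b ⇀ path A b c ⇀ path A a c)
  (lam fun A => lam₅ fun a _ c p q =>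
    J (lam₂ fun y _ => path A y c ⇀ path A a c) (lam fun q => q) p q)

/-- The inverse of a path. -/
def bk (p : Bd) : Bd := symmDef □ □ □ p
/-- The composite of paths; `refl a ⬝ q` is `q` by definition. -/
def cat (p q : Bd) : Bd := transDef □ □ □ □ p q

infixr:70 " ⬝ " => cat

/-- `e · (e⁻¹ · q) = q` -/
def cancelPath : Decl := .prove 68 <|
  given type fun A => given A fun a => given A fun b => given A fun c =>
  given (path A a b) fun e => given (path A a c) fun q =>
    (path (path A a c) (transDef A a b c e (transDef A b a c (symmDef A a b e) q)) q,
     J (lam₂ fun _ e => path (path A a c) (e ⬝ bk e ⬝ q) q) (refl □) e)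

/-- `e⁻¹ · e = refl` -/
def inverseLoop : Decl := .prove 69 <|
  given type fun A => given A fun a => given A fun b => given (path A a b) fun e =>
    (path (path A b b) (transDef A b a b (symmDef A a b e) e) (refl b),
     J (lam₂ fun b e => path (path A b b) (bk e ⬝ e) (refl b)) (refl □) e)

/-- Pairs with equal first components and, over that path, equal second components -/
def pairPath : Decl := .prove 70 <|
  given type fun A => given (A ⇀ type) fun B => given A fun a => given A fun a' =>
  given (B a) fun b => given (B a') fun b' => given (path A a a') fun e =>
  given (path (B a') (transport (fun x => B x) e b) b') fun q =>
    (path (total A B) (pair a b) (pair a' b'),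
     J (lam₂ fun a' e => pi (B a') fun b' => path (B a') (transport (fun x => B x) e b) b' ⇀
         path (total A B) (pair a b) (pair a' b'))
       (lam₂ fun _ q => cong (total A B) (fun y => pair a y) b q) e b' q)

/-! ### Propositions and retracts -/

def contrProp : Decl := .prove 71 <|
  given type fun A => given (isContr A) fun c => (isProp A, lam₂ fun a b => bk (snd c a) ⬝ snd c b)

def propContr : Decl := .prove 72 <|
  given type fun A => given (isProp A) fun h => given A fun a =>
    (isContr A, pair a (lam fun b => h a b))

def propPath : Decl := .prove 73 <|
  given type fun A => given (A ⇀ type) fun B => given (pi A fun a => isProp (B a)) fun h =>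
  given A fun a => given A fun a' => given (B a) fun b => given (B a') fun b' =>
  given (path A a a') fun e =>
    (path (total A B) (pair a b) (pair a' b'),
     pairPath A B a a' b b' e (h a' (transport (fun x => B x) e b) b'))

def sigProp : Decl := .prove 74 <|
  given type fun A => given (A ⇀ type) fun B =>
  given (isProp A) fun h => given (pi A fun a => isProp (B a)) fun k =>
    (isProp (total A B), lam₂ fun x y =>
      split (lam fun x => path (total A B) x y)
        (lam₂ fun a b => split (lam fun y => path (total A B) (pair a b) y)
          (lam₂ fun a' b' => propPath A B k a a' b b' (h a a')) y) x)

/-- A sum over a proposition is a proposition if one of the summands is. -/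
def sigPropCenter : Decl := .prove 75 <|
  given type fun A => given (A ⇀ type) fun B =>
  given (isProp A) fun h => given A fun a => given (isProp (B a)) fun k =>
    (isProp (total A B), sigProp A B h (lam fun x => transport (fun x => isProp (B x)) (h a x) k))

/-- `λ A B`: `A` is a retract of `B` -/
def retract : Decl := .defn 76 (type ⇀ type ⇀ type)
  (lam₂ fun A B => sig (A ⇀ B) fun s => sig (B ⇀ A) fun r => pi A fun a => path A (r (s a)) a)

def retractContr : Decl := .prove 77 <|
  given type fun A => given type fun B => given (retract A B) fun R => given (isContr B) fun c =>
    let s : Bd := fst R; let r : Bd := fst (snd R); let H : Bd := snd (snd R)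
    (isContr A, pair (r (fst c)) (lam fun a =>
      cong A (fun b => r b) (fst c) (snd c (s a)) ⬝ H a))

def retractProp : Decl := .prove 78 <|
  given type fun A => given type fun B => given (retract A B) fun R => given (isProp B) fun h =>
    let s : Bd := fst R; let r : Bd := fst (snd R); let H : Bd := snd (snd R)
    (isProp A, lam₂ fun a a' =>
      bk (H a) ⬝ cong A (fun b => r b) (s a) (h (s a) (s a')) ⬝ H a')

/-- If `e : X → Y` has the section `e'` and `h ∘ e = k`, then the fibers of `h` are retracts of
those of `k`. -/
def fiberRetract : Decl := .prove 79 <|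
  given type fun X => given type fun Y => given type fun T =>
  given (X ⇀ T) fun k => given (Y ⇀ T) fun h => given (X ⇀ Y) fun e => given (Y ⇀ X) fun e' =>
  given (pi Y fun y => path Y (e (e' y)) y) fun ε =>
  given (pi X fun x => path T (h (e x)) (k x)) fun H =>
  given T fun z =>
    let F : Bd := fiber Y T h z
    (retract F (fiber X T k z),
      pair (lam fun u => pair (e' (fst u))
          (bk (H (e' (fst u))) ⬝ cong T (fun y => h y) (e (e' (fst u))) (ε (fst u)) ⬝ snd u)) <|
      pair (lam fun v => pair (e (fst v)) (H (fst v) ⬝ snd v)) <|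
      lam fun u => split (lam fun u => path F
          (pair (e (e' (fst u))) (H (e' (fst u)) ⬝ bk (H (e' (fst u))) ⬝
            cong T (fun y => h y) (e (e' (fst u))) (ε (fst u)) ⬝ snd u)) u)
        (lam₂ fun y p =>
          -- Going to the fiber of `k` and back turns the path `p` into `H ⬝ bk H ⬝ c`. The first
          -- two factors cancel, and what remains is joined to `(y, p)` by contracting the path `ε
          -- y`.
          let c : Bd := cong T (fun y => h y) (e (e' y)) (ε y) ⬝ p
          transDef F (pair (e (e' y)) (H (e' y) ⬝ bk (H (e' y)) ⬝ c)) (pair (e (e' y)) c) (pair y p)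
            (cong F (fun q => pair (e (e' y)) q) (H (e' y) ⬝ bk (H (e' y)) ⬝ c)
              (cancelPath □ □ □ □ (H (e' y)) c))
            (J (lam₂ fun v w => pi (path T (h v) z) fun p =>
                path F (pair (e (e' y)) (cong T (fun y => h y) (e (e' y)) w ⬝ p)) (pair v p))
              (lam fun p => refl □) (ε y) p)) u)

/-! ### Equivalences and embeddings -/

/-- The two homotopies make each fiber of `f` a retract of a fiber of the identity, which is
contractible. So no coherence between the homotopies is needed. -/
def isoEquiv : Decl := .prove 80 <|
  given type fun A => given type fun B => given (A ⇀ B) fun f => given (B ⇀ A) fun g =>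
  given (pi A fun a => path A (g (f a)) a) fun η =>
  given (pi B fun b => path B (f (g b)) b) fun ε =>
    (isEquiv A B f, lam fun b =>
      retractContr (fiber A B f b) (fiber B B (lam fun x => x) b)
        (fiberRetract B A B (lam fun x => x) f g f η ε b) (snd (idEquiv B) b))

/-- Being an embedding passes to maps whose fibers are retracts of those of an embedding. The chain
rule is treated with `k` the projection from a subtype and `e` an inverse of the chain rule on that
subtype. -/
def sectionEmb : Decl := .prove 81 <|
  given type fun X => given type fun Y => given type fun T =>
  given (X ⇀ T) fun k => given (Y ⇀ T) fun h => given (X ⇀ Y) fun e => given (Y ⇀ X) fun e' =>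
  given (pi Y fun y => path Y (e (e' y)) y) fun ε =>
  given (pi X fun x => path T (h (e x)) (k x)) fun H =>
  given (isEmbedding X T k) fun m =>
    (isEmbedding Y T h, lam fun z =>
      retractProp (fiber Y T h z) (fiber X T k z) (fiberRetract X Y T k h e e' ε H z) (m z))

/-- The inverse function of `f : A → B`, for `m : isEquiv f`. -/
def back (m b : Bd) : Bd := fst (fst (m b))
/-- The path `f (f⁻¹ b) = b`. -/
def backRight (m b : Bd) : Bd := snd (fst (m b))

/-- The path `f⁻¹ (f a) = a` -/
def backLeft : Decl := .prove 82 <|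
  given type fun A => given type fun B => given (A ⇀ B) fun f => given (isEquiv A B f) fun m =>
  given A fun a =>
    (path A (back m (f a)) a,
     cong A (fun u => fst u) (fst (m (f a))) (snd (m (f a)) (pair a (refl (f a)))))

def compEquiv : Decl := .prove 83 <|
  given type fun A => given type fun B => given type fun C =>
  given (A ⇀ B) fun f => given (B ⇀ C) fun g =>
  given (isEquiv A B f) fun m => given (isEquiv B C g) fun n =>
    (isEquiv A C (lam fun x => g (f x)),
     isoEquiv A C (lam fun x => g (f x)) (lam fun z => back m (back n z))
      (lam fun a => cong A (fun y => back m y) (back n (g (f a))) (backLeft B C g n (f a)) ⬝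
        backLeft A B f m a)
      (lam fun c => cong C (fun y => g y) (f (back m (back n c))) (backRight m (back n c)) ⬝
        backRight n c))

def equivEmb : Decl := .prove 84 <|
  given type fun A => given type fun B => given (A ⇀ B) fun f => given (isEquiv A B f) fun m =>
    (isEmbedding A B f, lam fun b => contrProp (fiber A B f b) (m b))

/-- An embedding with inhabited fibers is an equivalence. -/
def embEquiv : Decl := .prove 85 <|
  given type fun A => given type fun B => given (A ⇀ B) fun f => given (isEmbedding A B f) fun m =>
  given (pi B fun b => fiber A B f b) fun k =>
    (isEquiv A B f, lam fun b => propContr (fiber A B f b) (m b) (k b))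

/-- Embeddings reflect paths. -/
def embPath : Decl := .prove 86 <|
  given type fun A => given type fun B => given (A ⇀ B) fun f => given (isEmbedding A B f) fun m =>
  given A fun a => given A fun a' => given (path B (f a) (f a')) fun p =>
    (path A a a', cong A (fun u => fst u) (ann (fiber A B f (f a')) (pair a p))
      (m (f a') (pair a p) (pair a' (refl (f a')))))

/-- The fiber of `g ∘ f` is a retract of the sum, over the fiber of `g`, of the fibers of `f`. -/
def compEmb : Decl := .prove 87 <|
  given type fun A => given type fun B => given type fun C =>
  given (A ⇀ B) fun f => given (B ⇀ C) fun g =>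
  given (isEmbedding A B f) fun m => given (isEmbedding B C g) fun n =>
    let h : Bd := lam fun x => g (f x)
    (isEmbedding A C h, lam fun z =>
      let V : Bd := sig (fiber B C g z) fun u => fiber A B f (fst u)
      retractProp (fiber A C h z) V
        (pair (lam fun u => pair (pair (f (fst u)) (snd u)) (pair (fst u) (refl □))) <|
         pair (lam fun v => pair (fst (snd v))
           (cong C (fun y => g y) (f (fst (snd v))) (snd (snd v)) ⬝ snd (fst v))) <|
         lam fun u => split (lam fun u => path (fiber A C h z) (pair (fst u) (snd u)) u)
           (lam₂ fun x p => refl □) u)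
        (sigProp (fiber B C g z) (lam fun u => fiber A B f (fst u)) (n z) (lam fun u => m (fst u))))

/-- The fiber of the projection over `a` is a retract of `B a`: transport the second component along
the path to `a`. -/
def fstEmb : Decl := .prove 88 <|
  given type fun A => given (A ⇀ type) fun B => given (pi A fun a => isProp (B a)) fun k =>
    (isEmbedding (total A B) A (lam fun x => fst x), lam fun a =>
      let F : Bd := fiber (total A B) A (lam fun x => fst x) a
      let t : Bd → Bd := fun u => transport (fun x => B x) (snd u) (snd (fst u))
      retractProp F (B a)
        (pair (lam fun u => t u) <|
         pair (lam fun b => pair (pair a b) (refl a)) <|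
         lam fun u => split (lam fun u => path F (pair (pair a (t u)) (refl a)) u)
           (lam₂ fun x e => split (lam fun x => pi (path A (fst x) a) fun e =>
               path F (pair (pair a (transport (fun x => B x) e (snd x))) (refl a)) (pair x e))
             (lam₃ fun x b e => J (lam₂ fun a e => path (fiber (total A B) A (lam fun x => fst x) a)
                 (pair (pair a (transport (fun x => B x) e b)) (refl a)) (pair (pair x b) e))
               (refl □) e) x e) u)
        (k a))

/-! ### Function extensionality -/

/-- `λ A B f g h` -/
def homotopyPath : Decl := .prove 89 <|
  given type fun A => given (A ⇀ type) fun B =>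
  given (pi A fun x => B x) fun f => given (pi A fun x => B x) fun g =>
  given (pi A fun x => path (B x) (f x) (g x)) fun h =>
    (path (pi A fun x => B x) f g, fst (fst (fext A B f g h)))

/-- Induction on homotopies. -/
def homotopyInd : Decl := .prove 90 <|
  given type fun A => given (A ⇀ type) fun B => given (pi A fun x => B x) fun f =>
  let M : Bd := pi A fun x => B x
  let H : Bd → Bd := fun g => pi A fun x => path (B x) (f x) (g x)
  given (pi M fun g => H g ⇀ type) fun C => given (C f (lam fun x => refl (f x))) fun c =>
  given M fun g => given (H g) fun h =>
    (C g h,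
      -- By function extensionality `h` is the homotopy of some path, up to a path, so induction on
      -- that path suffices.
      transport (fun h => C g h) (snd (fst (fext A B f g h)))
        (J (lam₂ fun g p => C g (happly A B f g p)) c (fst (fst (fext A B f g h)))))

def piProp : Decl := .prove 91 <|
  given type fun A => given (A ⇀ type) fun B => given (pi A fun x => isProp (B x)) fun h =>
    (isProp (pi A fun x => B x), lam₂ fun f g =>
      homotopyPath A B f g (lam fun x => h x (f x) (g x)))

def negProp : Decl := .prove 92 <|
  given type fun A => (isProp (neg A),
    piProp A (lam fun _ => zero) (lam₃ fun _ a _ => abort □ a))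

/-! ### Isolated points -/

def decProp : Decl := .prove 93 <|
  given type fun A => given (isProp A) fun h => (isProp (dec A), lam₂ fun d d' =>
    sumElim □
      (lam fun a => sumElim □
        (lam fun a' => cong (dec A) inl a (h a a'))
        (lam fun n => abort □ (n a)) d')
      (lam fun n => sumElim □
        (lam fun a => abort □ (n a))
        (lam fun n' => cong (dec A) inr n (negProp A n n')) d') d)

/-- Induction on one of two parallel paths turns the other into a loop, and loops at an isolated
point are trivial. -/
def isolatedPathProp : Decl := .prove 94 <|
  given type fun A => given A fun a => given (isIsolated A a) fun h => given A fun b =>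
    (isProp (path A a b), lam₂ fun p q =>
      J (lam₂ fun b q => pi (path A a b) fun p => path (path A a b) p q)
        (lam fun p => isolatedLoop A a h p) q p)

/-- To compare two proofs of isolation one may use the first of them: it makes all types `a = b`
propositions, and so their decisions. -/
def isIsolatedProp : Decl := .prove 95 <|
  given type fun A => given A fun a => (isProp (isIsolated A a), lam₂ fun h k =>
    piProp A (lam fun b => dec (path A a b))
      (lam fun b => decProp (path A a b) (isolatedPathProp A a h b)) h k)

def isolatedPath : Decl := .prove 96 <|
  given type fun A => given (isolated A) fun x => given (isolated A) fun y =>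
  given (path A (fst x) (fst y)) fun e =>
    (path (isolated A) x y,
      split (lam fun x => path A (fst x) (fst y) ⇀ path (isolated A) x y)
        (lam₂ fun a h => split (lam fun y => path A a (fst y) ⇀ path (isolated A) (pair a h) y)
          (lam₃ fun b k e => propPath A (isIsolated A) (isIsolatedProp A) a b h k e) y) x e)

def removePath : Decl := .prove 97 <|
  given type fun A => given A fun a => given (remove A a) fun x => given (remove A a) fun y =>
  given (path A (fst x) (fst y)) fun e =>
    (path (remove A a) x y,
      split (lam fun x => path A (fst x) (fst y) ⇀ path (remove A a) x y)
        (lam₂ fun b h => split (lam fun y => path A b (fst y) ⇀ path (remove A a) (pair b h) y)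
          (lam₃ fun c k e => propPath A (lam fun b => neg (path A a b))
            (lam fun b => negProp (path A a b)) b c h k e) y) x e)

/-- `graft` is `f` away from the isolated point. -/
def graftRestrict : Decl := .prove 98 <|
  given type fun A => given type fun T => given (isolated A) fun a =>
  given (remove A (fst a) ⇀ T) fun f => given T fun t => given (remove A (fst a)) fun x =>
    (path T (graft A T a f t (fst x)) (f x),
      split (lam fun x => path T (graft A T a f t (fst x)) (f x))
        (lam₂ fun b n => sumElim
          (lam fun d => path T (graftCase T f t b d) (f (pair b n)))
          (lam fun e => abort □ (n e))
          (lam fun m => cong T (fun n => f (pair b n)) m (negProp (path A (fst a) b) m n))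
          (snd a b)) x)

/-- A function is the graft of its restriction. -/
def graftSelf : Decl := .construct 99 <|
  given type fun A => given type fun T => given (isolated A) fun a => given (A ⇀ T) fun f =>
  given A fun x =>
    (path T (f x) (graft A T a (lam fun x => f (fst x)) (f (fst a)) x),
      sumElim (lam fun d => path T (f x) (graftCase T (lam fun x => f (fst x)) (f (fst a)) x d))
        (lam fun e => cong T (fun x => f x) x (symm A (fst a) e))
        (lam fun _ => refl (f x)) (snd a x))

/-- Coherence of `graftSelf` at the isolated point. The decision there yields a loop, which is
trivial by `isolatedLoop`. It guarantees that moving a position along the homotopy or along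
`graftPath` has the same effect. -/
def graftSelfPath : Decl := .prove 100 <|
  given type fun A => given type fun T => given (isolated A) fun a => given (A ⇀ T) fun f =>
    let f' : Bd := lam fun x => f (fst x)
    let t : Bd := f (fst a)
    (path (path T t (graft A T a f' t (fst a))) (graftSelf A T a f (fst a)) (graftPath A T a f' t),
      let a₀ : Bd := fst a
      sumElim (lam fun d => path (path T t (graftCase T f' t a₀ d))
          (sumElim (lam fun d => path T (f a₀) (graftCase T f' t a₀ d))
            (lam fun e => cong T (fun x => f x) a₀ (symm A a₀ e)) (lam fun _ => refl (f a₀)) d)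
          (sumElim (lam fun d => path T t (graftCase T f' t a₀ d)) (lam fun _ => refl t)
            (lam fun n => abort (path T t (f' (pair a₀ n))) (n (refl a₀))) d))
        (lam fun e => cong (path T t t) (fun e => cong T (fun x => f x) a₀ (symm A a₀ e)) e
          (isolatedLoop A a₀ (snd a) e))
        (lam fun n => abort □ (n (refl a₀))) (snd a a₀))

/-! ### The shape map of the chain rule is an embedding -/

/-- The families of positions from which the chain rule is made: `P` and `N` over `S`, and `Q` over
`T`. -/
structure Families where
  S : Bd
  P : Bd
  N : Bd
  T : Bd
  Q : Bd

def Decl.on (d : Decl) (v : Families) : Bd := d v.S v.P v.N v.T v.Q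

def givenFamilies (k : Families → Bd × Bd) : Bd × Bd :=
  given type fun S => given (S ⇀ type) fun P => given (S ⇀ type) fun N =>
  given type fun T => given (T ⇀ type) fun Q => k ⟨S, P, N, T, Q⟩

def chainDom : Decl := .construct 101 <| givenFamilies fun v => (type,
  sum (sig (sig v.S fun s => isolated (v.P s)) fun u => v.N (fst u) ⇀ v.T)
    ((sig (sig v.S fun s => isolated (v.N s)) fun u => remove (v.N (fst u)) (fst (snd u)) ⇀ v.T) ⊡
      sig v.T fun t => isolated (v.Q t)))

def Families.pos (v : Families) (s f : Bd) : Bd := sum (v.P s) (sig (v.N s) fun n => v.Q (f n))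

def chainCod : Decl := .construct 102 <| givenFamilies fun v => (type,
  sig (sig v.S fun s => v.N s ⇀ v.T) fun z => isolated (v.pos (fst z) (snd z)))

def chainFun : Decl := .construct 103 <| givenFamilies fun v =>
  (chainDom.on v ⇀ chainCod.on v, lam fun x => chainMap v.P v.N v.T v.Q (chainCod.on v) x)

/-- The position is isolated in its summand, and if it is a pair then so are its components. -/
def Families.apart (v : Families) (s f x : Bd) : Bd :=
  sumElim (lam fun _ => type) (lam fun p => isIsolated (v.P s) p)
    (lam fun w => isIsolated (v.N s) (fst w) ⊡ isIsolated (v.Q (f (fst w))) (snd w)) x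

/-- This describes the image of the chain rule. It is a proper condition on pairs in general: the
centre `(a, refl)` of `Σ b, a = b` is isolated, the type being contractible, whether or not `a` is
isolated. -/
def isApart : Decl := .construct 104 <| givenFamilies fun v =>
  (chainCod.on v ⇀ type, lam fun z => v.apart (fst (fst z)) (snd (fst z)) (fst (snd z)))

def isApartProp : Decl := .prove 105 <| givenFamilies fun v => given (chainCod.on v) fun z =>
  let s : Bd := fst (fst z)
  let f : Bd := snd (fst z)
  (isProp (isApart.on v z),
    sumElim (lam fun x => isProp (v.apart s f x))
      (lam fun p => isIsolatedProp (v.P s) p)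
      (lam fun w => sigProp (isIsolated (v.N s) (fst w))
        (lam fun _ => isIsolated (v.Q (f (fst w))) (snd w)) (isIsolatedProp (v.N s) (fst w))
        (lam fun _ => isIsolatedProp (v.Q (f (fst w))) (snd w))) (fst (snd z)))

/-- On the image the chain rule is undone by restricting the function to the complement of the
isolated point, keeping its value there separately. -/
def chainBack : Decl := .construct 106 <| givenFamilies fun v =>
  (total (chainCod.on v) (isApart.on v) ⇀ chainDom.on v, lam fun z =>
    let s : Bd := fst (fst (fst z))
    let f : Bd := snd (fst (fst z))
    sumElim (lam fun x => v.apart s f x ⇀ chainDom.on v)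
      (lam₂ fun p k => inl (pair (pair s (pair p k)) f))
      (lam₂ fun w k => inr (pair
        (pair (pair s (pair (fst w) (fst k))) (lam fun x => f (fst x)))
        (pair (f (fst w)) (pair (snd w) (snd k)))))
      (fst (snd (fst z))) (snd z))

def chainApart : Decl := .construct 107 <| givenFamilies fun v =>
  (pi (chainDom.on v) fun y => isApart.on v (chainFun.on v y), lam fun y =>
    sumElim (lam fun y => isApart.on v (chainFun.on v y))
      (lam fun u => snd (snd (fst u)))
      (lam fun u => pair (snd (snd (fst (fst u))))
        (snd (moveIsolated v.Q
          (graftPath (v.N (fst (fst (fst u)))) v.T (snd (fst (fst u))) (snd (fst u)) (fst (snd u)))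
          (snd (snd u))))) y)

/-- The round trip replaces `f` by the graft of its own restriction and `q` by its transport along
`graftPath`. Both changes have to be contracted together because the type of `q` depends on `f`. -/
def chainGraft : Decl := .prove 108 <| givenFamilies fun v =>
  given v.S fun s => given (v.N s ⇀ v.T) fun f => given (v.N s) fun n =>
  given (isIsolated (v.N s) n) fun h => given (v.Q (f n)) fun q =>
  given (isIsolated (v.Q (f n)) q) fun k => given (isIsolated (v.pos s f) (inr (pair n q))) fun i =>
    let D : Bd := chainCod.on v
    let move : Bd → Bd := fun c => fst (moveIsolated v.Q c (pair q k))
    let z : Bd := pair (pair s f) (pair (inr (pair n q)) i)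
    let a : Bd := pair n h
    let f' : Bd := lam fun x => f (fst x)
    let g : Bd := graft (v.N s) v.T a f' (f n)
    let c : Bd := graftPath (v.N s) v.T a f' (f n)
    let Z : Bd → Bd → Bd := fun g c => pi (isIsolated (v.pos s g) (inr (pair n (move c)))) fun j =>
      path D (pair (pair s g) (pair (inr (pair n (move c))) j)) z
    (Z g c,
      -- The induction generalizes the graft to a function `g` homotopic to `f`, and `graftPath` to
      -- a path `c` equal to the homotopy at `n`. For the constant homotopy `c` becomes `refl`, the
      -- transport disappears, and only the proofs of isolation differ.
      homotopyInd (v.N s) (lam fun _ => v.T) f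
        (lam₂ fun g h => pi (path v.T (f n) (g n)) fun c =>
          path (path v.T (f n) (g n)) (h n) c ⇀ Z g c)
        (lam₂ fun c r => J (lam₂ fun c _ => Z f c)
          (lam fun j => cong D (fun y => pair (pair s f) y) (pair (inr (pair n q)) j)
            (isolatedPath (v.pos s f) (pair (inr (pair n q)) j) (pair (inr (pair n q)) i)
              (refl □))) r)
        g (graftSelf (v.N s) v.T a f) c (graftSelfPath (v.N s) v.T a f))

def chainFunBack : Decl := .prove 109 <| givenFamilies fun v =>
  given (total (chainCod.on v) (isApart.on v)) fun z =>
    let D : Bd := isApart.on v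
    let goal : Bd → Bd → Bd := fun x k =>
      path (chainCod.on v) (chainFun.on v (chainBack.on v (pair x k))) x
    (path (chainCod.on v) (chainFun.on v (chainBack.on v z)) (fst z),
      split □ (lam₂ fun x k => split (lam fun x => pi (D x) fun k => goal x k)
        (lam₂ fun z x => split (lam fun z => pi (isolated (v.pos (fst z) (snd z))) fun x =>
            pi (D (pair z x)) fun k => goal (pair z x) k)
          (lam₃ fun s f x => split (lam fun x => pi (D (pair (pair s f) x)) fun k =>
              goal (pair (pair s f) x) k)
            (lam₂ fun x i => sumElim (lam fun x => pi (isIsolated (v.pos s f) x) fun i =>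
                pi (v.apart s f x) fun k => goal (pair (pair s f) (pair x i)) k)
              (lam₃ fun p i k => cong (chainCod.on v) (fun y => pair (pair s f) y)
                (pair (inl p) (inlIsolated (v.P s) (sig (v.N s) fun n => v.Q (f n)) p k))
                (isolatedPath (v.pos s f)
                  (pair (inl p) (inlIsolated (v.P s) (sig (v.N s) fun n => v.Q (f n)) p k))
                  (pair (inl p) i) (refl □)))
              (lam fun w => split (lam fun w => pi (isIsolated (v.pos s f) (inr w)) fun i =>
                  pi (v.apart s f (ann (v.pos s f) (inr w))) fun k => goal (pair (pair s f) (pair (inr w) i)) k)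
                (lam₄ fun n q i k => chainGraft.on v s f n (fst k) q (snd k) i
                  (snd (snd (chainFun.on v (chainBack.on v
                    (pair (pair (pair s f) (pair (inr (pair n q)) i)) k)))))) w) x i) x) z x) x k) z)

def chainBackFun : Decl := .prove 110 <| givenFamilies fun v => given (chainDom.on v) fun y =>
  let C : Bd := chainDom.on v
  let N : Bd := v.N
  let T : Bd := v.T
  let goal : Bd → Bd := fun y => path C (chainBack.on v (pair (chainFun.on v y) (chainApart.on v y))) y
  (goal y,
    sumElim (lam fun y => goal y)
      (lam fun u => split (lam fun u => goal (inl u))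
        (lam₂ fun w f => split (lam fun w => pi (N (fst w) ⇀ T) fun f => goal (inl (pair w f)))
          (lam₃ fun s p f => split (lam fun p => goal (inl (pair (pair s p) f)))
            (lam₂ fun a h => refl □) p) w f) u)
      (lam fun u => split (lam fun u => goal (inr u))
        (lam₂ fun w y => split (lam fun w => goal (inr (pair w y)))
          (lam₂ fun w f => split (lam fun w => pi (remove (N (fst w)) (fst (snd w)) ⇀ T) fun f =>
              goal (inr (pair (pair w f) y)))
            (lam₂ fun s p => split (lam fun p => pi (remove (N s) (fst p) ⇀ T) fun f =>
                goal (inr (pair (pair (pair s p) f) y)))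
              (lam₃ fun a h f => split (lam fun y => goal (inr (pair (pair (pair s (pair a h)) f) y)))
                (lam₂ fun t q => split (lam fun q =>
                    goal (inr (pair (pair (pair s (pair a h)) f) (pair t q))))
                  (lam₂ fun q k =>
                    let p : Bd := pair a h
                    let g : Bd := graft (N s) T p f t
                    let c : Bd := graftPath (N s) T p f t
                    let f' : Bd := lam fun x => g (fst x)
                    let move : Bd → Bd := fun c =>
                      moveIsolated v.Q c (pair q k)
                    -- The restriction of the graft is replaced by `f` through `graftRestrict`;
                    -- after that the path `c` from `t` to `g a` is free to be contracted, which
                    -- also removes the transport of `q`.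
                    cong C (fun f => inr (pair (pair (pair s p) f)
                        (pair (g a) (pair (fst (move c)) (snd (move c)))))) f'
                      (homotopyPath (remove (N s) a) (lam fun _ => T) f' f
                        (graftRestrict (N s) T p f t)) ⬝
                    J (lam₂ fun t' c => path C
                        (inr (pair (pair (pair s p) f) (pair t' (pair (fst (move c)) (snd (move c))))))
                        (inr (pair (pair (pair s p) f) (pair t (pair q k)))))
                      (refl □) c) q) y) p) w f) w) u) y)

/-- The chain rule corestricts to an inverse of `chainBack`, so its fibers are retracts of those of
the projection that forgets a proof of the proposition `isApart`. -/
def chainEmb : Decl := .prove 111 <| givenFamilies fun v =>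
  (isEmbedding (chainDom.on v) (chainCod.on v) (chainFun.on v),
    sectionEmb (total (chainCod.on v) (isApart.on v)) (chainDom.on v) (chainCod.on v)
      (lam fun z => fst z) (chainFun.on v) (chainBack.on v)
      (lam fun y => pair (chainFun.on v y) (chainApart.on v y))
      (chainBackFun.on v) (chainFunBack.on v)
      (fstEmb (chainCod.on v) (isApart.on v) (isApartProp.on v)))

/-! ### Recursion on trees preserves embeddings -/

def tree (S N : Bd) : Bd := W S fun s => N s

/-- `λ S N T a`, the map from trees to `T` defined by recursion from `a : (Σ s, N s → T) → T` -/
def treeRec : Decl := .construct 112 <|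
  given type fun S => given (S ⇀ type) fun N => given type fun T =>
  given ((sig S fun s => N s ⇀ T) ⇀ T) fun a =>
    (tree S N ⇀ T, lam fun w => wrec (lam fun _ => T) (lam₃ fun s _ ih => a (pair s ih)) w)

/-- Functions into the fibers of `r` are lifts along `r`. -/
def liftProp : Decl := .prove 113 <|
  given type fun N => given type fun U => given type fun T => given (U ⇀ T) fun r =>
  given (N ⇀ U) fun f => given (pi N fun n => isProp (fiber U T r (r (f n)))) fun h =>
    let g : Bd := lam fun n => r (f n)
    let L : Bd := sig (N ⇀ U) fun f' => path (N ⇀ T) (lam fun n => r (f' n)) g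
    (isProp L,
      let C : Bd := lam fun _ => T
      let H : Bd := lam fun n => fiber U T r (r (f n))
      let lift : Bd → Bd := fun f' => lam fun n => r (f' n)
      retractProp L (pi N fun n => H n)
        (pair (lam₂ fun u n => pair (fst u n) (happly N C (lift (fst u)) g (snd u) n)) <|
         pair (lam fun k => pair (lam fun n => fst (k n))
           (back (fext N C (lam fun n => r (fst (k n))) g) (lam fun n => snd (k n)))) <|
         lam fun u => split □ (lam₂ fun f' e =>
            cong L (fun e => pair f' e)
              (back (fext N C (lift f') g) (happly N C (lift f') g e))
              (backLeft (path (N ⇀ T) (lift f') g) (pi N fun n => path T (r (f' n)) (g n))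
                (happly N C (lift f') g) (fext N C (lift f') g) e)) u)
        (piProp N H h))

/-- The fiber over `a (s, r ∘ f)` consists of a point `x` of the fiber of `a` together with a lift
of the function in `x` along `r`. Since `a` is an embedding, `x` is unique; the lifts of `r ∘ f` are
unique by `liftProp`, whose assumption on the fibers of `r` is the induction hypothesis. -/
def treeRecEmb : Decl := .prove 114 <|
  given type fun S => given (S ⇀ type) fun N => given type fun T =>
  let A : Bd := sig S fun s => N s ⇀ T
  given (A ⇀ T) fun a => given (isEmbedding A T a) fun m =>
    let U : Bd := tree S N
    let r : Bd := treeRec S N T a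
    let F : Bd → Bd := fun z => fiber U T r z
    (isEmbedding U T r, lam₂ fun z u =>
      J (lam₂ fun z _ => isProp (F z))
        (wrec (lam fun w => isProp (F (r w)))
          (lam₃ fun s f ih =>
            let x₀ : Bd := pair s (lam fun n => r (f n))
            let z₀ : Bd := a x₀
            let L : Bd → Bd := fun x => sig (N (fst x) ⇀ U) fun f' =>
              path (N (fst x) ⇀ T) (lam fun n => r (f' n)) (snd x)
            let B : Bd := lam fun x => L (fst x)
            let X : Bd := fiber A T a z₀
            -- The recursor is used for a case distinction: `r w` computes to a value of `a` only
            -- when `w` is a node.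
            let into : Bd → Bd → Bd := fun w p => wrec (lam fun w => path T (r w) z₀ ⇀ total X B)
              (lam₄ fun s' f' _ p =>
                pair (pair (pair s' (lam fun n => r (f' n))) p) (pair f' (refl □))) w p
            let out : Bd → Bd → Bd → Bd := fun x p y =>
              split (lam fun x => path T (a x) z₀ ⇀ L x ⇀ F z₀)
                (lam₄ fun s' g p y => pair (sup s' (fst y))
                  (J (lam₂ fun g _ => path T (a (pair s' g)) z₀ ⇀
                      path T (a (pair s' (lam fun n => r (fst y n)))) z₀) (lam fun p => p)
                    (snd y) p)) x p y
            let back : Bd → Bd := fun v => out (fst (fst v)) (snd (fst v)) (snd v)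
            retractProp (F z₀) (total X B)
              (pair (lam fun u => into (fst u) (snd u)) <|
               pair (lam fun v => back v) <|
               lam fun u => split
                 (lam fun u => path (F z₀)
                   (app (lam fun v => back v) (ann (total X B) (into (fst u) (snd u)))) u)
                 (lam₂ fun w p => wrec
                   (lam fun w => pi (path T (r w) z₀) fun p => path (F z₀)
                     (app (lam fun v => back v) (ann (total X B) (into w p))) (pair w p))
                   (lam₄ fun s' f' _ p => refl □) w p) u)
              -- Uniqueness of lifts is available at the centre `x₀` only, which is enough over a
              -- proposition.
              (sigPropCenter X B (m z₀) (pair x₀ (refl z₀))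
                (liftProp (N s) U T r f ih)))
          (fst u))
        (snd u) u)

/-! ### The shape map of the `μ`-rule is an embedding -/

def unfoldInv : Decl := .construct 115 <|
  given type fun I => given (cont I) fun A => given (cont I) fun B => given (cont I) fun Y =>
    let F' : Bd := plus (opt I) (weaken I A) (times (opt I) (weaken I B) (proj (opt I) nothing))
    let X : Bd := Sh (substitute I F' Y)
    (Sh (plus I A (times I B Y)) ⇀ X, lam fun z => sumElim (lam fun _ => X)
      (lam fun a => pair (inl a) (lam fun e => abort (Sh Y) e))
      (lam fun u => pair (inr (pair (fst u) star)) (lam fun _ => snd u)) z)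

/-- The positions of `π nothing` at `nothing` are the loops at `nothing`. This point is isolated, so
the loop is unique, and a function on these positions amounts to its value at `refl`. -/
def unfoldEquiv : Decl := .prove 116 <|
  given type fun I => given (cont I) fun A => given (cont I) fun B => given (cont I) fun Y =>
    let F' : Bd := plus (opt I) (weaken I A) (times (opt I) (weaken I B) (proj (opt I) nothing))
    let X : Bd := Sh (substitute I F' Y)
    let Z : Bd := Sh (plus I A (times I B Y))
    let f : Bd := fst (unfoldSig I A B Y)
    let g : Bd := unfoldInv I A B Y
    let N : Bd → Bd := fun x => Ps F' nothing x
    let C : Bd := lam fun _ => Sh Y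
    let goal : Bd → Bd := fun z => path X (g (f z)) z
    (isEquiv X Z f, isoEquiv X Z f g
      (lam fun z => split (lam fun z => goal z)
        (lam₂ fun x k => sumElim (lam fun x => pi (N x ⇀ Sh Y) fun k => goal (pair x k))
          (lam₂ fun a k => cong X (fun k => pair (inl a) k) (lam fun e => abort (Sh Y) e)
            (homotopyPath zero C (lam fun e => abort (Sh Y) e) k (lam fun e => abort □ e)))
          (lam fun y => split
            (lam fun y => pi (N (inr y) ⇀ Sh Y) fun k => goal (pair (inr y) k))
            (lam₂ fun b u => oneElim
              (lam fun u => pi (N (inr (pair b u)) ⇀ Sh Y) fun k => goal (pair (inr (pair b u)) k))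
              (lam fun k =>
                let M : Bd := N (inr (pair b star))
                let k' : Bd := lam fun _ => k (inr (refl nothing))
                cong X (fun k => pair (inr (pair b star)) k) k'
                  -- The positions at `nothing` have an empty left summand, coming from a weakened
                  -- container, and a right summand of loops, each equal to `refl`.
                  (homotopyPath M C k' k (lam fun v =>
                    sumElim (lam fun v => path (Sh Y) (k (inr (refl nothing))) (k v))
                      (lam fun e => abort □ e)
                      (lam fun r => cong (Sh Y) (fun r => k (inr r)) (refl nothing)
                        (bk (isolatedLoop (opt I) nothing (snd (nothingIso I)) r))) v)))
              u) y) x k) z)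
      (lam fun z => sumElim (lam fun z => path Z (f (g z)) z)
        (lam fun a => refl □)
        (lam fun u => split (lam fun u => path Z (f (g (inr u))) (inr u)) (lam₂ fun _ _ => refl □) u)
        z))

def derInInv : Decl := .construct 117 <|
  given type fun I => given (isolated I) fun i => given (cont (opt I)) fun F =>
    let M : Bd := mu I F
    let X : Bd := Sh (der I i (substitute I F M))
    (Sh (der I i M) ⇀ X, lam fun y =>
      wrec (lam fun w => isolated (Ps M (fst i) w) ⇀ X)
        (lam₄ fun s f _ p => pair (pair s f) p) (fst y) (snd y))

/-- The structure map is a bijection on shapes, by cases on trees, and the identity on positions.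
Only the proofs of isolation are changed, and those are propositions. -/
def derInEquiv : Decl := .prove 118 <|
  given type fun I => given (isolated I) fun i => given (cont (opt I)) fun F =>
    let M : Bd := mu I F
    let FM : Bd := substitute I F M
    let X : Bd := Sh (der I i FM)
    let Y : Bd := Sh (der I i M)
    let f : Bd := fst (derMap I i FM M (muIn I F))
    let g : Bd := derInInv I i F
    (isEquiv X Y f, isoEquiv X Y f g
      (lam fun x => split (lam fun x => path X (g (f x)) x)
        (lam₂ fun z p => split
          (lam fun z => pi (isolated (Ps FM (fst i) z)) fun p =>
            path X (g (f (pair z p))) (pair z p))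
          (lam₃ fun s h p => cong X (fun p => pair (pair s h) p) (snd (g (f (pair (pair s h) p))))
            (isolatedPath (Ps FM (fst i) (pair s h)) (snd (g (f (pair (pair s h) p)))) p (refl □)))
          z p) x)
      (lam fun y => split (lam fun y => path Y (f (g y)) y)
        (lam₂ fun w p => wrec (lam fun w => pi (isolated (Ps M (fst i) w)) fun p =>
            path Y (f (g (pair w p))) (pair w p))
          (lam₄ fun s h _ p => cong Y (fun p => pair (sup s h) p) (snd (f (g (pair (sup s h) p))))
            (isolatedPath (Ps M (fst i) (sup s h)) (snd (f (g (pair (sup s h) p)))) p (refl □)))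
          w p) y))

/-- The families of which the chain rule for `F` and `G` is made. -/
def families (i F G : Bd) : Families :=
  ⟨Sh F, snd F (just (fst i)), snd F nothing, Sh G, snd G (fst i)⟩

def stepEmb : Decl := .prove 119 <|
  given type fun I => given (isolated I) fun i => given (cont (opt I)) fun F =>
    let M : Bd := mu I F
    let A : Bd := substitute I (der (opt I) (justIso I i) F) M
    let B : Bd := substitute I (der (opt I) (nothingIso I) F) M
    let Y : Bd := der I i M
    let X : Bd := Sh (substitute I (derSig I i F) Y)
    let V : Bd := Sh (chainSource I i F M)
    let Z : Bd := Sh (chainTarget I i F M)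
    let u : Bd := fst (unfoldSig I A B Y)
    let c : Bd := chainShape I i F M
    let δ : Bd := fst (derMap I i (substitute I F M) M (muIn I F))
    (isEmbedding X (Sh Y) (fst (muRuleStep I i F)),
      compEmb X Z (Sh Y) (lam fun x => c (u x)) δ
        -- `chainShape` and `chainFun` have the body `chainMap` in common, so the general result for
        -- families applies to the container by conversion.
        (compEmb X V Z u c (equivEmb X V u (unfoldEquiv I A B Y)) (chainEmb.on (families i F M)))
        (equivEmb Z (Sh Y) δ (derInEquiv I i F)))

/-- On shapes the `μ`-rule is, by unfolding, the recursion on trees given by the shape map of its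
step. -/
def muRuleEmb : Decl := .prove 120 <|
  given type fun I => given (isolated I) fun i => given (cont (opt I)) fun F =>
    let F' : Bd := derSig I i F
    let Y : Bd := der I i (mu I F)
    (isEmbeddingOfContainers I (mu I F') Y (muRule I i F),
      treeRecEmb (Sh F') (snd F' nothing) (Sh Y) (fst (muRuleStep I i F)) (stepEmb I i F))

/-! ### When the `μ`-rule and the chain rule are equivalences -/

/-- If the `μ`-rule is an equivalence then so is the chain rule. -/
def chainStrong : Decl := .prove 121 <|
  given type fun I => given (isolated I) fun i => given (cont (opt I)) fun F =>
    let M : Bd := mu I F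
    let F' : Bd := derSig I i F
    let A : Bd := substitute I (der (opt I) (justIso I i) F) M
    let B : Bd := substitute I (der (opt I) (nothingIso I) F) M
    let Y : Bd := der I i M
    let V : Bd := Sh (chainSource I i F M)
    let Z : Bd := Sh (chainTarget I i F M)
    let c : Bd := chainShape I i F M
    let δ : Bd := fst (derMap I i (substitute I F M) M (muIn I F))
    let r : Bd := fst (muRule I i F)
  given (isEquivalence I (mu I F') Y (muRule I i F)) fun m =>
    (isEquivalence I (chainSource I i F M) (chainTarget I i F M) (chain I i F M),
      embEquiv V Z c (chainEmb.on (families i F M)) (lam fun z =>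
        -- The tree over `δ z` is inspected at its root only. If it is a node, `r` computes to `δ (c
        -- v)`, and `δ` is an embedding, so that `c v = z`.
        wrec (lam fun w => path (Sh Y) (r w) (δ z) ⇀ fiber V Z c z)
          (lam₄ fun s f _ p =>
            let v : Bd := fst (unfoldSig I A B Y) (pair s (lam fun n => r (f n)))
            pair v (embPath Z (Sh Y) δ (equivEmb Z (Sh Y) δ (derInEquiv I i F)) (c v) z p))
          (back m (δ z)) (backRight m (δ z))))

/-- If the chain rule is an equivalence then so is the `μ`-rule. -/
def muRuleStrong : Decl := .prove 122 <|
  given type fun I => given (isolated I) fun i => given (cont (opt I)) fun F =>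
    let M : Bd := mu I F
    let F' : Bd := derSig I i F
    let Y : Bd := der I i M
    let U : Bd := Sh (mu I F')
    let V : Bd := Sh (chainSource I i F M)
    let Z : Bd := Sh (chainTarget I i F M)
    let c : Bd := chainShape I i F M
    let δ : Bd := fst (derMap I i (substitute I F M) M (muIn I F))
    let r : Bd := fst (muRule I i F)
    let v : Families := families i F M
    let Iso : Bd → Bd := fun w => isolated (Ps M (fst i) w)
    let goal : Bd → Bd := fun y => fiber U (Sh Y) r y
    -- the path from the value of `δ ∘ c` at `z` to `z`, for a point `z` with isolated components
    let down : Bd → Bd → Bd → Bd → Bd := fun s f x k =>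
      cong (Sh Y) (fun z => δ z) (c (chainBack.on v (pair (pair (pair s f) x) k)))
          (chainFunBack.on v (pair (pair (pair s f) x) k)) ⬝
        cong (Sh Y) (fun x => pair (sup s f) x) (snd (δ (pair (pair s f) x)))
          (isolatedPath (Ps M (fst i) (sup s f)) (snd (δ (pair (pair s f) x))) x (refl □))
  given (isEquivalence I (chainSource I i F M) (chainTarget I i F M) (chain I i F M)) fun m =>
    (isEquivalence I (mu I F') Y (muRule I i F),
      embEquiv U (Sh Y) r (muRuleEmb I i F) (lam fun y => split (lam fun y => goal y)
        (lam₂ fun w x => wrec (lam fun w => pi (Iso w) fun x => goal (pair w x))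
          (lam₄ fun s f ih x =>
            let z : Bd := pair (pair s f) x
            -- The chain rule hits `z`, and all its values satisfy `isApart`; this is the only use
            -- that is made of its surjectivity.
            let k : Bd := transport (fun z => isApart.on v z) (backRight m z)
              (chainApart.on v (back m z))
            split (lam fun x => isApart.on v (pair (pair s f) x) ⇀ goal (pair (sup s f) x))
              (lam₂ fun x h => sumElim
                (lam fun x => pi (isIsolated (v.pos s f) x) fun h =>
                  v.apart s f x ⇀ goal (pair (sup s f) (pair x h)))
                -- A position at the root corresponds to a node of the left summand of `F'`, which
                -- has no positions at `nothing` and hence no subtrees.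
                (lam₃ fun p h k => pair
                  (sup (inl (pair (pair s (pair p k)) f)) (lam fun e => abort U e))
                  (down s f (pair (inl p) h) k))
                (lam₃ fun n h k =>
                  -- A position in the subtree at `fst n`. Its remainder `snd n` is isolated by the
                  -- second half of `k`, so the induction hypothesis for that subtree gives a tree
                  -- `fst j`, which becomes the single subtree of the new node.
                  let t : Bd := pair (f (fst n)) (pair (snd n) (snd k))
                  let u : Bd := pair (pair s (pair (fst n) (fst k))) (lam fun x => f (fst x))
                  let j : Bd := ih (fst n) (pair (snd n) (snd k))
                  pair (sup (inr (pair u star)) (lam fun _ => fst j))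
                    (cong (Sh Y) (fun t => δ (c (inr (pair u t)))) (r (fst j)) (snd j) ⬝
                      down s f (pair (inr n) h) k))
                x h) x k)
          w x) y))

/-! ### Removing points -/

/-- Any path `p : a = b` equals `bk (h a a) ⬝ h a b`, by induction on `p`; for a loop the right-hand
side cancels. -/
def propLoop : Decl := .prove 123 <|
  given type fun A => given (isProp A) fun h => given A fun a => given (path A a a) fun p =>
    (path (path A a a) p (refl a),
      J (lam₂ fun b p => path (path A a b) p (bk (h a a) ⬝ h a b))
          (bk (inverseLoop A a a (h a a))) p ⬝
        inverseLoop A a a (h a a))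

/-- A point of a complement is determined by the underlying point, as a negation is a proposition.
So both inverse laws reduce to computations on underlying points; the same holds for
`removeInrEquiv`. -/
def removeInlEquiv : Decl := .prove 124 <|
  given type fun A => given type fun B => given A fun a =>
    let S : Bd := sum A B
    let X : Bd := remove S (inl a)
    let Y : Bd := sum (remove A a) B
    let g : Bd → Bd := fun y => sumElim (lam fun _ => X)
      (lam fun u => pair (inl (fst u)) (lam fun r => snd u (inlCode A a r)))
      (lam fun b => pair (inr b) (lam fun r => inlCode A a r)) y
    let f : Bd := removeInl A B a
    (isEquiv X Y f, isoEquiv X Y f (lam fun y => g y)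
      (lam fun z => split (lam fun z => path X (g (f z)) z)
        (lam₂ fun x n => sumElim
          (lam fun x => pi (neg (path S (inl a) x)) fun n => path X (g (f (pair x n))) (pair x n))
          (lam₂ fun x n => removePath S (inl a) (g (f (pair (inl x) n))) (pair (inl x) n) (refl □))
          (lam₂ fun x n => removePath S (inl a) (g (f (pair (inr x) n))) (pair (inr x) n) (refl □))
          x n) z)
      (lam fun y => sumElim (lam fun y => path Y (f (g y)) y)
        (lam fun u => cong Y (fun u => inl u) (pair (fst u) (lam fun p =>
            snd u (inlCode A a (cong S inl a p))))
          (removePath A a (pair (fst u) (lam fun p => snd u (inlCode A a (cong S inl a p)))) u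
            (refl □)))
        (lam fun b => refl □) y))

def removeInrEquiv : Decl := .prove 125 <|
  given type fun A => given type fun B => given B fun b =>
    let S : Bd := sum A B
    let X : Bd := remove S (inr b)
    let Y : Bd := sum A (remove B b)
    let g : Bd → Bd := fun y => sumElim (lam fun _ => X)
      (lam fun a => pair (inl a) (lam fun r => inrCode B b r))
      (lam fun u => pair (inr (fst u)) (lam fun r => snd u (inrCode B b r))) y
    let f : Bd := removeInr A B b
    (isEquiv X Y f, isoEquiv X Y f (lam fun y => g y)
      (lam fun z => split (lam fun z => path X (g (f z)) z)
        (lam₂ fun x n => sumElim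
          (lam fun x => pi (neg (path S (inr b) x)) fun n => path X (g (f (pair x n))) (pair x n))
          (lam₂ fun x n => removePath S (inr b) (g (f (pair (inl x) n))) (pair (inl x) n) (refl □))
          (lam₂ fun x n => removePath S (inr b) (g (f (pair (inr x) n))) (pair (inr x) n) (refl □))
          x n) z)
      (lam fun y => sumElim (lam fun y => path Y (f (g y)) y)
        (lam fun a => refl □)
        (lam fun u => cong Y (fun u => inr u) (pair (fst u) (lam fun p =>
            snd u (inrCode B b (cong S inr b p))))
          (removePath B b (pair (fst u) (lam fun p => snd u (inrCode B b (cong S inr b p)))) u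
            (refl □))) y))

/-- Isolation of `a` is used twice: it decides in which summand a pair `(a', b')` lies, and through
`sndPath` it shows that `b' ≠ b` implies `(a, b') ≠ (a, b)`. -/
def removeSigmaEquiv : Decl := .prove 126 <|
  given type fun A => given (A ⇀ type) fun B => given A fun a => given (B a) fun b =>
  given (isIsolated A a) fun h =>
    let S : Bd := total A B
    let X : Bd := remove S (pair a b)
    let Y : Bd := sum (sig (remove A a) fun x => B (fst x)) (remove (B a) b)
    let f : Bd := removeSigma A B a b h
    let g : Bd → Bd := fun y => sumElim (lam fun _ => X)
      (lam fun u => pair (pair (fst (fst u)) (snd u)) (lam fun r =>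
        snd (fst u) (cong A (fun w => fst w) (ann S (pair a b)) r)))
      (lam fun u => pair (pair a (fst u)) (lam fun r => snd u (sndPath A B a b (fst u) h r))) y
    let case : Bd → Bd → Bd → Bd → Bd := fun a' b' n d => removeSigmaCase A B a b a' b' n d
    let N : Bd → Bd → Bd := fun a' b' => neg (path S (pair a b) (pair a' b'))
    (isEquiv X Y f, isoEquiv X Y f (lam fun y => g y)
      (lam fun z => split (lam fun z => path X (g (f z)) z)
        (lam₂ fun w n => split
          (lam fun w => pi (neg (path S (pair a b) w)) fun n => path X (g (f (pair w n))) (pair w n))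
          (lam₃ fun a' b' n => sumElim
            (lam fun d => path X (g (case a' b' n d)) (pair (pair a' b') n))
            (lam fun e => J
              (lam₂ fun a' e => pi (B a') fun b' => pi (N a' b') fun n =>
                path X (g (case a' b' n (ann (dec (path A a a')) (inl e)))) (pair (pair a' b') n))
              (lam₂ fun b' n => removePath S (pair a b)
                (g (case a b' n (ann (dec (path A a a)) (inl (refl a))))) (pair (pair a b') n)
                (refl □)) e b' n)
            (lam fun m => removePath S (pair a b)
              (g (case a' b' n (ann (dec (path A a a')) (inr m)))) (pair (pair a' b') n) (refl □))
            (h a')) w n) z)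
      (lam fun y => sumElim (lam fun y => path Y (f (g y)) y)
        (lam fun u => split (lam fun u => path Y (f (g (ann Y (inl u)))) (inl u))
          (lam₂ fun x y => split
            (lam fun x => pi (B (fst x)) fun y =>
              path Y (f (g (ann Y (inl (pair x y))))) (inl (pair x y)))
            (lam₃ fun x m y => sumElim
              (lam fun d => path Y
                (case x y (snd (g (ann Y (inl (pair (pair x m) y))))) d) (inl (pair (pair x m) y)))
              (lam fun e => abort □ (m e))
              (lam fun m' => cong Y (fun m => inl (pair (pair x m) y)) m'
                (negProp (path A a x) m' m))
              (h x)) x y) u)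
        (lam fun u =>
          let n : Bd := snd (g (ann Y (inr u)))
          sumElim
            (lam fun d => path Y (case a (fst u) n d) (inr u))
            -- The decision at `a` itself yields some loop `e`; it equals `refl`, for which the
            -- transport hidden in `removeSigmaCase` computes.
            (lam fun e => transport
              (fun e => path Y (case a (fst u) n (ann (dec (path A a a)) (inl e))) (inr u))
              (bk (isolatedLoop A a h e))
              (cong Y (fun v => inr v)
                (pair (fst u) (lam fun p => n (cong S (fun y => pair a y) b p)))
                (removePath (B a) b
                  (pair (fst u) (lam fun p => n (cong S (fun y => pair a y) b p))) u (refl □))))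
            (lam fun m => abort □ (m (refl a)))
            (h a)) y))

/-! ### Grafts -/

/-- A sum over a type is a sum over its pairs with an element of a proposition. -/
def insertProp : Decl := .prove 127 <|
  given type fun A => given (A ⇀ type) fun D => given (pi A fun x => D x ⇀ type) fun C =>
  given (pi A fun x => D x) fun h => given (pi A fun x => isProp (D x)) fun k =>
    let X : Bd := sig A fun x => C x (h x)
    let Y : Bd := sig A fun x => sig (D x) fun d => C x d
    let f : Bd → Bd := fun v => pair (fst v) (pair (h (fst v)) (snd v))
    let g : Bd → Bd := fun w => pair (fst w) (transport (fun d => C (fst w) d)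
      (k (fst w) (fst (snd w)) (h (fst w))) (snd (snd w)))
    (isEquiv X Y (lam fun v => f v), isoEquiv X Y (lam fun v => f v) (lam fun w => g w)
      (lam fun v => split (lam fun v => path X (g (ann Y (f v))) v)
        (lam₂ fun x y => J
          (lam₂ fun p w => path X (pair x (transport (fun d => C x d) p y)) (pair x y)) (refl □)
          (bk (propLoop (D x) (k x) (h x) (k x (h x) (h x))))) v)
      (lam fun w => split (lam fun w => path Y (f (ann X (g w))) w)
        (lam₂ fun x u => split
          (lam fun u => path Y (f (ann X (g (ann Y (pair x u))))) (pair x u))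
          (lam₂ fun d y => J
            (lam₂ fun d' q => path Y
              (pair x (pair d' (transport (fun d => C x d) q y))) (pair x (pair d y)))
            (refl □) (k x d (h x))) u) w))

/-- The value of the graft at a point depends on the given decision of equality. Since such
decisions form a proposition, `insertProp` makes the decision an independent component, and then a
case distinction computes. The same device serves in `graftSplitEquiv`. -/
def graftOffEquiv : Decl := .prove 128 <|
  given type fun A => given type fun T => given (isolated A) fun a =>
  given (remove A (fst a) ⇀ T) fun f => given T fun t => given (T ⇀ type) fun B =>
    let E : Bd := remove A (fst a)
    let D : Bd → Bd := fun x => dec (path A (fst a) (fst x))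
    let C : Bd → Bd → Bd := fun x d => B (graftCase T f t (fst x) d)
    let X : Bd := sig E fun x => B (graft A T a f t (fst x))
    let Y : Bd := sig E fun x => B (f x)
    let Z : Bd := sig E fun x => sig (D x) fun d => C x d
    let k : Bd → Bd := fun w => sumElim (lam fun d => C (fst w) d ⇀ Y)
      (lam₂ fun e _ => abort Y (snd (fst w) e))
      (lam₂ fun n y => pair (pair (fst (fst w)) n) y) (fst (snd w)) (snd (snd w))
    let l : Bd → Bd := fun u => split (lam fun x => B (f x) ⇀ Z)
      (lam₃ fun x n y => pair (pair x n) (pair (inr n) y)) (fst u) (snd u)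
    (isEquiv X Y (graftOff A T a f t B),
      compEquiv X Z Y (lam fun v => pair (fst v) (pair (snd a (fst (fst v))) (snd v)))
        (lam fun w => k w)
        (insertProp E (lam fun x => D x) (lam₂ fun x d => C x d) (lam fun x => snd a (fst x)) (lam fun x =>
          decProp (path A (fst a) (fst x)) (isolatedPathProp A (fst a) (snd a) (fst x))))
        (isoEquiv Z Y (lam fun w => k w) (lam fun u => l u)
          (lam fun w => split (lam fun w => path Z (l (k w)) w)
            (lam₂ fun x u => split
              (lam fun x => pi (sig (D x) fun d => C x d) fun u =>
                path Z (l (k (ann Z (pair x u)))) (pair x u))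
              (lam₃ fun x n u => split
                (lam fun u => path Z (l (k (ann Z (pair (pair x n) u)))) (pair (pair x n) u))
                (lam fun d => sumElim
                  (lam fun d => pi (B (graftCase T f t x d)) fun y =>
                    path Z (l (k (ann Z (pair (pair x n) (pair d y))))) (pair (pair x n) (pair d y)))
                  (lam₂ fun e _ => abort □ (n e))
                  (lam₂ fun m y => cong Z (fun n => pair (pair x n) (pair (inr m) y)) m
                    (negProp (path A (fst a) x) m n)) d) u) x u) w)
          (lam fun u => split (lam fun u => path Y (k (l u)) u)
            (lam₂ fun x y => split (lam fun x => pi (B (f x)) fun y =>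
                path Y (k (l (ann Y (pair x y)))) (pair x y))
              (lam₃ fun x n y => refl □) x y) u)))

def graftSplitEquiv : Decl := .prove 129 <|
  given type fun A => given type fun T => given (isolated A) fun a =>
  given (remove A (fst a) ⇀ T) fun f => given T fun t => given (T ⇀ type) fun B =>
    let D : Bd → Bd := fun x => dec (path A (fst a) x)
    let C : Bd → Bd → Bd := fun x d => B (graftCase T f t x d)
    let X : Bd := sig A fun x => B (graft A T a f t x)
    let Y : Bd := sum (sig (remove A (fst a)) fun x => B (f x)) (B t)
    let Z : Bd := sig A fun x => sig (D x) fun d => C x d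
    let k : Bd → Bd := fun w => sumElim (lam fun d => C (fst w) d ⇀ Y)
      (lam₂ fun e y => inr y)
      (lam₂ fun n y => inl (pair (pair (fst w) n) y)) (fst (snd w)) (snd (snd w))
    let l : Bd → Bd := fun u => sumElim (lam fun _ => Z)
      (lam fun v => split (lam fun x => B (f x) ⇀ Z)
        (lam₃ fun x n y => pair x (pair (inr n) y)) (fst v) (snd v))
      (lam fun y => pair (fst a) (pair (inl (refl (fst a))) y)) u
    (isEquiv X Y (graftSplit A T a f t B),
      compEquiv X Z Y (lam fun v => pair (fst v) (pair (snd a (fst v)) (snd v)))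
        (lam fun w => k w)
        (insertProp A (lam fun x => D x) (lam₂ fun x d => C x d) (snd a) (lam fun x =>
          decProp (path A (fst a) x) (isolatedPathProp A (fst a) (snd a) x)))
        (isoEquiv Z Y (lam fun w => k w) (lam fun u => l u)
          (lam fun w => split (lam fun w => path Z (l (k w)) w)
            (lam₂ fun x u => split
              (lam fun u => path Z (l (k (ann Z (pair x u)))) (pair x u))
              (lam fun d => sumElim
                (lam fun d => pi (B (graftCase T f t x d)) fun y =>
                  path Z (l (k (ann Z (pair x (pair d y))))) (pair x (pair d y)))
                (lam₂ fun e y => J (lam₂ fun x e => path Z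
                  (pair (fst a) (pair (inl (refl (fst a))) y)) (pair x (pair (inl e) y))) (refl □) e)
                (lam₂ fun m y => refl □) d) u) w)
          (lam fun u => sumElim (lam fun u => path Y (k (l u)) u)
            (lam fun v => split (lam fun v => path Y (k (l (ann Y (inl v)))) (inl v))
              (lam₂ fun x y => split (lam fun x => pi (B (f x)) fun y =>
                  path Y (k (l (ann Y (inl (pair x y))))) (inl (pair x y)))
                (lam₃ fun x n y => refl □) x y) v)
            (lam fun y => refl □) u)))

def moveRemoveEquiv : Decl := .prove 130 <|
  given type fun T => given (T ⇀ type) fun B => given T fun t => given T fun t' =>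
  given (path T t t') fun p => given (isolated (B t)) fun q =>
    (isEquiv (remove (B t') (fst (moveIsolated B p q))) (remove (B t) (fst q))
        (moveRemove T B t t' p q),
      J (lam₂ fun t' p => isEquiv (remove (B t') (fst (moveIsolated B p q))) (remove (B t) (fst q))
          (moveRemove T B t t' p q))
        (snd (idEquiv (remove (B t) (fst q)))) p)

/-! ### Sums -/

/-- The position maps at the second summand of the chain rule have this form both for `i = j` and
for `i ≠ j`, with different equivalences `u`, `v` and `w`. -/
def assocEquiv : Decl := .prove 131 <|
  given type fun A => given type fun B => given type fun C => given type fun C' =>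
  given type fun D => given type fun D' =>
  given (B ⇀ sum C' D') fun u => given (C' ⇀ C) fun v => given (D' ⇀ D) fun w =>
  given (isEquiv B (sum C' D') u) fun hu => given (isEquiv C' C v) fun hv =>
  given (isEquiv D' D w) fun hw =>
    let X : Bd := sum A B
    let Y : Bd := sum (sum A C) D
    let S : Bd := sum C' D'
    let f : Bd → Bd := fun z => assocMap A C D u v w z
    let k : Bd → Bd := fun b => inr (back hu b)
    let g : Bd → Bd := fun y => sumElim (lam fun _ => X)
      (lam fun s => sumElim (lam fun _ => X) (lam fun a => inl a)
        (lam fun c => k (inl (back hv c))) s)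
      (lam fun d => k (inr (back hw d))) y
    let m : Bd → Bd := fun s => sumElim (lam fun _ => Y)
      (lam fun c => inl (inr (v c))) (lam fun d => inr (w d)) s
    (isEquiv X Y (lam fun z => f z), isoEquiv X Y (lam fun z => f z) (lam fun y => g y)
      (lam fun z => sumElim (lam fun z => path X (g (f z)) z)
        (lam fun a => refl □)
        (lam fun b =>
          sumElim (lam fun s => path X (g (m s)) (k s))
              (lam fun c => cong X (fun c => k (inl c)) (back hv (v c)) (backLeft C' C v hv c))
              (lam fun d => cong X (fun d => k (inr d)) (back hw (w d)) (backLeft D' D w hw d))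
              (u b) ⬝
            cong X (fun b => inr b) (back hu (u b)) (backLeft B S u hu b)) z)
      (lam fun y => sumElim (lam fun y => path Y (f (g y)) y)
        (lam fun s => sumElim (lam fun s => path Y (f (g (ann Y (inl s)))) (inl s))
          (lam fun a => refl □)
          (lam fun c =>
            cong Y (fun s => m s) (u (back hu (inl (back hv c)))) (backRight hu (inl (back hv c))) ⬝
              cong Y (fun c => inl (inr c)) (v (back hv c)) (backRight hv c)) s)
        (lam fun d =>
          cong Y (fun s => m s) (u (back hu (inr (back hw d)))) (backRight hu (inr (back hw d))) ⬝
            cong Y (fun d => inr d) (w (back hw d)) (backRight hw d)) y))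

/-! ### The chain rule is cartesian -/

/-- The map at the decision `d` of `i = j` is an equivalence, for a proof `b` for `i = i` and a proof
`o` for `i ≠ j`. -/
def PosMap.equiv (m : PosMap) (j d b o : Bd) : Bd :=
  sumElim (lam fun d => isEquiv (m.dom j d) (m.cod j d) (m.map j d))
    (lam fun e => J (lam₂ fun j e => isEquiv m.X (m.Y j) (J (lam₂ fun j _ => m.X ⇀ m.Y j) m.base e))
      b e)
    (lam fun _ => o) d

/-- In the first summand the map is `removeInl` for `i = j` and the identity otherwise. In the
second, for `i = j`, the point is removed from the right side of a sum and then from a dependent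
sum, after which the grafted function agrees with `f` off the point and with `t` at it; for `i ≠ j`
only the splitting of the graft remains. -/
def chainCartesian : Decl := .prove 132 <|
  given type fun I => given (isolated I) fun i => given (cont (opt I)) fun F =>
  given (cont I) fun G =>
    let L : Bd := chainSource I i F G
    let R : Bd := chainTarget I i F G
    let i₀ : Bd := fst i
    (isCartesian I L R (chain I i F G), lam₂ fun j x =>
      sumElim (lam fun x => isEquiv (Ps R j (chainShape I i F G x)) (Ps L j x) (chainPos I i F G j x))
        (lam fun y =>
          let s : Bd := fst (fst y)
          let p : Bd := snd (fst y)
          let Z : Bd := sig (Ps F nothing s) fun n => Ps G i₀ (snd y n)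
          (leftMap I i F G y).equiv j (snd i j) (removeInlEquiv (Ps F (just i₀) s) Z (fst p))
            (snd (idEquiv (Ps (substitute I F G) j (pair s (snd y))))))
        (lam fun y =>
          let s : Bd := fst (fst (fst y))
          let P : Bd → Bd := fun j => Ps F (just j) s
          let N : Bd := Ps F nothing s
          let T : Bd := Sh G
          let Q : Bd → Bd := fun j => snd G j
          let p : Bd := snd (fst (fst y))
          let a : Bd := fst p
          let f : Bd := snd (fst y)
          let t : Bd := fst (snd y)
          let q : Bd := snd (snd y)
          let g : Bd := graft N T p f t
          let c : Bd := graftPath N T p f t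
          let q' : Bd := fst (moveIsolated (Q i₀) c q)
          let V : Bd → Bd := fun j => sig (remove N a) fun n => Ps G j (f n)
          let V' : Bd := sig (remove N a) fun n => Ps G i₀ (g (fst n))
          let Z : Bd → Bd := fun j => sig N fun n => Ps G j (g n)
          let B : Bd := lam fun n => Ps G i₀ (g n)
          let z : Bd := pair a q'
          let W : Bd := remove (Z i₀) z
          let X : Bd := remove (sum (P i₀) (Z i₀)) (inr z)
          let D : Bd := remove (Ps G i₀ t) (fst q)
          let D' : Bd := remove (Ps G i₀ (g a)) q'
          let u : Bd := removeSigma N B a q' (snd p)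
          let v : Bd := graftOff N T p f t (Q i₀)
          let w : Bd := moveRemove T (Q i₀) t (g a) c q
          let h : Bd → Bd := fun j => lam fun x => x
          (rightMap I i F G y).equiv j (snd i j)
            (compEquiv X (sum (P i₀) W) (sum (sum (P i₀) (V i₀)) D) (removeInr (P i₀) (Z i₀) z)
              (lam fun z => assocMap (P i₀) (V i₀) D u v w z)
              (removeInrEquiv (P i₀) (Z i₀) z)
              (assocEquiv (P i₀) W (V i₀) V' D D' u v w (removeSigmaEquiv N B a q' (snd p))
                (graftOffEquiv N T p f t (Q i₀)) (moveRemoveEquiv T (Q i₀) t (g a) c q)))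
            (assocEquiv (P j) (Z j) (V j) (V j) (Ps G j t) (Ps G j t) (graftSplit N T p f t (Q j))
              (lam fun x => x) (lam fun x => x) (graftSplitEquiv N T p f t (Q j))
              (snd (idEquiv (V j))) (snd (idEquiv (Ps G j t))))) x)

/-! ### The `μ`-rule is cartesian -/

def compCartesian : Decl := .prove 133 <|
  given type fun I => given (cont I) fun F => given (cont I) fun G => given (cont I) fun H =>
  given (hom I G H) fun g => given (hom I F G) fun f =>
  given (isCartesian I G H g) fun n => given (isCartesian I F G f) fun m =>
    (isCartesian I F H (comp I F G H g f), lam₂ fun i s =>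
      compEquiv (Ps H i (fst g (fst f s))) (Ps G i (fst f s)) (Ps F i s)
        (snd g i (fst f s)) (snd f i s) (n i (fst f s)) (m i s))

/-- The positions of a node of `μF` compute to those of `F[μF]`, so the position map keeps the
underlying points and alters at most the proofs that they differ from the removed one. -/
def derInCartesian : Decl := .prove 134 <|
  given type fun I => given (isolated I) fun i => given (cont (opt I)) fun F =>
    let M : Bd := mu I F
    let FM : Bd := substitute I F M
    let m : Bd := derMap I i FM M (muIn I F)
    let i₀ : Bd := fst i
    (isCartesian I (der I i FM) (der I i M) m, lam₂ fun j x =>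
      let Q : Bd → Bd := fun j => Ps M j (sup (fst (fst x)) (snd (fst x)))
      let P : Bd → Bd := fun j => Ps FM j (fst x)
      let b : Bd := fst (snd x)
      let X : Bd := remove (Q i₀) b
      let Y : Bd := remove (P i₀) b
      let f : Bd := lam fun z => pair (fst z) (lam fun r => snd z
        (invPath (Q i₀) (P i₀) (idEquiv (P i₀)) b (fst z) r))
      let g : Bd := lam fun z => pair (fst z) (lam fun r => snd z r)
      let dom : Bd → Bd := fun d => ifDec d X (Q j)
      let cod : Bd → Bd := fun d => ifDec d Y (P j)
      sumElim (lam fun d => isEquiv (dom d) (cod d)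
          (sumElim (lam fun d => dom d ⇀ cod d) (lam fun _ => f) (lam₂ fun _ z => z) d))
        (lam fun _ => isoEquiv X Y f g
          (lam fun z => removePath (P i₀) b (pair (fst z) (lam fun r => snd z
            (invPath (Q i₀) (P i₀) (idEquiv (P i₀)) b (fst z) r))) z (refl □))
          (lam fun z => removePath (P i₀) b (pair (fst z) (lam fun r => snd z
            (invPath (Q i₀) (P i₀) (idEquiv (P i₀)) b (fst z) r))) z (refl □)))
        (lam fun _ => snd (idEquiv (P j)))
        (snd i j))

def unfoldCartesian : Decl := .prove 135 <|
  given type fun I => given (cont I) fun A => given (cont I) fun B => given (cont I) fun Y =>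
    let F' : Bd := plus (opt I) (weaken I A) (times (opt I) (weaken I B) (proj (opt I) nothing))
    let X : Bd := substitute I F' Y
    let T : Bd := plus I A (times I B Y)
    let m : Bd := unfoldSig I A B Y
    let N : Bd → Bd := fun x => Ps F' nothing x ⇀ Sh Y
    let loop : Bd → Bd := fun r => isolatedLoop (opt I) nothing (snd (nothingIso I)) r
    let L : Bd := path (opt I) nothing nothing
    (isCartesian I X T m, lam₂ fun i z =>
      let goal : Bd → Bd → Bd := fun x k =>
        isEquiv (Ps T i (fst m (pair x k))) (Ps X i (pair x k)) (snd m i (pair x k))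
      split (lam fun z => isEquiv (Ps T i (fst m z)) (Ps X i z) (snd m i z))
        (lam₂ fun x k => sumElim (lam fun x => pi (N x) fun k => goal x k)
          (lam₂ fun a k =>
            let D : Bd := Ps A i a
            let E : Bd := Ps X i (pair (inl a) k)
            isoEquiv D E (lam fun u => inl u)
              (lam fun w => sumElim (lam fun _ => D) (lam fun u => u) (lam fun v => abort D (fst v)) w)
              (lam fun u => refl □)
              (lam fun w => sumElim □ (lam fun u => refl □) (lam fun v => abort □ (fst v)) w))
          (lam₂ fun y k =>
            let D : Bd := Ps T i (fst m (pair (inr y) k))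
            let E : Bd := Ps X i (pair (inr y) k)
            let K : Bd → Bd := fun p => Ps Y i (k p)
            let f : Bd := snd m i (pair (inr y) k)
            let g : Bd := lam fun w => sumElim (lam fun _ => D)
              (lam fun c => sumElim (lam fun _ => D) (lam fun b => inl b)
                (lam fun r => abort D (inrCode one star r)) c)
              (lam fun v => sumElim (lam fun p => K p ⇀ D)
                (lam₂ fun e _ => abort D e)
                -- A position over an arbitrary loop `r` is moved to the chosen loop `refl nothing`,
                -- using that they are equal.
                (lam₂ fun r q => inr (transport (fun r => K (inr r)) (loop r) q)) (fst v) (snd v)) w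
            isoEquiv D E f g
              (lam fun u => sumElim (lam fun u => path D (g (f u)) u)
                (lam fun b => refl □)
                -- The path `loop (refl nothing)` between `refl nothing` and itself need not compute
                -- to `refl`, but it equals it because the loops at `nothing` form a proposition.
                (lam fun v => J
                  (lam₂ fun p w => path D
                    (inr (transport (fun r => K (inr r)) p v)) (inr v))
                  (refl □)
                  (bk (propLoop L (isolatedPathProp (opt I) nothing (snd (nothingIso I)) nothing)
                    (refl nothing) (loop (refl nothing))))) u)
              (lam fun w => sumElim (lam fun w => path E (f (g w)) w)
                (lam fun c => sumElim (lam fun c => path E (f (g (ann E (inl c)))) (inl c))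
                  (lam fun b => refl □)
                  (lam fun r => abort □ (inrCode one star r)) c)
                (lam fun v => split (lam fun v => path E (f (g (ann E (inr v)))) (inr v))
                  (lam₂ fun p q => sumElim
                    (lam fun p => pi (K p) fun q => path E (f (g (ann E (inr (pair p q))))) (inr (pair p q)))
                    (lam₂ fun e q => abort □ e)
                    (lam₂ fun r q => J
                      (lam₂ fun r' w => path E
                        (inr (pair (inr r') (transport (fun r => K (inr r)) w q)))
                        (inr (pair (inr r) q)))
                      (refl □) (loop r)) p q) v) w)) x k) z)

/-- `A + Σ B C → A + Σ B C'` is an equivalence if all maps `C b → C' b` are. -/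
def sumSigEquiv : Decl := .prove 136 <|
  given type fun A => given type fun B => given (B ⇀ type) fun C => given (B ⇀ type) fun C' =>
  given (pi B fun b => C b ⇀ C' b) fun k =>
  given (pi B fun b => isEquiv (C b) (C' b) (k b)) fun h =>
    let X : Bd := sum A (total B C)
    let Y : Bd := sum A (total B C')
    let f : Bd → Bd := fun x => sumElim (lam fun _ => Y) (lam fun a => inl a)
      (lam fun v => inr (pair (fst v) (k (fst v) (snd v)))) x
    let g : Bd → Bd := fun y => sumElim (lam fun _ => X) (lam fun a => inl a)
      (lam fun v => inr (pair (fst v) (back (h (fst v)) (snd v)))) y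
    (isEquiv X Y (lam fun x => f x), isoEquiv X Y (lam fun x => f x) (lam fun y => g y)
      (lam fun x => sumElim (lam fun x => path X (g (f x)) x)
        (lam fun a => refl □)
        (lam fun v => split (lam fun v => path X (g (f (ann X (inr v)))) (inr v))
          (lam₂ fun b c => cong X (fun c => inr (pair b c)) (back (h b) (k b c))
            (backLeft (C b) (C' b) (k b) (h b) c)) v) x)
      (lam fun y => sumElim (lam fun y => path Y (f (g y)) y)
        (lam fun a => refl □)
        (lam fun v => split (lam fun v => path Y (f (g (ann Y (inr v)))) (inr v))
          (lam₂ fun b c => cong Y (fun c => inr (pair b c)) (k b (back (h b) c))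
            (backRight (h b) c)) v) y))

/-- At a node the position map computes to the position map of `m` followed by the maps for the
subtrees inside a sum. The former is an equivalence by assumption, the latter by induction and
`sumSigEquiv`. -/
def recCartesian : Decl := .prove 137 <|
  given type fun I => given (cont (opt I)) fun F => given (cont I) fun G =>
  given (hom I (substitute I F G) G) fun m => given (isCartesian I (substitute I F G) G m) fun h =>
    let M : Bd := mu I F
    let r : Bd := recShape I F G m
    (isCartesian I M G (muRec I F G m), lam₂ fun i w =>
      wrec (lam fun w => isEquiv (Ps G i (r w)) (Ps M i w) (recPos I F G m i w))
        (lam₃ fun s f ih =>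
          let A : Bd := Ps F (just i) s
          let B : Bd := Ps F nothing s
          let C : Bd := lam fun p => Ps G i (r (f p))
          let C' : Bd := lam fun p => Ps M i (f p)
          let x : Bd := pair s (lam fun p => r (f p))
          let X : Bd := sum A (sig B fun p => Ps G i (r (f p)))
          let Y : Bd := Ps M i (sup s f)
          compEquiv (Ps G i (fst m x)) X Y (snd m i x)
            (lam fun x => sumElim (lam fun _ => Y) (lam fun a => inl a)
              (lam fun v => inr (pair (fst v) (recPos I F G m i (f (fst v)) (snd v)))) x)
            (h i x) (sumSigEquiv A B C C' (lam fun p => recPos I F G m i (f p)) ih)) w)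

def muRuleCartesian : Decl := .prove 138 <|
  given type fun I => given (isolated I) fun i => given (cont (opt I)) fun F =>
    let M : Bd := mu I F
    let F' : Bd := derSig I i F
    let A : Bd := substitute I (der (opt I) (justIso I i) F) M
    let B : Bd := substitute I (der (opt I) (nothingIso I) F) M
    let Y : Bd := der I i M
    let X : Bd := substitute I F' Y
    let L : Bd := chainSource I i F M
    let R : Bd := chainTarget I i F M
    let u : Bd := unfoldSig I A B Y
    let c : Bd := chain I i F M
    (isCartesian I (mu I F') Y (muRule I i F),
      recCartesian I F' Y (muRuleStep I i F)
        (compCartesian I X R Y (derMap I i (substitute I F M) M (muIn I F)) (comp I X L R c u)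
          (derInCartesian I i F)
          (compCartesian I X L R c u (chainCartesian I i F M) (unfoldCartesian I A B Y))))

/-- The `μ`-rule is cartesian and an embedding, and it is an equivalence if and only if the chain rule
is. -/
def strongMuRuleProof : Decl := .thm 139 strongMuRule <|
  lam₃ fun I i F =>
    pair (lam fun G => chainCartesian I i F G) <| pair (muRuleCartesian I i F) <|
      pair (muRuleEmb I i F) <| pair (chainStrong I i F) (muRuleStrong I i F)

/-! ### Checking of the proofs in the object theory. -/

def foundations : List Decl :=
  [symmDef, transDef, cancelPath, inverseLoop, pairPath, contrProp, propContr, propPath, sigProp,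
    sigPropCenter, retract, retractContr, retractProp, fiberRetract, isoEquiv, sectionEmb,
    backLeft, compEquiv, equivEmb, embEquiv, embPath, compEmb, fstEmb]

def foundationsEnv : Env := Src.extend (fext.entry :: env₀) foundations

theorem foundations_check : checkAll (fext.entry :: env₀) foundations = true := by
  decide +kernel

theorem sound_foundations : Sound foundationsEnv :=
  sound_fext.extend foundations foundations_check

def isolation : List Decl :=
  [homotopyPath, homotopyInd, piProp, negProp, decProp, isolatedPathProp, isIsolatedProp,
    isolatedPath, removePath, graftRestrict, graftSelf, graftSelfPath]

def isolationEnv : Env := Src.extend foundationsEnv isolation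

theorem isolation_check : checkAll foundationsEnv isolation = true := by
  decide +kernel

theorem sound_isolation : Sound isolationEnv :=
  sound_foundations.extend isolation isolation_check

def chainEmbedding : List Decl :=
  [chainDom, chainCod, chainFun, isApart, isApartProp, chainBack, chainApart, chainGraft,
    chainFunBack, chainBackFun, chainEmb]

def chainEmbeddingEnv : Env := Src.extend isolationEnv chainEmbedding

theorem chainEmbedding_check : checkAll isolationEnv chainEmbedding = true := by
  decide +kernel

theorem sound_chainEmbedding : Sound chainEmbeddingEnv :=
  sound_isolation.extend chainEmbedding chainEmbedding_check

def muRuleEmbedding : List Decl :=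
  [treeRec, liftProp, treeRecEmb, unfoldInv, unfoldEquiv, derInInv, derInEquiv, stepEmb,
    muRuleEmb]

def muRuleEmbeddingEnv : Env := Src.extend chainEmbeddingEnv muRuleEmbedding

theorem muRuleEmbedding_check : checkAll chainEmbeddingEnv muRuleEmbedding = true := by
  decide +kernel

theorem sound_muRuleEmbedding : Sound muRuleEmbeddingEnv :=
  sound_chainEmbedding.extend muRuleEmbedding muRuleEmbedding_check

def strongRules : List Decl :=
  [chainStrong, muRuleStrong]

def strongRulesEnv : Env := Src.extend muRuleEmbeddingEnv strongRules

theorem strongRules_check : checkAll muRuleEmbeddingEnv strongRules = true := by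
  decide +kernel

theorem sound_strongRules : Sound strongRulesEnv :=
  sound_muRuleEmbedding.extend strongRules strongRules_check

def removal : List Decl :=
  [propLoop, removeInlEquiv, removeInrEquiv, removeSigmaEquiv, insertProp, graftOffEquiv,
    graftSplitEquiv, moveRemoveEquiv, assocEquiv]

def removalEnv : Env := Src.extend strongRulesEnv removal

theorem removal_check : checkAll strongRulesEnv removal = true := by
  decide +kernel

theorem sound_removal : Sound removalEnv :=
  sound_strongRules.extend removal removal_check

def cartesianness : List Decl :=
  [chainCartesian, compCartesian, derInCartesian, unfoldCartesian, sumSigEquiv, recCartesian,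
    muRuleCartesian, strongMuRuleProof]

def cartesiannessEnv : Env := Src.extend removalEnv cartesianness

theorem cartesianness_check : checkAll removalEnv cartesianness = true := by
  decide +kernel

theorem sound_cartesianness : Sound cartesiannessEnv :=
  sound_removal.extend cartesianness cartesianness_check

end UF.Src

/-- Well-definedness is the typing of two of the 64 definitions, whose values in the model are the
raw terms of the statement; the remaining conjunct is the type of the last checked declaration. -/
theorem mainTheorem4 :
    UF.HasType [] UF.chain UF.chainType ∧
    UF.HasType [] UF.muRule UF.muRuleType ∧
    ∃ t : UF.Tm, UF.HasType [] t UF.strongMuRule :=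
  ⟨UF.Src.sound_fext.typed (d := UF.Src.chain) rfl (by decide) rfl rfl rfl,
    UF.Src.sound_fext.typed (d := UF.Src.muRule) rfl (by decide) rfl rfl rfl,
    UF.Src.sound_cartesianness.inhabited (d := UF.Src.strongMuRuleProof) rfl rfl rfl⟩
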